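/- **Setting.** Let $h>0$ and $\gamma,g,\sigma\in\mathbf R$. For functions of $(\lambda,t)\in\mathbf R\times[0,\infty)$ a dot denotes $\partial_\lambda$ and a subscript $t$ denotes $\partial_t$ (one-sided at $t=0$). Let $X,Y,\xi\in C^2(\mathbf R\times[0,\infty))$ be real valued such that * for each $t\ge 0$ the curve $\mathcal S(t)=\{(X(\lambda,t),Y(\lambda,t)):\lambda\in\mathbf R\}$ is injectively parametrised, $Y>-h$, $X\to\pm\infty$ as $\lambda\to\pm\infty$, and $Y\to0$ as $|\lambda|\to\infty$ (the curve need not be a graph over the $x$-axis); * for each $T>0$ there is $c>0$ with $\dot X^2+\dot Y^2\ge c$ on $\mathbf R\times[0,T]$ (e.g. $\lambda$ is arc length); * for each $T>0$ there are a constant $C$ and an integrable function $b$ on $\mathbf R$, with $b(\lambda)\to 0$ as $|\lambda|\to\infty$, such that for $0\le t\le T$ all first and second partial derivatives of $Y$ and $\dot\xi,\ddot\xi,\dot\xi_t$ are bounded by $b(\lambda)$ in absolute value, and all first and second partial derivatives of $X$ are bounded by $C$ in absolute value. Let $\Omega(t)$ be the region between the bottom $y=-h$ and $\mathcal S(t)$,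 that is, the set of points with $y>-h$ that can be joined to the bottom by a path in $\{y\ge -h\}\setminus\mathcal S(t)$, and let $D=\{(t,x,y): t\ge 0,\ (x,y)\in\overline{\Omega(t)}\}$. A *solution of the constant-vorticity problem* for $(\varphi,\mathcal S)$ is a real function $\varphi(x,y,t)$ that is $C^1$ on $D$ (up to the boundary), with $\nabla\varphi(x,y,t)\to0$ as $|x|\to\infty$ uniformly in $y$ for each $t\geq 0$, such that for all $t\ge0$ $$\Delta\varphi=0\ \text{ in }\Omega(t),\qquad (\varphi_x-\gamma y,\varphi_y)\cdot(0,-1)=0\ \text{ on } y=-h,$$ $$(\varphi_x-\gamma y-X_t,\ \varphi_y-Y_t)\cdot(-\dot Y,\dot X)=0\ \text{ on }\mathcal S(t),$$ $$\varphi_t+\tfrac12\varphi_y^2+\tfrac12(\varphi_x-\gamma y)^2+gy=\sigma\,\frac{\dot X\ddot Y-\dot Y\ddot X}{(\dot X^2+\dot Y^2)^{3/2}}\ \text{ on }\mathcal S(t).$$ **Proposition (Two Dimensional Water Waves with Constant Vorticity and Multivalued Free Surface).** The constant-vorticity problem for $(\varphi,\mathcal S)$ is equivalent to the following pair of equations for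 $(\xi,X,Y)$, where $\xi(\lambda,t)=\varphi(X(\lambda,t),Y(\lambda,t),t)$. That is, there is a solution $\varphi$ of the constant-vorticity problem whose trace on $\mathcal S$ is $\xi$ if and only if, for all $k\in\mathbf R$ and $t\ge0$, the following integral converges absolutely and $$\int_{\mathbf R} e^{ikX}\Big[\dot\xi\,\sinh(k(Y+h))+i(\dot XY_t-\dot YX_t-\gamma Y\dot Y)\cosh(k(Y+h))\Big]\,d\lambda=0,$$ and, for all $\lambda\in\mathbf R$ and $t\ge 0$, $$\xi_t+gY-\tfrac12X_t^2-\tfrac12Y_t^2+\frac{\gamma Y\,(2\dot X\dot YY_t-2\dot Y^2X_t-2\dot\xi\dot X+\gamma\dot X^2Y)}{2(\dot X^2+\dot Y^2)}+\frac{(\dot\xi-\dot XX_t-\dot YY_t)^2}{2(\dot X^2+\dot Y^2)}-\sigma\,\frac{\dot X\ddot Y-\dot Y\ddot X}{(\dot X^2+\dot Y^2)^{3/2}}=0.$$ Moreover, such a $\varphi$ is then uniquely determined on $D$ by $(\xi,X,Y)$. -/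

import Mathlib

open Set Filter Topology MeasureTheory

noncomputable section

namespace WaterWave

/-! Points `(x, y)` of the plane are the complex numbers `x + i y`.  Functions on the surface are
written `F s t`, where `s` is the parameter along the curve and `t ≥ 0` is time. -/

/-- Derivative along the curve (the dot). -/
def dS (F : ℝ → ℝ → ℝ) (s t : ℝ) : ℝ := deriv (fun r => F r t) s

/-- Time derivative on `[0, ∞)` (one-sided at `t = 0`). -/
def dT (F : ℝ → ℝ → ℝ) (s t : ℝ) : ℝ := derivWithin (fun r => F s r) (Ici 0) t

/-- The point of the free surface with parameter `s` at time `t`. -/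
def surfacePoint (X Y : ℝ → ℝ → ℝ) (s t : ℝ) : ℂ := ⟨X s t, Y s t⟩

/-- The free surface at time `t`. -/
def freeSurface (X Y : ℝ → ℝ → ℝ) (t : ℝ) : Set ℂ := range fun s => surfacePoint X Y s t

/-- The flat bottom `y = -h`. -/
def bottom (h : ℝ) : Set ℂ := {p | p.im = -h}

/-- The region between the bottom and the free surface at time `t`: the points above the bottom
that can be joined to it by a path which stays in `y ≥ -h` and does not meet the free surface. -/
def fluidDomain (h : ℝ) (X Y : ℝ → ℝ → ℝ) (t : ℝ) : Set ℂ :=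
  {p | -h < p.im ∧ ∃ q ∈ bottom h, JoinedIn ({z : ℂ | -h ≤ z.im} \ freeSurface X Y t) q p}

/-- The closed fluid region in space-time: `t ≥ 0` and `(x, y)` in the closure of the
fluid domain at time `t`. -/
def closedRegion (h : ℝ) (X Y : ℝ → ℝ → ℝ) : Set (ℝ × ℂ) :=
  {q | 0 ≤ q.1 ∧ q.2 ∈ closure (fluidDomain h X Y q.1)}

/-- `φ_x`, up to and including the boundary of the fluid. -/
def phiX (h : ℝ) (X Y : ℝ → ℝ → ℝ) (φ : ℝ × ℂ → ℝ) (t : ℝ) (p : ℂ) : ℝ :=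
  fderivWithin ℝ φ (closedRegion h X Y) (t, p) (0, 1)

/-- `φ_y`, up to and including the boundary of the fluid. -/
def phiY (h : ℝ) (X Y : ℝ → ℝ → ℝ) (φ : ℝ × ℂ → ℝ) (t : ℝ) (p : ℂ) : ℝ :=
  fderivWithin ℝ φ (closedRegion h X Y) (t, p) (0, Complex.I)

/-- `φ_t` (at fixed `(x, y)`), up to and including the boundary of the fluid. -/
def phiT (h : ℝ) (X Y : ℝ → ℝ → ℝ) (φ : ℝ × ℂ → ℝ) (t : ℝ) (p : ℂ) : ℝ :=
  fderivWithin ℝ φ (closedRegion h X Y) (t, p) (1, 0)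

/-- Curvature of the free surface. -/
def curvature (X Y : ℝ → ℝ → ℝ) (s t : ℝ) : ℝ :=
  (dS X s t * dS (dS Y) s t - dS Y s t * dS (dS X) s t) /
    ((dS X s t) ^ 2 + (dS Y s t) ^ 2) ^ ((3 : ℝ) / 2)

/-- Twice continuously differentiable on `ℝ × [0, ∞)`. -/
def IsC2 (F : ℝ → ℝ → ℝ) : Prop :=
  ContDiffOn ℝ 2 (fun p : ℝ × ℝ => F p.1 p.2) (univ ×ˢ Ici 0)

/-- The free surface is, at each time, an embedded `C²` curve above the bottom, which runs from
`x = -∞` to `x = +∞` and is asymptotic to the undisturbed level `y = 0`. -/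
structure IsSurface (h : ℝ) (X Y : ℝ → ℝ → ℝ) : Prop where
  smoothX : IsC2 X
  smoothY : IsC2 Y
  injective : ∀ t, 0 ≤ t → Function.Injective fun s => surfacePoint X Y s t
  /-- The curve is regular, locally uniformly in time; the arc-length parameter
  is the case `c = 1`. -/
  regular : ∀ T, 0 < T → ∃ c, 0 < c ∧ ∀ s, ∀ t ∈ Icc 0 T, c ≤ (dS X s t) ^ 2 + (dS Y s t) ^ 2
  right : ∀ t, 0 ≤ t → Tendsto (fun s => X s t) atTop atTop
  left : ∀ t, 0 ≤ t → Tendsto (fun s => X s t) atBot atBot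
  level : ∀ t, 0 ≤ t → Tendsto (fun s => Y s t) (cocompact ℝ) (𝓝 0)
  above : ∀ s t, 0 ≤ t → -h < Y s t

/-- Decay at infinity, locally uniformly in time: the derivatives of `Y` of order one and two and
`ξ_s`, `ξ_ss`, `ξ_st` are dominated by an integrable function of `s` that vanishes at infinity,
and the derivatives of `X` of order one and two are bounded. -/
structure HasDecay (X Y ξ : ℝ → ℝ → ℝ) : Prop where
  dominated : ∀ T, 0 < T → ∃ b : ℝ → ℝ, Integrable b ∧ Tendsto b (cocompact ℝ) (𝓝 0) ∧
    ∀ s, ∀ t ∈ Icc 0 T,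
      |dS Y s t| ≤ b s ∧ |dT Y s t| ≤ b s ∧
      |dS (dS Y) s t| ≤ b s ∧ |dT (dS Y) s t| ≤ b s ∧ |dT (dT Y) s t| ≤ b s ∧
      |dS ξ s t| ≤ b s ∧ |dS (dS ξ) s t| ≤ b s ∧ |dT (dS ξ) s t| ≤ b s
  bounded : ∀ T, 0 < T → ∃ C : ℝ, ∀ s, ∀ t ∈ Icc 0 T,
      |dS X s t| ≤ C ∧ |dT X s t| ≤ C ∧
      |dS (dS X) s t| ≤ C ∧ |dT (dS X) s t| ≤ C ∧ |dT (dT X) s t| ≤ C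

/-- The boundary value problem for the pseudo-potential `φ` in the fluid with bottom `y = -h` and
free surface `(X, Y)`, constant vorticity `γ`, gravity `g` and surface tension `σ`, for classical
solutions (`C¹` up to the boundary) whose velocity perturbation `∇φ` decays at infinity. -/
structure SolvesBVP (h γ g σ : ℝ) (X Y : ℝ → ℝ → ℝ) (φ : ℝ × ℂ → ℝ) : Prop where
  smooth : ContDiffOn ℝ 1 φ (closedRegion h X Y)
  /-- `∇φ → 0` as `|x| → ∞`, uniformly in `y`, at each time. -/
  decay : ∀ t, 0 ≤ t → ∀ ε, 0 < ε → ∃ R : ℝ, ∀ p ∈ closure (fluidDomain h X Y t), R ≤ |p.re| →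
    |phiX h X Y φ t p| ≤ ε ∧ |phiY h X Y φ t p| ≤ ε
  /-- `Δφ = 0` in the fluid. -/
  harmonic : ∀ t, 0 ≤ t →
    InnerProductSpace.HarmonicOnNhd (fun p : ℂ => φ (t, p)) (fluidDomain h X Y t)
  /-- `(φ_x - γ y, φ_y) · (0, -1) = 0` on the bottom. -/
  bed : ∀ t, 0 ≤ t → ∀ p ∈ bottom h,
    (phiX h X Y φ t p - γ * p.im) * 0 + phiY h X Y φ t p * (-1) = 0
  /-- `(φ_x - γ y - X_t, φ_y - Y_t) · N = 0` on the surface, `N = (-Y_s, X_s)`. -/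
  kinematic : ∀ s t, 0 ≤ t →
    (phiX h X Y φ t (surfacePoint X Y s t) - γ * Y s t - dT X s t) * (-dS Y s t) +
      (phiY h X Y φ t (surfacePoint X Y s t) - dT Y s t) * dS X s t = 0
  /-- The Bernoulli condition on the surface. -/
  dynamic : ∀ s t, 0 ≤ t →
    phiT h X Y φ t (surfacePoint X Y s t)
      + (1 / 2) * (phiY h X Y φ t (surfacePoint X Y s t)) ^ 2
      + (1 / 2) * (phiX h X Y φ t (surfacePoint X Y s t) - γ * Y s t) ^ 2
      + g * Y s t = σ * curvature X Y s t

/-- `ξ` is the trace of `φ` on the free surface. -/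
def IsTrace (X Y ξ : ℝ → ℝ → ℝ) (φ : ℝ × ℂ → ℝ) : Prop :=
  ∀ s t, 0 ≤ t → ξ s t = φ (t, surfacePoint X Y s t)

/-- The integrand of the nonlocal equation. -/
def nonlocalIntegrand (h γ : ℝ) (X Y ξ : ℝ → ℝ → ℝ) (k t s : ℝ) : ℂ :=
  Complex.exp (Complex.I * k * X s t) *
    ((dS ξ s t * Real.sinh (k * (Y s t + h)) : ℝ) +
      Complex.I * ((dS X s t * dT Y s t - dS Y s t * dT X s t - γ * Y s t * dS Y s t) *
        Real.cosh (k * (Y s t + h)) : ℝ))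

/-- The nonlocal equation, for all real `k` and all `t ≥ 0`. -/
def NonlocalEq (h γ : ℝ) (X Y ξ : ℝ → ℝ → ℝ) : Prop :=
  ∀ k t : ℝ, 0 ≤ t → Integrable (nonlocalIntegrand h γ X Y ξ k t) ∧
    ∫ s, nonlocalIntegrand h γ X Y ξ k t s = 0

/-- The Bernoulli equation in terms of the surface variables. -/
def BernoulliEq (γ g σ : ℝ) (X Y ξ : ℝ → ℝ → ℝ) : Prop :=
  ∀ s t : ℝ, 0 ≤ t →
    dT ξ s t + g * Y s t - (1 / 2) * (dT X s t) ^ 2 - (1 / 2) * (dT Y s t) ^ 2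
      + γ * Y s t * (2 * dS X s t * dS Y s t * dT Y s t - 2 * (dS Y s t) ^ 2 * dT X s t
          - 2 * dS ξ s t * dS X s t + γ * (dS X s t) ^ 2 * Y s t)
        / (2 * ((dS X s t) ^ 2 + (dS Y s t) ^ 2))
      + (dS ξ s t - dS X s t * dT X s t - dS Y s t * dT Y s t) ^ 2
        / (2 * ((dS X s t) ^ 2 + (dS Y s t) ^ 2))
      - σ * ((dS X s t * dS (dS Y) s t - dS Y s t * dS (dS X) s t)
        / ((dS X s t) ^ 2 + (dS Y s t) ^ 2) ^ ((3 : ℝ) / 2)) = 0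

end WaterWave

end

/-!
The equivalence of the boundary value problem with the two surface equations rests on complex
analysis at each fixed time.  In the fluid the function `w = φ_x - i φ_y` is holomorphic; it is real
on the bottom and vanishes at infinity.  On the surface `Z = X + i Y` the trace fixes its tangential
component and the kinematic condition its normal component, so that `w = f / Z_s` with
`f = ξ_s - i (X_s Y_t - Y_s X_t - γ Y Y_s)` (`velocityDensity`).  Given these boundary values, the
Bernoulli condition and the Bernoulli equation for the surface variables are equivalent by
algebra, point by point (`dynamic_iff`).  What remains is to decide which `f` are boundary values of
such a function `w`.

The answer is given by the Cauchy integral of `f` along the curve and its mirror image in the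
bottom (`symCauchy`), which is real on the bottom: `f` is admissible exactly if this integral
vanishes above the curve, and then `w` is minus the integral below the curve.  Far above the curve
the Cauchy kernel is a Laplace integral of exponentials, and by Fourier inversion the
integral vanishes if and only if the exponential moments of the curve and of its mirror image agree
(`Arc.symCauchy_eq_zero_iff`); combining the two moments produces the hyperbolic functions of the
nonlocal equation (`nonlocal_iff`).

From a solution to the surface equations: the Cauchy integral above the curve, and the sum of the
Cauchy integral and `w` below it, fit together to a continuous function on the half plane above the
bottom, because the Cauchy integral jumps by `f / Z_s`.  An arc is removable for continuous
functions (`Arc.differentiableOn_of_diff`), so this function is holomorphic; it is real on the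
bottom and vanishes at infinity, hence it is zero (`eq_zero_of_halfPlane`,
`ArcFamily.symCauchy_of_holomorphic`).  The same argument gives uniqueness (`eqOn_of_trace_eq`): the
velocity is a Cauchy integral of surface data, and the segment from a point of the fluid to the
nearest point of the surface stays in the fluid.

From the surface equations to a solution: let `F` be a primitive of `f` along the curve with real
part `ξ`. Its Cauchy integral, normalised because `F` need not decay, is constant above the curve,
and the difference between this constant and the integral is a complex potential below the curve
with boundary values `F` (`innerExtension`). The velocity and the time derivative of this potential
are of the same form, with densities `f / Z_s` and `F_t - f Z_t / Z_s`; each extends continuously to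
the curve, as the regular part of the Cauchy integral does
(`ArcFamily.continuousOn_innerExtension`), and therefore the potential is continuously
differentiable in space and time up to the curve (`BoundaryPotential.contDiffOn`).

The topology of the curve enters through a chord-arc estimate (`exists_chordArc`), which makes the
surface a family of bi-Lipschitz arcs with a tubular neighbourhood of uniform width.  The index, the
Cauchy integral of the constant `1`, is `0` on the side of the bottom and `1` on the other side, and
each side is path-connected (`Arc.index_eq`, `Arc.joinedIn_iff`).  This identifies the fluid domain
(`fluidDomain_eq`).
-/

noncomputable section

namespace WaterWave

/-! ### Arcs, nearest points and tubular neighbourhoods -/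

/-- A regular arc in the plane with tangent `γ'`, running from `x = -∞` to `x = +∞` in a horizontal
strip: it is bi-Lipschitz with constants `c` and `C`, and its tangent is `C`-Lipschitz. -/
structure Arc (c C : ℝ) (γ γ' : ℝ → ℂ) : Prop where
  c_pos : 0 < c
  hasDeriv : ∀ s, HasDerivAt γ (γ' s) s
  lower : ∀ s r, c * |s - r| ≤ ‖γ s - γ r‖
  upper : ∀ s, ‖γ' s‖ ≤ C
  lip : ∀ s r, ‖γ' s - γ' r‖ ≤ C * |s - r|
  im_le : ∀ s, |(γ s).im| ≤ C
  re_top : Tendsto (fun s => (γ s).re) atTop atTop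
  re_bot : Tendsto (fun s => (γ s).re) atBot atBot
  re_pos : ∃ L, ∀ s, L ≤ s → 0 < (γ' s).re

/-- A parameter of a point of the curve nearest to `p`. -/
def foot (γ : ℝ → ℂ) (p : ℂ) : ℝ :=
  Classical.epsilon fun s => ∀ r, ‖γ s - p‖ ≤ ‖γ r - p‖

/-- The signed distance of `p` from the curve, in units of the speed, measured along the normal
at the nearest point; it is positive to the left of the curve. -/
def normalCoord (γ γ' : ℝ → ℂ) (p : ℂ) : ℝ :=
  ((p - γ (foot γ p)) / γ' (foot γ p)).im

namespace Arc

variable {c C : ℝ} {γ γ' : ℝ → ℂ}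

theorem continuous (h : Arc c C γ γ') : Continuous γ :=
  continuous_iff_continuousAt.2 fun s => (h.hasDeriv s).continuousAt

theorem continuous_deriv (h : Arc c C γ γ') : Continuous γ' := by
  have : LipschitzWith (Real.toNNReal C) γ' := by
    refine LipschitzWith.of_dist_le_mul fun s r => ?_
    rw [dist_eq_norm, Real.dist_eq]
    exact (h.lip s r).trans (mul_le_mul_of_nonneg_right (Real.le_coe_toNNReal C) (abs_nonneg _))
  exact this.continuous

theorem lipschitz (h : Arc c C γ γ') (s r : ℝ) : ‖γ s - γ r‖ ≤ C * |s - r| := by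
  have := Convex.norm_image_sub_le_of_norm_hasDerivWithin_le (f := γ) (f' := γ') (s := univ)
    (x := r) (y := s) (C := C) (fun x _ => (h.hasDeriv x).hasDerivWithinAt) (fun x _ => h.upper x)
    convex_univ (mem_univ _) (mem_univ _)
  simpa using this

theorem c_le_norm_deriv (h : Arc c C γ γ') (s : ℝ) : c ≤ ‖γ' s‖ := by
  have h1 := (hasDerivAt_iff_tendsto_slope.1 (h.hasDeriv s)).norm
  refine ge_of_tendsto h1 ?_
  filter_upwards [self_mem_nhdsWithin] with r hr
  have hr' : 0 < |r - s| := abs_pos.2 (sub_ne_zero.2 hr)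
  rw [slope_def_module, norm_smul, norm_inv, Real.norm_eq_abs, ← div_eq_inv_mul, le_div_iff₀ hr']
  exact h.lower r s

theorem deriv_ne_zero (h : Arc c C γ γ') (s : ℝ) : γ' s ≠ 0 :=
  norm_pos_iff.1 (h.c_pos.trans_le (h.c_le_norm_deriv s))

theorem c_le_C (h : Arc c C γ γ') : c ≤ C := (h.c_le_norm_deriv 0).trans (h.upper 0)

theorem C_pos (h : Arc c C γ γ') : 0 < C := h.c_pos.trans_le h.c_le_C

theorem injective (h : Arc c C γ γ') : Function.Injective γ := by
  intro s r hsr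
  have := h.lower s r
  rw [hsr, sub_self, norm_zero] at this
  have h2 : |s - r| ≤ 0 := by
    by_contra hh
    push Not at hh
    nlinarith [mul_pos h.c_pos hh]
  exact sub_eq_zero.1 (abs_eq_zero.1 (le_antisymm h2 (abs_nonneg _)))

theorem isClosed_range (h : Arc c C γ γ') : IsClosed (range γ) := by
  have h1 : AntilipschitzWith (Real.toNNReal c⁻¹) γ := by
    refine AntilipschitzWith.of_le_mul_dist fun s r => ?_
    rw [Real.dist_eq, dist_eq_norm, Real.coe_toNNReal _ (inv_nonneg.2 h.c_pos.le),
      ← div_eq_inv_mul, le_div_iff₀ h.c_pos, mul_comm]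
    exact h.lower s r
  have h2 : LipschitzWith (Real.toNNReal C) γ := by
    refine LipschitzWith.of_dist_le_mul fun s r => ?_
    rw [dist_eq_norm, Real.dist_eq, Real.coe_toNNReal _ h.C_pos.le]
    exact h.lipschitz s r
  exact h1.isClosed_range h2.uniformContinuous

theorem isOpen_compl (h : Arc c C γ γ') : IsOpen (range γ)ᶜ := h.isClosed_range.isOpen_compl

theorem taylor (h : Arc c C γ γ') (s r : ℝ) :
    ‖γ r - γ s - γ' s * (r - s)‖ ≤ C * |r - s| ^ 2 := by
  have hd : ∀ x ∈ uIcc s r, HasDerivWithinAt (fun x : ℝ => γ x - γ' s * (x - s)) (γ' x - γ' s)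
      (uIcc s r) x := by
    intro x _
    have h1 : HasDerivAt (fun x : ℝ => γ' s * ((x : ℂ) - s)) (γ' s * 1) x :=
      (Complex.ofRealCLM.hasDerivAt.sub_const (s : ℂ)).const_mul _
    rw [mul_one] at h1
    exact ((h.hasDeriv x).sub h1).hasDerivWithinAt
  have hb : ∀ x ∈ uIcc s r, ‖γ' x - γ' s‖ ≤ C * |r - s| := by
    intro x hx
    refine (h.lip x s).trans (mul_le_mul_of_nonneg_left ?_ h.C_pos.le)
    exact abs_sub_left_of_mem_uIcc hx
  have := Convex.norm_image_sub_le_of_norm_hasDerivWithin_le hd hb (convex_uIcc s r)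
    left_mem_uIcc right_mem_uIcc
  simp only [sub_self, mul_zero, sub_zero, Real.norm_eq_abs] at this
  rw [sq, ← mul_assoc, sub_right_comm]
  exact this

theorem foot_le (h : Arc c C γ γ') (p : ℂ) (r : ℝ) : ‖γ (foot γ p) - p‖ ≤ ‖γ r - p‖ := by
  have hex : ∃ s, ∀ r, ‖γ s - p‖ ≤ ‖γ r - p‖ := by
    obtain ⟨y, ⟨s, rfl⟩, hy⟩ := h.isClosed_range.exists_infDist_eq_dist (range_nonempty γ) p
    refine ⟨s, fun r => ?_⟩
    rw [← dist_eq_norm, dist_comm, ← hy, ← dist_eq_norm, dist_comm (γ r)]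
    exact Metric.infDist_le_dist_of_mem (mem_range_self r)
  exact Classical.epsilon_spec hex r

theorem foot_lower (h : Arc c C γ γ') (p : ℂ) (s : ℝ) :
    c / 2 * |s - foot γ p| ≤ ‖γ s - p‖ := by
  have h1 := h.lower s (foot γ p)
  have h2 := h.foot_le p s
  have h3 : ‖γ s - γ (foot γ p)‖ ≤ ‖γ s - p‖ + ‖γ (foot γ p) - p‖ := by
    rw [show γ s - γ (foot γ p) = (γ s - p) - (γ (foot γ p) - p) by ring]
    exact norm_sub_le _ _
  linarith

theorem foot_self (h : Arc c C γ γ') (s : ℝ) : foot γ (γ s) = s := by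
  have := h.foot_le (γ s) s
  rw [sub_self, norm_zero] at this
  exact h.injective (sub_eq_zero.1 (norm_le_zero_iff.1 this))

/-- The line through `p` and the nearest point of the curve is normal to the curve. -/
theorem eq_foot_add (h : Arc c C γ γ') (p : ℂ) :
    p = γ (foot γ p) + normalCoord γ γ' p * (Complex.I * γ' (foot γ p)) := by
  set s := foot γ p with hs
  have hd : HasDerivAt (fun r => ‖γ r - p‖ ^ 2) (2 * inner ℝ (γ s - p) (γ' s)) s :=
    ((h.hasDeriv s).sub_const p).norm_sq
  have hmin : IsLocalMin (fun r => ‖γ r - p‖ ^ 2) s :=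
    Filter.Eventually.of_forall fun r => by
      have := h.foot_le p r
      exact pow_le_pow_left₀ (norm_nonneg _) this 2
  have h0 := hmin.hasDerivAt_eq_zero hd
  have hne := h.deriv_ne_zero s
  have hre : ((p - γ s) / γ' s).re = 0 := by
    rw [Complex.inner] at h0
    rw [Complex.div_re]
    simp only [Complex.mul_re, Complex.conj_re, Complex.conj_im, Complex.sub_re,
      Complex.sub_im] at h0 ⊢
    rw [← add_div]
    apply div_eq_zero_iff.2 (Or.inl _)
    linarith
  have h1 : (p - γ s) / γ' s = normalCoord γ γ' p * Complex.I := by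
    apply Complex.ext
    · simp [hre]
    · simp [normalCoord, ← hs]
  rw [← mul_assoc, ← h1, div_mul_cancel₀ _ hne]
  ring

theorem normalCoord_ne_zero (h : Arc c C γ γ') {p : ℂ} (hp : p ∉ range γ) :
    normalCoord γ γ' p ≠ 0 := by
  intro h0
  apply hp
  refine ⟨foot γ p, ?_⟩
  conv_rhs => rw [h.eq_foot_add p, h0]
  simp

/-- The open segment from `p` to the nearest point of the curve does not meet the curve. -/
theorem segment_notMem (h : Arc c C γ γ') {p : ℂ} (hp : p ∉ range γ) {u : ℝ} (hu0 : 0 < u)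
    (hu1 : u ≤ 1) : γ (foot γ p) + u * (p - γ (foot γ p)) ∉ range γ := by
  rintro ⟨r, hr⟩
  have h1 := h.foot_le p r
  have hne : 0 < ‖γ (foot γ p) - p‖ := norm_pos_iff.2 (sub_ne_zero.2 fun hh => hp ⟨_, hh⟩)
  rw [hr, show γ (foot γ p) + u * (p - γ (foot γ p)) - p = ((1 - u : ℝ) : ℂ) *
    (γ (foot γ p) - p) by push_cast; ring, norm_mul, Complex.norm_real, Real.norm_eq_abs,
    abs_of_nonneg (by linarith)] at h1
  nlinarith

/-- A tubular neighbourhood of uniform width meets the curve only along the curve itself. -/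
theorem tube_notMem (h : Arc c C γ γ') {s n : ℝ} (hn0 : n ≠ 0) (hn : |n| < (c / C) ^ 2) :
    γ s + n * (Complex.I * γ' s) ∉ range γ := by
  rintro ⟨r, hr⟩
  have hC := h.C_pos
  have hc := h.c_pos
  have h1 := h.lower r s
  have h2 : ‖γ r - γ s‖ ≤ |n| * C := by
    rw [hr, add_sub_cancel_left, norm_mul, norm_mul, Complex.norm_I, one_mul, Complex.norm_real,
      Real.norm_eq_abs]
    exact mul_le_mul_of_nonneg_left (h.upper s) (abs_nonneg _)
  have h3 := h.taylor s r
  have h4 : γ r - γ s - γ' s * (r - s) = γ' s * (⟨-(r - s), n⟩ : ℂ) := by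
    rw [hr, show (⟨-(r - s), n⟩ : ℂ) = n * Complex.I - (r - s) by
      apply Complex.ext <;> simp]
    ring
  rw [h4, norm_mul] at h3
  have h5 : |r - s| ≤ ‖(⟨-(r - s), n⟩ : ℂ)‖ := by
    have := Complex.abs_re_le_norm (⟨-(r - s), n⟩ : ℂ)
    simpa only [abs_neg] using this
  -- the chord is orthogonal to the tangent at `s`, so the Taylor remainder is at least
  -- `c * |r - s|`, which forces `r = s` or `c / C ≤ |r - s|`
  have h6 : c * |r - s| ≤ C * |r - s| ^ 2 :=
    (mul_le_mul (h.c_le_norm_deriv s) h5 (abs_nonneg _) (norm_nonneg _)).trans h3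
  have h7 : C * |r - s| < c := by
    have h8 : C * (c * |r - s|) ≤ |n| * C ^ 2 := by nlinarith
    have h9 : |n| * C ^ 2 < c ^ 2 := by
      rw [div_pow, lt_div_iff₀ (by positivity)] at hn
      exact hn
    nlinarith
  have h8 : |r - s| = 0 := by
    by_contra hne
    have : 0 < |r - s| := lt_of_le_of_ne (abs_nonneg _) (Ne.symm hne)
    nlinarith
  have h9 : r = s := sub_eq_zero.1 (abs_eq_zero.1 h8)
  rw [h9] at hr
  have : (n : ℂ) * (Complex.I * γ' s) = 0 := by
    linear_combination -hr
  simp [h.deriv_ne_zero, hn0] at this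

theorem tube_pos (h : Arc c C γ γ') : 0 < (c / C) ^ 2 := by
  have := h.C_pos
  have := h.c_pos
  positivity

/-- A point off the curve can be brought into the tubular neighbourhood along its normal. -/
theorem exists_joinedIn_tube (h : Arc c C γ γ') {p : ℂ} (hp : p ∉ range γ) :
    ∃ n : ℝ, 0 < n * normalCoord γ γ' p ∧ |n| < (c / C) ^ 2 ∧
      JoinedIn (range γ)ᶜ p (γ (foot γ p) + n * (Complex.I * γ' (foot γ p))) := by
  set ε := (c / C) ^ 2 with hε
  have hεpos : 0 < ε := h.tube_pos
  have hn := h.normalCoord_ne_zero hp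
  set n := normalCoord γ γ' p with hndef
  set u : ℝ := min 1 (ε / (2 * |n|)) with hu
  have hnpos : 0 < |n| := abs_pos.2 hn
  have hu0 : 0 < u := lt_min one_pos (by positivity)
  have hu1 : u ≤ 1 := min_le_left _ _
  have hpe : p - γ (foot γ p) = n * (Complex.I * γ' (foot γ p)) := by
    exact sub_eq_of_eq_add' (h.eq_foot_add p)
  refine ⟨u * n, ?_, ?_, ?_⟩
  · rw [mul_assoc]; exact mul_pos hu0 (mul_self_pos.2 hn)
  · rw [abs_mul, abs_of_pos hu0]
    calc u * |n| ≤ ε / (2 * |n|) * |n| := by gcongr; exact min_le_right _ _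
      _ = ε / 2 := by field_simp
      _ < ε := by linarith
  · apply JoinedIn.of_segment_subset
    rintro z ⟨a, b, ha, hb, hab, rfl⟩
    have hw : a • p + b • (γ (foot γ p) + ((u * n : ℝ) : ℂ) * (Complex.I * γ' (foot γ p))) =
        γ (foot γ p) + ((a + b * u : ℝ) : ℂ) * (p - γ (foot γ p)) := by
      have hb' : (a : ℂ) + b = 1 := by exact_mod_cast hab
      rw [hpe]
      have : p = γ (foot γ p) + n * (Complex.I * γ' (foot γ p)) := by
        linear_combination hpe
      simp only [Complex.real_smul]
      push_cast
      linear_combination a * this + γ (foot γ p) * hb'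
    rw [hw]
    apply h.segment_notMem hp
    · rcases ha.eq_or_lt with ha0 | ha0
      · have : b = 1 := by linarith
        rw [← ha0, this]; simpa using hu0
      · positivity
    · nlinarith

/-- Either side of the tubular neighbourhood is path-connected. -/
theorem joinedIn_tube (h : Arc c C γ γ') {s r n m : ℝ} (hnm : 0 < n * m) (hn : |n| < (c / C) ^ 2)
    (hm : |m| < (c / C) ^ 2) : JoinedIn (range γ)ᶜ (γ s + n * (Complex.I * γ' s))
      (γ r + m * (Complex.I * γ' r)) := by
  set ε := (c / C) ^ 2 with hε
  set B : Set (ℝ × ℝ) := univ ×ˢ {a | 0 < a * n ∧ |a| < ε} with hB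
  have hconv : Convex ℝ B := by
    refine convex_univ.prod ?_
    have h1 : Convex ℝ {a : ℝ | 0 < a * n} := by
      intro x hx y hy a b ha hb hab
      simp only [mem_ofPred_eq, smul_eq_mul] at hx hy ⊢
      rcases ha.eq_or_lt with ha0 | ha0
      · have : b = 1 := by linarith
        rw [← ha0, this]; simpa using hy
      · have := mul_nonneg hb hy.le
        nlinarith [mul_pos ha0 hx]
    have h2 : Convex ℝ {a : ℝ | |a| < ε} := by
      have : {a : ℝ | |a| < ε} = Ioo (-ε) ε := by ext a; simp [abs_lt]
      rw [this]
      exact convex_Ioo _ _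
    exact h1.inter h2
  have hmem1 : (s, n) ∈ B := ⟨mem_univ _, mul_self_pos.2 (left_ne_zero_of_mul hnm.ne'), hn⟩
  have hmem2 : (r, m) ∈ B := ⟨mem_univ _, by simpa [mul_comm] using hnm, hm⟩
  have hpc := hconv.isPathConnected ⟨_, hmem1⟩
  have hcont : ContinuousOn (fun x : ℝ × ℝ => γ x.1 + x.2 * (Complex.I * γ' x.1)) B := by
    have := h.continuous
    have := h.continuous_deriv
    fun_prop
  have := (hpc.image' hcont).joinedIn _ (mem_image_of_mem _ hmem1) _ (mem_image_of_mem _ hmem2)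
  refine this.mono ?_
  rintro _ ⟨⟨s, a⟩, ⟨-, ha1, ha2⟩, rfl⟩
  exact h.tube_notMem (left_ne_zero_of_mul ha1.ne') ha2

/-- Two points off the curve whose nearest points see them on the same side can be joined by a path
off the curve: along the normals, and then inside the tubular neighbourhood. -/
theorem joinedIn_of_mul_pos (h : Arc c C γ γ') {p q : ℂ} (hp : p ∉ range γ) (hq : q ∉ range γ)
    (hpq : 0 < normalCoord γ γ' p * normalCoord γ γ' q) : JoinedIn (range γ)ᶜ p q := by
  obtain ⟨n, hn1, hn2, hn3⟩ := h.exists_joinedIn_tube hp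
  obtain ⟨m, hm1, hm2, hm3⟩ := h.exists_joinedIn_tube hq
  have hnm : 0 < n * m := by
    have h1 : 0 < (n * normalCoord γ γ' p) * (m * normalCoord γ γ' q) := mul_pos hn1 hm1
    have h2 : 0 < (n * m) * (normalCoord γ γ' p * normalCoord γ γ' q) := by
      convert h1 using 1; ring
    exact (pos_iff_pos_of_mul_pos h2).2 hpq
  exact hn3.trans ((h.joinedIn_tube hnm hn2 hm2).trans hm3.symm)

end Arc

/-! ### Boundary integrals over rectangles -/

/-- Finitely many cells of a square grid, labelled by integers in a window of length `2 A` in such a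
way that cells with equal labels are at most `K` steps apart. -/
theorem card_le_of_label {B : Finset (ℕ × ℕ)} (m : ℕ × ℕ → ℤ) (A K : ℕ)
    (h1 : ∀ p ∈ B, ∀ q ∈ B, |m p - m q| ≤ A)
    (h2 : ∀ p ∈ B, ∀ q ∈ B, m p = m q →
      |(p.1 : ℤ) - q.1| ≤ K ∧ |(p.2 : ℤ) - q.2| ≤ K) :
    B.card ≤ (2 * K + 1) ^ 2 * (2 * A + 1) := by
  classical
  rcases B.eq_empty_or_nonempty with rfl | ⟨p0, hp0⟩
  · simp
  have himg : (B.image m).card ≤ 2 * A + 1 := by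
    calc (B.image m).card ≤ (Finset.Icc (m p0 - A) (m p0 + A)).card := by
          apply Finset.card_le_card
          intro x hx
          obtain ⟨p, hp, rfl⟩ := Finset.mem_image.1 hx
          have := abs_le.1 (h1 p hp p0 hp0)
          rw [Finset.mem_Icc]
          constructor <;> linarith [this.1, this.2]
      _ = 2 * A + 1 := by
          rw [Int.card_Icc]; omega
  have hfib : ∀ a ∈ B.image m, (B.filter fun x => m x = a).card ≤ (2 * K + 1) ^ 2 := by
    intro a ha
    obtain ⟨q, hq, rfl⟩ := Finset.mem_image.1 ha
    calc (B.filter fun x => m x = m q).card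
        ≤ (Finset.Icc (q.1 - K) (q.1 + K) ×ˢ Finset.Icc (q.2 - K) (q.2 + K)).card := by
          apply Finset.card_le_card
          intro x hx
          rw [Finset.mem_filter] at hx
          obtain ⟨h3, h4⟩ := h2 x hx.1 q hq hx.2
          rw [abs_le] at h3 h4
          simp only [Finset.mem_product, Finset.mem_Icc]
          omega
      _ ≤ (2 * K + 1) ^ 2 := by
          rw [Finset.card_product, Nat.card_Icc, Nat.card_Icc, sq]
          apply Nat.mul_le_mul <;> omega
  calc B.card ≤ (2 * K + 1) ^ 2 * (B.image m).card := Finset.card_le_mul_card_image B _ hfib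
    _ ≤ _ := Nat.mul_le_mul_left _ himg

/-- The integral of `M` along the boundary of the rectangle with opposite corners `a + c i` and
`b + d i`. -/
def rectIntegral (M : ℂ → ℂ) (a b c d : ℝ) : ℂ :=
  (∫ x in a..b, M (x + c * Complex.I)) - (∫ x in a..b, M (x + d * Complex.I)) +
    Complex.I • (∫ y in c..d, M (b + y * Complex.I)) -
    Complex.I • ∫ y in c..d, M (a + y * Complex.I)

/-- The boundary integral of a continuous function is at most its oscillation on the rectangle times
the perimeter. -/
theorem norm_rectIntegral_le {M : ℂ → ℂ} {a b c d ω : ℝ} (p : ℂ)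
    (hc : ContinuousOn M (uIcc a b ×ℂ uIcc c d))
    (hω : ∀ z ∈ uIcc a b ×ℂ uIcc c d, ‖M z - p‖ ≤ ω) :
    ‖rectIntegral M a b c d‖ ≤ 2 * ω * (|b - a| + |d - c|) := by
  have hx : ∀ y ∈ uIcc c d, ∀ x ∈ uIcc a b, (x + y * Complex.I : ℂ) ∈ uIcc a b ×ℂ uIcc c d := by
    intro y hy x hx
    rw [Complex.mem_reProdIm]
    simpa using ⟨hx, hy⟩
  have hH : ∀ y ∈ uIcc c d,
      (∫ x in a..b, M (x + y * Complex.I)) =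
        (∫ x in a..b, (M (x + y * Complex.I) - p)) + (b - a) * p := by
    intro y hy
    rw [intervalIntegral.integral_sub]
    · simp
    · apply ContinuousOn.intervalIntegrable
      refine hc.comp (by fun_prop) fun x h => hx y hy x h
    · simp
  have hV : ∀ x ∈ uIcc a b,
      (∫ y in c..d, M (x + y * Complex.I)) =
        (∫ y in c..d, (M (x + y * Complex.I) - p)) + (d - c) * p := by
    intro x hx'
    rw [intervalIntegral.integral_sub]
    · simp
    · apply ContinuousOn.intervalIntegrable
      refine hc.comp (by fun_prop) fun y h => hx y h x hx'
    · simp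
  have bH : ∀ y ∈ uIcc c d, ‖∫ x in a..b, (M (x + y * Complex.I) - p)‖ ≤ ω * |b - a| :=
    fun y hy => intervalIntegral.norm_integral_le_of_norm_le_const fun x h =>
      hω _ (hx y hy x (uIoc_subset_uIcc h))
  have bV : ∀ x ∈ uIcc a b, ‖∫ y in c..d, (M (x + y * Complex.I) - p)‖ ≤ ω * |d - c| :=
    fun x hx' => intervalIntegral.norm_integral_le_of_norm_le_const fun y h =>
      hω _ (hx y (uIoc_subset_uIcc h) x hx')
  have h1 := bH c left_mem_uIcc
  have h2 := bH d right_mem_uIcc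
  have h3 := bV b right_mem_uIcc
  have h4 := bV a left_mem_uIcc
  rw [rectIntegral, hH c left_mem_uIcc, hH d right_mem_uIcc, hV b right_mem_uIcc,
    hV a left_mem_uIcc]
  set A1 := ∫ x in a..b, (M (x + c * Complex.I) - p)
  set A2 := ∫ x in a..b, (M (x + d * Complex.I) - p)
  set A3 := ∫ y in c..d, (M (b + y * Complex.I) - p)
  set A4 := ∫ y in c..d, (M (a + y * Complex.I) - p)
  have : A1 + (b - a) * p - (A2 + (b - a) * p) + Complex.I • (A3 + (d - c) * p) -
      Complex.I • (A4 + (d - c) * p) = A1 - A2 + Complex.I * A3 - Complex.I * A4 := by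
    simp only [smul_eq_mul]; ring
  rw [this]
  have e3 : ‖Complex.I * A3‖ = ‖A3‖ := by simp
  have e4 : ‖Complex.I * A4‖ = ‖A4‖ := by simp
  calc _ ≤ ‖A1‖ + ‖A2‖ + ‖Complex.I * A3‖ + ‖Complex.I * A4‖ := by
        refine (norm_sub_le _ _).trans (add_le_add (norm_add_le_of_le (norm_sub_le _ _) le_rfl) le_rfl)
    _ ≤ _ := by rw [e3, e4]; linarith

/-- Boundary integrals are additive under subdivision into a grid. -/
theorem rectIntegral_eq_sum {M : ℂ → ℂ} {N : ℕ} {x y : ℕ → ℝ}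
    (hc : ∀ i < N, ∀ j ≤ N, IntervalIntegrable (fun u : ℝ => M (u + y j * Complex.I)) volume
      (x i) (x (i + 1)))
    (hc' : ∀ i ≤ N, ∀ j < N, IntervalIntegrable (fun u : ℝ => M (x i + u * Complex.I)) volume
      (y j) (y (j + 1))) :
    rectIntegral M (x 0) (x N) (y 0) (y N) =
      ∑ i ∈ Finset.range N, ∑ j ∈ Finset.range N,
        rectIntegral M (x i) (x (i + 1)) (y j) (y (j + 1)) := by
  have hH : ∀ j ≤ N, (∫ u in x 0..x N, M (u + y j * Complex.I)) =
      ∑ i ∈ Finset.range N, ∫ u in x i..x (i + 1), M (u + y j * Complex.I) := fun j hj =>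
    (intervalIntegral.sum_integral_adjacent_intervals fun k hk => hc k hk j hj).symm
  have hV : ∀ i ≤ N, (∫ u in y 0..y N, M (x i + u * Complex.I)) =
      ∑ j ∈ Finset.range N, ∫ u in y j..y (j + 1), M (x i + u * Complex.I) := fun i hi =>
    (intervalIntegral.sum_integral_adjacent_intervals fun k hk => hc' i hi k hk).symm
  have e1 : ∑ i ∈ Finset.range N, ∑ j ∈ Finset.range N,
      ((∫ u in x i..x (i + 1), M (u + y j * Complex.I)) -
        ∫ u in x i..x (i + 1), M (u + y (j + 1) * Complex.I)) =
      (∫ u in x 0..x N, M (u + y 0 * Complex.I)) - ∫ u in x 0..x N, M (u + y N * Complex.I) := by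
    rw [hH 0 (Nat.zero_le _), hH N le_rfl, ← Finset.sum_sub_distrib]
    refine Finset.sum_congr rfl fun i _ => ?_
    exact Finset.sum_range_sub' (fun j => ∫ u in x i..x (i + 1), M (u + y j * Complex.I)) N
  have e2 : ∑ i ∈ Finset.range N, ∑ j ∈ Finset.range N,
      (Complex.I • (∫ u in y j..y (j + 1), M (x (i + 1) + u * Complex.I)) -
        Complex.I • ∫ u in y j..y (j + 1), M (x i + u * Complex.I)) =
      Complex.I • (∫ u in y 0..y N, M (x N + u * Complex.I)) -
        Complex.I • ∫ u in y 0..y N, M (x 0 + u * Complex.I) := by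
    rw [hV 0 (Nat.zero_le _), hV N le_rfl, Finset.sum_comm, Finset.smul_sum, Finset.smul_sum,
      ← Finset.sum_sub_distrib]
    refine Finset.sum_congr rfl fun j _ => ?_
    exact Finset.sum_range_sub
      (fun i => Complex.I • ∫ u in y j..y (j + 1), M (x i + u * Complex.I)) N
  rw [rectIntegral, ← e1, add_sub_assoc, ← e2, ← Finset.sum_add_distrib]
  refine Finset.sum_congr rfl fun i _ => ?_
  rw [← Finset.sum_add_distrib]
  refine Finset.sum_congr rfl fun j _ => ?_
  rw [rectIntegral, add_sub_assoc]

/-! ### Removability of arcs for continuous functions -/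

theorem add_mul_mem_uIcc {a b θ : ℝ} (h0 : 0 ≤ θ) (h1 : θ ≤ 1) : a + θ * (b - a) ∈ uIcc a b := by
  rcases le_total a b with h | h
  · rw [uIcc_of_le h]; constructor <;> nlinarith
  · rw [uIcc_of_ge h]; constructor <;> nlinarith

/-- A function that is continuous on a rectangle and holomorphic there off an arc has vanishing
boundary integral.  In a grid of `N ^ 2` cells only `O(N)` cells meet the arc, the perimeters of
these add up to `O(1)`, and the oscillation of the function on a cell tends to `0`. -/
theorem Arc.rectIntegral_eq_zero {c C : ℝ} {γ γ' : ℝ → ℂ} (h : Arc c C γ γ') {M : ℂ → ℂ}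
    {a b u v : ℝ} (hc : ContinuousOn M (uIcc a b ×ℂ uIcc u v))
    (hd : DifferentiableOn ℂ M ((uIcc a b ×ℂ uIcc u v) \ range γ)) :
    rectIntegral M a b u v = 0 := by
  classical
  rcases eq_or_ne a b with rfl | hab
  · simp [rectIntegral]
  rcases eq_or_ne u v with rfl | huv
  · simp [rectIntegral]
  have hcpos := h.c_pos
  have hCpos := h.C_pos
  have hℓ : 0 < |b - a| := abs_pos.2 (sub_ne_zero.2 hab.symm)
  have hℓ' : 0 < |v - u| := abs_pos.2 (sub_ne_zero.2 huv.symm)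
  set D := |b - a| + |v - u| with hD
  -- `K` and the analogous `K'` bound the number of cells between two points at distance `C / N`,
  -- and `A` bounds the length of the parameter interval of the arc inside the rectangle
  obtain ⟨K, hK1⟩ := exists_nat_ge (2 + C / |b - a|)
  obtain ⟨K', hK2⟩ := exists_nat_ge (2 + C / |v - u|)
  obtain ⟨A, hA⟩ := exists_nat_ge (D / c)
  set L : ℕ := max K K'
  set K3 : ℝ := (2 * L + 1) ^ 2 * (2 * (A + 2) + 1) with hK3
  have hK3pos : 0 < K3 := by positivity
  have hcomp : IsCompact (uIcc a b ×ℂ uIcc u v) := isCompact_uIcc.reProdIm isCompact_uIcc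
  have huc := hcomp.uniformContinuousOn_of_continuous hc
  have main : ∀ ω > 0, ‖rectIntegral M a b u v‖ ≤ K3 * (2 * D) * ω := by
    intro ω hω
    obtain ⟨η, hη, hη'⟩ := Metric.uniformContinuousOn_iff.1 huc ω hω
    obtain ⟨N, hN⟩ := exists_nat_gt (D / η)
    have hNpos : (0 : ℝ) < N := lt_of_le_of_lt (by positivity) hN
    have hNpos' : 0 < N := by exact_mod_cast hNpos
    set x : ℕ → ℝ := fun i => a + (i / N : ℝ) * (b - a) with hx
    set y : ℕ → ℝ := fun j => u + (j / N : ℝ) * (v - u) with hy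
    have hxm : ∀ i ≤ N, x i ∈ uIcc a b := fun i hi =>
      add_mul_mem_uIcc (by positivity) (div_le_one_of_le₀ (by exact_mod_cast hi) hNpos.le)
    have hym : ∀ i ≤ N, y i ∈ uIcc u v := fun i hi =>
      add_mul_mem_uIcc (by positivity) (div_le_one_of_le₀ (by exact_mod_cast hi) hNpos.le)
    have hxd : ∀ i, |x (i + 1) - x i| = |b - a| / N := by
      intro i
      rw [show x (i + 1) - x i = (b - a) / N by simp only [hx]; push_cast; ring, abs_div,
        abs_of_pos hNpos]
    have hyd : ∀ i, |y (i + 1) - y i| = |v - u| / N := by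
      intro i
      rw [show y (i + 1) - y i = (v - u) / N by simp only [hy]; push_cast; ring, abs_div,
        abs_of_pos hNpos]
    have hxs : ∀ i < N, uIcc (x i) (x (i + 1)) ⊆ uIcc a b := fun i hi =>
      uIcc_subset_uIcc (hxm i hi.le) (hxm (i + 1) hi)
    have hys : ∀ i < N, uIcc (y i) (y (i + 1)) ⊆ uIcc u v := fun i hi =>
      uIcc_subset_uIcc (hym i hi.le) (hym (i + 1) hi)
    have hcell : ∀ i < N, ∀ j < N, uIcc (x i) (x (i + 1)) ×ℂ uIcc (y j) (y (j + 1)) ⊆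
        uIcc a b ×ℂ uIcc u v := fun i hi j hj z hz =>
      ⟨hxs i hi hz.1, hys j hj hz.2⟩
    have hsum : rectIntegral M a b u v = ∑ i ∈ Finset.range N, ∑ j ∈ Finset.range N,
        rectIntegral M (x i) (x (i + 1)) (y j) (y (j + 1)) := by
      have e1 : x 0 = a := by simp [hx]
      have e2 : x N = b := by simp [hx, div_self hNpos.ne']
      have e3 : y 0 = u := by simp [hy]
      have e4 : y N = v := by simp [hy, div_self hNpos.ne']
      rw [← rectIntegral_eq_sum, e1, e2, e3, e4]
      · intro i hi j hj
        apply ContinuousOn.intervalIntegrable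
        refine hc.comp (by fun_prop) fun r hr => ?_
        rw [Complex.mem_reProdIm]
        simpa using ⟨hxs i hi hr, hym j hj⟩
      · intro i hi j hj
        apply ContinuousOn.intervalIntegrable
        refine hc.comp (by fun_prop) fun r hr => ?_
        rw [Complex.mem_reProdIm]
        simpa using ⟨hxm i hi, hys j hj hr⟩
    set bad : ℕ × ℕ → Prop := fun p =>
      ∃ s, γ s ∈ uIcc (x p.1) (x (p.1 + 1)) ×ℂ uIcc (y p.2) (y (p.2 + 1)) with hbad
    set B : Finset (ℕ × ℕ) := (Finset.range N ×ˢ Finset.range N).filter bad with hB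
    -- oscillation bound on the cells that meet the arc
    have hbadle : ∀ p ∈ B, ‖rectIntegral M (x p.1) (x (p.1 + 1)) (y p.2) (y (p.2 + 1))‖ ≤
        2 * ω * (D / N) := by
      rintro ⟨i, j⟩ hp
      simp only [hB, Finset.mem_filter, Finset.mem_product, Finset.mem_range] at hp
      obtain ⟨⟨hi, hj⟩, s, hs⟩ := hp
      refine (norm_rectIntegral_le (M (γ s)) (hc.mono (hcell i hi j hj)) (ω := ω) ?_).trans ?_
      · intro z hz
        rw [← dist_eq_norm]
        refine (hη' z (hcell i hi j hj hz) _ (hcell i hi j hj hs) ?_).le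
        rw [dist_eq_norm]
        calc ‖z - γ s‖ ≤ |(z - γ s).re| + |(z - γ s).im| := Complex.norm_le_abs_re_add_abs_im _
          _ ≤ |b - a| / N + |v - u| / N := by
              rw [← hxd i, ← hyd j, Complex.sub_re, Complex.sub_im]
              exact add_le_add (abs_sub_le_of_uIcc_subset_uIcc (uIcc_subset_uIcc hs.1 hz.1))
                (abs_sub_le_of_uIcc_subset_uIcc (uIcc_subset_uIcc hs.2 hz.2))
          _ = D / N := by rw [← add_div]
          _ < η := by rw [div_lt_iff₀ hη] at hN; rw [div_lt_iff₀ hNpos]; linarith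
      · rw [hxd, hyd, ← add_div]
    have hgood : ∀ p ∈ Finset.range N ×ˢ Finset.range N, ¬ bad p →
        rectIntegral M (x p.1) (x (p.1 + 1)) (y p.2) (y (p.2 + 1)) = 0 := by
      rintro ⟨i, j⟩ hp hnb
      simp only [Finset.mem_product, Finset.mem_range] at hp
      have := Complex.integral_boundary_rect_eq_zero_of_differentiableOn M
        ⟨x i, y j⟩ ⟨x (i + 1), y (j + 1)⟩ (hd.mono fun z hz =>
          ⟨hcell i hp.1 j hp.2 hz, fun ⟨s, hs⟩ => hnb ⟨s, by rw [hs]; exact hz⟩⟩)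
      exact this
    -- only `O(N)` cells meet the arc
    have hcard : (B.card : ℝ) ≤ K3 * N := by
      -- choose a point of the arc in each cell
      have hex : ∀ p : ℕ × ℕ, ∃ s, p ∈ B → γ s ∈ uIcc (x p.1) (x (p.1 + 1)) ×ℂ
          uIcc (y p.2) (y (p.2 + 1)) := by
        intro p
        by_cases hp : p ∈ B
        · obtain ⟨s, hs⟩ := (Finset.mem_filter.1 hp).2
          exact ⟨s, fun _ => hs⟩
        · exact ⟨0, fun h => absurd h hp⟩
      choose σ hσ using hex
      have hlt : ∀ p ∈ B, p.1 < N ∧ p.2 < N := fun p hp => by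
        have := (Finset.mem_filter.1 hp).1
        simpa using this
      have hbnd : ∀ p ∈ B, ∀ q ∈ B, |σ p - σ q| ≤ D / c := by
        intro p hp q hq
        rw [le_div_iff₀ hcpos, mul_comm]
        refine (h.lower _ _).trans ?_
        have m1 := hcell p.1 (hlt p hp).1 p.2 (hlt p hp).2 (hσ p hp)
        have m2 := hcell q.1 (hlt q hq).1 q.2 (hlt q hq).2 (hσ q hq)
        refine (Complex.norm_le_abs_re_add_abs_im _).trans ?_
        rw [Complex.sub_re, Complex.sub_im]
        exact add_le_add (abs_sub_le_of_uIcc_subset_uIcc (uIcc_subset_uIcc m2.1 m1.1))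
          (abs_sub_le_of_uIcc_subset_uIcc (uIcc_subset_uIcc m2.2 m1.2))
      have hfl : ∀ r r' : ℝ, |(⌊r * N⌋ : ℝ) - ⌊r' * N⌋| ≤ |r - r'| * N + 1 := by
        intro r r'
        have e1 := Int.floor_le (r * N)
        have e2 := Int.lt_floor_add_one (r * N)
        have e3 := Int.floor_le (r' * N)
        have e4 := Int.lt_floor_add_one (r' * N)
        have e5 : |r - r'| * N = |r * N - r' * N| := by
          rw [← sub_mul, abs_mul, abs_of_pos hNpos]
        rw [e5, abs_le]
        constructor <;> linarith [neg_abs_le (r * N - r' * N), le_abs_self (r * N - r' * N)]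
      -- two points at distance at most `C / N` lie in rows that are at most `Q` apart
      have hst : ∀ (w0 w1 : ℝ) (Q : ℕ), 0 < |w1 - w0| → 2 + C / |w1 - w0| ≤ Q →
          ∀ (i k : ℕ) (r r' : ℝ),
          |r - (w0 + (i / N : ℝ) * (w1 - w0))| ≤ |w1 - w0| / N →
          |r' - (w0 + (k / N : ℝ) * (w1 - w0))| ≤ |w1 - w0| / N → |r - r'| ≤ C / N →
          |(i : ℤ) - k| ≤ Q := by
        intro w0 w1 Q hw hQ i k r r' h1 h2 h3
        have e1 : |((i : ℝ) - k)| * (|w1 - w0| / N) ≤ 2 * (|w1 - w0| / N) + C / N := by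
          have : |((i : ℝ) - k)| * (|w1 - w0| / N) =
              |(w0 + (i / N : ℝ) * (w1 - w0)) - (w0 + (k / N : ℝ) * (w1 - w0))| := by
            rw [← abs_of_pos hNpos, ← abs_div, ← abs_mul, abs_of_pos hNpos]
            congr 1; ring
          rw [this]
          rw [abs_le] at h1 h2 h3 ⊢
          constructor <;> linarith [h1.1, h1.2, h2.1, h2.2, h3.1, h3.2]
        have e2 : |((i : ℝ) - k)| ≤ 2 + C / |w1 - w0| := by
          have hp : 0 < |w1 - w0| / N := by positivity
          rw [← mul_le_mul_iff_left₀ hp]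
          refine e1.trans (le_of_eq ?_)
          field_simp
        have e3 := e2.trans hQ
        exact_mod_cast e3
      -- cells are labelled by the parameter of a chosen point of the arc in them, in units
      -- of `1 / N`
      have := card_le_of_label (B := B) (fun p => ⌊σ p * N⌋) (A * N + 1) L ?_ ?_
      · have h3 : (B.card : ℝ) ≤ (2 * L + 1) ^ 2 * (2 * (A * N + 1) + 1) := by exact_mod_cast this
        refine h3.trans ?_
        have hN1 : (1 : ℝ) ≤ N := by exact_mod_cast hNpos'
        rw [hK3, mul_assoc]
        apply mul_le_mul_of_nonneg_left _ (by positivity)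
        nlinarith
      · intro p hp q hq
        have e1 := hfl (σ p) (σ q)
        have e2 := (hbnd p hp q hq).trans hA
        have e3 : |(⌊σ p * N⌋ : ℝ) - ⌊σ q * N⌋| ≤ A * N + 1 := by nlinarith
        exact_mod_cast e3
      · intro p hp q hq hpq
        have hpq' : |σ p - σ q| ≤ 1 / N := by
          have e1 := Int.floor_le (σ p * N)
          have e2 := Int.lt_floor_add_one (σ p * N)
          have e3 := Int.floor_le (σ q * N)
          have e4 := Int.lt_floor_add_one (σ q * N)
          have hpq2 : ⌊σ p * N⌋ = ⌊σ q * N⌋ := hpq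
          rw [hpq2] at e1 e2
          rw [le_div_iff₀ hNpos, show |σ p - σ q| * N = |σ p * N - σ q * N| by
            rw [← sub_mul, abs_mul, abs_of_pos hNpos], abs_le]
          constructor <;> linarith
        have hγ : ‖γ (σ p) - γ (σ q)‖ ≤ C / N := by
          refine (h.lipschitz _ _).trans ?_
          rw [div_eq_mul_one_div C]
          exact mul_le_mul_of_nonneg_left hpq' hCpos.le
        have hre := (Complex.abs_re_le_norm _).trans hγ
        have him := (Complex.abs_im_le_norm _).trans hγ
        rw [Complex.sub_re] at hre
        rw [Complex.sub_im] at him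
        refine ⟨(hst a b K hℓ hK1 p.1 q.1 _ _ ?_ ?_ hre).trans
          (by exact_mod_cast le_max_left K K'), (hst u v K' hℓ' hK2 p.2 q.2 _ _ ?_ ?_ him).trans
          (by exact_mod_cast le_max_right K K')⟩
        · rw [← hxd p.1]; exact abs_sub_left_of_mem_uIcc (hσ p hp).1
        · rw [← hxd q.1]; exact abs_sub_left_of_mem_uIcc (hσ q hq).1
        · rw [← hyd p.2]; exact abs_sub_left_of_mem_uIcc (hσ p hp).2
        · rw [← hyd q.2]; exact abs_sub_left_of_mem_uIcc (hσ q hq).2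
    rw [hsum, ← Finset.sum_product (f := fun p : ℕ × ℕ =>
      rectIntegral M (x p.1) (x (p.1 + 1)) (y p.2) (y (p.2 + 1)))]
    rw [← Finset.sum_filter_of_ne (p := bad) fun p hp hne => by
      by_contra hnb; exact hne (hgood p hp hnb)]
    calc _ ≤ ∑ p ∈ B, 2 * ω * (D / N) := norm_sum_le_of_le _ hbadle
      _ = B.card * (2 * ω * (D / N)) := by rw [Finset.sum_const, nsmul_eq_mul]
      _ ≤ K3 * N * (2 * ω * (D / N)) := by gcongr
      _ = K3 * (2 * D) * ω := by field_simp
  have hDpos : 0 < D := by positivity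
  have : ‖rectIntegral M a b u v‖ ≤ 0 := by
    refine le_of_forall_pos_le_add fun ε hε => ?_
    have := main (ε / (K3 * (2 * D))) (by positivity)
    rwa [mul_div_cancel₀ _ (by positivity), ← zero_add ε] at this
  exact norm_le_zero_iff.1 this

/-- Arcs are removable for continuous functions: a function that is continuous on an open set and
holomorphic there off an arc is holomorphic. -/
theorem Arc.differentiableOn_of_diff {c C : ℝ} {γ γ' : ℝ → ℂ} (h : Arc c C γ γ') {M : ℂ → ℂ}
    {U : Set ℂ} (hU : IsOpen U) (hc : ContinuousOn M U)
    (hd : DifferentiableOn ℂ M (U \ range γ)) : DifferentiableOn ℂ M U := by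
  intro z hz
  obtain ⟨r, hr, hball⟩ := Metric.isOpen_iff.1 hU z hz
  have hcons : Complex.IsConservativeOn M (Metric.ball z r) := by
    intro p q hpq
    have := h.rectIntegral_eq_zero (hc.mono (hpq.trans hball))
      (hd.mono (sdiff_subset_sdiff_left (hpq.trans hball)))
    rw [rectIntegral] at this
    simp only [Complex.wedgeIntegral]
    have e1 := intervalIntegral.integral_symm p.re q.re (f := fun x : ℝ => M (x + q.im * Complex.I))
      (μ := volume)
    have e2 := intervalIntegral.integral_symm p.im q.im (f := fun y : ℝ => M (p.re + y * Complex.I))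
      (μ := volume)
    rw [e1, e2]
    simp only [smul_eq_mul] at this ⊢
    linear_combination this
  have hex := Complex.IsConservativeOn.isExactOn_ball (hc.mono hball) hcons
  exact ((hex.differentiableOn Metric.isOpen_ball).differentiableAt
    (Metric.isOpen_ball.mem_nhds (Metric.mem_ball_self hr))).differentiableWithinAt

/-! ### Cauchy integrals and separation by the index -/

/-- The Cauchy integral along `γ` with density `f` (with respect to the parameter). -/
def cauchy (γ f : ℝ → ℂ) (p : ℂ) : ℂ :=
  (2 * Real.pi * Complex.I)⁻¹ * ∫ s, f s / (γ s - p)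

/-- The Cauchy integral of `g dγ`, normalised to vanish at `o`.  The difference of the two kernels
decays like `s⁻²`, so that the integral exists for bounded `g`. -/
def cauchyDiff (γ γ' : ℝ → ℂ) (o : ℂ) (g : ℝ → ℂ) (p : ℂ) : ℂ :=
  (2 * Real.pi * Complex.I)⁻¹ * ∫ s, g s * (γ' s * ((γ s - p)⁻¹ - (γ s - o)⁻¹))

/-- The index of `p` relative to `o`: the number of crossings of the curve, counted with
orientation, on the way from `o` to `p`. -/
def index (γ γ' : ℝ → ℂ) (o p : ℂ) : ℂ := cauchyDiff γ γ' o (fun _ => 1) p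

theorem integrable_one_add_abs_sq : Integrable fun s : ℝ => ((1 + |s|) ^ 2)⁻¹ := by
  refine integrable_inv_one_add_sq.mono' ?_ (Eventually.of_forall fun s => ?_)
  · exact (Continuous.inv₀ (by fun_prop) fun s => by positivity).aestronglyMeasurable
  · rw [Real.norm_eq_abs, abs_of_nonneg (by positivity)]
    apply inv_anti₀ (by positivity)
    nlinarith [sq_abs s, abs_nonneg s]

namespace Arc

variable {c C : ℝ} {γ γ' : ℝ → ℂ}

/-- The distance from a point off the curve grows at least linearly in the parameter. -/
theorem exists_far (h : Arc c C γ γ') {p : ℂ} (hp : p ∉ range γ) :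
    ∃ κ > 0, ∀ s, κ * (1 + |s|) ≤ ‖γ s - p‖ := by
  set s0 := foot γ p
  have hδ : 0 < ‖γ s0 - p‖ := norm_pos_iff.2 (sub_ne_zero.2 fun hh => hp ⟨_, hh⟩)
  have hc := h.c_pos
  set δ := ‖γ s0 - p‖
  -- near the foot point the distance is at least `δ`, far from it the chord-arc bound takes over
  refine ⟨((1 + |s0|) / δ + 2 / c)⁻¹, by positivity, fun s => ?_⟩
  rw [← div_eq_inv_mul, div_le_iff₀ (by positivity)]
  have h1 := h.foot_le p s
  have h2 := h.foot_lower p s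
  have h3 : |s| ≤ |s0| + |s - s0| := by
    have := abs_add_le s0 (s - s0)
    rwa [add_sub_cancel] at this
  have h4 : 1 + |s0| ≤ ‖γ s - p‖ * ((1 + |s0|) / δ) := by
    rw [mul_div_assoc', le_div_iff₀ hδ, mul_comm]
    gcongr
  have h5 : |s - s0| ≤ ‖γ s - p‖ * (2 / c) := by
    rw [mul_div_assoc', le_div_iff₀ hc]
    linarith
  rw [mul_add]
  linarith

end Arc

theorem far_of_near {γ : ℝ → ℂ} {p q : ℂ} {κ : ℝ}
    (h : ∀ s, κ * (1 + |s|) ≤ ‖γ s - p‖) (hq : ‖q - p‖ ≤ κ / 2) (s : ℝ) :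
    κ / 2 * (1 + |s|) ≤ ‖γ s - q‖ := by
  have h1 := h s
  have h2 : ‖γ s - p‖ ≤ ‖γ s - q‖ + ‖q - p‖ := by
    rw [show γ s - p = (γ s - q) + (q - p) by ring]; exact norm_add_le _ _
  have h3 : 0 ≤ κ := by linarith [norm_nonneg (q - p)]
  nlinarith [abs_nonneg s, mul_nonneg h3 (abs_nonneg s)]

theorem ne_of_far {γ : ℝ → ℂ} {p : ℂ} {κ : ℝ} (hκ : 0 < κ)
    (h : ∀ s, κ * (1 + |s|) ≤ ‖γ s - p‖) (s : ℝ) : γ s - p ≠ 0 :=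
  norm_pos_iff.1 (lt_of_lt_of_le (by positivity) (h s))

theorem norm_inv_le_of_far {γ : ℝ → ℂ} {p : ℂ} {κ : ℝ} (hκ : 0 < κ)
    (h : ∀ s, κ * (1 + |s|) ≤ ‖γ s - p‖) (s : ℝ) : ‖(γ s - p)⁻¹‖ ≤ κ⁻¹ * (1 + |s|)⁻¹ := by
  rw [norm_inv, ← mul_inv]
  exact inv_anti₀ (by positivity) (h s)

theorem kernel_eq {z p o : ℂ} (hp : z - p ≠ 0) (ho : z - o ≠ 0) :
    (z - p)⁻¹ - (z - o)⁻¹ = (p - o) * ((z - p)⁻¹ * (z - o)⁻¹) := by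
  field_simp
  ring

namespace Arc

variable {c C : ℝ} {γ γ' : ℝ → ℂ}

theorem norm_kernel_le (h : Arc c C γ γ') {g : ℝ → ℂ} {G : ℝ} (hG : ∀ s, ‖g s‖ ≤ G) {p o : ℂ}
    {κ κ' : ℝ} (hκ : 0 < κ) (hp : ∀ s, κ * (1 + |s|) ≤ ‖γ s - p‖) (hκ' : 0 < κ')
    (ho : ∀ s, κ' * (1 + |s|) ≤ ‖γ s - o‖) (s : ℝ) :
    ‖g s * (γ' s * ((γ s - p)⁻¹ - (γ s - o)⁻¹))‖ ≤
      G * C * ‖p - o‖ * κ⁻¹ * κ'⁻¹ * ((1 + |s|) ^ 2)⁻¹ := by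
  rw [kernel_eq (ne_of_far hκ hp s) (ne_of_far hκ' ho s), norm_mul, norm_mul, norm_mul, norm_mul]
  have hG0 : 0 ≤ G := (norm_nonneg _).trans (hG 0)
  have hC := h.C_pos
  calc ‖g s‖ * (‖γ' s‖ * (‖p - o‖ * (‖(γ s - p)⁻¹‖ * ‖(γ s - o)⁻¹‖)))
      ≤ G * (C * (‖p - o‖ * ((κ⁻¹ * (1 + |s|)⁻¹) * (κ'⁻¹ * (1 + |s|)⁻¹)))) := by
        gcongr
        · exact hG s
        · exact h.upper s
        · exact norm_inv_le_of_far hκ hp s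
        · exact norm_inv_le_of_far hκ' ho s
    _ = _ := by rw [sq, mul_inv]; ring

theorem continuous_inv_sub (h : Arc c C γ γ') {p : ℂ} (hp : p ∉ range γ) :
    Continuous fun s => (γ s - p)⁻¹ :=
  (h.continuous.sub continuous_const).inv₀ fun s hs => hp ⟨s, sub_eq_zero.1 hs⟩

theorem continuous_kernel (h : Arc c C γ γ') {g : ℝ → ℂ} (hg : Continuous g) {p o : ℂ}
    (hp : p ∉ range γ) (ho : o ∉ range γ) :
    Continuous fun s => g s * (γ' s * ((γ s - p)⁻¹ - (γ s - o)⁻¹)) :=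
  hg.mul (h.continuous_deriv.mul ((h.continuous_inv_sub hp).sub (h.continuous_inv_sub ho)))

theorem integrable_kernel (h : Arc c C γ γ') {g : ℝ → ℂ} (hg : Continuous g) {G : ℝ}
    (hG : ∀ s, ‖g s‖ ≤ G) {p o : ℂ} (hp : p ∉ range γ) (ho : o ∉ range γ) :
    Integrable fun s => g s * (γ' s * ((γ s - p)⁻¹ - (γ s - o)⁻¹)) := by
  obtain ⟨κ, hκ, hpκ⟩ := h.exists_far hp
  obtain ⟨κ', hκ', hoκ⟩ := h.exists_far ho
  exact (integrable_one_add_abs_sq.const_mul _).mono'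
    (h.continuous_kernel hg hp ho).aestronglyMeasurable
    (Eventually.of_forall fun s => h.norm_kernel_le hG hκ hpκ hκ' hoκ s)

/-- The normalised Cauchy integral is holomorphic off the curve. -/
theorem hasDerivAt_cauchyDiff' (h : Arc c C γ γ') {g : ℝ → ℂ} (hg : Continuous g) {G : ℝ}
    (hG : ∀ s, ‖g s‖ ≤ G) {p o : ℂ} (hp : p ∉ range γ) (ho : o ∉ range γ) :
    HasDerivAt (cauchyDiff γ γ' o g)
      ((2 * Real.pi * Complex.I)⁻¹ * ∫ s, g s * (γ' s * ((γ s - p)⁻¹) ^ 2)) p := by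
  obtain ⟨κ, hκ, hpκ⟩ := h.exists_far hp
  have hnear : ∀ q ∈ Metric.ball p (κ / 2), ∀ s, κ / 2 * (1 + |s|) ≤ ‖γ s - q‖ := fun q hq s =>
    far_of_near hpκ (by rw [← dist_eq_norm]; exact (Metric.mem_ball.1 hq).le) s
  have hq : ∀ q ∈ Metric.ball p (κ / 2), q ∉ range γ := by
    rintro q hq ⟨s, hs⟩
    exact ne_of_far (half_pos hκ) (hnear q hq) s (sub_eq_zero.2 hs)
  have hball : Metric.ball p (κ / 2) ∈ 𝓝 p := Metric.ball_mem_nhds p (half_pos hκ)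
  refine HasDerivAt.const_mul _ (hasDerivAt_integral_of_dominated_loc_of_deriv_le
    (F := fun q s => g s * (γ' s * ((γ s - q)⁻¹ - (γ s - o)⁻¹)))
    (F' := fun q s => g s * (γ' s * ((γ s - q)⁻¹) ^ 2))
    (bound := fun s => G * C * (κ / 2)⁻¹ ^ 2 * ((1 + |s|) ^ 2)⁻¹) hball ?_
    (h.integrable_kernel hg hG hp ho) ?_ ?_ (integrable_one_add_abs_sq.const_mul _) ?_).2
  · filter_upwards [hball] with q hq'
    exact (h.continuous_kernel hg (hq q hq') ho).aestronglyMeasurable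
  · exact (hg.mul (h.continuous_deriv.mul ((h.continuous_inv_sub hp).pow 2))).aestronglyMeasurable
  · refine Eventually.of_forall fun s q hq' => ?_
    rw [norm_mul, norm_mul, norm_pow]
    have hG0 : 0 ≤ G := (norm_nonneg _).trans (hG 0)
    have hC := h.C_pos
    calc ‖g s‖ * (‖γ' s‖ * ‖(γ s - q)⁻¹‖ ^ 2)
        ≤ G * (C * ((κ / 2)⁻¹ * (1 + |s|)⁻¹) ^ 2) := by
          gcongr
          · exact hG s
          · exact h.upper s
          · exact norm_inv_le_of_far (half_pos hκ) (hnear q hq') s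
      _ = _ := by rw [mul_pow, inv_pow (1 + |s|)]; ring
  · refine Eventually.of_forall fun s q hq' => ?_
    have hne := ne_of_far (half_pos hκ) (hnear q hq') s
    have h1 : HasDerivAt (fun q => (γ s - q)⁻¹) (-(-1) / (γ s - q) ^ 2) q :=
      ((hasDerivAt_id q).const_sub (γ s)).inv hne
    have h2 := ((h1.sub_const ((γ s - o)⁻¹)).const_mul (γ' s)).const_mul (g s)
    refine h2.congr_deriv ?_
    rw [inv_pow, neg_neg, one_div]

theorem tendsto_inv_sub (h : Arc c C γ γ') {p : ℂ} (hp : p ∉ range γ) {F : ℝ → ℂ} {G : ℝ}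
    (hG : ∀ s, ‖F s‖ ≤ G) {l : Filter ℝ} (hl : Tendsto (fun s => |s|) l atTop) :
    Tendsto (fun s => F s * (γ s - p)⁻¹) l (𝓝 0) := by
  obtain ⟨κ, hκ, hpκ⟩ := h.exists_far hp
  have h1 : Tendsto (fun s : ℝ => G * (κ⁻¹ * (1 + |s|)⁻¹)) l (𝓝 0) := by
    have := ((tendsto_inv_atTop_zero.comp (tendsto_atTop_add_const_left _ 1 hl)).const_mul
      κ⁻¹).const_mul G
    simpa using this
  refine squeeze_zero_norm (fun s => ?_) h1
  rw [norm_mul]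
  exact mul_le_mul (hG s) (norm_inv_le_of_far hκ hpκ s) (norm_nonneg _)
    ((norm_nonneg _).trans (hG s))

theorem integrable_div (h : Arc c C γ γ') {f : ℝ → ℂ} (hf : Integrable f) {p : ℂ}
    (hp : p ∉ range γ) : Integrable fun s => f s * (γ s - p)⁻¹ := by
  obtain ⟨κ, hκ, hpκ⟩ := h.exists_far hp
  refine hf.mul_bdd (c := κ⁻¹)
    (h.continuous_inv_sub hp).aestronglyMeasurable (Eventually.of_forall fun s => ?_)
  refine (norm_inv_le_of_far hκ hpκ s).trans ?_
  exact mul_le_of_le_one_right (by positivity) (inv_le_one_of_one_le₀ (by linarith [abs_nonneg s]))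

/-- Integration by parts: the derivative of the normalised Cauchy integral of `F` is the Cauchy
integral of `F'`. -/
theorem hasDerivAt_cauchyDiff (h : Arc c C γ γ') {F f : ℝ → ℂ} (hF : ∀ s, HasDerivAt F (f s) s)
    {G : ℝ} (hG : ∀ s, ‖F s‖ ≤ G) (hf : Integrable f) {p o : ℂ} (hp : p ∉ range γ)
    (ho : o ∉ range γ) : HasDerivAt (cauchyDiff γ γ' o F) (cauchy γ f p) p := by
  have hFc : Continuous F := continuous_iff_continuousAt.2 fun s => (hF s).continuousAt
  convert h.hasDerivAt_cauchyDiff' hFc hG hp ho using 1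
  rw [cauchy]
  congr 1
  obtain ⟨κ, hκ, hpκ⟩ := h.exists_far hp
  have hi1 : Integrable fun s => f s * (γ s - p)⁻¹ := h.integrable_div hf hp
  have hi2 : Integrable fun s => F s * (γ' s * ((γ s - p)⁻¹) ^ 2) := by
    refine (integrable_one_add_abs_sq.const_mul (G * C * κ⁻¹ ^ 2)).mono'
      (hFc.mul (h.continuous_deriv.mul ((h.continuous_inv_sub hp).pow 2))).aestronglyMeasurable
      (Eventually.of_forall fun s => ?_)
    rw [norm_mul, norm_mul, norm_pow]
    have hG0 : 0 ≤ G := (norm_nonneg _).trans (hG 0)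
    have hC := h.C_pos
    calc ‖F s‖ * (‖γ' s‖ * ‖(γ s - p)⁻¹‖ ^ 2)
        ≤ G * (C * (κ⁻¹ * (1 + |s|)⁻¹) ^ 2) := by
          gcongr
          · exact hG s
          · exact h.upper s
          · exact norm_inv_le_of_far hκ hpκ s
      _ = _ := by rw [mul_pow, inv_pow (1 + |s|)]; ring
  have hd : ∀ s, HasDerivAt (fun s => F s * (γ s - p)⁻¹)
      (f s * (γ s - p)⁻¹ - F s * (γ' s * ((γ s - p)⁻¹) ^ 2)) s := by
    intro s
    have h1 : HasDerivAt (fun s => (γ s - p)⁻¹) (-γ' s / (γ s - p) ^ 2) s :=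
      ((h.hasDeriv s).sub_const p).inv (ne_of_far hκ hpκ s)
    refine ((hF s).mul h1).congr_deriv ?_
    rw [inv_pow, div_eq_mul_inv]; ring
  have := integral_of_hasDerivAt_of_tendsto hd (hi1.sub hi2)
    (h.tendsto_inv_sub hp hG tendsto_abs_atBot_atTop)
    (h.tendsto_inv_sub hp hG tendsto_abs_atTop_atTop)
  rw [integral_sub hi1 hi2, sub_self, sub_eq_zero] at this
  simpa only [div_eq_mul_inv] using this

theorem hasDerivAt_index (h : Arc c C γ γ') {p o : ℂ} (hp : p ∉ range γ) (ho : o ∉ range γ) :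
    HasDerivAt (index γ γ' o) 0 p := by
  have := h.hasDerivAt_cauchyDiff (F := fun _ => 1) (f := fun _ => 0) (G := 1)
    (fun s => hasDerivAt_const s 1) (by simp) (integrable_zero _ _ _) hp ho
  simp only [cauchy, zero_div, integral_zero, mul_zero] at this
  exact this

theorem index_eq_of_joinedIn (h : Arc c C γ γ') {p q o : ℂ} (ho : o ∉ range γ)
    (hpq : JoinedIn (range γ)ᶜ p q) : index γ γ' o p = index γ γ' o q := by
  have hU : IsOpen (pathComponentIn (range γ)ᶜ p) := h.isOpen_compl.pathComponentIn p
  have hsub : pathComponentIn (range γ)ᶜ p ⊆ (range γ)ᶜ := pathComponentIn_subset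
  refine hU.is_const_of_fderiv_eq_zero (𝕜 := ℂ)
    (isPathConnected_pathComponentIn hpq.source_mem).isConnected.isPreconnected
    (fun z hz => (h.hasDerivAt_index (hsub hz) ho).differentiableAt.differentiableWithinAt)
    (fun z hz => ?_) (mem_pathComponentIn_self hpq.source_mem) hpq
  ext
  simp [(h.hasDerivAt_index (hsub hz) ho).hasFDerivAt.fderiv]

theorem index_self (γ γ' : ℝ → ℂ) (o : ℂ) : index γ γ' o o = 0 := by
  simp [index, cauchyDiff]

/-- Far out the curve looks like the real axis. -/
theorem tendsto_sub_div (h : Arc c C γ γ') (p : ℂ) {l : Filter ℝ} {ε : ℝ} (hε : ε * ε = 1)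
    (hl : Tendsto (fun s => ε * (γ s).re) l atTop) :
    Tendsto (fun s => (γ s - p) / ((ε * (γ s).re : ℝ) : ℂ)) l (𝓝 ε) := by
  have h1 : ∀ᶠ s in l, (γ s - p) / ((ε * (γ s).re : ℝ) : ℂ) =
      ε + (Complex.I * (γ s).im - p) * (((ε * (γ s).re)⁻¹ : ℝ) : ℂ) := by
    filter_upwards [hl.eventually_gt_atTop 0] with s hs
    have hne : ((ε * (γ s).re : ℝ) : ℂ) ≠ 0 := by exact_mod_cast hs.ne'
    have hε' : (ε : ℂ) * ε = 1 := by exact_mod_cast hε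
    rw [div_eq_iff hne, Complex.ofReal_inv, add_mul, mul_assoc, inv_mul_cancel₀ hne]
    conv_lhs => rw [← Complex.re_add_im (γ s)]
    push_cast
    linear_combination (-(γ s).re : ℂ) * hε'
  rw [tendsto_congr' h1]
  have h2 : Tendsto (fun s => (Complex.I * (γ s).im - p) * (((ε * (γ s).re)⁻¹ : ℝ) : ℂ)) l
      (𝓝 0) := by
    have h3 : Tendsto (fun s => (C + ‖p‖) * |(ε * (γ s).re)⁻¹|) l (𝓝 0) := by
      have := ((tendsto_inv_atTop_zero.comp hl).abs).const_mul (C + ‖p‖)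
      simpa using this
    refine squeeze_zero_norm (fun s => ?_) h3
    rw [norm_mul, Complex.norm_real, Real.norm_eq_abs]
    gcongr
    refine (norm_sub_le _ _).trans ?_
    gcongr
    rw [norm_mul, Complex.norm_I, one_mul, Complex.norm_real]
    exact h.im_le s
  simpa using h2.const_add (ε : ℂ)

/-- Points above the strip that contains the curve have index `1` relative to points below it. -/
theorem index_eq_one_of_above (h : Arc c C γ γ') {p o : ℂ} (hp : ∀ s, (γ s).im < p.im)
    (ho : ∀ s, o.im < (γ s).im) : index γ γ' o p = 1 := by
  have hp' : p ∉ range γ := by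
    rintro ⟨s, hs⟩
    exact (hp s).ne (by rw [hs])
  have ho' : o ∉ range γ := by
    rintro ⟨s, hs⟩
    exact (ho s).ne (by rw [hs])
  -- a primitive of the integrand: the rotations by `i` and `-i` keep the principal branch of the
  -- logarithm continuous along the curve
  have hd : ∀ s, HasDerivAt (fun s => Complex.log (Complex.I * (γ s - p)) -
      Complex.log (-Complex.I * (γ s - o)))
      ((fun _ => (1 : ℂ)) s * (γ' s * ((γ s - p)⁻¹ - (γ s - o)⁻¹))) s := by
    intro s
    have m1 : Complex.I * (γ s - p) ∈ Complex.slitPlane := by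
      left; simpa using hp s
    have m2 : -Complex.I * (γ s - o) ∈ Complex.slitPlane := by
      left; simpa using ho s
    have d1 := (((h.hasDeriv s).sub_const p).const_mul Complex.I).clog_real m1
    have d2 := (((h.hasDeriv s).sub_const o).const_mul (-Complex.I)).clog_real m2
    refine (d1.sub d2).congr_deriv ?_
    have n1 : γ s - p ≠ 0 := fun hh => hp' ⟨s, sub_eq_zero.1 hh⟩
    have n2 : γ s - o ≠ 0 := fun hh => ho' ⟨s, sub_eq_zero.1 hh⟩
    field_simp
  -- the two logarithms have the same modulus at infinity, so only the arguments survive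
  have hlim : ∀ (l : Filter ℝ) (ε : ℝ), ε * ε = 1 →
      Tendsto (fun s => ε * (γ s).re) l atTop →
      Tendsto (fun s => Complex.log (Complex.I * (γ s - p)) -
        Complex.log (-Complex.I * (γ s - o))) l
        (𝓝 (Complex.log (Complex.I * ε) - Complex.log (-Complex.I * ε))) := by
    intro l ε hε hl
    have hε0 : ε ≠ 0 := left_ne_zero_of_mul_eq_one hε
    have t1 := (h.tendsto_sub_div p hε hl).const_mul Complex.I
    have t2 := (h.tendsto_sub_div o hε hl).const_mul (-Complex.I)
    have s1 : Complex.I * ε ∈ Complex.slitPlane := by right; simpa using hε0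
    have s2 : -Complex.I * ε ∈ Complex.slitPlane := by right; simpa using hε0
    refine ((t1.clog s1).sub (t2.clog s2)).congr' ?_
    filter_upwards [hl.eventually_gt_atTop 0] with s hs
    have n1 : Complex.I * ((γ s - p) / ((ε * (γ s).re : ℝ) : ℂ)) ≠ 0 := by
      refine mul_ne_zero Complex.I_ne_zero (div_ne_zero ?_ (by exact_mod_cast hs.ne'))
      exact fun hh => hp' ⟨s, sub_eq_zero.1 hh⟩
    have n2 : -Complex.I * ((γ s - o) / ((ε * (γ s).re : ℝ) : ℂ)) ≠ 0 := by
      refine mul_ne_zero (neg_ne_zero.2 Complex.I_ne_zero)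
        (div_ne_zero ?_ (by exact_mod_cast hs.ne'))
      exact fun hh => ho' ⟨s, sub_eq_zero.1 hh⟩
    have e1 := Complex.log_ofReal_mul hs n1
    have e2 := Complex.log_ofReal_mul hs n2
    have hne : ((ε * (γ s).re : ℝ) : ℂ) ≠ 0 := by exact_mod_cast hs.ne'
    rw [show ((ε * (γ s).re : ℝ) : ℂ) * (Complex.I * ((γ s - p) / ((ε * (γ s).re : ℝ) : ℂ))) =
      Complex.I * (γ s - p) by field_simp] at e1
    rw [show ((ε * (γ s).re : ℝ) : ℂ) * (-Complex.I * ((γ s - o) / ((ε * (γ s).re : ℝ) : ℂ))) =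
      -Complex.I * (γ s - o) by field_simp] at e2
    rw [e1, e2]
    ring
  have hint := h.integrable_kernel (g := fun _ => 1) continuous_const (G := 1) (by simp) hp' ho'
  have := integral_of_hasDerivAt_of_tendsto hd hint
    (hlim atBot (-1) (by norm_num) (by
      simp only [neg_one_mul]; exact tendsto_neg_atBot_atTop.comp h.re_bot))
    (hlim atTop 1 (by norm_num) (by simpa using h.re_top))
  rw [index, cauchyDiff, this]
  have hπ : (Real.pi : ℂ) ≠ 0 := by exact_mod_cast Real.pi_ne_zero
  simp only [Complex.ofReal_one, mul_one, Complex.ofReal_neg, mul_neg, neg_neg, Complex.log_I,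
    Complex.log_neg_I]
  field_simp
  ring

/-- There are points on every horizontal line off the strip of the curve which are seen from the
side of that line. -/
theorem exists_normalCoord_mul_pos (h : Arc c C γ γ') {y : ℝ} :
    ∃ b : ℂ, b.im = y ∧ ∃ s a, 0 < a ∧ a * normalCoord γ γ' b = y - (γ s).im := by
  obtain ⟨L, hL⟩ := h.re_pos
  have hc := h.c_pos
  -- this far to the right, the foot point still has a parameter beyond `L`, where the tangent
  -- points to the right
  set s1 := L + 2 * (C + |y|) / c with hs1
  refine ⟨⟨(γ s1).re, y⟩, rfl, foot γ ⟨(γ s1).re, y⟩, (γ' (foot γ ⟨(γ s1).re, y⟩)).re, ?_, ?_⟩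
  · apply hL
    set b : ℂ := ⟨(γ s1).re, y⟩ with hb
    have h1 := h.foot_lower b s1
    have h2 : ‖γ s1 - b‖ ≤ C + |y| := by
      have : γ s1 - b = Complex.I * (((γ s1).im - y : ℝ) : ℂ) := by
        apply Complex.ext <;> simp [hb]
      rw [this, norm_mul, Complex.norm_I, one_mul, Complex.norm_real, Real.norm_eq_abs]
      exact (abs_sub _ _).trans (add_le_add (h.im_le s1) le_rfl)
    have h3 : |s1 - foot γ b| ≤ 2 * (C + |y|) / c := by
      rw [le_div_iff₀ hc]; linarith
    have := (abs_le.1 h3).2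
    linarith
  · have := congrArg Complex.im (h.eq_foot_add ⟨(γ s1).re, y⟩)
    simp at this
    linarith

/-- Separation by the curve: the index is `1` at the points seen from the left, and `0` at those
seen from the right. -/
theorem index_eq (h : Arc c C γ γ') {p o : ℂ} (ho : ∀ s, o.im < (γ s).im) (hp : p ∉ range γ) :
    index γ γ' o p = if 0 < normalCoord γ γ' p then 1 else 0 := by
  have ho' : o ∉ range γ := by
    rintro ⟨s, hs⟩
    exact (ho s).ne (by rw [hs])
  split_ifs with hn
  · obtain ⟨b, hb, s, a, ha, hs⟩ := h.exists_normalCoord_mul_pos (y := C + 1)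
    have hab : ∀ s, (γ s).im < b.im := fun s => by
      rw [hb]; linarith [(abs_le.1 (h.im_le s)).2]
    have hb' : b ∉ range γ := by
      rintro ⟨s, hs⟩
      exact (hab s).ne (by rw [hs])
    have hnb : 0 < normalCoord γ γ' b := by
      refine (pos_iff_pos_of_mul_pos (?_ : 0 < a * _)).1 ha
      rw [hs, ← hb]; linarith [hab s]
    rw [h.index_eq_of_joinedIn ho' (h.joinedIn_of_mul_pos hp hb' (mul_pos hn hnb))]
    exact h.index_eq_one_of_above hab ho
  · obtain ⟨b, hb, s, a, ha, hs⟩ := h.exists_normalCoord_mul_pos (y := o.im)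
    have hb' : b ∉ range γ := by
      rintro ⟨s, hs⟩
      exact (ho s).ne (by rw [hs, hb])
    have hnb : normalCoord γ γ' b < 0 := by
      have := ho s
      by_contra hh
      have := mul_nonneg ha.le (not_lt.1 hh)
      linarith
    have hnp : normalCoord γ γ' p < 0 :=
      lt_of_le_of_ne (not_lt.1 hn) (h.normalCoord_ne_zero hp)
    rw [h.index_eq_of_joinedIn ho' (h.joinedIn_of_mul_pos hp hb' (mul_pos_of_neg_of_neg hnp hnb)),
      ← index_self γ γ' o]
    apply h.index_eq_of_joinedIn ho'
    apply JoinedIn.of_segment_subset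
    rintro z ⟨u, v, hu, hv, huv, rfl⟩ ⟨s, hs⟩
    have := ho s
    rw [hs] at this
    simp [hb, ← add_mul, huv] at this

theorem joinedIn_iff (h : Arc c C γ γ') {p q o : ℂ} (ho : ∀ s, o.im < (γ s).im)
    (hp : p ∉ range γ) (hq : q ∉ range γ) :
    JoinedIn (range γ)ᶜ p q ↔ index γ γ' o p = index γ γ' o q := by
  have ho' : o ∉ range γ := by
    rintro ⟨s, hs⟩
    exact (ho s).ne (by rw [hs])
  refine ⟨h.index_eq_of_joinedIn ho', fun hpq => h.joinedIn_of_mul_pos hp hq ?_⟩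
  rw [h.index_eq ho hp, h.index_eq ho hq] at hpq
  have h1 := h.normalCoord_ne_zero hp
  have h2 := h.normalCoord_ne_zero hq
  by_cases hnp : 0 < normalCoord γ γ' p <;> by_cases hnq : 0 < normalCoord γ γ' q
  · exact mul_pos hnp hnq
  · simp [hnp, hnq] at hpq
  · simp [hnp, hnq] at hpq
  · exact mul_pos_of_neg_of_neg (lt_of_le_of_ne (not_lt.1 hnp) h1)
      (lt_of_le_of_ne (not_lt.1 hnq) h2)

end Arc

/-! ### Cauchy integrals along moving arcs -/

/-- Continuous families of functions of the curve parameter that are bounded and Lipschitz, locally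
uniformly in time. -/
structure IsDensity (g : ℝ → ℝ → ℂ) : Prop where
  cont : ContinuousOn (fun x : ℝ × ℝ => g x.1 x.2) (univ ×ˢ Ici 0)
  bound : ∀ T, 0 < T → ∃ A, ∀ t ∈ Icc 0 T, (∀ s, ‖g s t‖ ≤ A) ∧ ∀ s r, ‖g s t - g r t‖ ≤ A * |s - r|

namespace IsDensity

variable {g k : ℝ → ℝ → ℂ}

theorem continuous (hg : IsDensity g) {t : ℝ} (ht : 0 ≤ t) : Continuous fun s => g s t := by
  refine continuousOn_univ.1 (hg.cont.comp (f := fun s => (s, t)) (by fun_prop) fun s _ => ?_)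
  exact ⟨mem_univ _, ht⟩

theorem sub (hg : IsDensity g) (hk : IsDensity k) : IsDensity fun s t => g s t - k s t := by
  refine ⟨hg.cont.sub hk.cont, fun T hT => ?_⟩
  obtain ⟨A, hA⟩ := hg.bound T hT
  obtain ⟨B, hB⟩ := hk.bound T hT
  refine ⟨A + B, fun t ht => ⟨fun s => ?_, fun s r => ?_⟩⟩
  · exact (norm_sub_le _ _).trans (add_le_add ((hA t ht).1 s) ((hB t ht).1 s))
  · rw [show g s t - k s t - (g r t - k r t) = (g s t - g r t) - (k s t - k r t) by ring, add_mul]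
    exact (norm_sub_le _ _).trans (add_le_add ((hA t ht).2 s r) ((hB t ht).2 s r))

theorem mul (hg : IsDensity g) (hk : IsDensity k) : IsDensity fun s t => g s t * k s t := by
  refine ⟨hg.cont.mul hk.cont, fun T hT => ?_⟩
  obtain ⟨A, hA⟩ := hg.bound T hT
  obtain ⟨B, hB⟩ := hk.bound T hT
  have hA0 : 0 ≤ A := (norm_nonneg _).trans ((hA 0 ⟨le_rfl, hT.le⟩).1 0)
  have hB0 : 0 ≤ B := (norm_nonneg _).trans ((hB 0 ⟨le_rfl, hT.le⟩).1 0)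
  have hAB := mul_nonneg hA0 hB0
  refine ⟨2 * (A * B), fun t ht => ⟨fun s => ?_, fun s r => ?_⟩⟩
  · rw [norm_mul]
    refine (mul_le_mul ((hA t ht).1 s) ((hB t ht).1 s) (norm_nonneg _) hA0).trans ?_
    linarith
  · rw [show g s t * k s t - g r t * k r t = (g s t - g r t) * k s t + g r t * (k s t - k r t) by
      ring]
    refine (norm_add_le _ _).trans ?_
    rw [norm_mul, norm_mul]
    have h1 := mul_le_mul ((hA t ht).2 s r) ((hB t ht).1 s) (norm_nonneg _)
      (mul_nonneg hA0 (abs_nonneg _))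
    have h2 := mul_le_mul ((hA t ht).1 r) ((hB t ht).2 s r) (norm_nonneg _) hA0
    linarith

theorem inv (hg : IsDensity g) (h : ∀ T, 0 < T → ∃ c > 0, ∀ t ∈ Icc 0 T, ∀ s, c ≤ ‖g s t‖) :
    IsDensity fun s t => (g s t)⁻¹ := by
  have hne : ∀ t, 0 ≤ t → ∀ s, g s t ≠ 0 := by
    intro t ht s
    obtain ⟨c, hc, hc'⟩ := h (t + 1) (by linarith)
    exact norm_pos_iff.1 (hc.trans_le (hc' t ⟨ht, by linarith⟩ s))
  refine ⟨hg.cont.inv₀ fun x hx => hne _ hx.2 _, fun T hT => ?_⟩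
  obtain ⟨A, hA⟩ := hg.bound T hT
  obtain ⟨c, hc, hc'⟩ := h T hT
  have hA0 : 0 ≤ A := (norm_nonneg _).trans ((hA 0 ⟨le_rfl, hT.le⟩).1 0)
  have h1 : ∀ t ∈ Icc 0 T, ∀ s, ‖(g s t)⁻¹‖ ≤ c⁻¹ := fun t ht s => by
    rw [norm_inv]; exact inv_anti₀ hc (hc' t ht s)
  refine ⟨c⁻¹ + c⁻¹ * A * c⁻¹, fun t ht => ⟨fun s => (h1 t ht s).trans ?_, fun s r => ?_⟩⟩
  · have : 0 ≤ c⁻¹ * A * c⁻¹ := by positivity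
    linarith
  · have e : (g s t)⁻¹ - (g r t)⁻¹ = -((g s t)⁻¹ * (g s t - g r t) * (g r t)⁻¹) := by
      have := hne t ht.1 s
      have := hne t ht.1 r
      field_simp
      ring
    rw [e, norm_neg, norm_mul, norm_mul]
    calc ‖(g s t)⁻¹‖ * ‖g s t - g r t‖ * ‖(g r t)⁻¹‖ ≤ c⁻¹ * (A * |s - r|) * c⁻¹ := by
          gcongr
          · exact h1 t ht s
          · exact (hA t ht).2 s r
          · exact h1 t ht r
      _ ≤ (c⁻¹ + c⁻¹ * A * c⁻¹) * |s - r| := by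
          have : 0 ≤ c⁻¹ * |s - r| := by positivity
          nlinarith

end IsDensity

/-- A family of arcs depending on time, with uniform constants on bounded time intervals; `Z'` is
the tangent and `Zt` the velocity at fixed parameter. -/
structure ArcFamily (Z Z' Zt : ℝ → ℝ → ℂ) : Prop where
  arc : ∀ T, 0 < T → ∃ c C, ∀ t ∈ Icc 0 T, Arc c C (fun s => Z s t) (fun s => Z' s t)
  tangent : IsDensity Z'
  velocity : IsDensity Zt
  hasDeriv : ∀ s t, 0 ≤ t → HasDerivWithinAt (fun r => Z s r) (Zt s t) (Ici 0) t

/-- The regular part of the normalised Cauchy integral: the value of the density at the nearest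
point is subtracted, which makes the integrand bounded also on the curve. -/
def cauchyReg (γ γ' : ℝ → ℂ) (o : ℂ) (g : ℝ → ℂ) (p : ℂ) : ℂ :=
  (2 * Real.pi * Complex.I)⁻¹ *
    ∫ s, (g s - g (foot γ p)) * (γ' s * ((γ s - p)⁻¹ - (γ s - o)⁻¹))

namespace Arc

variable {c C : ℝ} {γ γ' : ℝ → ℂ}

theorem cauchyDiff_eq_cauchyReg (h : Arc c C γ γ') {g : ℝ → ℂ} (hg : Continuous g) {G : ℝ}
    (hG : ∀ s, ‖g s‖ ≤ G) {p o : ℂ} (hp : p ∉ range γ) (ho : o ∉ range γ) :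
    cauchyDiff γ γ' o g p = cauchyReg γ γ' o g p + g (foot γ p) * index γ γ' o p := by
  have h1 := h.integrable_kernel hg hG hp ho
  have h2 := h.integrable_kernel (g := fun _ => 1) continuous_const (G := 1) (by simp) hp ho
  rw [index, cauchyReg, cauchyDiff, cauchyDiff]
  have e : ∀ s, (g s - g (foot γ p)) * (γ' s * ((γ s - p)⁻¹ - (γ s - o)⁻¹)) =
      g s * (γ' s * ((γ s - p)⁻¹ - (γ s - o)⁻¹)) -
        g (foot γ p) * (1 * (γ' s * ((γ s - p)⁻¹ - (γ s - o)⁻¹))) := fun s => by ring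
  simp_rw [e]
  rw [integral_sub h1 (h2.const_mul _), integral_const_mul]
  ring

/-- The subtracted density compensates the singularity of the kernel, uniformly in `p`. -/
theorem norm_regular_mul_inv_le (h : Arc c C γ γ') {g : ℝ → ℂ} {A : ℝ} (hA : ∀ s, ‖g s‖ ≤ A)
    (hL : ∀ s r, ‖g s - g r‖ ≤ A * |s - r|) (p : ℂ) (s : ℝ) :
    ‖g s - g (foot γ p)‖ * ‖(γ s - p)⁻¹‖ ≤ 6 * A / c * (1 + |s - foot γ p|)⁻¹ := by
  have hc := h.c_pos
  have hA0 : 0 ≤ A := (norm_nonneg _).trans (hA 0)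
  set s0 := foot γ p
  rcases eq_or_ne s s0 with rfl | hne
  · rw [sub_self, norm_zero, zero_mul]; positivity
  have hu : 0 < |s - s0| := abs_pos.2 (sub_ne_zero.2 hne)
  have h1 : c / 2 * |s - s0| ≤ ‖γ s - p‖ := h.foot_lower p s
  have h2 : ‖g s - g s0‖ ≤ 2 * A := (norm_sub_le _ _).trans (by linarith [hA s, hA s0])
  have h3 := hL s s0
  have h4 : ‖g s - g s0‖ * (1 + |s - s0|) ≤ 3 * A * |s - s0| := by nlinarith
  rw [norm_inv, ← div_eq_mul_inv, ← div_eq_mul_inv, div_div,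
    div_le_div_iff₀ (lt_of_lt_of_le (by positivity) h1) (by positivity)]
  calc ‖g s - g s0‖ * (c * (1 + |s - s0|)) = c * (‖g s - g s0‖ * (1 + |s - s0|)) := by ring
    _ ≤ c * (3 * A * |s - s0|) := by gcongr
    _ = 6 * A * (c / 2 * |s - s0|) := by ring
    _ ≤ 6 * A * ‖γ s - p‖ := by gcongr

/-- An integrable majorant of the integrand of `cauchyReg` that stays bounded as `p` approaches the
curve. -/
theorem norm_regular_le (h : Arc c C γ γ') {g : ℝ → ℂ} {A : ℝ} (hA : ∀ s, ‖g s‖ ≤ A)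
    (hL : ∀ s r, ‖g s - g r‖ ≤ A * |s - r|) (p : ℂ) {o : ℂ} {κ : ℝ} (hκ : 0 < κ)
    (ho : ∀ s, κ * (1 + |s|) ≤ ‖γ s - o‖) (s : ℝ) :
    ‖(g s - g (foot γ p)) * (γ' s * ((γ s - p)⁻¹ - (γ s - o)⁻¹))‖ ≤
      6 * A / c * (1 + |foot γ p|) * C * ‖p - o‖ * κ⁻¹ * ((1 + |s|) ^ 2)⁻¹ := by
  have hc := h.c_pos
  have hC := h.C_pos
  have hA0 : 0 ≤ A := (norm_nonneg _).trans (hA 0)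
  by_cases hp : γ s = p
  · have : foot γ p = s := by rw [← hp, h.foot_self]
    rw [this, sub_self, zero_mul, norm_zero]
    positivity
  have h1 := h.norm_regular_mul_inv_le hA hL p s
  have h2 : (1 + |s - foot γ p|)⁻¹ ≤ (1 + |foot γ p|) * (1 + |s|)⁻¹ := by
    rw [← div_eq_mul_inv, le_div_iff₀ (by positivity), ← div_eq_inv_mul, div_le_iff₀ (by positivity)]
    have : |s| ≤ |foot γ p| + |s - foot γ p| := by
      have := abs_add_le (foot γ p) (s - foot γ p)
      rwa [add_sub_cancel] at this
    nlinarith [abs_nonneg (foot γ p), abs_nonneg (s - foot γ p),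
      mul_nonneg (abs_nonneg (foot γ p)) (abs_nonneg (s - foot γ p))]
  rw [kernel_eq (sub_ne_zero.2 hp) (ne_of_far hκ ho s), norm_mul, norm_mul, norm_mul, norm_mul]
  calc ‖g s - g (foot γ p)‖ * (‖γ' s‖ * (‖p - o‖ * (‖(γ s - p)⁻¹‖ * ‖(γ s - o)⁻¹‖)))
      = (‖g s - g (foot γ p)‖ * ‖(γ s - p)⁻¹‖) * ‖γ' s‖ * ‖p - o‖ * ‖(γ s - o)⁻¹‖ := by ring
    _ ≤ (6 * A / c * ((1 + |foot γ p|) * (1 + |s|)⁻¹)) * C * ‖p - o‖ * (κ⁻¹ * (1 + |s|)⁻¹) := by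
        have h3 : ‖g s - g (foot γ p)‖ * ‖(γ s - p)⁻¹‖ ≤
            6 * A / c * ((1 + |foot γ p|) * (1 + |s|)⁻¹) := h1.trans (by gcongr)
        have h4 := h.upper s
        have h5 := norm_inv_le_of_far hκ ho s
        exact mul_le_mul (mul_le_mul_of_nonneg_right (mul_le_mul h3 h4 (norm_nonneg _)
          (by positivity)) (norm_nonneg _)) h5 (norm_nonneg _) (by positivity)
    _ = _ := by rw [sq, mul_inv]; ring

end Arc

/-- Space-time at nonnegative times. -/
abbrev timeSpace : Set (ℝ × ℂ) := Ici 0 ×ˢ univ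

namespace ArcFamily

variable {Z Z' Zt : ℝ → ℝ → ℂ}

theorem exists_arc (h : ArcFamily Z Z' Zt) {t : ℝ} (ht : 0 ≤ t) :
    ∃ c C, Arc c C (fun s => Z s t) fun s => Z' s t := by
  obtain ⟨c, C, hcC⟩ := h.arc (t + 1) (by linarith)
  exact ⟨c, C, hcC t ⟨ht, by linarith⟩⟩

theorem isDensity_inv_tangent (h : ArcFamily Z Z' Zt) : IsDensity fun s t => (Z' s t)⁻¹ := by
  refine h.tangent.inv fun T hT => ?_
  obtain ⟨c, C, hcC⟩ := h.arc T hT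
  exact ⟨c, (hcC 0 ⟨le_rfl, hT.le⟩).c_pos, fun t ht s => (hcC t ht).c_le_norm_deriv s⟩

theorem lipschitz_time (h : ArcFamily Z Z' Zt) {T : ℝ} (hT : 0 < T) :
    ∃ C > 0, ∀ s, ∀ t ∈ Icc 0 T, ∀ t' ∈ Icc 0 T, ‖Z s t - Z s t'‖ ≤ C * |t - t'| := by
  obtain ⟨A, hA⟩ := h.velocity.bound T hT
  refine ⟨max A 1, by positivity, fun s t ht t' ht' => ?_⟩
  exact Convex.norm_image_sub_le_of_norm_hasDerivWithin_le (s := Icc 0 T)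
    (fun x hx => (h.hasDeriv s x hx.1).mono Icc_subset_Ici_self)
    (fun x hx => ((hA x hx).1 s).trans (le_max_left _ _)) (convex_Icc 0 T) ht' ht

theorem eventually_time {t : ℝ} (p : ℂ) :
    ∀ᶠ x in 𝓝[timeSpace] (t, p), x.1 ∈ Icc 0 (t + 1) := by
  have h1 : ∀ᶠ x : ℝ × ℂ in 𝓝 (t, p), x.1 < t + 1 :=
    continuous_fst.continuousAt.eventually_lt continuousAt_const (by simp)
  filter_upwards [self_mem_nhdsWithin, mem_nhdsWithin_of_mem_nhds h1] with x hx hx'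
  exact ⟨hx.1, le_of_lt hx'⟩

theorem tendsto_of_density {g : ℝ → ℝ → ℂ} (hg : IsDensity g) {t : ℝ} (ht : 0 ≤ t) (p : ℂ) {s : ℝ}
    {σ : ℝ × ℂ → ℝ} (hσ : Tendsto σ (𝓝[timeSpace] (t, p)) (𝓝 s)) :
    Tendsto (fun x : ℝ × ℂ => g (σ x) x.1) (𝓝[timeSpace] (t, p)) (𝓝 (g s t)) := by
  have h1 := hg.cont (s, t) ⟨mem_univ _, ht⟩
  refine h1.tendsto.comp (f := fun x : ℝ × ℂ => (σ x, x.1)) ?_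
  refine tendsto_nhdsWithin_iff.2 ⟨hσ.prodMk_nhds ?_, ?_⟩
  · exact continuous_fst.continuousAt.tendsto.mono_left nhdsWithin_le_nhds
  · filter_upwards [self_mem_nhdsWithin] with x hx
    exact ⟨mem_univ _, hx.1⟩

theorem tendsto_point (h : ArcFamily Z Z' Zt) {t : ℝ} (ht : 0 ≤ t) (p : ℂ) (s : ℝ) :
    Tendsto (fun x : ℝ × ℂ => Z s x.1) (𝓝[timeSpace] (t, p)) (𝓝 (Z s t)) := by
  have h1 := (h.hasDeriv s t ht).continuousWithinAt
  refine h1.tendsto.comp (f := fun x : ℝ × ℂ => x.1) (tendsto_nhdsWithin_iff.2 ⟨?_, ?_⟩)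
  · exact continuous_fst.continuousAt.tendsto.mono_left nhdsWithin_le_nhds
  · filter_upwards [self_mem_nhdsWithin] with x hx using hx.1

theorem tendsto_snd {t : ℝ} (p : ℂ) :
    Tendsto (fun x : ℝ × ℂ => x.2) (𝓝[timeSpace] (t, p)) (𝓝 p) :=
  continuous_snd.continuousAt.tendsto.mono_left nhdsWithin_le_nhds

theorem tendsto_fst {t : ℝ} (p : ℂ) :
    Tendsto (fun x : ℝ × ℂ => x.1) (𝓝[timeSpace] (t, p)) (𝓝 t) :=
  continuous_fst.continuousAt.tendsto.mono_left nhdsWithin_le_nhds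

/-- Near a point off the curve, in space and time, the distance to the curve grows at least linearly
in the parameter, with a uniform constant. -/
theorem eventually_far (h : ArcFamily Z Z' Zt) {t : ℝ} (ht : 0 ≤ t) {p : ℂ}
    (hp : p ∉ range fun s => Z s t) :
    ∃ κ > 0, ∀ᶠ x in 𝓝[timeSpace] (t, p), ∀ s, κ * (1 + |s|) ≤ ‖Z s x.1 - x.2‖ := by
  obtain ⟨c, C, hcC⟩ := h.exists_arc ht
  obtain ⟨κ, hκ, hκ'⟩ := hcC.exists_far hp
  obtain ⟨C1, hC1, hC1'⟩ := h.lipschitz_time (T := t + 1) (by linarith)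
  refine ⟨κ / 2, half_pos hκ, ?_⟩
  have hlim : Tendsto (fun x : ℝ × ℂ => C1 * |x.1 - t| + ‖x.2 - p‖) (𝓝[timeSpace] (t, p)) (𝓝 0) := by
    have : Continuous fun x : ℝ × ℂ => C1 * |x.1 - t| + ‖x.2 - p‖ := by fun_prop
    have h2 := (this.tendsto (t, p)).mono_left (nhdsWithin_le_nhds (s := timeSpace))
    simpa using h2
  filter_upwards [eventually_time p, hlim.eventually_le_const (half_pos hκ)] with x hx hx' s
  have h1 := hκ' s
  have h2 := hC1' s x.1 hx t ⟨ht, by linarith⟩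
  have h3 : ‖Z s t - p‖ ≤ ‖Z s x.1 - x.2‖ + (‖Z s x.1 - Z s t‖ + ‖x.2 - p‖) := by
    rw [show Z s t - p = (Z s x.1 - x.2) - ((Z s x.1 - Z s t) - (x.2 - p)) by ring]
    exact (norm_sub_le _ _).trans (add_le_add le_rfl (norm_sub_le _ _))
  nlinarith [abs_nonneg s, mul_nonneg hκ.le (abs_nonneg s)]

theorem eventually_notMem (h : ArcFamily Z Z' Zt) {t : ℝ} (ht : 0 ≤ t) {p : ℂ}
    (hp : p ∉ range fun s => Z s t) :
    ∀ᶠ x in 𝓝[timeSpace] (t, p), x.2 ∉ range fun s => Z s x.1 := by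
  obtain ⟨κ, hκ, hκ'⟩ := h.eventually_far ht hp
  filter_upwards [hκ'] with x hx
  rintro ⟨s, hs⟩
  exact ne_of_far (γ := fun s => Z s x.1) hκ hx s (sub_eq_zero.2 hs)

theorem eventually_far_base (h : ArcFamily Z Z' Zt) {t : ℝ} (ht : 0 ≤ t) (p : ℂ) {o : ℂ}
    (ho : o ∉ range fun s => Z s t) :
    ∃ κ > 0, ∀ᶠ x in 𝓝[timeSpace] (t, p), ∀ s, κ * (1 + |s|) ≤ ‖Z s x.1 - o‖ := by
  obtain ⟨κ, hκ, hκ'⟩ := h.eventually_far ht ho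
  refine ⟨κ, hκ, ?_⟩
  have : Tendsto (fun x : ℝ × ℂ => (x.1, o)) (𝓝[timeSpace] (t, p)) (𝓝[timeSpace] (t, o)) := by
    refine tendsto_nhdsWithin_iff.2 ⟨(tendsto_fst p).prodMk_nhds tendsto_const_nhds, ?_⟩
    filter_upwards [self_mem_nhdsWithin] with x hx using ⟨hx.1, mem_univ _⟩
  exact this.eventually hκ'

theorem measurable_kernel (h : ArcFamily Z Z' Zt) {g : ℝ → ℂ} (hg : Continuous g) {t : ℝ}
    (ht : 0 ≤ t) (p o : ℂ) :
    AEStronglyMeasurable (fun s => g s * (Z' s t * ((Z s t - p)⁻¹ - (Z s t - o)⁻¹))) := by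
  obtain ⟨c, C, hcC⟩ := h.exists_arc ht
  have h1 : Measurable fun s => Z s t := hcC.continuous.measurable
  have h2 : Measurable fun s => Z' s t := hcC.continuous_deriv.measurable
  have h3 := hg.measurable
  exact (h3.mul (h2.mul (((h1.sub_const p).inv).sub ((h1.sub_const o).inv)))).aestronglyMeasurable

/-- The normalised Cauchy integral is continuous in space and time off the curve. -/
theorem continuousWithinAt_cauchyDiff (h : ArcFamily Z Z' Zt) {g : ℝ → ℝ → ℂ} (hg : IsDensity g)
    {t : ℝ} (ht : 0 ≤ t) {p o : ℂ} (hp : p ∉ range fun s => Z s t)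
    (ho : o ∉ range fun s => Z s t) :
    ContinuousWithinAt (fun x : ℝ × ℂ => cauchyDiff (fun s => Z s x.1) (fun s => Z' s x.1) o
      (fun s => g s x.1) x.2) timeSpace (t, p) := by
  have hT : 0 < t + 1 := by linarith
  obtain ⟨κ, hκ, hκ'⟩ := h.eventually_far ht hp
  obtain ⟨κo, hκo, hκo'⟩ := h.eventually_far_base ht p ho
  obtain ⟨c, C, hcC⟩ := h.arc (t + 1) hT
  obtain ⟨A, hA⟩ := hg.bound (t + 1) hT
  have hC := (hcC 0 ⟨le_rfl, hT.le⟩).C_pos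
  have hA0 : 0 ≤ A := (norm_nonneg _).trans ((hA 0 ⟨le_rfl, hT.le⟩).1 0)
  have hpo : ∀ᶠ x : ℝ × ℂ in 𝓝[timeSpace] (t, p), ‖x.2 - o‖ ≤ ‖p - o‖ + 1 := by
    have := ((tendsto_snd (t := t) p).sub_const o).norm
    exact this.eventually_le_const (by linarith)
  refine Tendsto.const_mul _ (tendsto_integral_filter_of_dominated_convergence
    (fun s => A * C * (‖p - o‖ + 1) * κ⁻¹ * κo⁻¹ * ((1 + |s|) ^ 2)⁻¹) ?_ ?_
    (integrable_one_add_abs_sq.const_mul _) ?_)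
  · filter_upwards [self_mem_nhdsWithin] with x hx
    exact h.measurable_kernel (hg.continuous hx.1) hx.1 _ _
  · filter_upwards [eventually_time p, hκ', hκo', hpo] with x hx h1 h2 h3
    refine Eventually.of_forall fun s => ?_
    refine ((hcC x.1 hx).norm_kernel_le (hA x.1 hx).1 hκ h1 hκo h2 s).trans ?_
    gcongr
  · refine Eventually.of_forall fun s => ?_
    have hne : Z s t - p ≠ 0 := fun hh => hp ⟨s, sub_eq_zero.1 hh⟩
    have hno : Z s t - o ≠ 0 := fun hh => ho ⟨s, sub_eq_zero.1 hh⟩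
    have h1 := tendsto_of_density hg ht p (s := s) (σ := fun _ => s) tendsto_const_nhds
    have h2 := tendsto_of_density h.tangent ht p (s := s) (σ := fun _ => s) tendsto_const_nhds
    have h3 := h.tendsto_point ht p s
    exact h1.mul (h2.mul (((h3.sub (tendsto_snd p)).inv₀ hne).sub ((h3.sub_const o).inv₀ hno)))

/-- Nearest points converge. -/
theorem tendsto_foot (h : ArcFamily Z Z' Zt) {t : ℝ} (ht : 0 ≤ t) (s : ℝ) :
    Tendsto (fun x : ℝ × ℂ => foot (fun s => Z s x.1) x.2) (𝓝[timeSpace] (t, Z s t)) (𝓝 s) := by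
  have hT : 0 < t + 1 := by linarith
  obtain ⟨c, C, hcC⟩ := h.arc (t + 1) hT
  have hc := (hcC 0 ⟨le_rfl, hT.le⟩).c_pos
  rw [tendsto_iff_norm_sub_tendsto_zero]
  have hlim : Tendsto (fun x : ℝ × ℂ => 2 / c * ‖Z s x.1 - x.2‖) (𝓝[timeSpace] (t, Z s t))
      (𝓝 0) := by
    have := (((h.tendsto_point ht (Z s t) s).sub (tendsto_snd (Z s t))).norm).const_mul (2 / c)
    simpa using this
  refine squeeze_zero' (Eventually.of_forall fun x => norm_nonneg _) ?_ hlim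
  filter_upwards [eventually_time (Z s t)] with x hx
  have := (hcC x.1 hx).foot_lower x.2 s
  rw [Real.norm_eq_abs, abs_sub_comm]
  rw [div_mul_eq_mul_div, le_div_iff₀ hc]
  linarith

/-- The regular part of the Cauchy integral is continuous across the curve. -/
theorem continuousWithinAt_cauchyReg (h : ArcFamily Z Z' Zt) {g : ℝ → ℝ → ℂ} (hg : IsDensity g)
    {t : ℝ} (ht : 0 ≤ t) (s : ℝ) {o : ℂ} (ho : o ∉ range fun s => Z s t) :
    ContinuousWithinAt (fun x : ℝ × ℂ => cauchyReg (fun s => Z s x.1) (fun s => Z' s x.1) o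
      (fun s => g s x.1) x.2) timeSpace (t, Z s t) := by
  have hT : 0 < t + 1 := by linarith
  obtain ⟨κo, hκo, hκo'⟩ := h.eventually_far_base ht (Z s t) ho
  obtain ⟨c, C, hcC⟩ := h.arc (t + 1) hT
  obtain ⟨A, hA⟩ := hg.bound (t + 1) hT
  have hC := (hcC 0 ⟨le_rfl, hT.le⟩).C_pos
  have hc := (hcC 0 ⟨le_rfl, hT.le⟩).c_pos
  have hA0 : 0 ≤ A := (norm_nonneg _).trans ((hA 0 ⟨le_rfl, hT.le⟩).1 0)
  have hft := h.tendsto_foot ht s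
  have hat : foot (fun s => Z s t) (Z s t) = s :=
    (hcC t ⟨ht, by linarith⟩).foot_self s
  have hpo : ∀ᶠ x : ℝ × ℂ in 𝓝[timeSpace] (t, Z s t), ‖x.2 - o‖ ≤ ‖Z s t - o‖ + 1 := by
    have := ((tendsto_snd (t := t) (Z s t)).sub_const o).norm
    exact this.eventually_le_const (by linarith)
  have hfs : ∀ᶠ x : ℝ × ℂ in 𝓝[timeSpace] (t, Z s t),
      |foot (fun s => Z s x.1) x.2| ≤ |s| + 1 :=
    hft.abs.eventually_le_const (by linarith)
  refine Tendsto.const_mul _ (tendsto_integral_filter_of_dominated_convergence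
    (fun r => 6 * A / c * (1 + (|s| + 1)) * C * (‖Z s t - o‖ + 1) * κo⁻¹ * ((1 + |r|) ^ 2)⁻¹) ?_ ?_
    (integrable_one_add_abs_sq.const_mul _) ?_)
  · filter_upwards [self_mem_nhdsWithin] with x hx
    exact h.measurable_kernel ((hg.continuous hx.1).sub continuous_const) hx.1 _ _
  · filter_upwards [eventually_time (Z s t), hκo', hpo, hfs] with x hx h1 h2 h3
    refine Eventually.of_forall fun r => ?_
    refine ((hcC x.1 hx).norm_regular_le (hA x.1 hx).1 (hA x.1 hx).2 x.2 hκo h1 r).trans ?_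
    gcongr
  · have hnull : ∀ᵐ r : ℝ, r ≠ s := by
      simp [ae_iff]
    filter_upwards [hnull] with r hr
    have hne : Z r t - Z s t ≠ 0 := fun hh =>
      hr ((hcC t ⟨ht, by linarith⟩).injective (sub_eq_zero.1 hh))
    have hno : Z r t - o ≠ 0 := fun hh => ho ⟨r, sub_eq_zero.1 hh⟩
    have h1 := tendsto_of_density hg ht (Z s t) (s := r) (σ := fun _ => r) tendsto_const_nhds
    have h1' := tendsto_of_density hg ht (Z s t) hft
    have h2 := tendsto_of_density h.tangent ht (Z s t) (s := r) (σ := fun _ => r) tendsto_const_nhds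
    have h3 := h.tendsto_point ht (Z s t) r
    have := (h1.sub h1').mul (h2.mul (((h3.sub (tendsto_snd (Z s t))).inv₀ hne).sub
      ((h3.sub_const o).inv₀ hno)))
    simpa only [hat] using this

end ArcFamily

/-! ### Time derivatives of Cauchy integrals -/

/-- Differentiation under the integral sign, with one-sided derivatives at the ends of the
parameter interval. -/
theorem hasDerivWithinAt_integral {Φ Φ' : ℝ → ℝ → ℂ} {S : Set ℝ} {t δ : ℝ} (hδ : 0 < δ)
    (hS : Convex ℝ S) (ht : t ∈ S) {bound : ℝ → ℝ} (hb : Integrable bound)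
    (hΦ : ∀ r ∈ Metric.ball t δ ∩ S, ∀ s, HasDerivWithinAt (fun r => Φ r s) (Φ' r s) S r)
    (hle : ∀ r ∈ Metric.ball t δ ∩ S, ∀ s, ‖Φ' r s‖ ≤ bound s)
    (hm : ∀ r ∈ Metric.ball t δ ∩ S, AEStronglyMeasurable (Φ r)) (hi : Integrable (Φ t)) :
    HasDerivWithinAt (fun r => ∫ s, Φ r s) (∫ s, Φ' t s) S t := by
  have htm : t ∈ Metric.ball t δ ∩ S := ⟨Metric.mem_ball_self hδ, ht⟩
  have hconv : Convex ℝ (Metric.ball t δ ∩ S) := (convex_ball t δ).inter hS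
  have hmv : ∀ r ∈ Metric.ball t δ ∩ S, ∀ s, ‖Φ r s - Φ t s‖ ≤ bound s * |r - t| := fun r hr s =>
    hconv.norm_image_sub_le_of_norm_hasDerivWithin_le (f := fun r => Φ r s) (f' := fun r => Φ' r s)
      (fun x hx => (hΦ x hx s).mono inter_subset_right) (fun x hx => hle x hx s) htm hr
  have hint : ∀ r ∈ Metric.ball t δ ∩ S, Integrable (Φ r) := fun r hr => by
    have : Integrable fun s => Φ r s - Φ t s :=
      (hb.mul_const _).mono' ((hm r hr).sub hi.1) (Eventually.of_forall fun s => hmv r hr s)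
    exact (this.add hi).congr (Eventually.of_forall fun s => sub_add_cancel _ _)
  rw [hasDerivWithinAt_iff_tendsto_slope]
  have hmem : ∀ᶠ r in 𝓝[S \ {t}] t, r ∈ Metric.ball t δ ∩ S ∧ r ≠ t := by
    filter_upwards [self_mem_nhdsWithin, mem_nhdsWithin_of_mem_nhds (Metric.ball_mem_nhds t hδ)]
      with r hr hr'
    exact ⟨⟨hr', hr.1⟩, hr.2⟩
  have hslope : (fun r => ∫ s, slope (fun r => Φ r s) t r) =ᶠ[𝓝[S \ {t}] t]
      slope (fun r => ∫ s, Φ r s) t := by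
    filter_upwards [hmem] with r hr
    simp only [slope_def_module]
    rw [integral_smul, integral_sub (hint r hr.1) hi]
  refine Tendsto.congr' hslope (tendsto_integral_filter_of_dominated_convergence bound ?_ ?_ hb ?_)
  · filter_upwards [hmem] with r hr
    simp only [slope_def_module]
    exact ((hm r hr.1).sub hi.1).const_smul _
  · filter_upwards [hmem] with r hr
    refine Eventually.of_forall fun s => ?_
    have h0 : 0 < |r - t| := abs_pos.2 (sub_ne_zero.2 hr.2)
    rw [slope_def_module, norm_smul, norm_inv, Real.norm_eq_abs, ← div_eq_inv_mul,
      div_le_iff₀ h0]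
    exact hmv r hr.1 s
  · exact Eventually.of_forall fun s => hasDerivWithinAt_iff_tendsto_slope.1 (hΦ t htm s)

/-- The common bound for the terms of the differentiated kernel. -/
theorem norm_mul_le_of_far {a b k : ℂ} {A B K w : ℝ} (ha : ‖a‖ ≤ A) (hb : ‖b‖ ≤ B)
    (hk : ‖k‖ ≤ K * w) : ‖a * b * k‖ ≤ A * B * K * w := by
  have hA : 0 ≤ A := (norm_nonneg _).trans ha
  have hB : 0 ≤ B := (norm_nonneg _).trans hb
  rw [norm_mul, norm_mul, mul_assoc (A * B)]
  exact mul_le_mul (mul_le_mul ha hb (norm_nonneg _) hA) hk (norm_nonneg _) (mul_nonneg hA hB)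

/-- The time derivative of a normalised Cauchy integral is the normalised Cauchy integral of the
derivative of the density along with the motion of the curve at fixed points of the plane. -/
theorem ArcFamily.hasDerivWithinAt_cauchyDiff {Z Z' Zt Zst F f Ft : ℝ → ℝ → ℂ}
    (h : ArcFamily Z Z' Zt)
    (hst : ∀ s t, 0 ≤ t → HasDerivWithinAt (fun r => Z' s r) (Zst s t) (Ici 0) t)
    (hst' : ∀ s t, 0 ≤ t → HasDerivAt (fun r => Zt r t) (Zst s t) s)
    (hstc : ∀ t, 0 ≤ t → Continuous fun s => Zst s t)
    (hstb : ∀ T, 0 < T → ∃ A, ∀ t ∈ Icc 0 T, ∀ s, ‖Zst s t‖ ≤ A)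
    (hF : IsDensity F) (hf : IsDensity f) (hFt : IsDensity Ft)
    (hFs' : ∀ s t, 0 ≤ t → HasDerivAt (fun r => F r t) (f s t) s)
    (hFt' : ∀ s t, 0 ≤ t → HasDerivWithinAt (fun r => F s r) (Ft s t) (Ici 0) t)
    {t : ℝ} (ht : 0 ≤ t) {p o : ℂ} (hp : p ∉ range fun s => Z s t)
    (ho : o ∉ range fun s => Z s t) :
    HasDerivWithinAt
      (fun t => cauchyDiff (fun s => Z s t) (fun s => Z' s t) o (fun s => F s t) p)
      (cauchyDiff (fun s => Z s t) (fun s => Z' s t) o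
        (fun s => Ft s t - f s t * Zt s t * (Z' s t)⁻¹) p) (Ici 0) t := by
  have hT : 0 < t + 1 := by linarith
  obtain ⟨c, C, hcC⟩ := h.arc (t + 1) hT
  have hC := (hcC 0 ⟨le_rfl, hT.le⟩).C_pos
  obtain ⟨A1, hA1⟩ := hF.bound (t + 1) hT
  obtain ⟨A2, hA2⟩ := hf.bound (t + 1) hT
  obtain ⟨A3, hA3⟩ := hFt.bound (t + 1) hT
  obtain ⟨A4, hA4⟩ := h.velocity.bound (t + 1) hT
  obtain ⟨A5, hA5⟩ := hstb (t + 1) hT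
  obtain ⟨κ, hκ, hκ'⟩ := h.eventually_far ht hp
  obtain ⟨κo, hκo, hκo'⟩ := h.eventually_far_base ht p ho
  -- everything holds on a one-sided neighbourhood of `t`
  have htime : Tendsto (fun r : ℝ => (r, p)) (𝓝[Ici 0] t) (𝓝[timeSpace] (t, p)) := by
    refine tendsto_nhdsWithin_iff.2 ⟨?_, ?_⟩
    · exact ((continuous_id.prodMk continuous_const).tendsto t).mono_left nhdsWithin_le_nhds
    · filter_upwards [self_mem_nhdsWithin] with r hr using ⟨hr, mem_univ _⟩
  have hall := (htime.eventually hκ').and ((htime.eventually hκo').and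
    (htime.eventually (ArcFamily.eventually_time p)))
  obtain ⟨δ, hδ, hδ'⟩ := Metric.mem_nhdsWithin_iff.1 hall
  set k : ℝ → ℝ → ℂ := fun r s => (Z s r - p)⁻¹ - (Z s r - o)⁻¹ with hk
  set l : ℝ → ℝ → ℂ := fun r s => ((Z s r - p)⁻¹) ^ 2 - ((Z s r - o)⁻¹) ^ 2 with hl
  set K : ℝ := ‖p - o‖ * κ⁻¹ * κo⁻¹ with hK
  set K' : ℝ := κ⁻¹ ^ 2 + κo⁻¹ ^ 2 with hK'
  set w : ℝ → ℝ := fun s => ((1 + |s|) ^ 2)⁻¹ with hw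
  have hkb : ∀ r ∈ Metric.ball t δ ∩ Ici 0, ∀ s, ‖k r s‖ ≤ K * w s := by
    intro r hr s
    obtain ⟨h1, h2, -⟩ := hδ' hr
    have e := kernel_eq (ne_of_far (γ := fun s => Z s r) hκ h1 s)
      (ne_of_far (γ := fun s => Z s r) hκo h2 s)
    have e' : k r s = _ := e
    rw [e', norm_mul, norm_mul]
    have h3 := norm_inv_le_of_far (γ := fun s => Z s r) hκ h1 s
    have h4 := norm_inv_le_of_far (γ := fun s => Z s r) hκo h2 s
    calc _ ≤ ‖p - o‖ * ((κ⁻¹ * (1 + |s|)⁻¹) * (κo⁻¹ * (1 + |s|)⁻¹)) := by gcongr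
      _ = K * w s := by simp only [hK, hw]; rw [sq, mul_inv]; ring
  have hlb : ∀ r ∈ Metric.ball t δ ∩ Ici 0, ∀ s, ‖l r s‖ ≤ K' * w s := by
    intro r hr s
    obtain ⟨h1, h2, -⟩ := hδ' hr
    have h3 := norm_inv_le_of_far (γ := fun s => Z s r) hκ h1 s
    have h4 := norm_inv_le_of_far (γ := fun s => Z s r) hκo h2 s
    refine (norm_sub_le _ _).trans ?_
    rw [norm_pow, norm_pow]
    calc _ ≤ (κ⁻¹ * (1 + |s|)⁻¹) ^ 2 + (κo⁻¹ * (1 + |s|)⁻¹) ^ 2 := by gcongr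
      _ = K' * w s := by simp only [hK', hw]; rw [mul_pow, mul_pow, inv_pow (1 + |s|)]; ring
  have hin : ∀ r ∈ Metric.ball t δ ∩ Ici 0, r ∈ Icc 0 (t + 1) := fun r hr => (hδ' hr).2.2
  have htm : t ∈ Metric.ball t δ ∩ Ici 0 := ⟨Metric.mem_ball_self hδ, ht⟩
  have hkt : ∀ r ∈ Metric.ball t δ ∩ Ici 0, ∀ s,
      HasDerivWithinAt (fun r => k r s) (-Zt s r * l r s) (Ici 0) r := by
    intro r hr s
    obtain ⟨h1, h2, -⟩ := hδ' hr
    have d1 := ((h.hasDeriv s r hr.2).sub_const p).inv (ne_of_far (γ := fun s => Z s r) hκ h1 s)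
    have d2 := ((h.hasDeriv s r hr.2).sub_const o).inv (ne_of_far (γ := fun s => Z s r) hκo h2 s)
    refine (d1.sub d2).congr_deriv ?_
    simp only [hl, inv_pow]
    ring
  have hks : ∀ s, HasDerivAt (fun s => k t s) (-Z' s t * l t s) s := by
    intro s
    obtain ⟨h1, h2, -⟩ := hδ' htm
    have d0 := (hcC t (hin t htm)).hasDeriv s
    have d1 := (d0.sub_const p).inv (ne_of_far (γ := fun s => Z s t) hκ h1 s)
    have d2 := (d0.sub_const o).inv (ne_of_far (γ := fun s => Z s t) hκo h2 s)
    refine (d1.sub d2).congr_deriv ?_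
    simp only [hl, inv_pow]
    ring
  have hkc : Continuous (k t) :=
    ((hcC t (hin t htm)).continuous_inv_sub hp).sub ((hcC t (hin t htm)).continuous_inv_sub ho)
  have hlc : Continuous (l t) :=
    (((hcC t (hin t htm)).continuous_inv_sub hp).pow 2).sub
      (((hcC t (hin t htm)).continuous_inv_sub ho).pow 2)
  have hZ't := h.tangent.continuous ht
  have hZt := h.velocity.continuous ht
  have hFc := hF.continuous ht
  have hfc := hf.continuous ht
  have hFtc := hFt.continuous ht
  have hZst := hstc t ht
  have hwi : Integrable w := integrable_one_add_abs_sq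
  have hder := hasDerivWithinAt_integral (Φ := fun r s => F s r * (Z' s r * k r s))
    (Φ' := fun r s => Ft s r * Z' s r * k r s + F s r * Zst s r * k r s -
      F s r * (Z' s r * Zt s r) * l r s)
    (bound := fun s => (A3 * C * K + A1 * A5 * K + A1 * (C * A4) * K') * w s) hδ (convex_Ici 0)
    (mem_Ici.2 ht) (hwi.const_mul _) ?_ ?_ ?_ ?_
  · refine (hder.const_mul _).congr_deriv ?_
    rw [cauchyDiff]
    congr 1
    -- the two integrands differ by a derivative along the curve
    have hds : ∀ s, HasDerivAt (fun s => F s t * Zt s t * k t s)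
        (f s t * Zt s t * k t s + F s t * Zst s t * k t s - F s t * (Z' s t * Zt s t) * l t s) s := by
      intro s
      refine (((hFs' s t ht).mul (hst' s t ht)).mul (hks s)).congr_deriv ?_
      simp only [Pi.mul_apply]
      ring
    have hti := hin t htm
    have i1 : Integrable fun s => F s t * Zt s t * k t s :=
      (hwi.const_mul _).mono' ((hFc.mul hZt).mul hkc).aestronglyMeasurable
        (Eventually.of_forall fun s => norm_mul_le_of_far ((hA1 t hti).1 s) ((hA4 t hti).1 s)
          (hkb t htm s))
    have i2 : Integrable fun s => f s t * Zt s t * k t s :=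
      (hwi.const_mul _).mono' ((hfc.mul hZt).mul hkc).aestronglyMeasurable
        (Eventually.of_forall fun s => norm_mul_le_of_far ((hA2 t hti).1 s) ((hA4 t hti).1 s)
          (hkb t htm s))
    have i3 : Integrable fun s => F s t * Zst s t * k t s :=
      (hwi.const_mul _).mono' ((hFc.mul hZst).mul hkc).aestronglyMeasurable
        (Eventually.of_forall fun s => norm_mul_le_of_far ((hA1 t hti).1 s) (hA5 t hti s)
          (hkb t htm s))
    have i4 : Integrable fun s => F s t * (Z' s t * Zt s t) * l t s :=
      (hwi.const_mul _).mono' ((hFc.mul (hZ't.mul hZt)).mul hlc).aestronglyMeasurable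
        (Eventually.of_forall fun s => norm_mul_le_of_far ((hA1 t hti).1 s)
          (by rw [norm_mul]; exact mul_le_mul ((hcC t hti).upper s) ((hA4 t hti).1 s)
                (norm_nonneg _) hC.le) (hlb t htm s))
    have i5 : Integrable fun s => Ft s t * Z' s t * k t s :=
      (hwi.const_mul _).mono' ((hFtc.mul hZ't).mul hkc).aestronglyMeasurable
        (Eventually.of_forall fun s => norm_mul_le_of_far ((hA3 t hti).1 s) ((hcC t hti).upper s)
          (hkb t htm s))
    have hzero := integral_eq_zero_of_hasDerivAt_of_integrable hds ((i2.add i3).sub i4) i1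
    have e1 : ∀ s, Ft s t * Z' s t * k t s + F s t * Zst s t * k t s -
        F s t * (Z' s t * Zt s t) * l t s =
        (Ft s t * Z' s t * k t s - f s t * Zt s t * k t s) +
        (f s t * Zt s t * k t s + F s t * Zst s t * k t s - F s t * (Z' s t * Zt s t) * l t s) :=
      fun s => by ring
    simp_rw [e1]
    have i6 : Integrable fun s => f s t * Zt s t * k t s + F s t * Zst s t * k t s -
        F s t * (Z' s t * Zt s t) * l t s := (i2.add i3).sub i4
    have i7 : Integrable fun s => Ft s t * Z' s t * k t s - f s t * Zt s t * k t s := i5.sub i2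
    rw [integral_add i7 i6, hzero, add_zero]
    refine integral_congr_ae (Eventually.of_forall fun s => ?_)
    have := (hcC t hti).deriv_ne_zero s
    simp only [hk]
    field_simp
  · intro r hr s
    refine ((hFt' s r hr.2).mul ((hst s r hr.2).mul (hkt r hr s))).congr_deriv ?_
    simp only [Pi.mul_apply]
    ring
  · intro r hr s
    have hri := hin r hr
    have b1 := norm_mul_le_of_far ((hA3 r hri).1 s) ((hcC r hri).upper s) (hkb r hr s)
    have b2 := norm_mul_le_of_far ((hA1 r hri).1 s) (hA5 r hri s) (hkb r hr s)
    have b3 : ‖F s r * (Z' s r * Zt s r) * l r s‖ ≤ A1 * (C * A4) * K' * w s :=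
      norm_mul_le_of_far ((hA1 r hri).1 s)
        (by rw [norm_mul]; exact mul_le_mul ((hcC r hri).upper s) ((hA4 r hri).1 s)
              (norm_nonneg _) hC.le) (hlb r hr s)
    refine (norm_sub_le _ _).trans ?_
    rw [add_mul, add_mul]
    exact add_le_add ((norm_add_le _ _).trans (add_le_add b1 b2)) b3
  · intro r hr
    exact h.measurable_kernel (hF.continuous hr.2) hr.2 p o
  · exact (hcC t (hin t htm)).integrable_kernel hFc (hA1 t (hin t htm)).1 hp ho

/-! ### The two sides of the curve and the fluid domain -/

/-- Reflection of the plane in the bottom `y = -H`. -/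
def reflect (H : ℝ) (p : ℂ) : ℂ := ⟨p.re, -p.im - 2 * H⟩

/-- The point of the bottom `y = -H` below the origin, used as base point. -/
def bedPoint (H : ℝ) : ℂ := ⟨0, -H⟩

/-- The part of the plane on the far side of the curve, as seen from the bottom. -/
def upperSide (γ γ' : ℝ → ℂ) (H : ℝ) : Set ℂ :=
  {p | p ∉ range γ ∧ index γ γ' (bedPoint H) p = 1}

/-- The part of the plane on the same side of the curve as the bottom. -/
def lowerSide (γ γ' : ℝ → ℂ) (H : ℝ) : Set ℂ :=
  {p | p ∉ range γ ∧ index γ γ' (bedPoint H) p = 0}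

theorem reflect_eq (H : ℝ) (p : ℂ) :
    reflect H p = (starRingEnd ℂ) p - 2 * H * Complex.I := by
  apply Complex.ext <;> simp [reflect]

theorem continuous_reflect (H : ℝ) : Continuous (reflect H) := by
  have : reflect H = fun p => (starRingEnd ℂ) p - 2 * H * Complex.I := funext (reflect_eq H)
  rw [this]
  exact Complex.continuous_conj.sub continuous_const

theorem conj_reflect (H : ℝ) (p : ℂ) :
    (starRingEnd ℂ) (reflect H p) = p + 2 * H * Complex.I := by
  apply Complex.ext
  · simp [reflect]
  · simp [reflect]; ring

theorem reflect_of_bottom {H : ℝ} {p : ℂ} (hp : p.im = -H) : reflect H p = p := by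
  apply Complex.ext
  · rfl
  · simp only [reflect]; linarith

namespace Arc

variable {c C H : ℝ} {γ γ' : ℝ → ℂ}

theorem bedPoint_lt {γ : ℝ → ℂ} {H : ℝ} (hb : ∀ s, -H < (γ s).im) (s : ℝ) :
    (bedPoint H).im < (γ s).im := hb s

theorem notMem_of_im_le {γ : ℝ → ℂ} {H : ℝ} (hb : ∀ s, -H < (γ s).im) {p : ℂ} (hp : p.im ≤ -H) :
    p ∉ range γ := by
  rintro ⟨s, hs⟩
  have := hb s
  rw [hs] at this
  linarith

theorem mem_or_mem (h : Arc c C γ γ') (hb : ∀ s, -H < (γ s).im) {p : ℂ} (hp : p ∉ range γ) :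
    p ∈ upperSide γ γ' H ∨ p ∈ lowerSide γ γ' H := by
  have := h.index_eq (bedPoint_lt hb) hp
  split_ifs at this
  · exact Or.inl ⟨hp, this⟩
  · exact Or.inr ⟨hp, this⟩

theorem notMem_upper_of_lower {p : ℂ} (hp : p ∈ lowerSide γ γ' H) :
    p ∉ upperSide γ γ' H := fun hp' => by
  have := hp.2.symm.trans hp'.2
  exact zero_ne_one this

theorem mem_lower_of_joinedIn (h : Arc c C γ γ') (hb : ∀ s, -H < (γ s).im) {p q : ℂ}
    (hp : p ∈ lowerSide γ γ' H) (hpq : JoinedIn (range γ)ᶜ p q) : q ∈ lowerSide γ γ' H := by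
  refine ⟨hpq.target_mem, ?_⟩
  rw [← hp.2]
  exact (h.index_eq_of_joinedIn (notMem_of_im_le hb le_rfl) hpq).symm

theorem mem_upper_of_joinedIn (h : Arc c C γ γ') (hb : ∀ s, -H < (γ s).im) {p q : ℂ}
    (hp : p ∈ upperSide γ γ' H) (hpq : JoinedIn (range γ)ᶜ p q) : q ∈ upperSide γ γ' H := by
  refine ⟨hpq.target_mem, ?_⟩
  rw [← hp.2]
  exact (h.index_eq_of_joinedIn (notMem_of_im_le hb le_rfl) hpq).symm

theorem mem_lower_of_im_le (h : Arc c C γ γ') (hb : ∀ s, -H < (γ s).im) {p : ℂ}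
    (hp : p.im ≤ -H) : p ∈ lowerSide γ γ' H := by
  refine h.mem_lower_of_joinedIn hb (p := bedPoint H)
    ⟨notMem_of_im_le hb le_rfl, index_self _ _ _⟩ (JoinedIn.of_segment_subset ?_)
  rintro z ⟨u, v, hu, hv, huv, rfl⟩
  apply notMem_of_im_le hb
  have : (bedPoint H).im = -H := rfl
  simp only [Complex.add_im, Complex.real_smul, Complex.mul_im, Complex.ofReal_re,
    Complex.ofReal_im, zero_mul, add_zero, this]
  have h1 : u * -H + v * -H = -H := by rw [← add_mul, huv, one_mul]
  have h2 := mul_le_mul_of_nonneg_left hp hv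
  linarith

theorem mem_upper_of_im_gt (h : Arc c C γ γ') (hb : ∀ s, -H < (γ s).im) {p : ℂ}
    (hp : C < p.im) : p ∈ upperSide γ γ' H := by
  have : ∀ s, (γ s).im < p.im := fun s => by linarith [(abs_le.1 (h.im_le s)).2]
  refine ⟨?_, h.index_eq_one_of_above this (bedPoint_lt hb)⟩
  rintro ⟨s, hs⟩
  exact (this s).ne (by rw [hs])

theorem im_gt_of_mem_upper (h : Arc c C γ γ') (hb : ∀ s, -H < (γ s).im) {p : ℂ}
    (hp : p ∈ upperSide γ γ' H) : -H < p.im := by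
  by_contra hh
  exact notMem_upper_of_lower (h.mem_lower_of_im_le hb (not_lt.1 hh)) hp

theorem reflect_mem_lower (h : Arc c C γ γ') (hb : ∀ s, -H < (γ s).im) {p : ℂ}
    (hp : -H ≤ p.im) : reflect H p ∈ lowerSide γ γ' H := by
  apply h.mem_lower_of_im_le hb
  simp only [reflect]
  linarith

theorem isOpen_upper (h : Arc c C γ γ') (hb : ∀ s, -H < (γ s).im) :
    IsOpen (upperSide γ γ' H) := by
  rw [isOpen_iff_mem_nhds]
  intro p hp
  have hU : pathComponentIn (range γ)ᶜ p ∈ 𝓝 p :=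
    (h.isOpen_compl.pathComponentIn p).mem_nhds (mem_pathComponentIn_self hp.1)
  filter_upwards [hU] with q hq using h.mem_upper_of_joinedIn hb hp hq

theorem isOpen_lower (h : Arc c C γ γ') (hb : ∀ s, -H < (γ s).im) :
    IsOpen (lowerSide γ γ' H) := by
  rw [isOpen_iff_mem_nhds]
  intro p hp
  have hU : pathComponentIn (range γ)ᶜ p ∈ 𝓝 p :=
    (h.isOpen_compl.pathComponentIn p).mem_nhds (mem_pathComponentIn_self hp.1)
  filter_upwards [hU] with q hq using h.mem_lower_of_joinedIn hb hp hq

theorem joinedIn_upper (h : Arc c C γ γ') (hb : ∀ s, -H < (γ s).im) {p q : ℂ}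
    (hp : p ∈ upperSide γ γ' H) (hq : q ∈ upperSide γ γ' H) : JoinedIn (range γ)ᶜ p q :=
  (h.joinedIn_iff (bedPoint_lt hb) hp.1 hq.1).2 (hp.2.trans hq.2.symm)

theorem joinedIn_lower (h : Arc c C γ γ') (hb : ∀ s, -H < (γ s).im) {p q : ℂ}
    (hp : p ∈ lowerSide γ γ' H) (hq : q ∈ lowerSide γ γ' H) : JoinedIn (range γ)ᶜ p q :=
  (h.joinedIn_iff (bedPoint_lt hb) hp.1 hq.1).2 (hp.2.trans hq.2.symm)

theorem isPreconnected_upper (h : Arc c C γ γ') (hb : ∀ s, -H < (γ s).im) :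
    IsPreconnected (upperSide γ γ' H) := by
  have hm : (⟨0, C + 1⟩ : ℂ) ∈ upperSide γ γ' H := h.mem_upper_of_im_gt hb (by simp)
  have : upperSide γ γ' H = pathComponentIn (range γ)ᶜ ⟨0, C + 1⟩ := by
    ext q
    exact ⟨fun hq => h.joinedIn_upper hb hm hq, fun hq => h.mem_upper_of_joinedIn hb hm hq⟩
  rw [this]
  exact (isPathConnected_pathComponentIn hm.1).isConnected.isPreconnected

/-- The half-open segment from a point off the curve to the nearest point of the curve stays on one
side. -/
theorem segment_mem_lower (h : Arc c C γ γ') (hb : ∀ s, -H < (γ s).im) {p : ℂ}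
    (hp : p ∈ lowerSide γ γ' H) {u : ℝ} (hu0 : 0 < u) (hu1 : u ≤ 1) :
    γ (foot γ p) + u * (p - γ (foot γ p)) ∈ lowerSide γ γ' H := by
  refine h.mem_lower_of_joinedIn hb hp (JoinedIn.of_segment_subset ?_)
  rintro z ⟨a, b, ha, hb', hab, rfl⟩
  have e : a • p + b • (γ (foot γ p) + u * (p - γ (foot γ p))) =
      γ (foot γ p) + ((a + b * u : ℝ) : ℂ) * (p - γ (foot γ p)) := by
    have hb' : (a : ℂ) + b = 1 := by exact_mod_cast hab
    simp only [Complex.real_smul]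
    push_cast
    linear_combination γ (foot γ p) * hb'
  rw [e]
  apply h.segment_notMem hp.1
  · rcases ha.eq_or_lt with ha0 | ha0
    · have : b = 1 := by linarith
      rw [← ha0, this]; simpa using hu0
    · positivity
  · nlinarith

theorem tube_mem_lower (h : Arc c C γ γ') (hb : ∀ s, -H < (γ s).im) {s n : ℝ} (hn0 : n < 0)
    (hn : |n| < (c / C) ^ 2) : γ s + n * (Complex.I * γ' s) ∈ lowerSide γ γ' H := by
  obtain ⟨b, hby, r, a, ha, har⟩ := h.exists_normalCoord_mul_pos (y := -H)
  have hbl : b ∈ lowerSide γ γ' H := h.mem_lower_of_im_le hb hby.le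
  have hnb : normalCoord γ γ' b < 0 := by
    have := hb r
    by_contra hh
    have := mul_nonneg ha.le (not_lt.1 hh)
    linarith
  obtain ⟨m, hm1, hm2, hm3⟩ := h.exists_joinedIn_tube hbl.1
  have hm : m < 0 := (neg_iff_neg_of_mul_pos hm1).2 hnb
  exact h.mem_lower_of_joinedIn hb hbl
    (hm3.trans (h.joinedIn_tube (mul_pos_of_neg_of_neg hm hn0) hm2 hn))

theorem tube_mem_upper (h : Arc c C γ γ') (hb : ∀ s, -H < (γ s).im) {s n : ℝ} (hn0 : 0 < n)
    (hn : |n| < (c / C) ^ 2) : γ s + n * (Complex.I * γ' s) ∈ upperSide γ γ' H := by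
  obtain ⟨b, hby, r, a, ha, har⟩ := h.exists_normalCoord_mul_pos (y := C + 1)
  have hbl : b ∈ upperSide γ γ' H := h.mem_upper_of_im_gt hb (by rw [hby]; linarith)
  have hnb : 0 < normalCoord γ γ' b := by
    have := (abs_le.1 (h.im_le r)).2
    refine (pos_iff_pos_of_mul_pos (?_ : 0 < a * _)).1 ha
    rw [har]; linarith
  obtain ⟨m, hm1, hm2, hm3⟩ := h.exists_joinedIn_tube hbl.1
  have hm : 0 < m := (pos_iff_pos_of_mul_pos hm1).2 hnb
  exact h.mem_upper_of_joinedIn hb hbl (hm3.trans (h.joinedIn_tube (mul_pos hm hn0) hm2 hn))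

theorem tendsto_normal (γ γ' : ℝ → ℂ) (s : ℝ) :
    Tendsto (fun n : ℝ => γ s + n * (Complex.I * γ' s)) (𝓝 0) (𝓝 (γ s)) := by
  have : Continuous fun n : ℝ => γ s + n * (Complex.I * γ' s) := by fun_prop
  simpa using this.tendsto 0

theorem eventually_tube_lower (h : Arc c C γ γ') (hb : ∀ s, -H < (γ s).im) (s : ℝ) :
    ∀ᶠ n : ℝ in 𝓝[<] 0, γ s + n * (Complex.I * γ' s) ∈ lowerSide γ γ' H := by
  have h1 : ∀ᶠ n : ℝ in 𝓝 0, |n| < (c / C) ^ 2 :=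
    continuous_abs.continuousAt.eventually_lt continuousAt_const (by simpa using h.tube_pos)
  filter_upwards [self_mem_nhdsWithin, mem_nhdsWithin_of_mem_nhds h1] with n hn hn'
  exact h.tube_mem_lower hb hn hn'

theorem eventually_tube_upper (h : Arc c C γ γ') (hb : ∀ s, -H < (γ s).im) (s : ℝ) :
    ∀ᶠ n : ℝ in 𝓝[>] 0, γ s + n * (Complex.I * γ' s) ∈ upperSide γ γ' H := by
  have h1 : ∀ᶠ n : ℝ in 𝓝 0, |n| < (c / C) ^ 2 :=
    continuous_abs.continuousAt.eventually_lt continuousAt_const (by simpa using h.tube_pos)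
  filter_upwards [self_mem_nhdsWithin, mem_nhdsWithin_of_mem_nhds h1] with n hn hn'
  exact h.tube_mem_upper hb hn hn'

theorem eventually_im_gt (hb : ∀ s, -H < (γ s).im) (s : ℝ) :
    ∀ᶠ n : ℝ in 𝓝 0, -H < (γ s + n * (Complex.I * γ' s)).im :=
  ((Complex.continuous_im.tendsto _).comp (tendsto_normal γ γ' s)).eventually_const_lt (hb s)

end Arc

section Domain

variable {c C h t : ℝ} {X Y : ℝ → ℝ → ℝ} {γ' : ℝ → ℂ}

/-- The fluid occupies the part between the bottom and the curve. -/
theorem fluidDomain_eq (ha : Arc c C (fun s => surfacePoint X Y s t) γ')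
    (hb : ∀ s, -h < (surfacePoint X Y s t).im) :
    fluidDomain h X Y t = {p | -h < p.im} ∩ lowerSide (fun s => surfacePoint X Y s t) γ' h := by
  ext p
  constructor
  · rintro ⟨hp, q, hq, hqp⟩
    refine ⟨hp, ha.mem_lower_of_joinedIn hb (p := q) (ha.mem_lower_of_im_le hb (le_of_eq hq))
      (hqp.mono ?_)⟩
    exact fun z hz => hz.2
  · rintro ⟨hp, hp'⟩
    have hbed : (bedPoint h) ∈ lowerSide (fun s => surfacePoint X Y s t) γ' h :=
      ha.mem_lower_of_im_le hb le_rfl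
    -- a path off the curve can be pushed up to the closed half-plane above the bottom
    have hj := ha.joinedIn_lower hb hbed hp'
    -- `F` is the retraction onto the half-plane
    set F : ℂ → ℂ := fun z => ⟨z.re, max z.im (-h)⟩ with hF
    have hFc : Continuous F := by
      have : F = fun z => (z.re : ℂ) + ((max z.im (-h) : ℝ) : ℂ) * Complex.I := by
        ext z; apply Complex.ext <;> simp [hF]
      rw [this]
      fun_prop
    have hFfix : ∀ z : ℂ, -h ≤ z.im → F z = z := fun z hz => by
      apply Complex.ext
      · rfl
      · simp only [hF]; exact max_eq_left hz
    have hmaps : MapsTo F (range fun s => surfacePoint X Y s t)ᶜ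
        ({z : ℂ | -h ≤ z.im} \ freeSurface X Y t) := by
      intro z hz
      refine ⟨show -h ≤ max z.im (-h) from le_max_right _ _, ?_⟩
      rcases le_total (-h) z.im with hh | hh
      · rw [hFfix z hh]; exact hz
      · apply Arc.notMem_of_im_le hb
        simp only [hF]
        exact (max_eq_right hh).le
    refine ⟨hp, bedPoint h, rfl, ?_⟩
    have := hj.map_continuousOn hFc.continuousOn
    rw [hFfix (bedPoint h) le_rfl, hFfix p (le_of_lt hp)] at this
    exact this.mono (image_subset_iff.2 hmaps)

theorem isOpen_fluidDomain (ha : Arc c C (fun s => surfacePoint X Y s t) γ')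
    (hb : ∀ s, -h < (surfacePoint X Y s t).im) : IsOpen (fluidDomain h X Y t) := by
  rw [fluidDomain_eq ha hb]
  exact (isOpen_lt continuous_const Complex.continuous_im).inter (ha.isOpen_lower hb)

theorem closure_fluidDomain (ha : Arc c C (fun s => surfacePoint X Y s t) γ')
    (hb : ∀ s, -h < (surfacePoint X Y s t).im) :
    closure (fluidDomain h X Y t) =
      {p | -h ≤ p.im ∧ p ∉ upperSide (fun s => surfacePoint X Y s t) γ' h} := by
  set γ := fun s => surfacePoint X Y s t with hγ
  rw [fluidDomain_eq ha hb]
  apply Subset.antisymm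
  · apply closure_minimal
    · exact fun p hp => ⟨le_of_lt hp.1, Arc.notMem_upper_of_lower hp.2⟩
    · exact (isClosed_le continuous_const Complex.continuous_im).inter
        (ha.isOpen_upper hb).isClosed_compl
  · rintro p ⟨hp, hpu⟩
    by_cases hpr : p ∈ range γ
    · obtain ⟨s, rfl⟩ := hpr
      refine mem_closure_of_tendsto ((Arc.tendsto_normal γ γ' s).mono_left
        (nhdsWithin_le_nhds (s := Iio 0))) ?_
      filter_upwards [ha.eventually_tube_lower hb s, mem_nhdsWithin_of_mem_nhds
        (Arc.eventually_im_gt (γ := γ) (γ' := γ') hb s)] with n h1 h2 using ⟨h2, h1⟩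
    · have hpl : p ∈ lowerSide γ γ' h := (ha.mem_or_mem hb hpr).resolve_left hpu
      have ht : Tendsto (fun n : ℝ => p + n * Complex.I) (𝓝[>] 0) (𝓝 p) := by
        have : Continuous fun n : ℝ => p + n * Complex.I := by fun_prop
        have := (this.tendsto 0).mono_left (nhdsWithin_le_nhds (s := Ioi 0))
        simpa using this
      refine mem_closure_of_tendsto ht ?_
      filter_upwards [self_mem_nhdsWithin, ht.eventually ((ha.isOpen_lower hb).mem_nhds hpl)]
        with n hn hn'
      refine ⟨?_, hn'⟩
      simp only [mem_Ioi] at hn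
      simp only [mem_ofPred_eq, Complex.add_im, Complex.mul_im, Complex.ofReal_re, Complex.I_im,
        mul_one, Complex.ofReal_im, Complex.I_re, mul_zero, add_zero]
      linarith

end Domain

/-! ### Cauchy integrals along the curve and its mirror image -/

/-- The normalised Cauchy integral along the curve and its mirror image in the bottom. -/
def symCauchyDiff (γ γ' : ℝ → ℂ) (H : ℝ) (g : ℝ → ℂ) (p : ℂ) : ℂ :=
  cauchyDiff γ γ' (bedPoint H) g p +
    (starRingEnd ℂ) (cauchyDiff γ γ' (bedPoint H) g (reflect H p))

/-- The Cauchy integral along the curve and its mirror image in the bottom. -/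
def symCauchy (γ : ℝ → ℂ) (H : ℝ) (f : ℝ → ℂ) (p : ℂ) : ℂ :=
  cauchy γ f p + (starRingEnd ℂ) (cauchy γ f (reflect H p))

theorem HasDerivAt.conj_reflect {G : ℂ → ℂ} {G' p : ℂ} {H : ℝ}
    (hG : HasDerivAt G G' (reflect H p)) :
    HasDerivAt (fun q => (starRingEnd ℂ) (G (reflect H q))) ((starRingEnd ℂ) G') p := by
  have h1 : HasDerivAt (starRingEnd ℂ ∘ G ∘ starRingEnd ℂ) ((starRingEnd ℂ) G')
      ((starRingEnd ℂ) (reflect H p)) := hG.conj_conj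
  rw [WaterWave.conj_reflect] at h1
  have h2 := h1.comp_add_const p (2 * H * Complex.I)
  refine h2.congr_of_eventuallyEq (Eventually.of_forall fun q => ?_)
  simp only [Function.comp_apply]
  congr 2
  rw [reflect_eq]
  apply Complex.ext
  · simp
  · simp; ring

/-- On the bottom the two halves of the symmetric Cauchy integral are complex conjugates. -/
theorem symCauchy_im_eq_zero {γ f : ℝ → ℂ} {H : ℝ} {p : ℂ} (hp : p.im = -H) :
    (symCauchy γ H f p).im = 0 := by
  rw [symCauchy, reflect_of_bottom hp]
  simp

namespace Arc

variable {c C H : ℝ} {γ γ' : ℝ → ℂ}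

theorem hasDerivAt_symCauchyDiff (h : Arc c C γ γ') (hb : ∀ s, -H < (γ s).im) {F f : ℝ → ℂ}
    (hF : ∀ s, HasDerivAt F (f s) s) {G : ℝ} (hG : ∀ s, ‖F s‖ ≤ G) (hf : Integrable f) {p : ℂ}
    (hp : p ∉ range γ) (hp' : reflect H p ∉ range γ) :
    HasDerivAt (symCauchyDiff γ γ' H F) (symCauchy γ H f p) p :=
  (h.hasDerivAt_cauchyDiff hF hG hf hp (notMem_of_im_le hb le_rfl)).add
    (HasDerivAt.conj_reflect
      (h.hasDerivAt_cauchyDiff hF hG hf hp' (notMem_of_im_le hb le_rfl)))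

theorem cauchyDiff_div (h : Arc c C γ γ') {f : ℝ → ℂ} (hf : Integrable f) {p o : ℂ}
    (hp : p ∉ range γ) (ho : o ∉ range γ) :
    cauchyDiff γ γ' o (fun s => f s * (γ' s)⁻¹) p = cauchy γ f p - cauchy γ f o := by
  rw [cauchyDiff, cauchy, cauchy, ← mul_sub, ← integral_sub]
  · congr 1
    refine integral_congr_ae (Eventually.of_forall fun s => ?_)
    have := h.deriv_ne_zero s
    simp only
    rw [div_eq_mul_inv, div_eq_mul_inv]
    field_simp
  · simpa only [div_eq_mul_inv] using h.integrable_div hf hp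
  · simpa only [div_eq_mul_inv] using h.integrable_div hf ho

/-- The Cauchy integral of `f` is, up to a constant, the normalised one of `f / γ'`. -/
theorem symCauchyDiff_div (h : Arc c C γ γ') (hb : ∀ s, -H < (γ s).im) {f : ℝ → ℂ}
    (hf : Integrable f) {p : ℂ} (hp : p ∉ range γ) (hp' : reflect H p ∉ range γ) :
    symCauchyDiff γ γ' H (fun s => f s * (γ' s)⁻¹) p =
      symCauchy γ H f p - symCauchy γ H f (bedPoint H) := by
  have ho := notMem_of_im_le hb (p := bedPoint H) le_rfl
  rw [symCauchyDiff, h.cauchyDiff_div hf hp ho, h.cauchyDiff_div hf hp' ho, symCauchy, symCauchy,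
    reflect_of_bottom (show (bedPoint H).im = -H from rfl), map_sub]
  ring

theorem differentiableAt_symCauchy (h : Arc c C γ γ') (hb : ∀ s, -H < (γ s).im) {f : ℝ → ℂ}
    (hfc : Continuous f) {G : ℝ} (hG : ∀ s, ‖f s‖ ≤ G) (hf : Integrable f) {p : ℂ}
    (hp : p ∉ range γ) (hp' : reflect H p ∉ range γ) :
    DifferentiableAt ℂ (symCauchy γ H f) p := by
  have ho := notMem_of_im_le hb (p := bedPoint H) le_rfl
  have hgc : Continuous fun s => f s * (γ' s)⁻¹ :=
    hfc.mul (h.continuous_deriv.inv₀ h.deriv_ne_zero)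
  have hG0 : 0 ≤ G := (norm_nonneg _).trans (hG 0)
  have hgb : ∀ s, ‖f s * (γ' s)⁻¹‖ ≤ G * c⁻¹ := fun s => by
    rw [norm_mul, norm_inv]
    exact mul_le_mul (hG s) (inv_anti₀ h.c_pos (h.c_le_norm_deriv s)) (by positivity) hG0
  have h1 := (h.hasDerivAt_cauchyDiff' hgc hgb hp ho).add
    (HasDerivAt.conj_reflect (h.hasDerivAt_cauchyDiff' hgc hgb hp' ho))
  have h2 : DifferentiableAt ℂ (fun q => symCauchyDiff γ γ' H (fun s => f s * (γ' s)⁻¹) q +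
      symCauchy γ H f (bedPoint H)) p := h1.differentiableAt.add_const _
  refine h2.congr_of_eventuallyEq ?_
  filter_upwards [h.isOpen_compl.mem_nhds hp, ((continuous_reflect H).continuousAt.preimage_mem_nhds
    (h.isOpen_compl.mem_nhds hp'))] with q hq hq'
  rw [h.symCauchyDiff_div hb hf hq hq']
  ring

end Arc

/-- The closed fluid region in space-time, described by the sides of the curve. -/
def lowerRegion (Z Z' : ℝ → ℝ → ℂ) (H : ℝ) : Set (ℝ × ℂ) :=
  {x | 0 ≤ x.1 ∧ -H ≤ x.2.im ∧ x.2 ∉ upperSide (fun s => Z s x.1) (fun s => Z' s x.1) H}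

/-- The function below the curves that the symmetric Cauchy integral of `g` defines, if that
integral is equal to `κ` above the curves; it is given the values `g` on the curves. -/
def innerExtension (Z Z' : ℝ → ℝ → ℂ) (H : ℝ) (g : ℝ → ℝ → ℂ) (κ : ℝ → ℂ) (x : ℝ × ℂ) : ℂ :=
  open Classical in
  if x.2 ∈ range fun s => Z s x.1 then g (foot (fun s => Z s x.1) x.2) x.1
  else κ x.1 - symCauchyDiff (fun s => Z s x.1) (fun s => Z' s x.1) H (fun s => g s x.1) x.2

namespace ArcFamily

variable {Z Z' Zt : ℝ → ℝ → ℂ} {H : ℝ} {g : ℝ → ℝ → ℂ}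

theorem innerExtension_surface (h : ArcFamily Z Z' Zt) (κ : ℝ → ℂ) {t : ℝ} (ht : 0 ≤ t) (s : ℝ) :
    innerExtension Z Z' H g κ (t, Z s t) = g s t := by
  obtain ⟨c, C, hcC⟩ := h.exists_arc ht
  have : foot (fun s => Z s t) (Z s t) = s := hcC.foot_self s
  simp only [innerExtension, this]
  exact if_pos (mem_range_self (f := fun s => Z s t) s)

theorem innerExtension_of_notMem (κ : ℝ → ℂ) {t : ℝ} {p : ℂ} (hp : p ∉ range fun s => Z s t) :
    innerExtension Z Z' H g κ (t, p) = κ t -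
      symCauchyDiff (fun s => Z s t) (fun s => Z' s t) H (fun s => g s t) p := if_neg hp

theorem continuousWithinAt_cauchyDiff_reflect (h : ArcFamily Z Z' Zt) (hg : IsDensity g) {t : ℝ}
    (ht : 0 ≤ t) (hb : ∀ s, -H < (Z s t).im) {p : ℂ} (hp : reflect H p ∉ range fun s => Z s t) :
    ContinuousWithinAt (fun x : ℝ × ℂ => (starRingEnd ℂ) (cauchyDiff (fun s => Z s x.1)
      (fun s => Z' s x.1) (bedPoint H) (fun s => g s x.1) (reflect H x.2))) timeSpace (t, p) := by
  have h1 := h.continuousWithinAt_cauchyDiff hg ht hp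
    (Arc.notMem_of_im_le (p := bedPoint H) hb le_rfl)
  have h2 : ContinuousWithinAt (fun x : ℝ × ℂ => (x.1, reflect H x.2)) timeSpace (t, p) :=
    (continuous_fst.prodMk ((continuous_reflect H).comp continuous_snd)).continuousWithinAt
  have h3 := ContinuousWithinAt.comp (x := (t, p)) (t := timeSpace) h1 h2
    fun x hx => ⟨hx.1, mem_univ _⟩
  exact Complex.continuous_conj.continuousAt.comp_continuousWithinAt h3

theorem continuousWithinAt_symCauchyDiff (h : ArcFamily Z Z' Zt) (hg : IsDensity g) {t : ℝ}
    (ht : 0 ≤ t) (hb : ∀ s, -H < (Z s t).im) {p : ℂ} (hp : p ∉ range fun s => Z s t)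
    (hp' : reflect H p ∉ range fun s => Z s t) :
    ContinuousWithinAt (fun x : ℝ × ℂ => symCauchyDiff (fun s => Z s x.1) (fun s => Z' s x.1) H
      (fun s => g s x.1) x.2) timeSpace (t, p) :=
  (h.continuousWithinAt_cauchyDiff hg ht hp (Arc.notMem_of_im_le (p := bedPoint H) hb le_rfl)).add
    (h.continuousWithinAt_cauchyDiff_reflect hg ht hb hp')

theorem tendsto_prodMk {t : ℝ} (ht : 0 ≤ t) {p : ℂ} {α : Type*} {l : Filter α} {u : α → ℂ}
    (hu : Tendsto u l (𝓝 p)) : Tendsto (fun a => (t, u a)) l (𝓝[timeSpace] (t, p)) :=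
  tendsto_nhdsWithin_iff.2 ⟨tendsto_const_nhds.prodMk_nhds hu,
    Eventually.of_forall fun _ => ⟨ht, mem_univ _⟩⟩

/-- The jump relation: if the symmetric Cauchy integral is constant above the curve, its regular
part on the curve is determined by the density. -/
theorem density_eq (h : ArcFamily Z Z' Zt) (hg : IsDensity g) {t : ℝ} (ht : 0 ≤ t)
    (hb : ∀ s, -H < (Z s t).im) {κ : ℂ}
    (hκ : ∀ p ∈ upperSide (fun s => Z s t) (fun s => Z' s t) H,
      symCauchyDiff (fun s => Z s t) (fun s => Z' s t) H (fun s => g s t) p = κ) (s : ℝ) :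
    g s t = κ - (cauchyReg (fun s => Z s t) (fun s => Z' s t) (bedPoint H) (fun s => g s t) (Z s t) +
      (starRingEnd ℂ) (cauchyDiff (fun s => Z s t) (fun s => Z' s t) (bedPoint H) (fun s => g s t)
        (reflect H (Z s t)))) := by
  obtain ⟨c, C, hcC⟩ := h.exists_arc ht
  obtain ⟨A, hA⟩ := hg.bound (t + 1) (by linarith)
  have ho := Arc.notMem_of_im_le (p := bedPoint H) hb le_rfl
  set u : ℝ → ℂ := fun n => Z s t + n * (Complex.I * Z' s t) with hu
  have hu0 : Tendsto u (𝓝[>] 0) (𝓝 (Z s t)) :=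
    (Arc.tendsto_normal (fun s => Z s t) (fun s => Z' s t) s).mono_left nhdsWithin_le_nhds
  -- approach the curve from above along the normal; there the index is `1`, so the density itself
  -- appears in the limit
  have hu1 := tendsto_prodMk ht hu0
  have r1 := (h.continuousWithinAt_cauchyReg hg ht s ho).tendsto.comp hu1
  have r2 := (h.continuousWithinAt_cauchyDiff_reflect hg ht hb
    (hcC.reflect_mem_lower hb (p := Z s t) (hb s).le).1).tendsto.comp hu1
  have r3 := (tendsto_of_density hg ht (Z s t) (h.tendsto_foot ht s)).comp hu1
  have := tendsto_nhds_unique_of_eventuallyEq ((r1.add r2).add r3)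
      (tendsto_const_nhds (x := κ)) <| by
    filter_upwards [hcC.eventually_tube_upper hb s] with n hn
    have e1 := hκ (u n) hn
    rw [symCauchyDiff, hcC.cauchyDiff_eq_cauchyReg (hg.continuous ht) (hA t ⟨ht, by linarith⟩).1
      hn.1 ho, hn.2] at e1
    simp only [Function.comp_apply]
    rw [← e1]
    ring
  simp only at this
  rw [← this]
  ring

/-- The constant value above the curves depends continuously on time: it is attained at a point that
lies above the curves for a whole time interval. -/
theorem continuousWithinAt_const (h : ArcFamily Z Z' Zt) (hg : IsDensity g)
    (hb : ∀ s t, 0 ≤ t → -H < (Z s t).im) {κ : ℝ → ℂ}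
    (hκ : ∀ t, 0 ≤ t → ∀ p ∈ upperSide (fun s => Z s t) (fun s => Z' s t) H,
      symCauchyDiff (fun s => Z s t) (fun s => Z' s t) H (fun s => g s t) p = κ t) {t : ℝ}
    (ht : 0 ≤ t) : ContinuousWithinAt κ (Ici 0) t := by
  obtain ⟨c, C, hcC⟩ := h.arc (t + 1) (by linarith)
  set p1 : ℂ := ⟨0, C + 1⟩ with hp1
  have hup : ∀ r ∈ Icc 0 (t + 1), p1 ∈ upperSide (fun s => Z s r) (fun s => Z' s r) H := fun r hr =>
    (hcC r hr).mem_upper_of_im_gt (fun s => hb s r hr.1) (by simp [hp1])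
  have htt : t ∈ Icc 0 (t + 1) := ⟨ht, by linarith⟩
  have h1 := h.continuousWithinAt_symCauchyDiff hg ht (fun s => hb s t ht) (hup t htt).1
    ((hcC t htt).reflect_mem_lower (fun s => hb s t ht)
      ((hcC t htt).im_gt_of_mem_upper (fun s => hb s t ht) (hup t htt)).le).1
  have h2 : Tendsto (fun r : ℝ => (r, p1)) (𝓝[Ici 0] t) (𝓝[timeSpace] (t, p1)) := by
    refine tendsto_nhdsWithin_iff.2 ⟨?_, ?_⟩
    · exact ((continuous_id.prodMk continuous_const).tendsto t).mono_left nhdsWithin_le_nhds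
    · filter_upwards [self_mem_nhdsWithin] with r hr using ⟨hr, mem_univ _⟩
  have h3 := h1.tendsto.comp h2
  rw [ContinuousWithinAt, ← hκ t ht p1 (hup t htt)]
  refine h3.congr' ?_
  filter_upwards [h2.eventually (eventually_time p1)] with r hr
  exact hκ r hr.1 p1 (hup r hr)

theorem continuousWithinAt_innerExtension_of_notMem (h : ArcFamily Z Z' Zt) (hg : IsDensity g)
    (hb : ∀ s t, 0 ≤ t → -H < (Z s t).im) {κ : ℝ → ℂ}
    (hκ : ∀ t, 0 ≤ t → ∀ p ∈ upperSide (fun s => Z s t) (fun s => Z' s t) H,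
      symCauchyDiff (fun s => Z s t) (fun s => Z' s t) H (fun s => g s t) p = κ t) {t : ℝ}
    (ht : 0 ≤ t) {p : ℂ} (hp : p ∉ range fun s => Z s t)
    (hp' : reflect H p ∉ range fun s => Z s t) :
    ContinuousWithinAt (innerExtension Z Z' H g κ) timeSpace (t, p) := by
  have hκc : ContinuousWithinAt (fun x : ℝ × ℂ => κ x.1) timeSpace (t, p) :=
    (h.continuousWithinAt_const hg hb hκ ht).comp (t := Ici 0) continuousWithinAt_fst
      fun x hx => hx.1
  have h1 := hκc.sub (h.continuousWithinAt_symCauchyDiff hg ht (fun s => hb s t ht) hp hp')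
  refine h1.congr_of_eventuallyEq ?_ (innerExtension_of_notMem κ hp)
  filter_upwards [h.eventually_notMem ht hp] with x hx
  exact innerExtension_of_notMem (t := x.1) (p := x.2) κ hx

/-- The function below the curves defined by the symmetric Cauchy integral is continuous in space
and time, up to the curves. -/
theorem continuousOn_innerExtension (h : ArcFamily Z Z' Zt) (hg : IsDensity g)
    (hb : ∀ s t, 0 ≤ t → -H < (Z s t).im) {κ : ℝ → ℂ}
    (hκ : ∀ t, 0 ≤ t → ∀ p ∈ upperSide (fun s => Z s t) (fun s => Z' s t) H,
      symCauchyDiff (fun s => Z s t) (fun s => Z' s t) H (fun s => g s t) p = κ t) :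
    ContinuousOn (innerExtension Z Z' H g κ) (lowerRegion Z Z' H) := by
  rintro ⟨t, p⟩ ⟨ht, hp, hpu⟩
  simp only at ht hp hpu
  have hsub : lowerRegion Z Z' H ⊆ timeSpace := fun x hx => ⟨hx.1, mem_univ _⟩
  obtain ⟨c, C, hcC⟩ := h.exists_arc ht
  have hbt : ∀ s, -H < (Z s t).im := fun s => hb s t ht
  have hκc : ContinuousWithinAt (fun x : ℝ × ℂ => κ x.1) timeSpace (t, p) :=
    (h.continuousWithinAt_const hg hb hκ ht).comp (t := Ici 0) continuousWithinAt_fst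
      fun x hx => hx.1
  have hpr : reflect H p ∉ range fun s => Z s t := (hcC.reflect_mem_lower hbt hp).1
  by_cases hps : p ∈ range fun s => Z s t
  · obtain ⟨s, rfl⟩ := hps
    simp only at *
    have ho := Arc.notMem_of_im_le (p := bedPoint H) hbt le_rfl
    -- below the curve the index is `0` and on it the jump relation holds, so one formula with the
    -- regular part covers both
    have key : ∀ x ∈ lowerRegion Z Z' H, innerExtension Z Z' H g κ x = κ x.1 -
        (cauchyReg (fun s => Z s x.1) (fun s => Z' s x.1) (bedPoint H) (fun s => g s x.1) x.2 +
        (starRingEnd ℂ) (cauchyDiff (fun s => Z s x.1) (fun s => Z' s x.1) (bedPoint H)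
          (fun s => g s x.1) (reflect H x.2))) := by
      rintro ⟨r, q⟩ ⟨hr, hq, hqu⟩
      simp only at hr hq hqu ⊢
      obtain ⟨c', C', hcC'⟩ := h.exists_arc hr
      by_cases hqs : q ∈ range fun s => Z s r
      · obtain ⟨s', rfl⟩ := hqs
        simp only
        rw [h.innerExtension_surface κ hr s']
        exact h.density_eq hg hr (fun s => hb s r hr) (hκ r hr) s'
      · obtain ⟨A, hA⟩ := hg.bound (r + 1) (by linarith)
        have hql := (hcC'.mem_or_mem (fun s => hb s r hr) hqs).resolve_left hqu
        rw [innerExtension_of_notMem κ hqs, symCauchyDiff, hcC'.cauchyDiff_eq_cauchyReg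
          (hg.continuous hr) (hA r ⟨hr, by linarith⟩).1 hqs
          (Arc.notMem_of_im_le (p := bedPoint H) (fun s => hb s r hr) le_rfl), hql.2, mul_zero,
          add_zero]
    refine ContinuousWithinAt.congr (f := fun x : ℝ × ℂ => κ x.1 -
        (cauchyReg (fun s => Z s x.1) (fun s => Z' s x.1) (bedPoint H) (fun s => g s x.1) x.2 +
        (starRingEnd ℂ) (cauchyDiff (fun s => Z s x.1) (fun s => Z' s x.1) (bedPoint H)
          (fun s => g s x.1) (reflect H x.2)))) ?_ key (key _ ⟨ht, hp, hpu⟩)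
    exact (hκc.sub ((h.continuousWithinAt_cauchyReg hg ht s ho).add
      (h.continuousWithinAt_cauchyDiff_reflect hg ht hbt hpr))).mono hsub
  · exact (h.continuousWithinAt_innerExtension_of_notMem hg hb hκ ht hps hpr).mono hsub

end ArcFamily

/-! ### Exponential moments and the vanishing of Cauchy integrals -/

/-- The integral of `f` against the exponentials `e ^ (i k (z - ζ))`. -/
def expTransform (ζ f : ℝ → ℂ) (z : ℂ) (k : ℝ) : ℂ :=
  ∫ s, f s * Complex.exp (Complex.I * k * (z - ζ s))

section

variable {ζ f : ℝ → ℂ} {z : ℂ} {δ : ℝ}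

theorem norm_exp_le (hδ : ∀ s, δ ≤ (z - ζ s).im) {k : ℝ} (hk : 0 ≤ k) (s : ℝ) :
    ‖Complex.exp (Complex.I * k * (z - ζ s))‖ ≤ Real.exp (-δ * k) := by
  rw [Complex.norm_exp]
  apply Real.exp_le_exp.2
  have : (Complex.I * k * (z - ζ s)).re = -((z - ζ s).im * k) := by
    simp; ring
  rw [this]
  nlinarith [hδ s]

theorem integrable_prod_exp (hζ : Continuous ζ) (hf : Integrable f) (hδ0 : 0 < δ)
    (hδ : ∀ s, δ ≤ (z - ζ s).im) :
    Integrable (fun x : ℝ × ℝ => f x.1 * Complex.exp (Complex.I * x.2 * (z - ζ x.1)))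
      (volume.prod (volume.restrict (Ioi 0))) := by
  have h1 : Integrable (fun x : ℝ × ℝ => ‖f x.1‖ * Real.exp (-δ * x.2))
      (volume.prod (volume.restrict (Ioi 0))) :=
    hf.norm.mul_prod (exp_neg_integrableOn_Ioi 0 hδ0)
  refine h1.mono' ?_ ?_
  · exact hf.aestronglyMeasurable.comp_fst.mul (by fun_prop)
  · have : ∀ᵐ x : ℝ × ℝ ∂(volume.prod (volume.restrict (Ioi 0))), 0 < x.2 := by
      have h2 : ∀ᵐ k : ℝ ∂(volume.restrict (Ioi 0)), 0 < k := ae_restrict_mem measurableSet_Ioi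
      exact (Measure.quasiMeasurePreserving_snd (μ := (volume : Measure ℝ))
        (ν := volume.restrict (Ioi (0 : ℝ)))).ae h2
    filter_upwards [this] with x hx
    rw [norm_mul]
    exact mul_le_mul_of_nonneg_left (norm_exp_le hδ hx.le x.1) (norm_nonneg _)

/-- The Cauchy integral at a point above the curve as a Laplace transform. -/
theorem integral_div_eq_expTransform (hζ : Continuous ζ) (hf : Integrable f) (hδ0 : 0 < δ)
    (hδ : ∀ s, δ ≤ (z - ζ s).im) :
    ∫ s, f s / (ζ s - z) = Complex.I * ∫ k in Ioi (0 : ℝ), expTransform ζ f z k := by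
  have h1 : ∀ s, f s / (ζ s - z) = Complex.I *
      ∫ k in Ioi (0 : ℝ), f s * Complex.exp (Complex.I * k * (z - ζ s)) := by
    intro s
    have hre : (Complex.I * (z - ζ s)).re < 0 := by
      have : (Complex.I * (z - ζ s)).re = -(z - ζ s).im := by simp
      rw [this]
      linarith [hδ s]
    have h2 := integral_exp_mul_complex_Ioi hre 0
    have hne : z - ζ s ≠ 0 := fun hh => by
      rw [hh] at hre
      simp at hre
    have hne' : ζ s - z ≠ 0 := fun hh => hne (by linear_combination -hh)
    rw [integral_const_mul]
    have h3 : ∀ k : ℝ, Complex.I * k * (z - ζ s) = Complex.I * (z - ζ s) * k := fun k => by ring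
    simp_rw [h3]
    rw [h2]
    simp only [Complex.ofReal_zero, mul_zero, Complex.exp_zero]
    field_simp
    ring
  simp_rw [h1]
  rw [integral_const_mul]
  congr 1
  exact integral_integral_swap (integrable_prod_exp hζ hf hδ0 hδ)

theorem integrableOn_expTransform (hζ : Continuous ζ) (hf : Integrable f) (hδ0 : 0 < δ)
    (hδ : ∀ s, δ ≤ (z - ζ s).im) : IntegrableOn (expTransform ζ f z) (Ioi 0) :=
  (integrable_prod_exp hζ hf hδ0 hδ).integral_prod_right

theorem continuousAt_expTransform (hζ : Continuous ζ) (hf : Integrable f) (hδ0 : 0 < δ)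
    (hδ : ∀ s, δ ≤ (z - ζ s).im) {k : ℝ} (hk : 0 < k) : ContinuousAt (expTransform ζ f z) k := by
  refine continuousAt_of_dominated (bound := fun s => ‖f s‖) ?_ ?_ hf.norm ?_
  · exact Eventually.of_forall fun k => hf.aestronglyMeasurable.mul
      (Continuous.aestronglyMeasurable (by fun_prop))
  · filter_upwards [lt_mem_nhds hk] with r hr
    refine Eventually.of_forall fun s => ?_
    rw [norm_mul]
    refine mul_le_of_le_one_right (norm_nonneg _) ((norm_exp_le hδ hr.le s).trans ?_)
    exact Real.exp_le_one_iff.2 (by nlinarith)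
  · exact Eventually.of_forall fun s => by fun_prop

theorem expTransform_add (x k : ℝ) :
    expTransform ζ f (z + x) k = Complex.exp (Complex.I * k * x) * expTransform ζ f z k := by
  rw [expTransform, expTransform, ← integral_const_mul]
  congr 1
  ext s
  rw [show Complex.I * k * (z + x - ζ s) = Complex.I * k * x + Complex.I * k * (z - ζ s) by ring,
    Complex.exp_add]
  ring

end

/-- A function on the half-line with vanishing Fourier integrals is zero where it is continuous. -/
theorem eq_zero_of_fourier_Ioi {u : ℝ → ℂ} (hu : IntegrableOn u (Ioi 0))
    (h0 : ∀ x : ℝ, ∫ k in Ioi (0 : ℝ), Complex.exp (Complex.I * k * x) * u k = 0) {k : ℝ}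
    (hk : 0 < k) (hc : ContinuousAt u k) : u k = 0 := by
  set v : ℝ → ℂ := (Ioi (0 : ℝ)).indicator u with hv
  have hvi : Integrable v := hu.integrable_indicator measurableSet_Ioi
  have hF : FourierTransform.fourier v = 0 := by
    ext x
    rw [Real.fourier_eq' v x]
    have := h0 (-2 * Real.pi * x)
    rw [← integral_indicator measurableSet_Ioi] at this
    rw [Pi.zero_apply, ← this]
    congr 1
    ext r
    by_cases hr : r ∈ Ioi (0 : ℝ)
    · rw [hv, indicator_of_mem hr, indicator_of_mem hr, smul_eq_mul]
      congr 2
      simp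
      ring
    · rw [hv, indicator_of_notMem hr, indicator_of_notMem hr, smul_zero]
  have hev : v =ᶠ[𝓝 k] u := by
    filter_upwards [lt_mem_nhds hk] with r hr
    exact indicator_of_mem (mem_Ioi.2 hr) u
  have := hvi.fourierInv_fourier_eq (by rw [hF]; exact integrable_zero _ _ _)
    (hc.congr hev.symm)
  rw [hF, hev.eq_of_nhds] at this
  rw [← this]
  simp [Real.fourierInv_eq]

namespace Arc

variable {c C H : ℝ} {γ γ' : ℝ → ℂ}

/-- Far above the curve, both halves of the symmetric Cauchy integral are Laplace transforms. -/
theorem symCauchy_eq_expTransform (h : Arc c C γ γ') (hH : 0 ≤ H) {f : ℝ → ℂ}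
    (hf : Integrable f) {z : ℂ} (hz : C < z.im) :
    symCauchy γ H f z = (2 * Real.pi : ℂ)⁻¹ * ∫ k in Ioi (0 : ℝ), (expTransform γ f z k -
      expTransform (fun s => reflect H (γ s)) (fun s => (starRingEnd ℂ) (f s)) z k) := by
  have hδ0 : 0 < z.im - C := by linarith
  have hδ1 : ∀ s, z.im - C ≤ (z - γ s).im := fun s => by
    have := (abs_le.1 (h.im_le s)).2
    simp only [Complex.sub_im]; linarith
  have hδ2 : ∀ s, z.im - C ≤ (z - reflect H (γ s)).im := fun s => by
    have := (abs_le.1 (h.im_le s)).1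
    simp only [Complex.sub_im, reflect]; linarith
  have hc2 : Continuous fun s => reflect H (γ s) := (continuous_reflect H).comp h.continuous
  have hf2 : Integrable fun s => (starRingEnd ℂ) (f s) :=
    Complex.conjCLE.toContinuousLinearMap.integrable_comp hf
  rw [integral_sub (integrableOn_expTransform h.continuous hf hδ0 hδ1)
    (integrableOn_expTransform hc2 hf2 hδ0 hδ2)]
  have e1 := integral_div_eq_expTransform h.continuous hf hδ0 hδ1
  have e2 := integral_div_eq_expTransform hc2 hf2 hδ0 hδ2
  have e3 : (starRingEnd ℂ) (∫ s, f s / (γ s - reflect H z)) =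
      ∫ s, (starRingEnd ℂ) (f s) / (reflect H (γ s) - z) := by
    rw [← integral_conj]
    congr 1
    ext s
    rw [map_div₀, map_sub, conj_reflect, reflect_eq]
    congr 1
    ring
  rw [symCauchy, cauchy, cauchy, map_mul, e3, e1, e2]
  have hπ : (Real.pi : ℂ) ≠ 0 := by exact_mod_cast Real.pi_ne_zero
  simp only [map_inv₀, map_mul, Complex.conj_ofReal, Complex.conj_I, map_ofNat]
  field_simp
  ring

/-- The symmetric Cauchy integral vanishes far above the curve if and only if the exponential
moments of the curve and of its mirror image agree. -/
theorem symCauchy_eq_zero_iff (h : Arc c C γ γ') (hH : 0 ≤ H) {f : ℝ → ℂ} (hf : Integrable f) :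
    (∀ z : ℂ, C < z.im → symCauchy γ H f z = 0) ↔
      ∀ k : ℝ, 0 < k → ∀ z : ℂ, C < z.im → expTransform γ f z k =
        expTransform (fun s => reflect H (γ s)) (fun s => (starRingEnd ℂ) (f s)) z k := by
  constructor
  · intro h0 k hk z hz
    have hδ0 : 0 < z.im - C := by linarith
    have hδ1 : ∀ s, z.im - C ≤ (z - γ s).im := fun s => by
      have := (abs_le.1 (h.im_le s)).2
      simp only [Complex.sub_im]; linarith
    have hδ2 : ∀ s, z.im - C ≤ (z - reflect H (γ s)).im := fun s => by
      have := (abs_le.1 (h.im_le s)).1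
      simp only [Complex.sub_im, reflect]; linarith
    have hc2 : Continuous fun s => reflect H (γ s) := (continuous_reflect H).comp h.continuous
    have hf2 : Integrable fun s => (starRingEnd ℂ) (f s) :=
      Complex.conjCLE.toContinuousLinearMap.integrable_comp hf
    refine sub_eq_zero.1 (eq_zero_of_fourier_Ioi (u := fun k => expTransform γ f z k -
      expTransform (fun s => reflect H (γ s)) (fun s => (starRingEnd ℂ) (f s)) z k)
      ((integrableOn_expTransform h.continuous hf hδ0 hδ1).sub
        (integrableOn_expTransform hc2 hf2 hδ0 hδ2)) (fun x => ?_) hk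
      ((continuousAt_expTransform h.continuous hf hδ0 hδ1 hk).sub
        (continuousAt_expTransform hc2 hf2 hδ0 hδ2 hk)))
    -- translating `z` by real `x` turns the Laplace integral into the Fourier integral at `x`
    have h1 := h.symCauchy_eq_expTransform hH hf (z := z + x) (by simpa using hz)
    rw [h0 (z + x) (by simpa using hz)] at h1
    have hπ : (2 * Real.pi : ℂ)⁻¹ ≠ 0 := by
      simp [Real.pi_ne_zero]
    have h2 := (mul_eq_zero.1 h1.symm).resolve_left hπ
    simp_rw [expTransform_add, ← mul_sub] at h2
    exact h2
  · intro h0 z hz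
    rw [h.symCauchy_eq_expTransform hH hf hz, setIntegral_congr_fun measurableSet_Ioi
      (g := fun _ => 0) fun k hk => sub_eq_zero.2 (h0 k hk z hz)]
    simp

/-- By the identity theorem, it suffices that the symmetric Cauchy integral vanishes far above the
curve. -/
theorem symCauchy_eq_zero_of_upper (h : Arc c C γ γ') (hb : ∀ s, -H < (γ s).im) {f : ℝ → ℂ}
    (hfc : Continuous f) {G : ℝ} (hG : ∀ s, ‖f s‖ ≤ G) (hf : Integrable f)
    (h0 : ∀ z : ℂ, C < z.im → symCauchy γ H f z = 0) {p : ℂ} (hp : p ∈ upperSide γ γ' H) :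
    symCauchy γ H f p = 0 := by
  have hd : DifferentiableOn ℂ (symCauchy γ H f) (upperSide γ γ' H) := fun q hq =>
    (h.differentiableAt_symCauchy hb hfc hG hf hq.1
      (h.reflect_mem_lower hb (h.im_gt_of_mem_upper hb hq).le).1).differentiableWithinAt
  have hm : (⟨0, C + 1⟩ : ℂ) ∈ upperSide γ γ' H := h.mem_upper_of_im_gt hb (by simp)
  have hev : symCauchy γ H f =ᶠ[𝓝 (⟨0, C + 1⟩ : ℂ)] 0 := by
    have : {z : ℂ | C < z.im} ∈ 𝓝 (⟨0, C + 1⟩ : ℂ) :=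
      (isOpen_lt continuous_const Complex.continuous_im).mem_nhds (by simp)
    filter_upwards [this] with z hz using h0 z hz
  exact (hd.analyticOnNhd (h.isOpen_upper hb)).eqOn_zero_of_preconnected_of_eventuallyEq_zero
    (h.isPreconnected_upper hb) hm hev hp

end Arc

/-! ### Behaviour at infinity and Liouville in the half plane -/

/-- The majorant of the regular part of a Cauchy integral near infinity tends to zero with the
oscillation of the density. -/
theorem tendsto_oscillation {g : ℝ → ℂ} (hg : Continuous g) {a b : ℝ} (ha : 0 ≤ a) (hb : 0 ≤ b)
    (h0 : Tendsto g (cocompact ℝ) (𝓝 0)) :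
    Tendsto (fun r : ℝ => ∫ u : ℝ, min (a * (1 + |u|)⁻¹) (‖g (u + r) - g r‖ * (b * |u|⁻¹)) *
      (1 + |u|)⁻¹) (comap abs atTop) (𝓝 0) := by
  have hl : comap (abs : ℝ → ℝ) atTop = cocompact ℝ := by
    rw [← Metric.cobounded_eq_cocompact, ← comap_norm_atTop]; rfl
  rw [show (0 : ℝ) = ∫ u : ℝ, (0 : ℝ) by simp]
  refine tendsto_integral_filter_of_dominated_convergence
    (fun u => a * ((1 + |u|) ^ 2)⁻¹) ?_ ?_ (integrable_one_add_abs_sq.const_mul a) ?_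
  · refine Eventually.of_forall fun r => ?_
    apply Measurable.aestronglyMeasurable
    have : Continuous fun u => g (u + r) := by fun_prop
    have h2 := this.measurable
    fun_prop
  · refine Eventually.of_forall fun r => Eventually.of_forall fun u => ?_
    rw [Real.norm_of_nonneg (by positivity)]
    exact (mul_le_mul_of_nonneg_right (min_le_left _ _) (by positivity)).trans_eq
      (by rw [sq, mul_inv, mul_assoc])
  · refine Eventually.of_forall fun u => ?_
    rw [hl]
    have h1 : Tendsto (fun r : ℝ => g (u + r)) (cocompact ℝ) (𝓝 0) :=
      h0.comp (Homeomorph.addLeft u).isClosedEmbedding.tendsto_cocompact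
    have h2 := (((h1.sub h0).norm.mul_const (b * |u|⁻¹)).mul_const (1 + |u|)⁻¹)
    rw [sub_zero, norm_zero, zero_mul, zero_mul] at h2
    refine squeeze_zero (fun r => by positivity) (fun r => ?_) h2
    gcongr
    exact min_le_right _ _

namespace Arc

variable {c C H : ℝ} {γ γ' : ℝ → ℂ}

/-- Cauchy integrals of integrable densities vanish at infinity away from the curve. -/
theorem exists_norm_cauchy_le_of_far (h : Arc c C γ γ') {f : ℝ → ℂ} (hf : Integrable f) {ε : ℝ}
    (hε : 0 < ε) :
    ∃ R, ∀ p, (∀ s, 1 ≤ ‖γ s - p‖) → R ≤ ‖p‖ → ‖cauchy γ f p‖ ≤ ε := by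
  have key : Tendsto (cauchy γ f) (comap norm atTop ⊓ 𝓟 {p | ∀ s, 1 ≤ ‖γ s - p‖}) (𝓝 0) := by
    rw [show (0 : ℂ) = (2 * Real.pi * Complex.I)⁻¹ * ∫ s : ℝ, (0 : ℂ) by simp]
    refine Tendsto.const_mul _ ?_
    refine tendsto_integral_filter_of_dominated_convergence (fun s => ‖f s‖) ?_ ?_ hf.norm ?_
    · refine Eventually.of_forall fun p => ?_
      exact (hf.aestronglyMeasurable.aemeasurable.div
        (h.continuous.sub continuous_const).measurable.aemeasurable).aestronglyMeasurable
    · filter_upwards [mem_inf_of_right (mem_principal_self _)] with p hp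
      refine Eventually.of_forall fun s => ?_
      rw [norm_div]
      exact div_le_self (norm_nonneg _) (hp s)
    · refine Eventually.of_forall fun s => ?_
      refine Tendsto.mono_left ?_ inf_le_left
      have h1 : Tendsto (fun p : ℂ => ‖γ s - p‖) (comap norm atTop) atTop := by
        refine tendsto_atTop_mono (f := fun p : ℂ => ‖p‖ - ‖γ s‖) (fun p => ?_)
          (tendsto_atTop_add_const_right _ _ tendsto_comap)
        rw [norm_sub_rev]
        exact norm_sub_norm_le _ _
      have h2 := (tendsto_inv_atTop_zero.comp h1).const_mul ‖f s‖
      rw [mul_zero] at h2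
      refine squeeze_zero_norm (fun p => ?_) h2
      rw [norm_div, div_eq_mul_inv]
      rfl
  have := key.norm.eventually (ge_mem_nhds (by simpa using hε : ‖(0 : ℂ)‖ < ε))
  rw [eventually_inf_principal, eventually_comap] at this
  obtain ⟨R, hR⟩ := this.exists_forall_of_atTop
  exact ⟨R, fun p hp hpR => hR _ hpR p rfl hp⟩

/-- For points on the same side of the curve the index drops out, so that their Cauchy integrals
differ by a regular part. -/
theorem cauchy_eq_add (h : Arc c C γ γ') {f : ℝ → ℂ} (hfc : Continuous f) {G : ℝ}
    (hG : ∀ s, ‖f s * (γ' s)⁻¹‖ ≤ G) (hf : Integrable f) {p q : ℂ}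
    (hpq : JoinedIn (range γ)ᶜ q p) :
    cauchy γ f p = cauchyReg γ γ' q (fun s => f s * (γ' s)⁻¹) p + cauchy γ f q := by
  have hgc : Continuous fun s => f s * (γ' s)⁻¹ :=
    hfc.mul (h.continuous_deriv.inv₀ h.deriv_ne_zero)
  have h1 := h.cauchyDiff_eq_cauchyReg hgc hG hpq.target_mem hpq.source_mem
  rw [← h.index_eq_of_joinedIn hpq.source_mem hpq, index_self, mul_zero, add_zero,
    h.cauchyDiff_div hf hpq.target_mem hpq.source_mem] at h1
  rw [← h1]; ring

/-- Comparison of the Cauchy integral at two points on the same side of the curve, one of which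
has distance at least one from the curve. -/
theorem norm_cauchyReg_le (h : Arc c C γ γ') {g : ℝ → ℂ} (hg : Continuous g) {A : ℝ}
    (hA : ∀ s, ‖g s‖ ≤ A) (hL : ∀ s r, ‖g s - g r‖ ≤ A * |s - r|) {p q : ℂ} {D : ℝ}
    (hD : ‖p - q‖ ≤ D) (hp : p ∉ range γ) (hq : ∀ s, 1 ≤ ‖γ s - q‖) :
    ‖cauchyReg γ γ' q g p‖ ≤ ‖(2 * Real.pi * Complex.I : ℂ)⁻¹‖ * (C * D * (1 + 2 / c * (1 + D)) *
      ∫ u : ℝ, min (6 * A / c * (1 + |u|)⁻¹)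
        (‖g (u + foot γ p) - g (foot γ p)‖ * (2 / c * |u|⁻¹)) * (1 + |u|)⁻¹) := by
  have hc := h.c_pos
  have hC := h.C_pos
  have hA0 : 0 ≤ A := (norm_nonneg _).trans (hA 0)
  have hD0 : 0 ≤ D := (norm_nonneg _).trans hD
  set r := foot γ p with hr
  set K := 1 + 2 / c * (1 + D) with hK
  set ρ : ℝ → ℝ := fun u => min (6 * A / c * (1 + |u|)⁻¹) (‖g (u + r) - g r‖ * (2 / c * |u|⁻¹)) *
    (1 + |u|)⁻¹ with hρ
  have hρi : Integrable ρ := by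
    refine (integrable_one_add_abs_sq.const_mul (6 * A / c)).mono' ?_ ?_
    · apply Measurable.aestronglyMeasurable
      have : Continuous fun u => g (u + r) := by fun_prop
      have h2 := this.measurable
      fun_prop
    · refine Eventually.of_forall fun u => ?_
      rw [Real.norm_of_nonneg (by positivity)]
      exact (mul_le_mul_of_nonneg_right (min_le_left _ _) (by positivity)).trans_eq
        (by rw [sq, mul_inv, mul_assoc])
  rw [cauchyReg, norm_mul]
  refine mul_le_mul_of_nonneg_left ?_ (norm_nonneg _)
  rw [← integral_sub_right_eq_self ρ r, ← integral_const_mul]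
  refine norm_integral_le_of_norm_le ((hρi.comp_sub_right r).const_mul _)
    (Eventually.of_forall fun s => ?_)
  have hsp : γ s - p ≠ 0 := sub_ne_zero.2 fun hh => hp ⟨s, hh⟩
  have hsq : γ s - q ≠ 0 := norm_pos_iff.1 (by linarith [hq s])
  rw [kernel_eq hsp hsq, norm_mul, norm_mul, norm_mul, norm_mul]
  have h1 : ‖g s - g r‖ * ‖(γ s - p)⁻¹‖ ≤ min (6 * A / c * (1 + |s - r|)⁻¹)
      (‖g (s - r + r) - g r‖ * (2 / c * |s - r|⁻¹)) := by
    refine le_min (h.norm_regular_mul_inv_le hA hL p s) ?_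
    rw [sub_add_cancel]
    rcases eq_or_ne s r with rfl | hne
    · simp
    refine mul_le_mul_of_nonneg_left ?_ (norm_nonneg _)
    have hu : 0 < |s - r| := abs_pos.2 (sub_ne_zero.2 hne)
    have := h.foot_lower p s
    rw [norm_inv, show 2 / c * |s - r|⁻¹ = (c / 2 * |s - r|)⁻¹ by field_simp]
    exact inv_anti₀ (by positivity) this
  have h2 : ‖(γ s - q)⁻¹‖ ≤ K * (1 + |s - r|)⁻¹ := by
    have e1 := h.foot_lower p s
    have e2 : ‖γ s - p‖ ≤ ‖γ s - q‖ + D := by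
      have := norm_sub_le (γ s - q) (p - q)
      rw [sub_sub_sub_cancel_right] at this
      linarith
    have e3 := hq s
    rw [norm_inv, ← div_eq_mul_inv, inv_eq_one_div, div_le_div_iff₀ (by linarith) (by positivity)]
    have e4 : |s - r| ≤ 2 / c * (‖γ s - q‖ + D) := by
      rw [div_mul_eq_mul_div, le_div_iff₀ hc]
      linarith
    have e5 : 2 / c * (‖γ s - q‖ + D) ≤ 2 / c * ((1 + D) * ‖γ s - q‖) := by
      gcongr
      nlinarith
    rw [hK]
    linarith
  calc ‖g s - g r‖ * (‖γ' s‖ * (‖p - q‖ * (‖(γ s - p)⁻¹‖ * ‖(γ s - q)⁻¹‖)))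
      = ‖γ' s‖ * ‖p - q‖ * ((‖g s - g r‖ * ‖(γ s - p)⁻¹‖) * ‖(γ s - q)⁻¹‖) := by ring
    _ ≤ C * D * (min (6 * A / c * (1 + |s - r|)⁻¹)
      (‖g (s - r + r) - g r‖ * (2 / c * |s - r|⁻¹)) * (K * (1 + |s - r|)⁻¹)) := by
        have h3 := h.upper s
        gcongr
    _ = _ := by simp only [hρ]; ring

/-- The Cauchy integral vanishes at infinity, uniformly up to the curve. -/
theorem exists_norm_cauchy_le (h : Arc c C γ γ') {f : ℝ → ℂ} (hfc : Continuous f) {A : ℝ}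
    (hA : ∀ s, ‖f s * (γ' s)⁻¹‖ ≤ A)
    (hL : ∀ s r, ‖f s * (γ' s)⁻¹ - f r * (γ' r)⁻¹‖ ≤ A * |s - r|) (hf : Integrable f)
    (h0 : Tendsto (fun s => f s * (γ' s)⁻¹) (cocompact ℝ) (𝓝 0)) {ε : ℝ} (hε : 0 < ε) :
    ∃ R, ∀ p ∉ range γ, R ≤ ‖p‖ → ‖cauchy γ f p‖ ≤ ε := by
  have hc := h.c_pos
  have hC := h.C_pos
  have hA0 : 0 ≤ A := (norm_nonneg _).trans (hA 0)
  have hgc : Continuous fun s => f s * (γ' s)⁻¹ :=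
    hfc.mul (h.continuous_deriv.inv₀ h.deriv_ne_zero)
  obtain ⟨R1, hR1⟩ := h.exists_norm_cauchy_le_of_far hf (half_pos hε)
  set D := 2 * (C + 1) with hD
  have ht := ((tendsto_oscillation hgc (a := 6 * A / c) (b := 2 / c) (by positivity)
    (by positivity) h0).const_mul (C * D * (1 + 2 / c * (1 + D)))).const_mul
      ‖(2 * Real.pi * Complex.I : ℂ)⁻¹‖
  rw [mul_zero, mul_zero] at ht
  have ht' := ht.eventually (ge_mem_nhds (half_pos hε))
  rw [eventually_comap] at ht'
  obtain ⟨R2, hR2⟩ := ht'.exists_forall_of_atTop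
  refine ⟨max (R1 + D) (2 * C + 1 + ‖γ 0‖ + C * |R2|), fun p hp hpR => ?_⟩
  have far : ∀ q : ℂ, C + 1 ≤ |q.im| → ∀ s, 1 ≤ ‖γ s - q‖ := by
    intro q hq s
    have h1 := Complex.abs_im_le_norm (γ s - q)
    rw [Complex.sub_im] at h1
    have h2 := abs_sub_abs_le_abs_sub q.im (γ s).im
    rw [abs_sub_comm] at h2
    linarith [h.im_le s]
  by_cases hpi : C + 1 ≤ |p.im|
  · refine (hR1 p (far p hpi) ?_).trans (half_le_self hε.le)
    have := (le_max_left _ _).trans hpR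
    linarith
  push Not at hpi
  have hb : ∀ s, -(C + 1) < (γ s).im := fun s => by linarith [(abs_le.1 (h.im_le s)).1]
  -- compare with the point `q` above or below `p`, off the strip that contains the curve and on the
  -- same side of the curve
  obtain ⟨q, hqre, hqi, hqp⟩ : ∃ q : ℂ, q.re = p.re ∧ |q.im| = C + 1 ∧
      JoinedIn (range γ)ᶜ q p := by
    rcases h.mem_or_mem hb hp with hp' | hp'
    · exact ⟨⟨p.re, C + 1⟩, rfl, abs_of_pos (by linarith),
        h.joinedIn_upper hb (h.mem_upper_of_im_gt hb (by simp)) hp'⟩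
    · exact ⟨⟨p.re, -(C + 1)⟩, rfl, by rw [abs_neg]; exact abs_of_pos (by linarith),
        h.joinedIn_lower hb (h.mem_lower_of_im_le hb (by simp)) hp'⟩
  have hpq : ‖p - q‖ ≤ D := by
    refine (Complex.norm_le_abs_re_add_abs_im _).trans ?_
    rw [Complex.sub_re, Complex.sub_im, hqre, sub_self, abs_zero, zero_add]
    refine (abs_sub _ _).trans ?_
    rw [hqi, hD]; linarith
  have hq1 : ‖cauchy γ f q‖ ≤ ε / 2 := by
    apply hR1 q (far q hqi.ge)
    have h1 := (le_max_left _ _).trans hpR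
    have h2 := norm_sub_norm_le p q
    linarith
  -- a point of the strip far from the origin has a foot point with a large parameter
  have hfoot : R2 ≤ |foot γ p| := by
    obtain ⟨s, hs⟩ : ∃ s, (γ s).re = p.re :=
      (Complex.continuous_re.comp h.continuous).surjective h.re_top h.re_bot p.re
    have h1 : ‖γ s - p‖ ≤ 2 * C + 1 := by
      refine (Complex.norm_le_abs_re_add_abs_im _).trans ?_
      rw [Complex.sub_re, Complex.sub_im, hs, sub_self, abs_zero, zero_add]
      refine (abs_sub _ _).trans ?_
      linarith [h.im_le s]
    have h2 := (h.foot_le p s).trans h1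
    have h3 := h.lipschitz (foot γ p) 0
    rw [sub_zero] at h3
    have h4 := (le_max_right _ _).trans hpR
    have h5 : ‖p‖ ≤ ‖γ (foot γ p) - p‖ + ‖γ (foot γ p) - γ 0‖ + ‖γ 0‖ := by
      have e : p = -(γ (foot γ p) - p) + (γ (foot γ p) - γ 0) + γ 0 := by ring
      conv_lhs => rw [e]
      refine (norm_add₃_le).trans ?_
      rw [norm_neg]
    have h6 : C * |R2| ≤ C * |foot γ p| := by linarith
    exact (le_abs_self _).trans (le_of_mul_le_mul_left h6 hC)
  rw [h.cauchy_eq_add hfc hA hf hqp]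
  have h7 := (h.norm_cauchyReg_le hgc hA hL hpq hp (far q hqi.ge)).trans (hR2 _ hfoot _ rfl)
  refine (norm_add_le _ _).trans ?_
  linarith

theorem exists_norm_symCauchy_le (h : Arc c C γ γ') (hb : ∀ s, -H < (γ s).im) {f : ℝ → ℂ}
    (hfc : Continuous f) {A : ℝ}
    (hA : ∀ s, ‖f s * (γ' s)⁻¹‖ ≤ A)
    (hL : ∀ s r, ‖f s * (γ' s)⁻¹ - f r * (γ' r)⁻¹‖ ≤ A * |s - r|) (hf : Integrable f)
    (h0 : Tendsto (fun s => f s * (γ' s)⁻¹) (cocompact ℝ) (𝓝 0)) {ε : ℝ} (hε : 0 < ε) :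
    ∃ R, ∀ p ∉ range γ, -H ≤ p.im → R ≤ ‖p‖ → ‖symCauchy γ H f p‖ ≤ ε := by
  obtain ⟨R, hR⟩ := h.exists_norm_cauchy_le hfc hA hL hf h0 (half_pos hε)
  refine ⟨R + 2 * |H|, fun p hp hpH hpR => ?_⟩
  have h1 := hR p hp (by linarith [abs_nonneg H])
  have h2 := hR (reflect H p) (h.reflect_mem_lower hb hpH).1 (by
    have e : ‖p‖ ≤ ‖reflect H p‖ + ‖(2 * H * Complex.I : ℂ)‖ := by
      rw [← RCLike.norm_conj p, show (starRingEnd ℂ) p = reflect H p + 2 * H * Complex.I by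
        rw [reflect_eq]; ring]
      exact norm_add_le _ _
    have e2 : ‖(2 * H * Complex.I : ℂ)‖ = 2 * |H| := by simp
    linarith)
  refine (norm_add_le _ _).trans ?_
  rw [RCLike.norm_conj]
  linarith

end Arc

/-- A bounded holomorphic function on a half plane that is real on the boundary and vanishes at
infinity is zero. -/
theorem eq_zero_of_halfPlane {M : ℂ → ℂ} {H : ℝ}
    (hc : ContinuousOn M {p | -H ≤ p.im}) (hd : DifferentiableOn ℂ M {p | -H < p.im})
    (hr : ∀ p : ℂ, p.im = -H → (M p).im = 0)
    (h0 : ∀ ε > 0, ∃ R, ∀ p : ℂ, -H ≤ p.im → R ≤ ‖p‖ → ‖M p‖ ≤ ε) {p : ℂ} (hp : -H ≤ p.im) :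
    M p = 0 := by
  have hopen : IsOpen {p : ℂ | -H < p.im} := isOpen_lt continuous_const Complex.continuous_im
  -- the maximum principle for `exp (∓ i M)` bounds the imaginary part of `M` from both sides
  have him : ∀ σ : ℝ, |σ| = 1 → ∀ p : ℂ, -H ≤ p.im → σ * (M p).im ≤ 0 := by
    intro σ hσ p hp
    refine le_of_forall_pos_le_add fun ε hε => ?_
    rw [zero_add]
    obtain ⟨R, hR⟩ := h0 ε hε
    set R' := max R (‖p‖ + 1) with hR'
    set U : Set ℂ := {p | -H < p.im} ∩ Metric.ball 0 R' with hU
    have hUo : IsOpen U := hopen.inter Metric.isOpen_ball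
    have hcl : ∀ q ∈ closure U, -H ≤ q.im ∧ ‖q‖ ≤ R' := by
      intro q hq
      have hcl : IsClosed {q : ℂ | -H ≤ q.im ∧ ‖q‖ ≤ R'} :=
        (isClosed_le continuous_const Complex.continuous_im).inter
          (isClosed_le continuous_norm continuous_const)
      refine closure_minimal ?_ hcl hq
      rintro z ⟨hz1, hz2⟩
      exact ⟨le_of_lt hz1, (mem_ball_zero_iff.1 hz2).le⟩
    have hE : DiffContOnCl ℂ (fun q => Complex.exp (-(σ * Complex.I * M q))) U := by
      refine ⟨?_, ?_⟩
      · exact (((hd.mono inter_subset_left).const_mul _).neg).cexp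
      · exact ((continuousOn_const.mul (hc.mono fun q hq => (hcl q hq).1)).neg).cexp
    have hn : ∀ q, ‖Complex.exp (-(σ * Complex.I * M q))‖ = Real.exp (σ * (M q).im) := fun q => by
      rw [Complex.norm_exp]; simp
    have hfr : ∀ q ∈ frontier U, ‖Complex.exp (-(σ * Complex.I * M q))‖ ≤ Real.exp ε := by
      intro q hq
      rw [hn]
      apply Real.exp_le_exp.2
      rw [hUo.frontier_eq] at hq
      obtain ⟨hq1, hq2⟩ := hq
      obtain ⟨h1, h2⟩ := hcl q hq1
      rcases h1.eq_or_lt with h1 | h1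
      · rw [hr q h1.symm, mul_zero]; exact hε.le
      · have h3 : R' ≤ ‖q‖ := by
          by_contra hh
          exact hq2 ⟨h1, mem_ball_zero_iff.2 (not_le.1 hh)⟩
        have h4 := hR q h1.le ((le_max_left _ _).trans h3)
        refine (le_abs_self _).trans ?_
        rw [abs_mul, hσ, one_mul]
        exact (Complex.abs_im_le_norm _).trans h4
    have hpU : p ∈ closure U := by
      refine mem_closure_of_tendsto (f := fun u : ℝ => p + u * Complex.I) (b := 𝓝[>] 0) ?_ ?_
      · have : Continuous fun u : ℝ => p + u * Complex.I := by fun_prop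
        simpa using (this.tendsto 0).mono_left nhdsWithin_le_nhds
      · filter_upwards [Ioo_mem_nhdsGT (zero_lt_one' ℝ)] with u hu
        refine ⟨?_, mem_ball_zero_iff.2 ?_⟩
        · simp only [mem_ofPred_eq, Complex.add_im, Complex.mul_im, Complex.ofReal_re,
            Complex.ofReal_im, Complex.I_im, Complex.I_re]
          linarith [hu.1]
        · refine (norm_add_le _ _).trans_lt ?_
          rw [norm_mul, Complex.norm_I, mul_one, Complex.norm_real, Real.norm_of_nonneg hu.1.le]
          have := le_max_right R (‖p‖ + 1)
          linarith [hu.2]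
    have := Complex.norm_le_of_forall_mem_frontier_norm_le
      (Metric.isBounded_ball.subset inter_subset_right) hE hfr hpU
    rw [hn] at this
    exact Real.exp_le_exp.1 this
  have him0 : ∀ p : ℂ, -H ≤ p.im → (M p).im = 0 := fun p hp => by
    have h1 := him 1 (by simp) p hp
    have h2 := him (-1) (by simp) p hp
    linarith
  have hpre : IsPreconnected {p : ℂ | -H < p.im} :=
    (convex_halfSpace_im_gt _).isPreconnected
  -- a real-valued holomorphic function is not an open map, hence constant
  have hconst : ∃ w, ∀ z ∈ {p : ℂ | -H < p.im}, M z = w := by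
    rcases (hd.analyticOnNhd hopen).is_constant_or_isOpen hpre with h1 | h1
    · exact h1
    exfalso
    have h2 := h1 _ Subset.rfl hopen
    set z0 : ℂ := ⟨0, -H + 1⟩
    have hz0 : z0 ∈ {p : ℂ | -H < p.im} := by
      show -H < -H + 1
      linarith
    have h3 := h2.mem_nhds (mem_image_of_mem M hz0)
    have h4 : Tendsto (fun u : ℝ => M z0 + u * Complex.I) (𝓝[>] 0) (𝓝 (M z0)) := by
      have : Continuous fun u : ℝ => M z0 + u * Complex.I := by fun_prop
      simpa using (this.tendsto 0).mono_left nhdsWithin_le_nhds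
    obtain ⟨u, ⟨q, hq, hqu⟩, hu⟩ := ((h4.eventually h3).and self_mem_nhdsWithin).exists
    have h5 := him0 q (le_of_lt hq)
    rw [hqu] at h5
    simp [him0 z0 (le_of_lt hz0)] at h5
    exact (mem_Ioi.1 hu).ne' h5
  obtain ⟨w, hw⟩ := hconst
  have hw0 : w = 0 := by
    refine norm_le_zero_iff.1 (le_of_forall_pos_le_add fun ε hε => ?_)
    rw [zero_add]
    obtain ⟨R, hR⟩ := h0 ε hε
    have hz : -H < (⟨0, |R| + |H| + 1⟩ : ℂ).im := by
      show -H < |R| + |H| + 1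
      linarith [abs_nonneg R, neg_abs_le H]
    rw [← hw _ hz]
    refine hR _ hz.le ?_
    refine le_trans ?_ (Complex.abs_im_le_norm _)
    refine le_trans ?_ (le_abs_self _)
    show R ≤ |R| + |H| + 1
    linarith [le_abs_self R, abs_nonneg H]
  have heq : EqOn M 0 {p : ℂ | -H < p.im} := fun z hz => (hw z hz).trans hw0
  exact heq.of_subset_closure hc continuousOn_const (fun z hz => le_of_lt (mem_ofPred_eq ▸ hz))
    (fun z hz => by rw [Complex.closure_setOfPred_lt_im]; exact hz) hp

/-! ### Differentiable functions on the surface -/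

/-- Surface functions are defined on `ℝ × [0, ∞)`. -/
abbrev paramSpace : Set (ℝ × ℝ) := univ ×ˢ Ici 0

/-- Once continuously differentiable on `ℝ × [0, ∞)`. -/
def IsC1 (F : ℝ → ℝ → ℝ) : Prop := ContDiffOn ℝ 1 (fun p : ℝ × ℝ => F p.1 p.2) paramSpace

theorem uniqueDiffOn_paramSpace : UniqueDiffOn ℝ paramSpace :=
  uniqueDiffOn_univ.prod (uniqueDiffOn_Ici 0)

namespace IsC1

variable {F K : ℝ → ℝ → ℝ} {s t : ℝ}

theorem hasFDerivWithinAt (hF : IsC1 F) (ht : 0 ≤ t) :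
    HasFDerivWithinAt (fun p : ℝ × ℝ => F p.1 p.2)
      (fderivWithin ℝ (fun p : ℝ × ℝ => F p.1 p.2) paramSpace (s, t)) paramSpace (s, t) :=
  (hF.differentiableOn one_ne_zero (s, t) ⟨mem_univ _, ht⟩).hasFDerivWithinAt

theorem hasDerivAt' (hF : IsC1 F) (ht : 0 ≤ t) : HasDerivAt (fun r => F r t)
    (fderivWithin ℝ (fun p : ℝ × ℝ => F p.1 p.2) paramSpace (s, t) (1, 0)) s := by
  have h1 : HasDerivWithinAt (fun r : ℝ => (r, t)) (1, 0) univ s :=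
    ((hasDerivAt_id s).prodMk (hasDerivAt_const s t)).hasDerivWithinAt
  have h2 := (hF.hasFDerivWithinAt (s := s) ht).comp_hasDerivWithinAt s h1
    fun r _ => (⟨mem_univ _, ht⟩ : (r, t) ∈ paramSpace)
  exact hasDerivWithinAt_univ.1 h2

theorem hasDerivWithinAt' (hF : IsC1 F) (ht : 0 ≤ t) : HasDerivWithinAt (fun r => F s r)
    (fderivWithin ℝ (fun p : ℝ × ℝ => F p.1 p.2) paramSpace (s, t) (0, 1)) (Ici 0) t := by
  have h1 : HasDerivWithinAt (fun r : ℝ => (s, r)) (0, 1) (Ici 0) t :=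
    ((hasDerivAt_const t s).prodMk (hasDerivAt_id t)).hasDerivWithinAt
  exact (hF.hasFDerivWithinAt ht).comp_hasDerivWithinAt t h1 fun r hr => ⟨mem_univ _, hr⟩

theorem dS_eq (hF : IsC1 F) (ht : 0 ≤ t) : dS F s t =
    fderivWithin ℝ (fun p : ℝ × ℝ => F p.1 p.2) paramSpace (s, t) (1, 0) :=
  (hF.hasDerivAt' ht).deriv

theorem dT_eq (hF : IsC1 F) (ht : 0 ≤ t) : dT F s t =
    fderivWithin ℝ (fun p : ℝ × ℝ => F p.1 p.2) paramSpace (s, t) (0, 1) :=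
  (hF.hasDerivWithinAt' ht).derivWithin (uniqueDiffOn_Ici 0 t ht)

theorem hasDerivAt (hF : IsC1 F) (ht : 0 ≤ t) : HasDerivAt (fun r => F r t) (dS F s t) s := by
  rw [hF.dS_eq ht]; exact hF.hasDerivAt' ht

theorem hasDerivWithinAt (hF : IsC1 F) (ht : 0 ≤ t) :
    HasDerivWithinAt (fun r => F s r) (dT F s t) (Ici 0) t := by
  rw [hF.dT_eq ht]; exact hF.hasDerivWithinAt' ht

theorem continuousOn (hF : IsC1 F) : ContinuousOn (fun p : ℝ × ℝ => F p.1 p.2) paramSpace :=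
  ContDiffOn.continuousOn hF

theorem continuousOn_fderivWithin (hF : IsC1 F) : ContinuousOn
    (fun p => fderivWithin ℝ (fun p : ℝ × ℝ => F p.1 p.2) paramSpace p) paramSpace :=
  ContDiffOn.continuousOn_fderivWithin hF uniqueDiffOn_paramSpace le_rfl

theorem continuousOn_dS (hF : IsC1 F) :
    ContinuousOn (fun p : ℝ × ℝ => dS F p.1 p.2) paramSpace :=
  (hF.continuousOn_fderivWithin.clm_apply continuousOn_const).congr fun _ hp => hF.dS_eq hp.2

theorem continuousOn_dT (hF : IsC1 F) :
    ContinuousOn (fun p : ℝ × ℝ => dT F p.1 p.2) paramSpace :=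
  (hF.continuousOn_fderivWithin.clm_apply continuousOn_const).congr fun _ hp => hF.dT_eq hp.2

theorem sub (hF : IsC1 F) (hK : IsC1 K) : IsC1 fun s t => F s t - K s t := ContDiffOn.sub hF hK

theorem mul (hF : IsC1 F) (hK : IsC1 K) : IsC1 fun s t => F s t * K s t := ContDiffOn.mul hF hK

theorem const_mul (a : ℝ) (hF : IsC1 F) : IsC1 fun s t => a * F s t :=
  ContDiffOn.mul contDiffOn_const hF

end IsC1

namespace IsC2

variable {F : ℝ → ℝ → ℝ} {s t : ℝ}

theorem isC1 (hF : IsC2 F) : IsC1 F := ContDiffOn.of_le hF (by norm_num)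

theorem isC1_dS (hF : IsC2 F) : IsC1 (dS F) := by
  have h1 : ContDiffOn ℝ 1 (fderivWithin ℝ (fun p : ℝ × ℝ => F p.1 p.2) paramSpace) paramSpace :=
    ContDiffOn.fderivWithin hF uniqueDiffOn_paramSpace (by norm_num)
  exact (h1.clm_apply contDiffOn_const).congr fun _ hp => hF.isC1.dS_eq hp.2

theorem isC1_dT (hF : IsC2 F) : IsC1 (dT F) := by
  have h1 : ContDiffOn ℝ 1 (fderivWithin ℝ (fun p : ℝ × ℝ => F p.1 p.2) paramSpace) paramSpace :=
    ContDiffOn.fderivWithin hF uniqueDiffOn_paramSpace (by norm_num)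
  exact (h1.clm_apply contDiffOn_const).congr fun _ hp => hF.isC1.dT_eq hp.2

theorem hasFDerivWithinAt_fderivWithin (hF : IsC2 F) (ht : 0 ≤ t) :
    HasFDerivWithinAt (fderivWithin ℝ (fun p : ℝ × ℝ => F p.1 p.2) paramSpace)
      (fderivWithin ℝ (fderivWithin ℝ (fun p : ℝ × ℝ => F p.1 p.2) paramSpace) paramSpace (s, t))
      paramSpace (s, t) := by
  have h1 : ContDiffOn ℝ 1 (fderivWithin ℝ (fun p : ℝ × ℝ => F p.1 p.2) paramSpace) paramSpace :=
    ContDiffOn.fderivWithin hF uniqueDiffOn_paramSpace (by norm_num)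
  exact (h1.differentiableOn one_ne_zero (s, t) ⟨mem_univ _, ht⟩).hasFDerivWithinAt

/-- The mixed second derivatives agree, also at the initial time. -/
theorem dS_dT (hF : IsC2 F) (ht : 0 ≤ t) : dS (dT F) s t = dT (dS F) s t := by
  set D := fderivWithin ℝ (fun p : ℝ × ℝ => F p.1 p.2) paramSpace with hD
  have h2 := hF.hasFDerivWithinAt_fderivWithin (s := s) ht
  have hs : HasDerivAt (fun r : ℝ => D (r, t) (0, 1)) (fderivWithin ℝ D paramSpace (s, t)
      (1, 0) (0, 1)) s := by
    have h1 : HasDerivWithinAt (fun r : ℝ => (r, t)) (1, 0) univ s :=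
      ((hasDerivAt_id s).prodMk (hasDerivAt_const s t)).hasDerivWithinAt
    have h3 := hasDerivWithinAt_univ.1
      (h2.comp_hasDerivWithinAt s h1 fun r _ => (⟨mem_univ _, ht⟩ : (r, t) ∈ paramSpace))
    exact ((ContinuousLinearMap.apply ℝ ℝ ((0, 1) : ℝ × ℝ)).hasFDerivAt.comp_hasDerivAt s h3)
  have ht' : HasDerivWithinAt (fun r : ℝ => D (s, r) (1, 0)) (fderivWithin ℝ D paramSpace (s, t)
      (0, 1) (1, 0)) (Ici 0) t := by
    have h1 : HasDerivWithinAt (fun r : ℝ => (s, r)) (0, 1) (Ici 0) t :=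
      ((hasDerivAt_const t s).prodMk (hasDerivAt_id t)).hasDerivWithinAt
    have h3 := h2.comp_hasDerivWithinAt t h1 fun r hr => ⟨mem_univ _, hr⟩
    exact ((ContinuousLinearMap.apply ℝ ℝ ((1, 0) : ℝ × ℝ)).hasFDerivAt.comp_hasDerivWithinAt t h3)
  have hsym : IsSymmSndFDerivWithinAt ℝ (fun p : ℝ × ℝ => F p.1 p.2) paramSpace (s, t) := by
    refine ContDiffWithinAt.isSymmSndFDerivWithinAt (n := 2) (hF (s, t) ⟨mem_univ _, ht⟩) (by simp)
      uniqueDiffOn_paramSpace ?_ ⟨mem_univ _, ht⟩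
    rw [interior_prod_eq, interior_univ, interior_Ici, closure_prod_eq, closure_univ,
      closure_Ioi]
    exact ⟨mem_univ _, ht⟩
  have e1 : dS (dT F) s t = fderivWithin ℝ D paramSpace (s, t) (1, 0) (0, 1) := by
    rw [← hs.deriv, dS]
    congr 1
    ext r
    exact hF.isC1.dT_eq ht
  have e2 : dT (dS F) s t = fderivWithin ℝ D paramSpace (s, t) (0, 1) (1, 0) := by
    rw [← ht'.derivWithin (uniqueDiffOn_Ici 0 t ht), dT]
    exact derivWithin_congr (fun r hr => hF.isC1.dS_eq hr) (hF.isC1.dS_eq ht)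
  rw [e1, e2]
  exact hsym _ _

end IsC2

/-- A continuous function on `ℝ × [0, T]` dominated by a function that vanishes at infinity is
bounded. -/
theorem exists_bound_of_dominated {G : ℝ → ℝ → ℝ}
    (hG : ContinuousOn (fun p : ℝ × ℝ => G p.1 p.2) paramSpace) {T : ℝ} {b : ℝ → ℝ}
    (hb : Tendsto b (cocompact ℝ) (𝓝 0)) (hle : ∀ s, ∀ t ∈ Icc 0 T, |G s t| ≤ b s) :
    ∃ A, 0 ≤ A ∧ ∀ s, ∀ t ∈ Icc 0 T, |G s t| ≤ A := by
  obtain ⟨K, hK, hK'⟩ := mem_cocompact.1 (hb.eventually (ge_mem_nhds (zero_lt_one' ℝ)))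
  obtain ⟨A, hA⟩ := (hK.prod (isCompact_Icc (a := (0 : ℝ)) (b := T))).exists_bound_of_continuousOn
    (hG.mono fun p hp => ⟨mem_univ _, hp.2.1⟩)
  refine ⟨max A 1, by positivity, fun s t ht => ?_⟩
  by_cases hs : s ∈ K
  · exact (hA (s, t) ⟨hs, ht⟩).trans (le_max_left _ _)
  · exact (hle s t ht).trans ((hK' hs : b s ≤ 1).trans (le_max_right _ _))

theorem isDensity_ofReal {F : ℝ → ℝ → ℝ} (hF : IsC1 F)
    (hb : ∀ T, 0 < T → ∃ A, ∀ s, ∀ t ∈ Icc 0 T, |F s t| ≤ A ∧ |dS F s t| ≤ A) :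
    IsDensity fun s t => (F s t : ℂ) := by
  refine ⟨Complex.continuous_ofReal.comp_continuousOn hF.continuousOn, fun T hT => ?_⟩
  obtain ⟨A, hA⟩ := hb T hT
  refine ⟨A, fun t ht => ⟨fun s => ?_, fun s r => ?_⟩⟩
  · rw [Complex.norm_real]; exact (hA s t ht).1
  · rw [← Complex.ofReal_sub, Complex.norm_real]
    have := Convex.norm_image_sub_le_of_norm_hasDerivWithin_le (f := fun s => F s t)
      (f' := fun s => dS F s t) (s := univ) (x := r) (y := s) (C := A)
      (fun x _ => (hF.hasDerivAt ht.1).hasDerivWithinAt) (fun x _ => (hA x t ht).2)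
      convex_univ (mem_univ _) (mem_univ _)
    simpa using this

namespace IsDensity

theorem const (a : ℂ) : IsDensity fun _ _ => a :=
  ⟨continuousOn_const, fun _ _ => ⟨‖a‖, fun _ _ => ⟨fun _ => le_rfl, fun s r => by
    rw [sub_self, norm_zero]; positivity⟩⟩⟩

theorem add {g k : ℝ → ℝ → ℂ} (hg : IsDensity g) (hk : IsDensity k) :
    IsDensity fun s t => g s t + k s t := by
  have := hg.sub ((const (-1)).mul hk)
  simpa using this

end IsDensity

/-! ### Bounds for the surface functions -/

section surfacePoint

variable {X Y : ℝ → ℝ → ℝ} {s t : ℝ}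

theorem surfacePoint_eq (X Y : ℝ → ℝ → ℝ) (s t : ℝ) :
    surfacePoint X Y s t = X s t + Complex.I * Y s t := by
  apply Complex.ext <;> simp [surfacePoint]

theorem norm_surfacePoint_le {A B : ℝ} (hX : |X s t| ≤ A) (hY : |Y s t| ≤ B) :
    ‖surfacePoint X Y s t‖ ≤ A + B :=
  (Complex.norm_le_abs_re_add_abs_im _).trans (add_le_add hX hY)

theorem norm_sq_surfacePoint : ‖surfacePoint X Y s t‖ ^ 2 = X s t ^ 2 + Y s t ^ 2 := by
  rw [Complex.sq_norm, Complex.normSq_apply]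
  simp only [surfacePoint]; ring

theorem hasDerivAt_surfacePoint (hX : IsC1 X) (hY : IsC1 Y) (ht : 0 ≤ t) :
    HasDerivAt (fun r => surfacePoint X Y r t) (surfacePoint (dS X) (dS Y) s t) s := by
  simp only [surfacePoint_eq]
  exact (hX.hasDerivAt ht).ofReal_comp.add ((hY.hasDerivAt ht).ofReal_comp.const_mul Complex.I)

theorem hasDerivWithinAt_surfacePoint (hX : IsC1 X) (hY : IsC1 Y) (ht : 0 ≤ t) :
    HasDerivWithinAt (fun r => surfacePoint X Y s r) (surfacePoint (dT X) (dT Y) s t) (Ici 0) t := by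
  simp only [surfacePoint_eq]
  have h1 := Complex.ofRealCLM.hasFDerivAt.comp_hasDerivWithinAt t (hX.hasDerivWithinAt (s := s) ht)
  have h2 := Complex.ofRealCLM.hasFDerivAt.comp_hasDerivWithinAt t (hY.hasDerivWithinAt (s := s) ht)
  exact h1.add (h2.const_mul Complex.I)

theorem continuousOn_surfacePoint (hX : IsC1 X) (hY : IsC1 Y) :
    ContinuousOn (fun p : ℝ × ℝ => surfacePoint X Y p.1 p.2) paramSpace := by
  simp only [surfacePoint_eq]
  exact (Complex.continuous_ofReal.comp_continuousOn hX.continuousOn).add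
    (continuousOn_const.mul (Complex.continuous_ofReal.comp_continuousOn hY.continuousOn))

theorem isDensity_surfacePoint (hX : IsC1 X) (hY : IsC1 Y)
    (hb : ∀ T, 0 < T → ∃ A, ∀ s, ∀ t ∈ Icc 0 T,
      |X s t| ≤ A ∧ |dS X s t| ≤ A ∧ |Y s t| ≤ A ∧ |dS Y s t| ≤ A) :
    IsDensity (surfacePoint X Y) := by
  have h1 : IsDensity fun s t => (X s t : ℂ) := isDensity_ofReal hX fun T hT => by
    obtain ⟨A, hA⟩ := hb T hT
    exact ⟨A, fun s t ht => ⟨(hA s t ht).1, (hA s t ht).2.1⟩⟩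
  have h2 : IsDensity fun s t => (Y s t : ℂ) := isDensity_ofReal hY fun T hT => by
    obtain ⟨A, hA⟩ := hb T hT
    exact ⟨A, fun s t ht => ⟨(hA s t ht).2.2.1, (hA s t ht).2.2.2⟩⟩
  have : surfacePoint X Y = fun s t => (X s t : ℂ) + Complex.I * Y s t :=
    funext fun s => funext fun t => surfacePoint_eq X Y s t
  rw [this]
  exact h1.add ((IsDensity.const _).mul h2)

end surfacePoint

/-- The bounds on the surface functions on a time interval `[0, T]`. -/
structure SurfaceBounds (X Y ξ : ℝ → ℝ → ℝ) (T C : ℝ) (b : ℝ → ℝ) : Prop where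
  b_int : Integrable b
  b_lim : Tendsto b (cocompact ℝ) (𝓝 0)
  C_pos : 0 < C
  decay : ∀ s, ∀ t ∈ Icc 0 T, |dS Y s t| ≤ b s ∧ |dT Y s t| ≤ b s ∧
      |dS (dS Y) s t| ≤ b s ∧ |dT (dS Y) s t| ≤ b s ∧ |dT (dT Y) s t| ≤ b s ∧
      |dS ξ s t| ≤ b s ∧ |dS (dS ξ) s t| ≤ b s ∧ |dT (dS ξ) s t| ≤ b s
  boundX : ∀ s, ∀ t ∈ Icc 0 T, |dS X s t| ≤ C ∧ |dT X s t| ≤ C ∧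
      |dS (dS X) s t| ≤ C ∧ |dT (dS X) s t| ≤ C ∧ |dT (dT X) s t| ≤ C
  boundY : ∀ s, ∀ t ∈ Icc 0 T, |dS Y s t| ≤ C ∧ |dT Y s t| ≤ C ∧
      |dS (dS Y) s t| ≤ C ∧ |dT (dS Y) s t| ≤ C ∧ |dT (dT Y) s t| ≤ C
  bound : ∀ s, ∀ t ∈ Icc 0 T, |Y s t| ≤ C ∧
      |dS ξ s t| ≤ C ∧ |dS (dS ξ) s t| ≤ C ∧ |dT (dS ξ) s t| ≤ C

section

variable {h : ℝ} {X Y ξ : ℝ → ℝ → ℝ}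

theorem exists_surfaceBounds (hS : IsSurface h X Y) (hξ : IsC2 ξ) (hD : HasDecay X Y ξ) {T : ℝ}
    (hT : 0 < T) : ∃ C b, SurfaceBounds X Y ξ T C b := by
  obtain ⟨b, hbi, hb0, hb⟩ := hD.dominated T hT
  obtain ⟨C0, hC0⟩ := hD.bounded T hT
  have hY := hS.smoothY
  have hYb : ∀ s, ∀ t ∈ Icc 0 T, |Y s t| ≤ |Y s 0| + T * b s := by
    intro s t ht
    have h1 := Convex.norm_image_sub_le_of_norm_hasDerivWithin_le (f := fun r => Y s r)
      (f' := fun r => dT Y s r) (s := Icc 0 T) (x := 0) (y := t) (C := b s)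
      (fun x hx => (hY.isC1.hasDerivWithinAt hx.1).mono Icc_subset_Ici_self)
      (fun x hx => (hb s x hx).2.1) (convex_Icc _ _) ⟨le_rfl, hT.le⟩ ht
    rw [Real.norm_eq_abs, Real.norm_eq_abs, sub_zero, abs_of_nonneg ht.1] at h1
    have h2 := abs_sub_abs_le_abs_sub (Y s t) (Y s 0)
    have h3 : 0 ≤ b s := (abs_nonneg _).trans (hb s t ht).1
    have h4 : b s * t ≤ T * b s := by rw [mul_comm]; exact mul_le_mul_of_nonneg_right ht.2 h3
    linarith
  have hYl : Tendsto (fun s => |Y s 0| + T * b s) (cocompact ℝ) (𝓝 0) := by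
    have := (hS.level 0 le_rfl).abs.add (hb0.const_mul T)
    simpa using this
  obtain ⟨A0, hA0, h0⟩ := exists_bound_of_dominated hY.isC1.continuousOn hYl hYb
  obtain ⟨A1, hA1, h1⟩ := exists_bound_of_dominated hY.isC1.continuousOn_dS hb0
    fun s t ht => (hb s t ht).1
  obtain ⟨A2, hA2, h2⟩ := exists_bound_of_dominated hY.isC1.continuousOn_dT hb0
    fun s t ht => (hb s t ht).2.1
  obtain ⟨A3, hA3, h3⟩ := exists_bound_of_dominated hY.isC1_dS.continuousOn_dS hb0
    fun s t ht => (hb s t ht).2.2.1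
  obtain ⟨A4, hA4, h4⟩ := exists_bound_of_dominated hY.isC1_dS.continuousOn_dT hb0
    fun s t ht => (hb s t ht).2.2.2.1
  obtain ⟨A5, hA5, h5⟩ := exists_bound_of_dominated hY.isC1_dT.continuousOn_dT hb0
    fun s t ht => (hb s t ht).2.2.2.2.1
  obtain ⟨A6, hA6, h6⟩ := exists_bound_of_dominated hξ.isC1.continuousOn_dS hb0
    fun s t ht => (hb s t ht).2.2.2.2.2.1
  obtain ⟨A7, hA7, h7⟩ := exists_bound_of_dominated hξ.isC1_dS.continuousOn_dS hb0
    fun s t ht => (hb s t ht).2.2.2.2.2.2.1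
  obtain ⟨A8, hA8, h8⟩ := exists_bound_of_dominated hξ.isC1_dS.continuousOn_dT hb0
    fun s t ht => (hb s t ht).2.2.2.2.2.2.2
  have hCn : 0 ≤ C0 := (abs_nonneg _).trans (hC0 0 0 ⟨le_rfl, hT.le⟩).1
  refine ⟨C0 + A0 + A1 + A2 + A3 + A4 + A5 + A6 + A7 + A8 + 1, b, hbi, hb0, by positivity, hb,
    fun s t ht => ?_, fun s t ht => ?_, fun s t ht => ?_⟩
  · obtain ⟨a1, a2, a3, a4, a5⟩ := hC0 s t ht
    refine ⟨?_, ?_, ?_, ?_, ?_⟩ <;> linarith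
  · refine ⟨?_, ?_, ?_, ?_, ?_⟩
    · linarith [h1 s t ht]
    · linarith [h2 s t ht]
    · linarith [h3 s t ht]
    · linarith [h4 s t ht]
    · linarith [h5 s t ht]
  · refine ⟨?_, ?_, ?_, ?_⟩
    · linarith [h0 s t ht]
    · linarith [h6 s t ht]
    · linarith [h7 s t ht]
    · linarith [h8 s t ht]

/-- Far out the horizontal component of the tangent is positive, locally uniformly in time. -/
theorem exists_le_dS_X (hS : IsSurface h X Y) {T C : ℝ} (hT : 0 < T) {b : ℝ → ℝ}
    (hb : SurfaceBounds X Y ξ T C b) :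
    ∃ m, 0 < m ∧ ∃ L, 0 < L ∧ ∀ t ∈ Icc 0 T, ∀ s, L ≤ |s| → m ≤ dS X s t := by
  obtain ⟨c, hc, hreg⟩ := hS.regular T hT
  have hX := hS.smoothX
  have hm : 0 < Real.sqrt (c / 2) := Real.sqrt_pos.2 (by positivity)
  set m := Real.sqrt (c / 2) with hmdef
  have hm2 : m ^ 2 = c / 2 := Real.sq_sqrt (by positivity)
  have hev := hb.b_lim.eventually (ge_mem_nhds hm)
  rw [← Metric.cobounded_eq_cocompact, ← comap_norm_atTop, eventually_comap] at hev
  obtain ⟨L0, hL0⟩ := hev.exists_forall_of_atTop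
  set L := max L0 1 with hL
  have hL1 : 0 < L := lt_of_lt_of_le one_pos (le_max_right _ _)
  have habs : ∀ t ∈ Icc 0 T, ∀ s, L ≤ |s| → m ≤ |dS X s t| := by
    intro t ht s hs
    have h1 := hL0 |s| ((le_max_left _ _).trans hs) s rfl
    have h2 := hreg s t ht
    have h3 := (hb.decay s t ht).1.trans h1
    have h4 : dS Y s t ^ 2 ≤ m ^ 2 := sq_le_sq.2 (by rwa [abs_of_pos hm])
    refine abs_le_of_sq_le_sq' ?_ (abs_nonneg _) |>.2
    rw [sq_abs]
    linarith
  have hcont : ∀ t ∈ Icc 0 T, Continuous fun s => dS X s t := fun t ht =>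
    continuousOn_univ.1 (hX.isC1.continuousOn_dS.comp (f := fun s => (s, t)) (by fun_prop)
      fun s _ => ⟨mem_univ _, ht.1⟩)
  -- a continuous function without zeros has constant sign; the negative sign contradicts the
  -- limits of `X`
  have key : ∀ t ∈ Icc 0 T, ∀ S : Set ℝ, Convex ℝ S → (∀ s ∈ S, L ≤ |s|) →
      (¬ AntitoneOn (fun s => X s t) S) → ∀ s ∈ S, m ≤ dS X s t := by
    intro t ht S hSc hSL hanti s hs
    by_contra hneg
    have hlt : ∀ r ∈ S, dS X r t ≤ 0 := by
      intro r hr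
      by_contra hpos
      have hs0 : dS X s t < 0 := by
        rcases abs_cases (dS X s t) with ⟨h1, _⟩ | ⟨h1, h2⟩
        · have := habs t ht s (hSL s hs)
          rw [h1] at this
          exact absurd this hneg
        · exact h2
      obtain ⟨z, hz, hz0⟩ := hSc.isPreconnected.intermediate_value hs hr (hcont t ht).continuousOn
        (⟨hs0.le, (not_le.1 hpos).le⟩ : (0 : ℝ) ∈ Icc (dS X s t) (dS X r t))
      have := habs t ht z (hSL z hz)
      rw [show dS X z t = 0 from hz0, abs_zero] at this
      linarith
    apply hanti
    refine antitoneOn_of_deriv_nonpos hSc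
      (fun r _ => (hX.isC1.hasDerivAt ht.1).continuousAt.continuousWithinAt)
      (fun r _ => (hX.isC1.hasDerivAt ht.1).differentiableAt.differentiableWithinAt) fun r hr => ?_
    exact hlt r (interior_subset hr)
  refine ⟨m, hm, L, hL1, fun t ht s hs => ?_⟩
  rcases le_abs.1 hs with h1 | h1
  · refine key t ht (Ici L) (convex_Ici _) (fun r hr => hr.trans (le_abs_self _)) (fun hanti => ?_)
      s h1
    obtain ⟨r, hr1, hr2⟩ := (((hS.right t ht.1).eventually (eventually_gt_atTop (X L t))).and
      (eventually_ge_atTop L)).exists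
    exact absurd (hanti (mem_Ici.2 le_rfl) hr2 hr2) (not_le.2 hr1)
  · refine key t ht (Iic (-L)) (convex_Iic _) (fun r hr => ?_) (fun hanti => ?_) s
      (by simp only [mem_Iic]; linarith)
    · exact le_trans (by linarith [mem_Iic.1 hr]) (neg_le_abs r)
    obtain ⟨r, hr1, hr2⟩ := (((hS.left t ht.1).eventually (eventually_lt_atBot (X (-L) t))).and
      (eventually_le_atBot (-L))).exists
    exact absurd (hanti hr2 (mem_Iic.2 le_rfl) hr2) (not_le.2 hr1)

end

/-! ### The chord-arc condition -/

section

variable {h : ℝ} {X Y ξ : ℝ → ℝ → ℝ}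

/-- The horizontal distance of two points on the surface grows linearly in the parameter. -/
theorem le_sub_X (hS : IsSurface h X Y) {T C m L : ℝ} {b : ℝ → ℝ}
    (hb : SurfaceBounds X Y ξ T C b) (hL : 0 < L) (hm : 0 < m)
    (hmL : ∀ t ∈ Icc 0 T, ∀ s, L ≤ |s| → m ≤ dS X s t) {t : ℝ} (ht : t ∈ Icc 0 T) {r s : ℝ}
    (hrs : r ≤ s) : m * (s - r) - (m + C) * (2 * L) ≤ X s t - X r t := by
  have hX := hS.smoothX.isC1
  have hd : ∀ (a s : ℝ), HasDerivAt (fun s => X s t + a * s) (dS X s t + a * 1) s := fun a s =>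
    (hX.hasDerivAt ht.1).add ((hasDerivAt_id s).const_mul a)
  have hmono : ∀ (a : ℝ) (S : Set ℝ), Convex ℝ S → (∀ s ∈ S, 0 ≤ dS X s t + a) →
      MonotoneOn (fun s => X s t + a * s) S := fun a S hS hS' =>
    monotoneOn_of_deriv_nonneg hS (fun s _ => (hd a s).continuousAt.continuousWithinAt)
      (fun s _ => (hd a s).differentiableAt.differentiableWithinAt) fun s hs => by
        rw [(hd a s).deriv, mul_one]
        exact hS' s (interior_subset hs)
  -- the parameter clamped to the interval on which the tangent is not controlled
  set k : ℝ → ℝ := fun s => max (-L) (min s L) with hk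
  set V : ℝ → ℝ := fun s => X s t + (-m) * s + (m + C) * k s with hV
  have hV1 : MonotoneOn V (Iic (-L)) := by
    intro x hx y hy hxy
    have hk' : ∀ z ∈ Iic (-L), k z = -L := fun z hz =>
      max_eq_left ((min_le_left _ _).trans hz)
    have := hmono (-m) (Iic (-L)) (convex_Iic _) (fun s hs => by
      have := hmL t ht s (le_abs.2 (Or.inr (by linarith [mem_Iic.1 hs]))); linarith) hx hy hxy
    simp only [hV, hk' x hx, hk' y hy]
    linarith
  have hV2 : MonotoneOn V (Icc (-L) L) := by
    intro x hx y hy hxy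
    have hk' : ∀ z ∈ Icc (-L) L, k z = z := fun z hz => by
      simp only [hk, min_eq_left hz.2, max_eq_right hz.1]
    have := hmono C univ convex_univ (fun s _ => by
      linarith [neg_abs_le (dS X s t), (hb.boundX s t ht).1]) (mem_univ x) (mem_univ y) hxy
    simp only at this
    simp only [hV, hk' x hx, hk' y hy]
    linarith
  have hV3 : MonotoneOn V (Ici L) := by
    intro x hx y hy hxy
    have hk' : ∀ z ∈ Ici L, k z = L := fun z hz => by
      simp only [hk, min_eq_right (mem_Ici.1 hz)]
      exact max_eq_right (by linarith)
    have := hmono (-m) (Ici L) (convex_Ici _) (fun s hs => by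
      have := hmL t ht s (le_abs.2 (Or.inl hs)); linarith) hx hy hxy
    simp only [hV, hk' x hx, hk' y hy]
    linarith
  have hV4 : Monotone V := by
    have h12 := hV1.union_right hV2 isGreatest_Iic (isLeast_Icc (by linarith))
    rw [Iic_union_Icc_eq_Iic (by linarith)] at h12
    exact h12.Iic_union_Ici hV3
  have h1 := hV4 hrs
  have h2 : k s ≤ L := max_le (by linarith) (min_le_right _ _)
  have h3 : -L ≤ k r := le_max_left _ _
  have h4 : (m + C) * (k s - k r) ≤ (m + C) * (2 * L) :=
    mul_le_mul_of_nonneg_left (by linarith) (by linarith [hb.C_pos])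
  simp only [hV] at h1
  linarith

theorem norm_surfacePoint_sub_le (hS : IsSurface h X Y) {T C : ℝ} {b : ℝ → ℝ}
    (hb : SurfaceBounds X Y ξ T C b) {t : ℝ} (ht : t ∈ Icc 0 T) (s r : ℝ) :
    ‖surfacePoint (dS X) (dS Y) s t - surfacePoint (dS X) (dS Y) r t‖ ≤ 2 * C * |s - r| := by
  have := Convex.norm_image_sub_le_of_norm_hasDerivWithin_le
    (f := fun s => surfacePoint (dS X) (dS Y) s t)
    (f' := fun s => surfacePoint (dS (dS X)) (dS (dS Y)) s t) (s := univ) (x := r) (y := s)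
    (C := 2 * C)
    (fun x _ => (hasDerivAt_surfacePoint hS.smoothX.isC1_dS hS.smoothY.isC1_dS
      ht.1).hasDerivWithinAt)
    (fun x _ => (norm_surfacePoint_le (hb.boundX x t ht).2.2.1 (hb.boundY x t ht).2.2.1).trans
      (by linarith))
    convex_univ (mem_univ _) (mem_univ _)
  simpa using this

/-- Injectivity of the parametrisation, regularity and the behaviour at infinity combine to the
chord-arc condition. -/
theorem exists_chordArc (hS : IsSurface h X Y) {T C : ℝ} (hT : 0 < T) {b : ℝ → ℝ}
    (hb : SurfaceBounds X Y ξ T C b) :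
    ∃ c, 0 < c ∧ ∀ t ∈ Icc 0 T, ∀ s r,
      c * |s - r| ≤ ‖surfacePoint X Y s t - surfacePoint X Y r t‖ := by
  have hC := hb.C_pos
  have hX := hS.smoothX
  have hY := hS.smoothY
  obtain ⟨m, hm, L, hL, hmL⟩ := exists_le_dS_X hS hT hb
  obtain ⟨c0, hc0, hreg⟩ := hS.regular T hT
  set μ := Real.sqrt c0 with hμ
  have hμ0 : 0 < μ := Real.sqrt_pos.2 hc0
  have hμle : ∀ t ∈ Icc 0 T, ∀ s, μ ≤ ‖surfacePoint (dS X) (dS Y) s t‖ := fun t ht s => by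
    refine abs_le_of_sq_le_sq' ?_ (norm_nonneg _) |>.2
    rw [hμ, Real.sq_sqrt hc0.le, norm_sq_surfacePoint]
    exact hreg s t ht
  set δ := μ / (4 * C) with hδ
  have hδ0 : 0 < δ := by positivity
  -- nearby parameters are controlled by the tangent
  have near : ∀ t ∈ Icc 0 T, ∀ s r, |s - r| ≤ δ →
      μ / 2 * |s - r| ≤ ‖surfacePoint X Y s t - surfacePoint X Y r t‖ := by
    intro t ht s r hsr
    have hd : ∀ x ∈ uIcc r s, HasDerivWithinAt (fun x : ℝ => surfacePoint X Y x t -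
        surfacePoint (dS X) (dS Y) r t * (x - r))
        (surfacePoint (dS X) (dS Y) x t - surfacePoint (dS X) (dS Y) r t) (uIcc r s) x := by
      intro x _
      have h1 : HasDerivAt (fun x : ℝ => surfacePoint (dS X) (dS Y) r t * ((x : ℂ) - r))
          (surfacePoint (dS X) (dS Y) r t * 1) x :=
        (Complex.ofRealCLM.hasDerivAt.sub_const (r : ℂ)).const_mul _
      rw [mul_one] at h1
      exact ((hasDerivAt_surfacePoint hX.isC1 hY.isC1 ht.1).sub h1).hasDerivWithinAt
    have h1 := (convex_uIcc r s).norm_image_sub_le_of_norm_hasDerivWithin_le hd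
      (C := 2 * C * |s - r|) (fun x hx => (norm_surfacePoint_sub_le hS hb ht x r).trans
        (mul_le_mul_of_nonneg_left (abs_sub_left_of_mem_uIcc hx) (by linarith)))
      left_mem_uIcc right_mem_uIcc
    set a := surfacePoint X Y s t - surfacePoint X Y r t with ha
    set d := surfacePoint (dS X) (dS Y) r t * ((s : ℂ) - r) with hdd
    have h2 : ‖a - d‖ ≤ 2 * C * |s - r| * |s - r| := by
      have e : a - d = surfacePoint X Y s t - d -
          (surfacePoint X Y r t - surfacePoint (dS X) (dS Y) r t * ((r : ℂ) - r)) := by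
        rw [ha, sub_self, mul_zero]; ring
      rw [e]
      exact h1
    have h3 : ‖d‖ = ‖surfacePoint (dS X) (dS Y) r t‖ * |s - r| := by
      rw [hdd, norm_mul, ← Complex.ofReal_sub, Complex.norm_real, Real.norm_eq_abs]
    have h4 : ‖d‖ ≤ ‖a‖ + ‖a - d‖ := by
      have := norm_sub_le a (a - d)
      rwa [sub_sub_cancel] at this
    have h5 := mul_le_mul_of_nonneg_right (hμle t ht r) (abs_nonneg (s - r))
    have h6 : 2 * C * |s - r| * |s - r| ≤ 2 * C * δ * |s - r| := by gcongr
    have h7 : 2 * C * δ = μ / 2 := by rw [hδ]; field_simp; ring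
    rw [h7] at h6
    linarith
  -- parameters at distance at least `R1` are controlled by the growth of `X`
  set M := (m + C) * (2 * L) with hM
  have hM0 : 0 < M := by positivity
  set R1 := 2 * M / m with hR1
  have hR10 : 0 < R1 := by positivity
  have far : ∀ t ∈ Icc 0 T, ∀ s r, R1 ≤ |s - r| →
      m / 2 * |s - r| ≤ ‖surfacePoint X Y s t - surfacePoint X Y r t‖ := by
    intro t ht s r hsr
    wlog hrs : r ≤ s generalizing s r
    · rw [abs_sub_comm, norm_sub_rev]
      exact this r s (by rwa [abs_sub_comm]) (le_of_not_ge hrs)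
    have h1 := le_sub_X hS hb hL hm hmL ht hrs
    have h2 := (le_abs_self _).trans
      (Complex.abs_re_le_norm (surfacePoint X Y s t - surfacePoint X Y r t))
    have h3 : (surfacePoint X Y s t - surfacePoint X Y r t).re = X s t - X r t := rfl
    rw [h3] at h2
    rw [abs_of_nonneg (sub_nonneg.2 hrs)] at hsr ⊢
    have h4 : 2 * M ≤ m * (s - r) := by
      rw [hR1, div_le_iff₀ hm] at hsr
      linarith
    linarith
  -- the remaining pairs of parameters are either in a compact set, where injectivity gives a bound,
  -- or both far out
  set K : Set (ℝ × ℝ × ℝ) := {x | x.1 ∈ Icc 0 T ∧ x.2.1 ∈ Icc (-(L + R1)) (L + R1) ∧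
    x.2.2 ∈ Icc (-(L + R1)) (L + R1) ∧ δ ≤ |x.2.1 - x.2.2|} with hK
  have hKc : IsCompact K := by
    have h1 : IsCompact ((Icc 0 T) ×ˢ (Icc (-(L + R1)) (L + R1) ×ˢ Icc (-(L + R1)) (L + R1))) :=
      isCompact_Icc.prod (isCompact_Icc.prod isCompact_Icc)
    have h2 : IsClosed {x : ℝ × ℝ × ℝ | δ ≤ |x.2.1 - x.2.2|} :=
      isClosed_le continuous_const (by fun_prop)
    convert h1.inter_right h2 using 1
    ext x
    simp only [hK, mem_ofPred_eq, mem_inter_iff, mem_prod]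
    tauto
  have hcont : ContinuousOn (fun x : ℝ × ℝ × ℝ => ‖surfacePoint X Y x.2.1 x.1 -
      surfacePoint X Y x.2.2 x.1‖) K := by
    have h0 := continuousOn_surfacePoint hX.isC1 hY.isC1
    refine (ContinuousOn.sub ?_ ?_).norm
    · exact h0.comp (f := fun x : ℝ × ℝ × ℝ => (x.2.1, x.1)) (by fun_prop)
        fun x hx => ⟨mem_univ _, hx.1.1⟩
    · exact h0.comp (f := fun x : ℝ × ℝ × ℝ => (x.2.2, x.1)) (by fun_prop)
        fun x hx => ⟨mem_univ _, hx.1.1⟩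
  obtain ⟨ν, hν, hνle⟩ := hKc.exists_forall_le' hcont (a := 0) fun x hx => by
    refine norm_pos_iff.2 (sub_ne_zero.2 fun hh => ?_)
    have h1 := hS.injective x.1 hx.1.1 hh
    have h2 := hx.2.2.2
    rw [h1, sub_self, abs_zero] at h2
    linarith
  have hνR : 0 < ν / R1 := div_pos hν hR10
  refine ⟨min (μ / 2) (min (m / 2) (ν / R1)), by positivity, fun t ht s r => ?_⟩
  rcases le_or_gt (|s - r|) δ with h1 | h1
  · exact (mul_le_mul_of_nonneg_right (min_le_left _ _) (abs_nonneg _)).trans (near t ht s r h1)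
  rcases le_or_gt R1 (|s - r|) with h2 | h2
  · exact (mul_le_mul_of_nonneg_right ((min_le_right _ _).trans (min_le_left _ _))
      (abs_nonneg _)).trans (far t ht s r h2)
  by_cases hK' : (t, s, r) ∈ K
  · have h3 := hνle _ hK'
    refine (mul_le_mul_of_nonneg_right ((min_le_right _ _).trans (min_le_right _ _))
      (abs_nonneg _)).trans (le_trans ?_ h3)
    calc ν / R1 * |s - r| ≤ ν / R1 * R1 := by gcongr
      _ = ν := by field_simp
  · -- both parameters lie on the same side of `[-L, L]`, where `X` has slope at least `m`
    wlog hrs : r ≤ s generalizing s r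
    · rw [abs_sub_comm, norm_sub_rev]
      refine this r s (by rwa [abs_sub_comm]) (by rwa [abs_sub_comm]) (fun hh => hK' ?_)
        (le_of_not_ge hrs)
      exact ⟨hh.1, hh.2.2.1, hh.2.1, by simpa only [abs_sub_comm] using hh.2.2.2⟩
    have hrs' := abs_of_nonneg (sub_nonneg.2 hrs)
    have hside : L ≤ r ∨ s ≤ -L := by
      by_contra hh
      push Not at hh
      rw [hrs'] at h2
      exact hK' ⟨ht, ⟨by linarith, by linarith⟩, ⟨by linarith, by linarith⟩, h1.le⟩
    have hmem : ∀ x ∈ interior (Icc r s), m ≤ deriv (fun s => X s t) x := by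
      intro x hx
      have hx := interior_subset hx
      apply hmL t ht
      rcases hside with h3 | h3
      · exact le_abs.2 (Or.inl (h3.trans hx.1))
      · exact le_abs.2 (Or.inr (by linarith [hx.2]))
    have h4 := (convex_Icc r s).mul_sub_le_image_sub_of_le_deriv
      (fun x _ => (hX.isC1.hasDerivAt ht.1).continuousAt.continuousWithinAt)
      (fun x _ => (hX.isC1.hasDerivAt ht.1).differentiableAt.differentiableWithinAt) hmem
      r (left_mem_Icc.2 hrs) s (right_mem_Icc.2 hrs) hrs
    have h5 := (le_abs_self _).trans
      (Complex.abs_re_le_norm (surfacePoint X Y s t - surfacePoint X Y r t))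
    have h6 : (surfacePoint X Y s t - surfacePoint X Y r t).re = X s t - X r t := rfl
    rw [h6] at h5
    refine (mul_le_mul_of_nonneg_right ((min_le_right _ _).trans (min_le_left _ _))
      (abs_nonneg _)).trans ?_
    rw [hrs']
    have := mul_le_mul_of_nonneg_right (half_le_self hm.le) (sub_nonneg.2 hrs)
    linarith

end

/-! ### The densities of velocity and potential -/

/-- The primitive along the curve, starting from the parameter `0`. -/
def primitive (n : ℝ → ℝ → ℂ) (s t : ℝ) : ℂ := ∫ r in (0 : ℝ)..s, n r t

section primitive

variable {n nt : ℝ → ℝ → ℂ}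

theorem continuous_of_continuousOn (hn : ContinuousOn (fun p : ℝ × ℝ => n p.1 p.2) paramSpace)
    {t : ℝ} (ht : 0 ≤ t) : Continuous fun s => n s t :=
  continuousOn_univ.1 (hn.comp (f := fun s => (s, t)) (by fun_prop) fun _ _ => ⟨mem_univ _, ht⟩)

theorem hasDerivAt_primitive (hn : ContinuousOn (fun p : ℝ × ℝ => n p.1 p.2) paramSpace) {s t : ℝ}
    (ht : 0 ≤ t) : HasDerivAt (fun r => primitive n r t) (n s t) s := by
  have h1 := continuous_of_continuousOn hn ht
  exact intervalIntegral.integral_hasDerivAt_right (h1.intervalIntegrable _ _)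
    h1.stronglyMeasurable.stronglyMeasurableAtFilter h1.continuousAt

theorem continuousOn_primitive (hn : ContinuousOn (fun p : ℝ × ℝ => n p.1 p.2) paramSpace) :
    ContinuousOn (fun p : ℝ × ℝ => primitive n p.1 p.2) paramSpace := by
  -- freeze the density at negative times
  have h1 : Continuous (Function.uncurry fun (p : ℝ × ℝ) (r : ℝ) => n r (max p.2 0)) := by
    refine continuousOn_univ.1 (hn.comp (f := fun x : (ℝ × ℝ) × ℝ => (x.2, max x.1.2 0))
      (by fun_prop) fun x _ => ⟨mem_univ _, (le_max_right x.1.2 0 : (0 : ℝ) ≤ max x.1.2 0)⟩)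
  have h2 := intervalIntegral.continuous_parametric_intervalIntegral_of_continuous (μ := volume)
    (a₀ := 0) h1 continuous_fst
  refine h2.continuousOn.congr fun p hp => ?_
  simp only [primitive, max_eq_left (mem_Ici.1 hp.2)]

theorem isDensity_primitive (hn : ContinuousOn (fun p : ℝ × ℝ => n p.1 p.2) paramSpace)
    (hb : ∀ T, 0 < T → ∃ b : ℝ → ℝ, Integrable b ∧ ∃ A, ∀ s, ∀ t ∈ Icc 0 T,
      ‖n s t‖ ≤ b s ∧ ‖n s t‖ ≤ A) : IsDensity (primitive n) := by
  refine ⟨continuousOn_primitive hn, fun T hT => ?_⟩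
  obtain ⟨b, hbi, A, hA⟩ := hb T hT
  have hb0 : ∀ s, 0 ≤ b s := fun s => (norm_nonneg _).trans (hA s 0 ⟨le_rfl, hT.le⟩).1
  refine ⟨max (∫ s, b s) A, fun t ht => ⟨fun s => ?_, fun s r => ?_⟩⟩
  · refine le_trans ?_ (le_max_left _ _)
    rw [primitive, intervalIntegral.norm_intervalIntegral_eq]
    refine (norm_integral_le_of_norm_le hbi.integrableOn
      (Eventually.of_forall fun r => (hA r t ht).1)).trans ?_
    exact setIntegral_le_integral hbi (Eventually.of_forall hb0)
  · have := Convex.norm_image_sub_le_of_norm_hasDerivWithin_le (f := fun s => primitive n s t)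
      (f' := fun s => n s t) (s := univ) (x := r) (y := s) (C := A)
      (fun x _ => (hasDerivAt_primitive hn ht.1).hasDerivWithinAt) (fun x _ => (hA x t ht).2)
      convex_univ (mem_univ _) (mem_univ _)
    rw [Real.norm_eq_abs] at this
    exact this.trans (mul_le_mul_of_nonneg_right (le_max_right _ _) (abs_nonneg _))

theorem hasDerivWithinAt_primitive (hn : ContinuousOn (fun p : ℝ × ℝ => n p.1 p.2) paramSpace)
    (hnt : ∀ s t, 0 ≤ t → HasDerivWithinAt (fun r => n s r) (nt s t) (Ici 0) t)
    (hb : ∀ T, 0 < T → ∃ A, ∀ s, ∀ t ∈ Icc 0 T, ‖nt s t‖ ≤ A) {s t : ℝ} (ht : 0 ≤ t) :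
    HasDerivWithinAt (fun r => primitive n s r) (primitive nt s t) (Ici 0) t := by
  obtain ⟨A, hA⟩ := hb (t + 1) (by linarith)
  have hA0 : 0 ≤ A := (norm_nonneg _).trans (hA 0 0 ⟨le_rfl, by linarith⟩)
  have hmem : ∀ r ∈ Metric.ball t 1 ∩ Ici (0 : ℝ), r ∈ Icc 0 (t + 1) := fun r hr => by
    have := (abs_lt.1 (Real.dist_eq r t ▸ Metric.mem_ball.1 hr.1)).2
    exact ⟨hr.2, by linarith⟩
  have hmeas : ∀ r, 0 ≤ r → StronglyMeasurable fun u => n u r := fun r hr =>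
    (continuous_of_continuousOn hn hr).stronglyMeasurable
  have h1 := hasDerivWithinAt_integral (Φ := fun r => (uIoc 0 s).indicator fun u => n u r)
    (Φ' := fun r => (uIoc 0 s).indicator fun u => nt u r) (S := Ici 0) (t := t) one_pos
    (convex_Ici _) ht (bound := (uIoc 0 s).indicator fun _ => A)
    ((integrable_indicator_iff measurableSet_uIoc).2
      (integrableOn_const (by simp [uIoc])))
    (fun r hr u => by
      by_cases hu : u ∈ uIoc 0 s
      · simp only [indicator_of_mem hu]; exact hnt u r hr.2
      · simp only [indicator_of_notMem hu]; exact hasDerivWithinAt_const _ _ _)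
    (fun r hr u => by
      by_cases hu : u ∈ uIoc 0 s
      · simp only [indicator_of_mem hu]; exact hA u r (hmem r hr)
      · simp only [indicator_of_notMem hu, norm_zero]; exact le_rfl)
    (fun r hr => ((hmeas r hr.2).indicator measurableSet_uIoc).aestronglyMeasurable)
    ((integrable_indicator_iff measurableSet_uIoc).2 (by
      have := (continuous_of_continuousOn hn ht).intervalIntegrable (μ := volume) 0 s
      exact intervalIntegrable_iff.1 this))
  simp only [integral_indicator measurableSet_uIoc] at h1
  simp only [primitive, intervalIntegral.intervalIntegral_eq_integral_uIoc]
  exact h1.const_smul _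

end primitive

namespace IsDensity

theorem of_time {k : ℝ → ℂ} (hk : ContinuousOn k (Ici 0)) : IsDensity fun _ t => k t := by
  refine ⟨hk.comp continuousOn_snd fun p hp => hp.2, fun T _ => ?_⟩
  obtain ⟨A, hA⟩ := (isCompact_Icc (a := (0 : ℝ)) (b := T)).exists_bound_of_continuousOn
    (hk.mono Icc_subset_Ici_self)
  refine ⟨A, fun t ht => ⟨fun _ => hA t ht, fun s r => ?_⟩⟩
  rw [sub_self, norm_zero]
  exact mul_nonneg ((norm_nonneg _).trans (hA t ht)) (abs_nonneg _)

end IsDensity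

/-- The normal component of the relative velocity that the kinematic condition prescribes, in
units of the speed of the parametrisation. -/
def normalFlux (γ : ℝ) (X Y : ℝ → ℝ → ℝ) (s t : ℝ) : ℝ :=
  dS X s t * dT Y s t - dS Y s t * dT X s t - γ * Y s t * dS Y s t

/-- The boundary values of `φ_x - i φ_y`, multiplied by the tangent: `ξ_s - i N`. -/
def velocityDensity (γ : ℝ) (X Y ξ : ℝ → ℝ → ℝ) : ℝ → ℝ → ℂ :=
  surfacePoint (dS ξ) fun s t => -1 * normalFlux γ X Y s t

/-- The boundary values of the complex potential. -/
def potentialDensity (γ : ℝ) (X Y ξ : ℝ → ℝ → ℝ) (s t : ℝ) : ℂ :=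
  ξ 0 t + primitive (velocityDensity γ X Y ξ) s t

/-- The time derivative of the boundary values of the complex potential at a fixed parameter. -/
def potentialRate (γ : ℝ) (X Y ξ : ℝ → ℝ → ℝ) (s t : ℝ) : ℂ :=
  dT ξ 0 t + primitive (surfacePoint (dT (dS ξ)) fun s t => -1 * dT (normalFlux γ X Y) s t) s t

theorem abs_combination_le {p1 p2 p3 p4 p5 p6 p7 p8 p9 p10 p11 p12 γ C β : ℝ} (h1 : |p1| ≤ C)
    (h2 : |p2| ≤ β) (h3 : |p3| ≤ C) (h4 : |p4| ≤ β) (h5 : |p5| ≤ β) (h6 : |p6| ≤ C) (h7 : |p7| ≤ β)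
    (h8 : |p8| ≤ C) (h9 : |p9| ≤ C) (h10 : |p10| ≤ β) (h11 : |p11| ≤ C) (h12 : |p12| ≤ β) :
    |(p1 * p2 + p3 * p4) - (p5 * p6 + p7 * p8) - (γ * p9 * p10 + γ * p11 * p12)| ≤
      (4 + 2 * |γ|) * C * β := by
  have hC : 0 ≤ C := (abs_nonneg _).trans h1
  have hβ : 0 ≤ β := (abs_nonneg _).trans h2
  have e1 : ∀ {a b : ℝ}, |a| ≤ C → |b| ≤ β → |a * b| ≤ C * β := fun ha hb => by
    rw [abs_mul]; exact mul_le_mul ha hb (abs_nonneg _) hC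
  have e2 : ∀ {a b : ℝ}, |a| ≤ C → |b| ≤ β → |γ * a * b| ≤ |γ| * (C * β) := fun ha hb => by
    rw [mul_assoc, abs_mul]; exact mul_le_mul_of_nonneg_left (e1 ha hb) (abs_nonneg _)
  have a1 := abs_le.1 (e1 h1 h2)
  have a2 := abs_le.1 (e1 h3 h4)
  have a3 := abs_le.1 (e1 h6 h5)
  have a4 := abs_le.1 (e1 h8 h7)
  have a5 := abs_le.1 (e2 h9 h10)
  have a6 := abs_le.1 (e2 h11 h12)
  rw [abs_le]
  constructor <;> linarith [a1.1, a1.2, a2.1, a2.2, a3.1, a3.2, a4.1, a4.2, a5.1, a5.2, a6.1, a6.2]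

section

variable {h γ : ℝ} {X Y ξ : ℝ → ℝ → ℝ}

theorem isC1_normalFlux (hX : IsC2 X) (hY : IsC2 Y) : IsC1 (normalFlux γ X Y) :=
  ((hX.isC1_dS.mul hY.isC1_dT).sub (hY.isC1_dS.mul hX.isC1_dT)).sub
    ((hY.isC1.const_mul γ).mul hY.isC1_dS)

theorem dS_normalFlux (hX : IsC2 X) (hY : IsC2 Y) {s t : ℝ} (ht : 0 ≤ t) :
    dS (normalFlux γ X Y) s t =
      (dS (dS X) s t * dT Y s t + dS X s t * dT (dS Y) s t) -
      (dS (dS Y) s t * dT X s t + dS Y s t * dT (dS X) s t) -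
      (γ * dS Y s t * dS Y s t + γ * Y s t * dS (dS Y) s t) := by
  rw [← hX.dS_dT ht, ← hY.dS_dT ht]
  refine HasDerivAt.deriv ?_
  exact (((hX.isC1_dS.hasDerivAt ht).mul (hY.isC1_dT.hasDerivAt ht)).sub
    ((hY.isC1_dS.hasDerivAt ht).mul (hX.isC1_dT.hasDerivAt ht))).sub
    (((hY.isC1.hasDerivAt ht).const_mul γ).mul (hY.isC1_dS.hasDerivAt ht))

theorem dT_normalFlux (hX : IsC2 X) (hY : IsC2 Y) {s t : ℝ} (ht : 0 ≤ t) :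
    dT (normalFlux γ X Y) s t =
      (dT (dS X) s t * dT Y s t + dS X s t * dT (dT Y) s t) -
      (dT (dS Y) s t * dT X s t + dS Y s t * dT (dT X) s t) -
      (γ * dT Y s t * dS Y s t + γ * Y s t * dT (dS Y) s t) := by
  refine HasDerivWithinAt.derivWithin ?_ (uniqueDiffOn_Ici 0 t ht)
  exact (((hX.isC1_dS.hasDerivWithinAt ht).mul (hY.isC1_dT.hasDerivWithinAt ht)).sub
    ((hY.isC1_dS.hasDerivWithinAt ht).mul (hX.isC1_dT.hasDerivWithinAt ht))).sub
    (((hY.isC1.hasDerivWithinAt ht).const_mul γ).mul (hY.isC1_dS.hasDerivWithinAt ht))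

theorem normalFlux_bounds (hX : IsC2 X) (hY : IsC2 Y) {T C : ℝ} {b : ℝ → ℝ}
    (hb : SurfaceBounds X Y ξ T C b) {s t β : ℝ} (ht : t ∈ Icc 0 T)
    (hβ : |dS Y s t| ≤ β ∧ |dT Y s t| ≤ β ∧ |dS (dS Y) s t| ≤ β ∧ |dT (dS Y) s t| ≤ β ∧
      |dT (dT Y) s t| ≤ β) :
    |normalFlux γ X Y s t| ≤ (4 + 2 * |γ|) * C * β ∧
      |dS (normalFlux γ X Y) s t| ≤ (4 + 2 * |γ|) * C * β ∧
      |dT (normalFlux γ X Y) s t| ≤ (4 + 2 * |γ|) * C * β := by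
  obtain ⟨x1, x2, x3, x4, x5⟩ := hb.boundX s t ht
  obtain ⟨y1, y2, y3, y4, y5⟩ := hb.boundY s t ht
  obtain ⟨z1, z2, z3, z4⟩ := hb.bound s t ht
  obtain ⟨b1, b2, b3, b4, b5⟩ := hβ
  have hC := hb.C_pos.le
  have h0 : |(0 : ℝ)| ≤ C := by rwa [abs_zero]
  have h0' : |(0 : ℝ)| ≤ β := by rw [abs_zero]; exact (abs_nonneg _).trans b1
  refine ⟨?_, ?_, ?_⟩
  · have := abs_combination_le (γ := γ) x1 b2 h0 h0' b1 x2 h0' h0 z1 b1 h0 h0'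
    simpa [normalFlux] using this
  · rw [dS_normalFlux hX hY ht.1]
    exact abs_combination_le x3 b2 x1 b4 b3 x2 b1 x4 y1 b1 z1 b3
  · rw [dT_normalFlux hX hY ht.1]
    exact abs_combination_le x4 b2 x1 b5 b4 x2 b1 x5 y2 b1 z1 b4

/-- The free surface is a family of arcs. -/
theorem arcFamily (hS : IsSurface h X Y) (hξ : IsC2 ξ) (hD : HasDecay X Y ξ) :
    ArcFamily (surfacePoint X Y) (surfacePoint (dS X) (dS Y)) (surfacePoint (dT X) (dT Y)) := by
  have hX := hS.smoothX
  have hY := hS.smoothY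
  refine ⟨fun T hT => ?_, ?_, ?_,
    fun s t ht => hasDerivWithinAt_surfacePoint hX.isC1 hY.isC1 ht⟩
  · obtain ⟨C, b, hb⟩ := exists_surfaceBounds hS hξ hD hT
    obtain ⟨c, hc, hcle⟩ := exists_chordArc hS hT hb
    obtain ⟨m, hm, L, hL, hmL⟩ := exists_le_dS_X hS hT hb
    have hC := hb.C_pos
    refine ⟨c, 2 * C, fun t ht => ⟨hc, fun s => hasDerivAt_surfacePoint hX.isC1 hY.isC1 ht.1,
      hcle t ht, fun s => ?_, norm_surfacePoint_sub_le hS hb ht, fun s => ?_, hS.right t ht.1,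
      hS.left t ht.1, L, fun s hs => ?_⟩⟩
    · exact (norm_surfacePoint_le (hb.boundX s t ht).1 (hb.boundY s t ht).1).trans (by linarith)
    · exact (hb.bound s t ht).1.trans (by linarith)
    · exact hm.trans_le (hmL t ht s (hs.trans (le_abs_self _)))
  · refine isDensity_surfacePoint hX.isC1_dS hY.isC1_dS fun T hT => ?_
    obtain ⟨C, b, hb⟩ := exists_surfaceBounds hS hξ hD hT
    exact ⟨C, fun s t ht => ⟨(hb.boundX s t ht).1, (hb.boundX s t ht).2.2.1, (hb.boundY s t ht).1,
      (hb.boundY s t ht).2.2.1⟩⟩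
  · refine isDensity_surfacePoint hX.isC1_dT hY.isC1_dT fun T hT => ?_
    obtain ⟨C, b, hb⟩ := exists_surfaceBounds hS hξ hD hT
    refine ⟨C, fun s t ht => ?_⟩
    rw [hX.dS_dT ht.1, hY.dS_dT ht.1]
    exact ⟨(hb.boundX s t ht).2.1, (hb.boundX s t ht).2.2.2.1, (hb.boundY s t ht).2.1,
      (hb.boundY s t ht).2.2.2.1⟩

theorem isC1_neg_normalFlux (hX : IsC2 X) (hY : IsC2 Y) :
    IsC1 fun s t => -1 * normalFlux γ X Y s t :=
  (isC1_normalFlux hX hY).const_mul _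

theorem dS_neg_normalFlux (s t : ℝ) :
    dS (fun s t => -1 * normalFlux γ X Y s t) s t = -1 * dS (normalFlux γ X Y) s t := by
  simp [dS]

theorem dT_neg_normalFlux (s t : ℝ) :
    dT (fun s t => -1 * normalFlux γ X Y s t) s t = -1 * dT (normalFlux γ X Y) s t := by
  exact derivWithin_const_mul_field _

theorem isDensity_velocityDensity (hS : IsSurface h X Y) (hξ : IsC2 ξ) (hD : HasDecay X Y ξ) :
    IsDensity (velocityDensity γ X Y ξ) := by
  refine isDensity_surfacePoint hξ.isC1_dS (isC1_neg_normalFlux hS.smoothX hS.smoothY)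
    fun T hT => ?_
  obtain ⟨C, b, hb⟩ := exists_surfaceBounds hS hξ hD hT
  refine ⟨max C ((4 + 2 * |γ|) * C * C), fun s t ht => ?_⟩
  obtain ⟨a1, a2, a3⟩ := normalFlux_bounds (γ := γ) hS.smoothX hS.smoothY hb ht (hb.boundY s t ht)
  rw [dS_neg_normalFlux, abs_mul, abs_mul, abs_neg, abs_one, one_mul, one_mul]
  exact ⟨(hb.bound s t ht).2.1.trans (le_max_left _ _),
    (hb.bound s t ht).2.2.1.trans (le_max_left _ _), a1.trans (le_max_right _ _),
    a2.trans (le_max_right _ _)⟩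

/-- The densities for the velocity and its rate of change decay in an integrable way. -/
theorem exists_velocityDensity_le (hS : IsSurface h X Y) (hξ : IsC2 ξ) (hD : HasDecay X Y ξ)
    {T : ℝ} (hT : 0 < T) : ∃ b : ℝ → ℝ, Integrable b ∧ Tendsto b (cocompact ℝ) (𝓝 0) ∧ ∃ A,
      ∀ s, ∀ t ∈ Icc 0 T, (‖velocityDensity γ X Y ξ s t‖ ≤ b s ∧
        ‖velocityDensity γ X Y ξ s t‖ ≤ A) ∧
        ‖surfacePoint (dT (dS ξ)) (fun s t => -1 * dT (normalFlux γ X Y) s t) s t‖ ≤ b s ∧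
        ‖surfacePoint (dT (dS ξ)) (fun s t => -1 * dT (normalFlux γ X Y) s t) s t‖ ≤ A := by
  obtain ⟨C, b, hb⟩ := exists_surfaceBounds hS hξ hD hT
  refine ⟨fun s => b s + (4 + 2 * |γ|) * C * b s, hb.b_int.add (hb.b_int.const_mul _), ?_,
    C + (4 + 2 * |γ|) * C * C, fun s t ht => ?_⟩
  · have := hb.b_lim.add (hb.b_lim.const_mul ((4 + 2 * |γ|) * C))
    simpa using this
  obtain ⟨d1, d2, d3, d4, d5, d6, d7, d8⟩ := hb.decay s t ht
  obtain ⟨a1, a2, a3⟩ := normalFlux_bounds (γ := γ) hS.smoothX hS.smoothY hb ht (hb.boundY s t ht)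
  obtain ⟨b1, b2, b3⟩ := normalFlux_bounds (γ := γ) hS.smoothX hS.smoothY hb ht
    ⟨d1, d2, d3, d4, d5⟩
  have e : ∀ x : ℝ, |-1 * x| = |x| := fun x => by rw [abs_mul, abs_neg, abs_one, one_mul]
  refine ⟨⟨norm_surfacePoint_le d6 (by rwa [e]), norm_surfacePoint_le (hb.bound s t ht).2.1
    (by rwa [e])⟩, norm_surfacePoint_le d8 (by rwa [e]), norm_surfacePoint_le
    (hb.bound s t ht).2.2.2 (by rwa [e])⟩

theorem integrable_velocityDensity (hS : IsSurface h X Y) (hξ : IsC2 ξ) (hD : HasDecay X Y ξ)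
    {t : ℝ} (ht : 0 ≤ t) : Integrable fun s => velocityDensity γ X Y ξ s t := by
  obtain ⟨b, hb, -, A, hA⟩ := exists_velocityDensity_le (γ := γ) hS hξ hD (T := t + 1)
    (by linarith)
  exact hb.mono' ((isDensity_velocityDensity hS hξ hD).continuous ht).aestronglyMeasurable
    (Eventually.of_forall fun s => (hA s t ⟨ht, by linarith⟩).1.1)

theorem continuousOn_velocityDensity (hS : IsSurface h X Y) (hξ : IsC2 ξ) :
    ContinuousOn (fun p : ℝ × ℝ => velocityDensity γ X Y ξ p.1 p.2) paramSpace :=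
  continuousOn_surfacePoint hξ.isC1_dS (isC1_neg_normalFlux hS.smoothX hS.smoothY)

theorem hasDerivAt_potentialDensity (hS : IsSurface h X Y) (hξ : IsC2 ξ) {s t : ℝ} (ht : 0 ≤ t) :
    HasDerivAt (fun r => potentialDensity γ X Y ξ r t) (velocityDensity γ X Y ξ s t) s :=
  (hasDerivAt_primitive (continuousOn_velocityDensity hS hξ) ht).const_add _

theorem isDensity_potentialDensity (hS : IsSurface h X Y) (hξ : IsC2 ξ) (hD : HasDecay X Y ξ) :
    IsDensity (potentialDensity γ X Y ξ) := by
  have hc : ContinuousOn (fun t => (ξ 0 t : ℂ)) (Ici 0) :=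
    Complex.continuous_ofReal.comp_continuousOn (hξ.isC1.continuousOn.comp
      (f := fun t => ((0 : ℝ), t)) (by fun_prop) fun t ht => ⟨mem_univ _, ht⟩)
  refine (IsDensity.of_time hc).add (isDensity_primitive (continuousOn_velocityDensity hS hξ)
    fun T hT => ?_)
  obtain ⟨b, hb, -, A, hA⟩ := exists_velocityDensity_le (γ := γ) hS hξ hD hT
  exact ⟨b, hb, A, fun s t ht => (hA s t ht).1⟩

theorem continuousOn_velocityRate (hS : IsSurface h X Y) (hξ : IsC2 ξ) :
    ContinuousOn (fun p : ℝ × ℝ => surfacePoint (dT (dS ξ))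
      (fun s t => -1 * dT (normalFlux γ X Y) s t) p.1 p.2) paramSpace := by
  simp only [surfacePoint_eq]
  exact (Complex.continuous_ofReal.comp_continuousOn hξ.isC1_dS.continuousOn_dT).add
    (continuousOn_const.mul (Complex.continuous_ofReal.comp_continuousOn
      (continuousOn_const.mul (isC1_normalFlux hS.smoothX hS.smoothY).continuousOn_dT)))

theorem isDensity_potentialRate (hS : IsSurface h X Y) (hξ : IsC2 ξ) (hD : HasDecay X Y ξ) :
    IsDensity (potentialRate γ X Y ξ) := by
  have hc : ContinuousOn (fun t => (dT ξ 0 t : ℂ)) (Ici 0) :=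
    Complex.continuous_ofReal.comp_continuousOn (hξ.isC1.continuousOn_dT.comp
      (f := fun t => ((0 : ℝ), t)) (by fun_prop) fun t ht => ⟨mem_univ _, ht⟩)
  refine (IsDensity.of_time hc).add (isDensity_primitive (continuousOn_velocityRate hS hξ)
    fun T hT => ?_)
  obtain ⟨b, hb, -, A, hA⟩ := exists_velocityDensity_le (γ := γ) hS hξ hD hT
  exact ⟨b, hb, A, fun s t ht => (hA s t ht).2⟩

theorem hasDerivWithinAt_velocityDensity (hS : IsSurface h X Y) (hξ : IsC2 ξ) {s t : ℝ}
    (ht : 0 ≤ t) : HasDerivWithinAt (fun r => velocityDensity γ X Y ξ s r)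
      (surfacePoint (dT (dS ξ)) (fun s t => -1 * dT (normalFlux γ X Y) s t) s t) (Ici 0) t := by
  have := hasDerivWithinAt_surfacePoint (s := s) hξ.isC1_dS
    (isC1_neg_normalFlux (γ := γ) hS.smoothX hS.smoothY) ht
  refine this.congr_deriv ?_
  simp only [surfacePoint, dT_neg_normalFlux]

theorem hasDerivWithinAt_potentialDensity (hS : IsSurface h X Y) (hξ : IsC2 ξ)
    (hD : HasDecay X Y ξ) {s t : ℝ} (ht : 0 ≤ t) :
    HasDerivWithinAt (fun r => potentialDensity γ X Y ξ s r) (potentialRate γ X Y ξ s t)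
      (Ici 0) t := by
  have h1 := Complex.ofRealCLM.hasFDerivAt.comp_hasDerivWithinAt t
    (hξ.isC1.hasDerivWithinAt (s := 0) ht)
  refine h1.add (hasDerivWithinAt_primitive (continuousOn_velocityDensity hS hξ)
    (fun s t ht => hasDerivWithinAt_velocityDensity hS hξ ht) (fun T hT => ?_) ht)
  obtain ⟨b, hb, -, A, hA⟩ := exists_velocityDensity_le (γ := γ) hS hξ hD hT
  exact ⟨A, fun s t ht => (hA s t ht).2.2⟩

theorem re_potentialDensity (hS : IsSurface h X Y) (hξ : IsC2 ξ) {s t : ℝ} (ht : 0 ≤ t) :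
    (potentialDensity γ X Y ξ s t).re = ξ s t := by
  have hd : ∀ s, HasDerivAt (fun s => (potentialDensity γ X Y ξ s t).re - ξ s t) 0 s := fun s => by
    have h1 := Complex.reCLM.hasFDerivAt.comp_hasDerivAt s
      (hasDerivAt_potentialDensity (γ := γ) hS hξ (s := s) ht)
    have h2 := h1.sub (hξ.isC1.hasDerivAt (s := s) ht)
    refine h2.congr_deriv ?_
    simp [velocityDensity, surfacePoint]
  have := is_const_of_deriv_eq_zero (fun s => (hd s).differentiableAt) (fun s => (hd s).deriv) s 0
  simp [potentialDensity, primitive] at this ⊢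
  linarith

end

/-! ### The closed fluid region in space-time -/

namespace ArcFamily

variable {H : ℝ} {Z Z' Zt : ℝ → ℝ → ℂ}

theorem continuousWithinAt_index (h : ArcFamily Z Z' Zt) {t : ℝ} (ht : 0 ≤ t)
    (hb : ∀ s, -H < (Z s t).im) {p : ℂ} (hp : p ∉ range fun s => Z s t) :
    ContinuousWithinAt (fun x : ℝ × ℂ => index (fun s => Z s x.1) (fun s => Z' s x.1)
      (bedPoint H) x.2) timeSpace (t, p) :=
  h.continuousWithinAt_cauchyDiff (IsDensity.const 1) ht hp
    (Arc.notMem_of_im_le (p := bedPoint H) hb le_rfl)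

theorem eventually_lower (h : ArcFamily Z Z' Zt) (hb : ∀ s t, 0 ≤ t → -H < (Z s t).im) {t : ℝ}
    (ht : 0 ≤ t) {p : ℂ} (hp : p ∈ lowerSide (fun s => Z s t) (fun s => Z' s t) H) :
    ∀ᶠ x in 𝓝[timeSpace] (t, p),
      x.2 ∈ lowerSide (fun s => Z s x.1) (fun s => Z' s x.1) H := by
  have h1 := h.continuousWithinAt_index ht (fun s => hb s t ht) hp.1
  have h2 := Tendsto.eventually_ne (b₂ := 1) h1
    (by simp only [hp.2]; exact zero_ne_one)
  filter_upwards [h2, h.eventually_notMem ht hp.1, self_mem_nhdsWithin] with x hx1 hx2 hx3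
  obtain ⟨c, C, hcC⟩ := h.exists_arc hx3.1
  exact (hcC.mem_or_mem (fun s => hb s x.1 hx3.1) hx2).resolve_left fun hh => hx1 hh.2

theorem eventually_upper (h : ArcFamily Z Z' Zt) (hb : ∀ s t, 0 ≤ t → -H < (Z s t).im) {t : ℝ}
    (ht : 0 ≤ t) {p : ℂ} (hp : p ∈ upperSide (fun s => Z s t) (fun s => Z' s t) H) :
    ∀ᶠ x in 𝓝[timeSpace] (t, p),
      x.2 ∈ upperSide (fun s => Z s x.1) (fun s => Z' s x.1) H := by
  have h1 := h.continuousWithinAt_index ht (fun s => hb s t ht) hp.1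
  have h2 := Tendsto.eventually_ne (b₂ := 0) h1
    (by simp only [hp.2]; exact one_ne_zero)
  filter_upwards [h2, h.eventually_notMem ht hp.1, self_mem_nhdsWithin] with x hx1 hx2 hx3
  obtain ⟨c, C, hcC⟩ := h.exists_arc hx3.1
  exact (hcC.mem_or_mem (fun s => hb s x.1 hx3.1) hx2).resolve_right fun hh => hx1 hh.2

end ArcFamily

theorem mem_tangentConeAt_of_hasDerivWithinAt {E : Type*} [NormedAddCommGroup E] [NormedSpace ℝ E]
    {D : Set E} {u : ℝ → E} {v x : E} (hx : u 0 = x) (hu : HasDerivWithinAt u v (Ici 0) 0)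
    (hD : ∀ᶠ r in 𝓝[>] 0, u r ∈ D) : v ∈ tangentConeAt ℝ D x := by
  have h1 : Tendsto (slope u 0) (𝓝[>] 0) (𝓝 v) :=
    (hasDerivWithinAt_iff_tendsto_slope' (by simp)).1 (hu.mono Ioi_subset_Ici_self)
  have h2 : Tendsto u (𝓝[>] 0) (𝓝 x) := by
    rw [← hx]
    exact hu.continuousWithinAt.tendsto.mono_left (nhdsWithin_mono _ Ioi_subset_Ici_self)
  refine mem_tangentConeAt_of_seq (𝓝[>] (0 : ℝ)) (fun r => r⁻¹) (fun r => u r - x) ?_ ?_ ?_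
  · simpa using h2.sub_const x
  · simpa using hD
  · refine h1.congr fun r => ?_
    rw [slope_def_module, sub_zero, hx]

/-- A set of space-time has unique derivatives at a point at which two orthogonal directions at
fixed time and a direction transversal to these are tangent. -/
theorem uniqueDiffWithinAt_of_tangent {D : Set (ℝ × ℂ)} {x : ℝ × ℂ} {a b : ℂ} (ha : a ≠ 0)
    (hx : x ∈ D) (h1 : (0, a) ∈ tangentConeAt ℝ D x)
    (h2 : (0, -(Complex.I * a)) ∈ tangentConeAt ℝ D x) (h3 : (1, b) ∈ tangentConeAt ℝ D x) :
    UniqueDiffWithinAt ℝ D x := by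
  refine ⟨?_, subset_closure hx⟩
  have hspan : Submodule.span ℝ (tangentConeAt ℝ D x) = ⊤ := by
    rw [eq_top_iff]
    have k1 := Submodule.subset_span (R := ℝ) h1
    have k2 := Submodule.subset_span (R := ℝ) h2
    have k3 := Submodule.subset_span (R := ℝ) h3
    have hz : ∀ z : ℂ, ((0, z) : ℝ × ℂ) ∈ Submodule.span ℝ (tangentConeAt ℝ D x) := by
      intro z
      have e : ((0, z) : ℝ × ℂ) = (z / a).re • ((0, a) : ℝ × ℂ) +
          (-(z / a).im) • ((0, -(Complex.I * a)) : ℝ × ℂ) := by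
        refine Prod.ext (by simp) ?_
        simp only [Prod.smul_mk, Prod.mk_add_mk, Complex.real_smul]
        have := Complex.re_add_im (z / a)
        have hz : z = z / a * a := by field_simp
        conv_lhs => rw [hz, ← this]
        push_cast
        ring
      rw [e]
      exact Submodule.add_mem _ (Submodule.smul_mem _ _ k1) (Submodule.smul_mem _ _ k2)
    rintro ⟨r, z⟩ -
    have e : ((r, z) : ℝ × ℂ) = r • ((1, b) : ℝ × ℂ) + (0, z - r * b) := by
      refine Prod.ext (by simp) (by simp)
    rw [e]
    exact Submodule.add_mem _ (Submodule.smul_mem _ _ k3) (hz _)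
  rw [hspan]
  exact dense_univ

namespace ArcFamily

variable {H : ℝ} {Z Z' Zt : ℝ → ℝ → ℂ}

/-- The closed fluid region has unique derivatives.  At a point of the surface the tangent, the
downward normal and the motion of the particle with fixed parameter are tangent directions. -/
theorem uniqueDiffOn_lowerRegion (h : ArcFamily Z Z' Zt) (hb : ∀ s t, 0 ≤ t → -H < (Z s t).im) :
    UniqueDiffOn ℝ (lowerRegion Z Z' H) := by
  rintro ⟨t, p⟩ hx
  obtain ⟨ht, hp, hpu⟩ := hx
  simp only at ht hp hpu
  obtain ⟨c, C, hcC⟩ := h.exists_arc ht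
  have hbt : ∀ s, -H < (Z s t).im := fun s => hb s t ht
  have hdir : ∀ v : ℂ, HasDerivWithinAt (fun r : ℝ => ((t, p + r * v) : ℝ × ℂ)) (0, v) (Ici 0) 0 := by
    intro v
    have h1 : HasDerivAt (fun r : ℝ => p + (r : ℂ) * v) (1 * v) 0 :=
      (Complex.ofRealCLM.hasDerivAt.mul_const v).const_add p
    rw [one_mul] at h1
    exact ((hasDerivAt_const 0 t).prodMk h1).hasDerivWithinAt
  have hlim : ∀ v : ℂ, Tendsto (fun r : ℝ => ((t, p + r * v) : ℝ × ℂ)) (𝓝[>] 0)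
      (𝓝[timeSpace] (t, p)) := by
    intro v
    refine tendsto_nhdsWithin_iff.2 ⟨?_, Eventually.of_forall fun r => ⟨ht, mem_univ _⟩⟩
    have : Continuous fun r : ℝ => ((t, p + r * v) : ℝ × ℂ) := by fun_prop
    simpa using (this.tendsto 0).mono_left nhdsWithin_le_nhds
  by_cases hps : p ∈ range fun s => Z s t
  · obtain ⟨s, rfl⟩ := hps
    simp only at *
    have him : ∀ᶠ x in 𝓝[timeSpace] (t, Z s t), -H ≤ x.2.im :=
      (((Complex.continuous_im.tendsto _).comp (tendsto_snd (Z s t))).eventually_const_lt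
        (hbt s)).mono fun x hx => le_of_lt hx
    refine uniqueDiffWithinAt_of_tangent (a := Z' s t) (b := Zt s t) (hcC.deriv_ne_zero s)
      ⟨ht, hp, hpu⟩ ?_ ?_ ?_
    · refine mem_tangentConeAt_of_hasDerivWithinAt (u := fun r => (t, Z (s + r) t)) (by simp) ?_ ?_
      · have h1 : HasDerivAt (fun r => Z (s + r) t) (Z' s t) 0 := by
          have := (hcC.hasDeriv (s + 0)).comp_const_add s 0
          simpa using this
        exact ((hasDerivAt_const 0 t).prodMk h1).hasDerivWithinAt
      · exact Eventually.of_forall fun r => ⟨ht, (hbt _).le, fun hh => hh.1 ⟨_, rfl⟩⟩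
    · refine mem_tangentConeAt_of_hasDerivWithinAt (by simp) (hdir _) ?_
      have h1 := (hlim (-(Complex.I * Z' s t))).eventually him
      have h2 : Tendsto (fun r : ℝ => -r) (𝓝[>] 0) (𝓝[<] 0) := by
        have := tendsto_neg_nhdsGT (a := (0 : ℝ))
        rwa [neg_zero] at this
      filter_upwards [h1, h2.eventually (hcC.eventually_tube_lower hbt s)] with r hr1 hr2
      refine ⟨ht, hr1, Arc.notMem_upper_of_lower ?_⟩
      convert hr2 using 1
      push_cast
      ring
    · refine mem_tangentConeAt_of_hasDerivWithinAt (u := fun r => (t + r, Z s (t + r))) (by simp)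
        ?_ ?_
      · have h1 : HasDerivWithinAt (fun r => t + r) 1 (Ici 0) (0 : ℝ) :=
          ((hasDerivAt_id (0 : ℝ)).const_add t).hasDerivWithinAt
        have h2 : HasDerivWithinAt (fun r => Z s (t + r)) (Zt s t) (Ici 0) 0 := by
          have h3 := h.hasDeriv s t ht
          rw [← add_zero t] at h3
          have := h3.scomp (h := fun r => t + r) 0 h1 fun r hr => by
            simp only [mem_Ici] at hr ⊢; linarith
          rw [one_smul, add_zero] at this
          exact this
        exact h1.prodMk h2
      · filter_upwards [self_mem_nhdsWithin] with r hr
        have hr' : 0 ≤ t + r := by linarith [mem_Ioi.1 hr]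
        exact ⟨hr', (hb s _ hr').le, fun hh => hh.1 ⟨_, rfl⟩⟩
  · have hpl := (hcC.mem_or_mem hbt hps).resolve_left hpu
    have hlow := h.eventually_lower hb ht hpl
    refine uniqueDiffWithinAt_of_tangent (a := Complex.I) (b := 0) Complex.I_ne_zero
      ⟨ht, hp, hpu⟩ ?_ ?_ ?_
    · refine mem_tangentConeAt_of_hasDerivWithinAt (by simp) (hdir _) ?_
      filter_upwards [(hlim Complex.I).eventually hlow, self_mem_nhdsWithin] with r hr hr0
      refine ⟨ht, ?_, Arc.notMem_upper_of_lower hr⟩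
      have := mem_Ioi.1 hr0
      simp
      linarith
    · refine mem_tangentConeAt_of_hasDerivWithinAt (by simp) (hdir _) ?_
      filter_upwards [(hlim (-(Complex.I * Complex.I))).eventually hlow] with r hr
      exact ⟨ht, by simpa using hp, Arc.notMem_upper_of_lower hr⟩
    · refine mem_tangentConeAt_of_hasDerivWithinAt (u := fun r => (t + r, p)) (by simp) ?_ ?_
      · exact (((hasDerivAt_id (0 : ℝ)).const_add t).prodMk
          (hasDerivAt_const 0 p)).hasDerivWithinAt
      · have h1 : Tendsto (fun r : ℝ => ((t + r, p) : ℝ × ℂ)) (𝓝[>] 0) (𝓝[timeSpace] (t, p)) := by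
          refine tendsto_nhdsWithin_iff.2 ⟨?_, ?_⟩
          · have : Continuous fun r : ℝ => ((t + r, p) : ℝ × ℂ) := by fun_prop
            simpa using (this.tendsto 0).mono_left nhdsWithin_le_nhds
          · filter_upwards [self_mem_nhdsWithin] with r hr
            exact ⟨by simp only [mem_Ici]; linarith [mem_Ioi.1 hr], mem_univ _⟩
        filter_upwards [h1.eventually hlow, self_mem_nhdsWithin] with r hr hr0
        exact ⟨by simp only; linarith [mem_Ioi.1 hr0], hp, Arc.notMem_upper_of_lower hr⟩

end ArcFamily

/-- The closed fluid region is described by the sides of the curve. -/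
theorem closedRegion_eq {h : ℝ} {X Y ξ : ℝ → ℝ → ℝ} (hS : IsSurface h X Y) (hξ : IsC2 ξ)
    (hD : HasDecay X Y ξ) : closedRegion h X Y =
      lowerRegion (surfacePoint X Y) (surfacePoint (dS X) (dS Y)) h := by
  ext ⟨t, p⟩
  refine and_congr_right fun ht => ?_
  obtain ⟨c, C, hcC⟩ := (arcFamily hS hξ hD).exists_arc ht
  rw [closure_fluidDomain hcC fun s => hS.above s t ht]
  rfl

/-! ### Holomorphic functions between the bottom and the curve -/

namespace ArcFamily

variable {H : ℝ} {Z Z' Zt f : ℝ → ℝ → ℂ}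

/-- A function that is holomorphic between the bottom and the curve, real on the bottom and zero at
infinity is the symmetric Cauchy integral of its boundary values on the curve, and this Cauchy
integral vanishes above the curve.  Indeed both statements say that the Cauchy integral and the
function below the curve fit together to the zero function; they fit together to a
holomorphic function on the half plane above the bottom, to which Liouville's theorem applies. -/
theorem symCauchy_of_holomorphic (h : ArcFamily Z Z' Zt) {t : ℝ} (ht : 0 ≤ t)
    (hb : ∀ s, -H < (Z s t).im) (hg : IsDensity fun s t => f s t * (Z' s t)⁻¹)
    (hfc : Continuous fun s => f s t) {G : ℝ} (hG : ∀ s, ‖f s t‖ ≤ G)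
    (hf : Integrable fun s => f s t)
    (hg0 : Tendsto (fun s => f s t * (Z' s t)⁻¹) (cocompact ℝ) (𝓝 0)) {w : ℂ → ℂ}
    (hwc : ContinuousOn w {p | -H ≤ p.im ∧ p ∉ upperSide (fun s => Z s t) (fun s => Z' s t) H})
    (hwd : DifferentiableOn ℂ w
      ({p | -H < p.im} ∩ lowerSide (fun s => Z s t) (fun s => Z' s t) H))
    (hws : ∀ s, w (Z s t) = f s t * (Z' s t)⁻¹) (hwr : ∀ p : ℂ, p.im = -H → (w p).im = 0)
    (hw0 : ∀ ε > 0, ∃ R, ∀ p : ℂ, -H ≤ p.im →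
      p ∉ upperSide (fun s => Z s t) (fun s => Z' s t) H → R ≤ ‖p‖ → ‖w p‖ ≤ ε) :
    (∀ p ∈ upperSide (fun s => Z s t) (fun s => Z' s t) H,
      symCauchy (fun s => Z s t) H (fun s => f s t) p = 0) ∧
    ∀ p ∈ lowerSide (fun s => Z s t) (fun s => Z' s t) H, -H ≤ p.im →
      w p = -symCauchy (fun s => Z s t) H (fun s => f s t) p := by
  classical
  obtain ⟨c, C, hcC⟩ := h.exists_arc ht
  obtain ⟨A, hA⟩ := hg.bound (t + 1) (by linarith)
  have hAt := hA t ⟨ht, by linarith⟩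
  set γ : ℝ → ℂ := fun s => Z s t with hγ
  set γ' : ℝ → ℂ := fun s => Z' s t with hγ'
  set g : ℝ → ℂ := fun s => f s t * (γ' s)⁻¹ with hgdef
  set o := bedPoint H with ho
  have ho' : o ∉ range γ := Arc.notMem_of_im_le (p := bedPoint H) hb le_rfl
  have hgc : Continuous g := hfc.mul (hcC.continuous_deriv.inv₀ hcC.deriv_ne_zero)
  -- `M` is the regular part of the symmetric Cauchy integral plus `W`.  As the Cauchy integral
  -- jumps by `g` across the curve, `M` is the Cauchy integral above the curve and its sum with `w`
  -- below it.
  set W : ℂ → ℂ := fun p => if p ∈ upperSide γ γ' H then g (foot γ p) else w p with hW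
  set M : ℂ → ℂ := fun p => cauchyReg γ γ' o g p +
    (starRingEnd ℂ) (cauchyDiff γ γ' o g (reflect H p)) + symCauchy γ H (fun s => f s t) o + W p
    with hM
  have hMup : ∀ p ∈ upperSide γ γ' H, M p = symCauchy γ H (fun s => f s t) p := by
    intro p hp
    have h1 := hcC.cauchyDiff_eq_cauchyReg hgc hAt.1 hp.1 ho'
    have h2 := hcC.symCauchyDiff_div hb hf hp.1
      (hcC.reflect_mem_lower hb (hcC.im_gt_of_mem_upper hb hp).le).1
    rw [hp.2, mul_one] at h1
    simp only [symCauchyDiff] at h2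
    simp only [hM, hW, if_pos hp]
    rw [h1] at h2
    linear_combination h2
  have hMlow : ∀ p ∈ lowerSide γ γ' H, -H ≤ p.im →
      M p = symCauchy γ H (fun s => f s t) p + w p := by
    intro p hp hpi
    have h1 := hcC.cauchyDiff_eq_cauchyReg hgc hAt.1 hp.1 ho'
    have h2 := hcC.symCauchyDiff_div hb hf hp.1 (hcC.reflect_mem_lower hb hpi).1
    rw [hp.2, mul_zero, add_zero] at h1
    simp only [symCauchyDiff] at h2
    simp only [hM, hW, if_neg (Arc.notMem_upper_of_lower hp)]
    rw [h1] at h2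
    linear_combination h2
  have hSd : ∀ p, p ∉ range γ → -H ≤ p.im →
      DifferentiableAt ℂ (symCauchy γ H fun s => f s t) p := fun p hp hpi =>
    hcC.differentiableAt_symCauchy hb hfc hG hf hp (hcC.reflect_mem_lower hb hpi).1
  have hopen : IsOpen {p : ℂ | -H < p.im} := isOpen_lt continuous_const Complex.continuous_im
  -- `W` is continuous across the curve, since `w` has the boundary values `g`
  have hcont : ContinuousOn M {p | -H ≤ p.im} := by
    intro p hp
    by_cases hps : p ∈ range γ
    · obtain ⟨s, rfl⟩ := hps
      have l0 : ContinuousWithinAt (fun q : ℂ => ((t, q) : ℝ × ℂ)) {p | -H ≤ p.im} (γ s) := by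
        fun_prop
      have l1 : MapsTo (fun q : ℂ => ((t, q) : ℝ × ℂ)) {p | -H ≤ p.im} timeSpace :=
        fun q _ => ⟨ht, mem_univ _⟩
      have h1 := (h.continuousWithinAt_cauchyReg hg ht s ho').comp (x := γ s) l0 l1
      have h2 := (h.continuousWithinAt_cauchyDiff_reflect hg ht hb (p := γ s)
        (hcC.reflect_mem_lower hb hp).1).comp (x := γ s) l0 l1
      have h3 : ContinuousWithinAt W {p | -H ≤ p.im} (γ s) := by
        have hWs : W (γ s) = g s := by
          simp only [hW, if_neg fun hh : γ s ∈ upperSide γ γ' H => hh.1 ⟨s, rfl⟩]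
          exact hws s
        have h4 : ContinuousWithinAt W {p | -H ≤ p.im ∧ p ∉ upperSide γ γ' H} (γ s) := by
          refine (hwc (γ s) ⟨hp, fun hh => hh.1 ⟨s, rfl⟩⟩).congr (fun q hq => ?_) ?_
          · simp only [hW, if_neg hq.2]
          · simp only [hW, if_neg fun hh : γ s ∈ upperSide γ γ' H => hh.1 ⟨s, rfl⟩]
        have h5 : ContinuousWithinAt W (upperSide γ γ' H) (γ s) := by
          have h6 : Tendsto (fun q : ℂ => ((t, q) : ℝ × ℂ)) (𝓝[upperSide γ γ' H] (γ s))
              (𝓝[timeSpace] (t, Z s t)) := tendsto_prodMk ht (tendsto_id.mono_left nhdsWithin_le_nhds)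
          have h7 := (tendsto_of_density hg ht (Z s t) (h.tendsto_foot ht s)).comp h6
          rw [ContinuousWithinAt, hWs]
          refine h7.congr' ?_
          filter_upwards [self_mem_nhdsWithin] with q hq
          simp only [hW, if_pos hq]
          rfl
        refine (h4.union h5).mono fun q hq => ?_
        by_cases hqu : q ∈ upperSide γ γ' H
        · exact Or.inr hqu
        · exact Or.inl ⟨hq, hqu⟩
      exact ((h1.add h2).add _root_.continuousWithinAt_const).add h3
    · rcases hcC.mem_or_mem hb hps with hp' | hp'
      · refine ((hSd p hps hp).continuousAt.congr ?_).continuousWithinAt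
        filter_upwards [(hcC.isOpen_upper hb).mem_nhds hp'] with q hq using (hMup q hq).symm
      · have h1 : ContinuousWithinAt (fun p => symCauchy γ H (fun s => f s t) p + w p)
            ({p | -H ≤ p.im} ∩ lowerSide γ γ' H) p :=
          (hSd p hps hp).continuousAt.continuousWithinAt.add
            ((hwc p ⟨hp, Arc.notMem_upper_of_lower hp'⟩).mono fun q hq =>
              ⟨hq.1, Arc.notMem_upper_of_lower hq.2⟩)
        refine ContinuousWithinAt.mono_of_mem_nhdsWithin (h1.congr (fun q hq =>
          hMlow q hq.2 hq.1) (hMlow p hp' hp)) ?_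
        exact inter_mem self_mem_nhdsWithin
          (mem_nhdsWithin_of_mem_nhds ((hcC.isOpen_lower hb).mem_nhds hp'))
  have hdiff : DifferentiableOn ℂ M {p | -H < p.im} := by
    refine hcC.differentiableOn_of_diff hopen (hcont.mono fun p (hp : -H < p.im) => le_of_lt hp) ?_
    rintro p ⟨hp, hps⟩
    refine DifferentiableAt.differentiableWithinAt ?_
    rcases hcC.mem_or_mem hb hps with hp' | hp'
    · refine (hSd p hps (le_of_lt hp)).congr_of_eventuallyEq ?_
      filter_upwards [(hcC.isOpen_upper hb).mem_nhds hp'] with q hq using hMup q hq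
    · have hmem := (hopen.inter (hcC.isOpen_lower hb)).mem_nhds ⟨hp, hp'⟩
      refine ((hSd p hps (le_of_lt hp)).add (hwd.differentiableAt hmem)).congr_of_eventuallyEq ?_
      filter_upwards [hmem] with q hq using hMlow q hq.2 (le_of_lt hq.1)
  have hreal : ∀ p : ℂ, p.im = -H → (M p).im = 0 := by
    intro p hp
    rw [hMlow p (hcC.mem_lower_of_im_le hb hp.le) hp.ge, Complex.add_im, symCauchy_im_eq_zero hp,
      hwr p hp, add_zero]
  have hdecay : ∀ ε > 0, ∃ R, ∀ p : ℂ, -H ≤ p.im → R ≤ ‖p‖ → ‖M p‖ ≤ ε := by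
    intro ε hε
    obtain ⟨R1, hR1⟩ := hcC.exists_norm_symCauchy_le hb hfc hAt.1 hAt.2 hf hg0 (half_pos hε)
    obtain ⟨R2, hR2⟩ := hw0 _ (half_pos hε)
    have hoff : ∀ p ∉ range γ, -H ≤ p.im → max R1 R2 ≤ ‖p‖ → ‖M p‖ ≤ ε := by
      intro p hp hpi hpR
      have h1 := hR1 p hp hpi ((le_max_left _ _).trans hpR)
      rcases hcC.mem_or_mem hb hp with hp' | hp'
      · rw [hMup p hp']
        linarith
      · rw [hMlow p hp' hpi]
        have h2 := hR2 p hpi (Arc.notMem_upper_of_lower hp') ((le_max_right _ _).trans hpR)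
        exact (norm_add_le _ _).trans (by linarith)
    refine ⟨max R1 R2 + 1, fun p hpi hpR => ?_⟩
    by_cases hps : p ∈ range γ
    · -- points of the curve are limits of points above the curve
      obtain ⟨s, rfl⟩ := hps
      have h1 : Tendsto (fun n : ℝ => γ s + n * (Complex.I * γ' s)) (𝓝[>] 0) (𝓝 (γ s)) :=
        (Arc.tendsto_normal γ γ' s).mono_left nhdsWithin_le_nhds
      have h2 := hcC.eventually_tube_upper hb s
      have h3 : Tendsto (fun n : ℝ => γ s + n * (Complex.I * γ' s)) (𝓝[>] 0)
          (𝓝[{p | -H ≤ p.im}] (γ s)) := by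
        refine tendsto_nhdsWithin_iff.2 ⟨h1, ?_⟩
        filter_upwards [h2] with n hn using (hcC.im_gt_of_mem_upper hb hn).le
      have h4 := ((hcont (γ s) hpi).tendsto.comp h3).norm
      refine le_of_tendsto h4 ?_
      have h5 : max R1 R2 < ‖γ s‖ := by linarith
      filter_upwards [h2, h1.norm.eventually_const_lt h5] with n hn hn'
      exact hoff _ hn.1 (hcC.im_gt_of_mem_upper hb hn).le hn'.le
    · exact hoff p hps hpi (by linarith)
  have hzero : ∀ p : ℂ, -H ≤ p.im → M p = 0 := fun p hp =>
    eq_zero_of_halfPlane hcont hdiff hreal hdecay hp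
  refine ⟨fun p hp => ?_, fun p hp hpi => ?_⟩
  · rw [← hMup p hp]
    exact hzero p (hcC.im_gt_of_mem_upper hb hp).le
  · have := hzero p hpi
    rw [hMlow p hp hpi] at this
    linear_combination this

end ArcFamily

/-! ### The nonlocal equation in terms of Cauchy integrals -/

section

variable {h γ : ℝ} {X Y ξ : ℝ → ℝ → ℝ} {t : ℝ}

theorem nonlocalIntegrand_eq (k s : ℝ) : nonlocalIntegrand h γ X Y ξ k t s =
    Complex.exp (Complex.I * k * X s t) * ((dS ξ s t * Real.sinh (k * (Y s t + h)) : ℝ) +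
      Complex.I * (normalFlux γ X Y s t * Real.cosh (k * (Y s t + h)) : ℝ)) := rfl

/-- Negative wave numbers give the complex conjugate equation. -/
theorem nonlocalIntegrand_neg (k s : ℝ) : nonlocalIntegrand h γ X Y ξ (-k) t s =
    -(starRingEnd ℂ) (nonlocalIntegrand h γ X Y ξ k t s) := by
  rw [nonlocalIntegrand_eq, nonlocalIntegrand_eq, map_mul, ← Complex.exp_conj]
  simp only [map_add, map_mul, Complex.conj_I, Complex.conj_ofReal, neg_mul, Real.sinh_neg,
    Real.cosh_neg, Complex.ofReal_neg, mul_neg]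
  push_cast
  ring

/-- The integrand of the nonlocal equation as the difference of the exponential moments of the
surface and of its mirror image. -/
theorem sub_exp_eq_nonlocalIntegrand (k s : ℝ) :
    velocityDensity γ X Y ξ s t * Complex.exp (Complex.I * k * (0 - surfacePoint X Y s t)) -
      (starRingEnd ℂ) (velocityDensity γ X Y ξ s t) *
        Complex.exp (Complex.I * k * (0 - reflect h (surfacePoint X Y s t))) =
    2 * Complex.exp (-(k * h : ℝ)) *
      (starRingEnd ℂ) (nonlocalIntegrand h γ X Y ξ k t s) := by
  have e1 : Complex.exp (Complex.I * k * (0 - surfacePoint X Y s t)) =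
      Complex.exp (-(k * h : ℝ)) * (Complex.exp (-(Complex.I * k * X s t)) *
        Complex.exp (k * (Y s t + h) : ℝ)) := by
    rw [← Complex.exp_add, ← Complex.exp_add, surfacePoint_eq]
    congr 1
    push_cast
    linear_combination -(k * Y s t : ℂ) * Complex.I_sq
  have e2 : Complex.exp (Complex.I * k * (0 - reflect h (surfacePoint X Y s t))) =
      Complex.exp (-(k * h : ℝ)) * (Complex.exp (-(Complex.I * k * X s t)) *
        Complex.exp (-(k * (Y s t + h) : ℝ))) := by
    rw [← Complex.exp_add, ← Complex.exp_add, reflect_eq, surfacePoint_eq]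
    simp only [map_add, map_mul, Complex.conj_I, Complex.conj_ofReal]
    congr 1
    push_cast
    linear_combination (k * Y s t + 2 * k * h : ℂ) * Complex.I_sq
  have e3 : (starRingEnd ℂ) (Complex.exp (Complex.I * k * X s t)) =
      Complex.exp (-(Complex.I * k * X s t)) := by
    rw [← Complex.exp_conj]
    simp
  rw [e1, e2, nonlocalIntegrand_eq, velocityDensity, surfacePoint_eq, map_mul, e3]
  simp only [map_add, map_mul, Complex.conj_I, Complex.conj_ofReal]
  push_cast
  rw [Complex.sinh, Complex.cosh]
  ring

theorem continuous_nonlocalIntegrand (hS : IsSurface h X Y) (hξ : IsC2 ξ) (ht : 0 ≤ t) (k : ℝ) :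
    Continuous (nonlocalIntegrand h γ X Y ξ k t) := by
  have c1 : ∀ {F : ℝ → ℝ → ℝ}, ContinuousOn (fun p : ℝ × ℝ => F p.1 p.2) paramSpace →
      Continuous fun s => F s t := fun hF =>
    continuousOn_univ.1 (hF.comp (f := fun s => (s, t)) (by fun_prop) fun _ _ => ⟨mem_univ _, ht⟩)
  have h1 := c1 hS.smoothX.isC1.continuousOn
  have h2 := c1 hS.smoothY.isC1.continuousOn
  have h3 := c1 hξ.isC1.continuousOn_dS
  have h4 := c1 (isC1_normalFlux (γ := γ) hS.smoothX hS.smoothY).continuousOn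
  simp only [funext fun s => nonlocalIntegrand_eq (h := h) (γ := γ) (X := X) (Y := Y) (ξ := ξ)
    (t := t) k s]
  have h5 := Real.continuous_sinh
  have h6 := Real.continuous_cosh
  fun_prop

theorem exists_nonlocalIntegrand_le (hS : IsSurface h X Y) (hξ : IsC2 ξ)
    (hD : HasDecay X Y ξ) (ht : 0 ≤ t) : ∃ B : ℝ, ∀ k s,
    ‖nonlocalIntegrand h γ X Y ξ k t s‖ ≤ 2 * ‖velocityDensity γ X Y ξ s t‖ * Real.exp (|k| * B) := by
  obtain ⟨C, b, hb⟩ := exists_surfaceBounds hS hξ hD (T := t + 1) (by linarith)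
  refine ⟨C + |h|, fun k s => ?_⟩
  have hY := (hb.bound s t ⟨ht, by linarith⟩).1
  have h1 : |k * (Y s t + h)| ≤ |k| * (C + |h|) := by
    rw [abs_mul]
    exact mul_le_mul_of_nonneg_left ((abs_add_le _ _).trans (by linarith)) (abs_nonneg _)
  set u := k * (Y s t + h) with hu
  set E := Real.exp (|k| * (C + |h|)) with hE
  have hp : Real.exp u ≤ E := Real.exp_le_exp.2 ((le_abs_self _).trans h1)
  have hn : Real.exp (-u) ≤ E := Real.exp_le_exp.2 ((neg_le_abs _).trans h1)
  have hc : |Real.cosh u| ≤ E := by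
    rw [abs_of_pos (Real.cosh_pos u), Real.cosh_eq]; linarith
  have hs : |Real.sinh u| ≤ E := by
    rw [Real.sinh_eq, abs_le]
    have := Real.exp_pos u
    have := Real.exp_pos (-u)
    constructor <;> linarith
  have hre : |dS ξ s t| ≤ ‖velocityDensity γ X Y ξ s t‖ :=
    Complex.abs_re_le_norm (velocityDensity γ X Y ξ s t)
  have him : |normalFlux γ X Y s t| ≤ ‖velocityDensity γ X Y ξ s t‖ := by
    have := Complex.abs_im_le_norm (velocityDensity γ X Y ξ s t)
    simpa [velocityDensity, surfacePoint] using this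
  rw [nonlocalIntegrand_eq, norm_mul, Complex.norm_exp]
  have hz : (Complex.I * k * X s t : ℂ).re = 0 := by simp
  rw [hz, Real.exp_zero, one_mul]
  refine (norm_add_le _ _).trans ?_
  rw [norm_mul, Complex.norm_I, one_mul, Complex.norm_real, Complex.norm_real, Real.norm_eq_abs,
    Real.norm_eq_abs, abs_mul, abs_mul]
  have k1 := mul_le_mul hre hs (abs_nonneg _) (norm_nonneg _)
  have k2 := mul_le_mul him hc (abs_nonneg _) (norm_nonneg _)
  linarith

theorem integrable_nonlocalIntegrand (hS : IsSurface h X Y) (hξ : IsC2 ξ)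
    (hD : HasDecay X Y ξ) (ht : 0 ≤ t) (k : ℝ) :
    Integrable (nonlocalIntegrand h γ X Y ξ k t) := by
  obtain ⟨B, hB⟩ := exists_nonlocalIntegrand_le (γ := γ) hS hξ hD ht
  exact (((integrable_velocityDensity hS hξ hD ht).norm.const_mul 2).mul_const _).mono'
    (continuous_nonlocalIntegrand hS hξ ht k).aestronglyMeasurable
    (Eventually.of_forall (hB k))

theorem continuousAt_integral_nonlocalIntegrand (hS : IsSurface h X Y) (hξ : IsC2 ξ)
    (hD : HasDecay X Y ξ) (ht : 0 ≤ t) :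
    ContinuousAt (fun k => ∫ s, nonlocalIntegrand h γ X Y ξ k t s) 0 := by
  obtain ⟨B, hB⟩ := exists_nonlocalIntegrand_le (γ := γ) hS hξ hD ht
  refine continuousAt_of_dominated (bound := fun s => 2 * ‖velocityDensity γ X Y ξ s t‖ *
    Real.exp |B|) ?_ ?_ ?_ ?_
  · exact Eventually.of_forall fun k =>
      (continuous_nonlocalIntegrand hS hξ ht k).aestronglyMeasurable
  · filter_upwards [Metric.ball_mem_nhds (0 : ℝ) one_pos] with k hk
    refine Eventually.of_forall fun s => (hB k s).trans ?_
    have hk1 : |k| ≤ 1 := by simpa using (Metric.mem_ball.1 hk).le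
    gcongr
    calc |k| * B ≤ |k| * |B| := by gcongr; exact le_abs_self B
      _ ≤ 1 * |B| := by gcongr
      _ = |B| := one_mul _
  · exact ((integrable_velocityDensity hS hξ hD ht).norm.const_mul 2).mul_const _
  · refine Eventually.of_forall fun s => ?_
    simp only [nonlocalIntegrand_eq]
    have h5 := Real.continuous_sinh
    have h6 := Real.continuous_cosh
    have : Continuous fun k : ℝ => Complex.exp (Complex.I * k * X s t) *
      ((dS ξ s t * Real.sinh (k * (Y s t + h)) : ℝ) +
      Complex.I * (normalFlux γ X Y s t * Real.cosh (k * (Y s t + h)) : ℝ)) := by fun_prop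
    exact this.continuousAt

/-- The equation for positive wave numbers implies it for all: by conjugation for negative ones, and
by continuity for zero. -/
theorem integral_nonlocalIntegrand_eq_zero (hS : IsSurface h X Y) (hξ : IsC2 ξ)
    (hD : HasDecay X Y ξ) (ht : 0 ≤ t)
    (h0 : ∀ k : ℝ, 0 < k → ∫ s, nonlocalIntegrand h γ X Y ξ k t s = 0) (k : ℝ) :
    ∫ s, nonlocalIntegrand h γ X Y ξ k t s = 0 := by
  rcases lt_trichotomy k 0 with hk | rfl | hk
  · have h1 := h0 (-k) (by linarith)
    have h2 : ∀ s, nonlocalIntegrand h γ X Y ξ k t s =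
        -(starRingEnd ℂ) (nonlocalIntegrand h γ X Y ξ (-k) t s) := fun s => by
      rw [← nonlocalIntegrand_neg, neg_neg]
    simp_rw [h2]
    rw [integral_neg, integral_conj, h1, map_zero, neg_zero]
  · have h1 := (continuousAt_integral_nonlocalIntegrand (γ := γ) hS hξ hD ht).tendsto.mono_left
      (nhdsWithin_le_nhds (s := Ioi 0))
    refine tendsto_nhds_unique h1 (tendsto_const_nhds.congr' ?_)
    filter_upwards [self_mem_nhdsWithin] with r hr using (h0 r hr).symm
  · exact h0 k hk

theorem integrable_velocityDensity_mul_exp (hS : IsSurface h X Y) (hξ : IsC2 ξ)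
    (hD : HasDecay X Y ξ) (ht : 0 ≤ t) (k : ℝ) :
    Integrable (fun s => velocityDensity γ X Y ξ s t *
      Complex.exp (Complex.I * k * (0 - surfacePoint X Y s t))) ∧
    Integrable (fun s => (starRingEnd ℂ) (velocityDensity γ X Y ξ s t) *
      Complex.exp (Complex.I * k * (0 - reflect h (surfacePoint X Y s t)))) := by
  obtain ⟨c, C, hcC⟩ := (arcFamily hS hξ hD).exists_arc ht
  have hf := integrable_velocityDensity (γ := γ) hS hξ hD ht
  have hf2 : Integrable fun s => (starRingEnd ℂ) (velocityDensity γ X Y ξ s t) :=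
    Complex.conjCLE.toContinuousLinearMap.integrable_comp hf
  have hZ := hcC.continuous
  have hR : Continuous fun s => reflect h (surfacePoint X Y s t) :=
    (continuous_reflect h).comp hcC.continuous
  have hle : ∀ (z : ℂ) (B : ℝ), |z.im| ≤ B →
      ‖Complex.exp (Complex.I * k * (0 - z))‖ ≤ Real.exp (|k| * B) := by
    intro z B hz
    rw [Complex.norm_exp]
    apply Real.exp_le_exp.2
    have e : (Complex.I * k * (0 - z)).re = k * z.im := by simp
    rw [e]
    refine (le_abs_self _).trans ?_
    rw [abs_mul]
    exact mul_le_mul_of_nonneg_left hz (abs_nonneg _)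
  refine ⟨hf.mul_bdd (c := Real.exp (|k| * C)) (by fun_prop)
    (Eventually.of_forall fun s => hle _ _ (hcC.im_le s)),
    hf2.mul_bdd (c := Real.exp (|k| * (C + 2 * |h|)))
    (Continuous.aestronglyMeasurable
      (Complex.continuous_exp.comp (continuous_const.mul (continuous_const.sub hR))))
    (Eventually.of_forall fun s => hle _ _ ?_)⟩
  have h1 := hcC.im_le s
  simp only [reflect]
  have h2 := abs_sub (-(surfacePoint X Y s t).im) (2 * h)
  rw [abs_neg, abs_mul, abs_two] at h2
  linarith

/-- The difference of the exponential moments of the surface and of its mirror image is, up to a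
nonzero factor, the conjugate of the integral in the nonlocal equation. -/
theorem expTransform_sub (hS : IsSurface h X Y) (hξ : IsC2 ξ)
    (hD : HasDecay X Y ξ) (ht : 0 ≤ t) (k : ℝ) (z : ℂ) :
    expTransform (fun s => surfacePoint X Y s t) (fun s => velocityDensity γ X Y ξ s t) z k -
      expTransform (fun s => reflect h (surfacePoint X Y s t))
        (fun s => (starRingEnd ℂ) (velocityDensity γ X Y ξ s t)) z k =
    Complex.exp (Complex.I * k * z) * (2 * Complex.exp (-(k * h : ℝ)) *
      (starRingEnd ℂ) (∫ s, nonlocalIntegrand h γ X Y ξ k t s)) := by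
  have h1 : ∀ ζ f : ℝ → ℂ, expTransform ζ f z k =
      Complex.exp (Complex.I * k * z) * ∫ s, f s * Complex.exp (Complex.I * k * (0 - ζ s)) := by
    intro ζ f
    rw [expTransform, ← integral_const_mul]
    congr 1
    ext s
    rw [show Complex.I * k * (z - ζ s) = Complex.I * k * z + Complex.I * k * (0 - ζ s) by ring,
      Complex.exp_add]
    ring
  obtain ⟨i1, i2⟩ := integrable_velocityDensity_mul_exp (γ := γ) hS hξ hD ht k
  rw [h1, h1, ← mul_sub, ← integral_sub i1 i2]
  simp_rw [sub_exp_eq_nonlocalIntegrand]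
  rw [integral_const_mul, integral_conj]

/-- The nonlocal equation says that the symmetric Cauchy integral of the boundary velocity vanishes
above the surface. -/
theorem nonlocal_iff (hh : 0 < h) (hS : IsSurface h X Y) (hξ : IsC2 ξ)
    (hD : HasDecay X Y ξ) (ht : 0 ≤ t) :
    (∀ k, Integrable (nonlocalIntegrand h γ X Y ξ k t) ∧
      ∫ s, nonlocalIntegrand h γ X Y ξ k t s = 0) ↔
    ∀ p ∈ upperSide (fun s => surfacePoint X Y s t) (fun s => surfacePoint (dS X) (dS Y) s t) h,
      symCauchy (fun s => surfacePoint X Y s t) h (fun s => velocityDensity γ X Y ξ s t) p = 0 := by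
  obtain ⟨c, C, hcC⟩ := (arcFamily hS hξ hD).exists_arc ht
  have hb : ∀ s, -h < (surfacePoint X Y s t).im := fun s => hS.above s t ht
  have hf := integrable_velocityDensity (γ := γ) hS hξ hD ht
  have hd := isDensity_velocityDensity (γ := γ) hS hξ hD
  obtain ⟨A, hA⟩ := hd.bound (t + 1) (by linarith)
  have hiff := hcC.symCauchy_eq_zero_iff hh.le hf
  constructor
  · intro h0 p hp
    refine hcC.symCauchy_eq_zero_of_upper hb (hd.continuous ht) (hA t ⟨ht, by linarith⟩).1 hf ?_ hp
    refine hiff.2 fun k _ z _ => sub_eq_zero.1 ?_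
    rw [expTransform_sub hS hξ hD ht, (h0 k).2]
    simp
  · intro h0 k
    refine ⟨integrable_nonlocalIntegrand hS hξ hD ht k,
      integral_nonlocalIntegrand_eq_zero hS hξ hD ht (fun k hk => ?_) k⟩
    have hz : C < (⟨0, C + 1⟩ : ℂ).im := by simp
    have h1 := sub_eq_zero.2 (hiff.1 (fun z hz => h0 z (hcC.mem_upper_of_im_gt hb hz)) k hk _ hz)
    rw [expTransform_sub hS hξ hD ht] at h1
    simpa using h1

end

/-! ### The surface equations satisfied by a solution -/

theorem clm_apply_eq (L : ℝ × ℂ →L[ℝ] ℝ) (r : ℝ) (z : ℂ) :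
    L (r, z) = r * L (1, 0) + z.re * L (0, 1) + z.im * L (0, Complex.I) := by
  have e : ((r, z) : ℝ × ℂ) = r • ((1, 0) : ℝ × ℂ) + z.re • ((0, 1) : ℝ × ℂ) +
      z.im • ((0, Complex.I) : ℝ × ℂ) := by
    refine Prod.ext (by simp) ?_
    simp only [Prod.smul_mk, Prod.mk_add_mk, Complex.real_smul, mul_zero, zero_add, mul_one]
    exact (Complex.re_add_im z).symm
  rw [e, map_add, map_add, map_smul, map_smul, map_smul, smul_eq_mul, smul_eq_mul, smul_eq_mul]

/-- The complex velocity perturbation `φ_x - i φ_y`. -/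
def complexVelocity (h : ℝ) (X Y : ℝ → ℝ → ℝ) (φ : ℝ × ℂ → ℝ) (x : ℝ × ℂ) : ℂ :=
  phiX h X Y φ x.1 x.2 - Complex.I * phiY h X Y φ x.1 x.2

theorem velocityDensity_eq (γ : ℝ) (X Y ξ : ℝ → ℝ → ℝ) (s t : ℝ) :
    velocityDensity γ X Y ξ s t = dS ξ s t - Complex.I * normalFlux γ X Y s t := by
  rw [velocityDensity, surfacePoint_eq]
  push_cast
  ring

/-- The tangential derivative and the normal flux determine the velocity on the surface. -/
theorem velocity_mul_tangent {a b x y ξs n : ℝ} (h1 : ξs = a * x + b * y) (h2 : n = b * x - a * y) :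
    ((a : ℂ) - Complex.I * b) * (x + Complex.I * y) = ξs - Complex.I * n := by
  rw [h1, h2]
  push_cast
  linear_combination -(b * y : ℂ) * Complex.I_sq

/-- The Bernoulli condition, expressed in terms of the surface variables. -/
theorem bernoulli_algebra {γ a b x y xt yt v ξs : ℝ} (hJ : 0 < x ^ 2 + y ^ 2)
    (hk : (a - γ * v - xt) * (-y) + (b - yt) * x = 0) (hs : ξs = a * x + b * y) :
    γ * v * (2 * x * y * yt - 2 * y ^ 2 * xt - 2 * ξs * x + γ * x ^ 2 * v) /
        (2 * (x ^ 2 + y ^ 2)) + (ξs - x * xt - y * yt) ^ 2 / (2 * (x ^ 2 + y ^ 2)) =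
      (1 / 2) * (b - yt) ^ 2 + (1 / 2) * (a - xt) ^ 2 - γ * v * a + (1 / 2) * (γ * v) ^ 2 := by
  rw [← add_div, div_eq_iff (by positivity), hs]
  linear_combination (-((a - γ * v - xt) * (-y) + (b - yt) * x)) * hk

section

variable {h γ g σ : ℝ} {X Y ξ : ℝ → ℝ → ℝ} {φ : ℝ × ℂ → ℝ} {s t : ℝ}

theorem surfacePoint_mem_closedRegion (hS : IsSurface h X Y) (hξ : IsC2 ξ) (hD : HasDecay X Y ξ)
    (s : ℝ) (ht : 0 ≤ t) : (t, surfacePoint X Y s t) ∈ closedRegion h X Y := by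
  rw [closedRegion_eq hS hξ hD]
  exact ⟨ht, (hS.above s t ht).le, fun hh => hh.1 ⟨s, rfl⟩⟩

theorem uniqueDiffOn_closedRegion (hS : IsSurface h X Y) (hξ : IsC2 ξ) (hD : HasDecay X Y ξ) :
    UniqueDiffOn ℝ (closedRegion h X Y) := by
  rw [closedRegion_eq hS hξ hD]
  exact (arcFamily hS hξ hD).uniqueDiffOn_lowerRegion hS.above

theorem trace_dS (hS : IsSurface h X Y) (hξ : IsC2 ξ) (hD : HasDecay X Y ξ)
    (hφ : DifferentiableOn ℝ φ (closedRegion h X Y)) (hT : IsTrace X Y ξ φ) (ht : 0 ≤ t) :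
    dS ξ s t = phiX h X Y φ t (surfacePoint X Y s t) * dS X s t +
      phiY h X Y φ t (surfacePoint X Y s t) * dS Y s t := by
  have hm := fun s => surfacePoint_mem_closedRegion hS hξ hD s ht
  have h1 : HasDerivWithinAt (fun r => (t, surfacePoint X Y r t))
      (0, surfacePoint (dS X) (dS Y) s t) univ s :=
    ((hasDerivAt_const s t).prodMk
      (hasDerivAt_surfacePoint hS.smoothX.isC1 hS.smoothY.isC1 ht)).hasDerivWithinAt
  have h2 := (hφ _ (hm s)).hasFDerivWithinAt.comp_hasDerivWithinAt s h1 fun r _ => hm r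
  have h3 : HasDerivAt (fun r => ξ r t) _ s :=
    (hasDerivWithinAt_univ.1 h2).congr_of_eventuallyEq
      (Eventually.of_forall fun r => hT r t ht)
  rw [dS, h3.deriv, clm_apply_eq]
  simp only [phiX, phiY, surfacePoint, zero_mul, zero_add]
  ring

theorem trace_dT (hS : IsSurface h X Y) (hξ : IsC2 ξ) (hD : HasDecay X Y ξ)
    (hφ : DifferentiableOn ℝ φ (closedRegion h X Y)) (hT : IsTrace X Y ξ φ) (ht : 0 ≤ t) :
    dT ξ s t = phiT h X Y φ t (surfacePoint X Y s t) +
      phiX h X Y φ t (surfacePoint X Y s t) * dT X s t +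
      phiY h X Y φ t (surfacePoint X Y s t) * dT Y s t := by
  have hm := fun (r : ℝ) (hr : 0 ≤ r) => surfacePoint_mem_closedRegion hS hξ hD s hr
  have h1 : HasDerivWithinAt (fun r => (r, surfacePoint X Y s r))
      (1, surfacePoint (dT X) (dT Y) s t) (Ici 0) t :=
    (hasDerivAt_id t).hasDerivWithinAt.prodMk
      (hasDerivWithinAt_surfacePoint hS.smoothX.isC1 hS.smoothY.isC1 ht)
  have h2 := (hφ _ (hm t ht)).hasFDerivWithinAt.comp_hasDerivWithinAt t h1 fun r hr => hm r hr
  have h3 : HasDerivWithinAt (fun r => ξ s r) _ (Ici 0) t :=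
    h2.congr (fun r hr => hT s r hr) (hT s t ht)
  rw [dT, h3.derivWithin (uniqueDiffOn_Ici 0 t ht), clm_apply_eq]
  simp only [phiX, phiY, phiT, surfacePoint]
  ring

/-- The kinematic condition in terms of the normal flux. -/
theorem kinematic_iff : (phiX h X Y φ t (surfacePoint X Y s t) - γ * Y s t - dT X s t) *
      (-dS Y s t) + (phiY h X Y φ t (surfacePoint X Y s t) - dT Y s t) * dS X s t = 0 ↔
    normalFlux γ X Y s t = phiY h X Y φ t (surfacePoint X Y s t) * dS X s t -
      phiX h X Y φ t (surfacePoint X Y s t) * dS Y s t := by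
  rw [normalFlux]
  constructor <;> intro hk <;> linear_combination -hk

/-- Under the kinematic condition, the Bernoulli condition holds at a point of the surface if and
only if the Bernoulli equation for the surface variables does. -/
theorem dynamic_iff (hS : IsSurface h X Y) (hξ : IsC2 ξ) (hD : HasDecay X Y ξ)
    (hφ : DifferentiableOn ℝ φ (closedRegion h X Y)) (hT : IsTrace X Y ξ φ) (ht : 0 ≤ t)
    (hk : (phiX h X Y φ t (surfacePoint X Y s t) - γ * Y s t - dT X s t) *
      (-dS Y s t) + (phiY h X Y φ t (surfacePoint X Y s t) - dT Y s t) * dS X s t = 0) :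
    phiT h X Y φ t (surfacePoint X Y s t)
      + (1 / 2) * (phiY h X Y φ t (surfacePoint X Y s t)) ^ 2
      + (1 / 2) * (phiX h X Y φ t (surfacePoint X Y s t) - γ * Y s t) ^ 2
      + g * Y s t = σ * curvature X Y s t ↔
    dT ξ s t + g * Y s t - (1 / 2) * (dT X s t) ^ 2 - (1 / 2) * (dT Y s t) ^ 2
      + γ * Y s t * (2 * dS X s t * dS Y s t * dT Y s t - 2 * (dS Y s t) ^ 2 * dT X s t
          - 2 * dS ξ s t * dS X s t + γ * (dS X s t) ^ 2 * Y s t)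
        / (2 * ((dS X s t) ^ 2 + (dS Y s t) ^ 2))
      + (dS ξ s t - dS X s t * dT X s t - dS Y s t * dT Y s t) ^ 2
        / (2 * ((dS X s t) ^ 2 + (dS Y s t) ^ 2))
      - σ * ((dS X s t * dS (dS Y) s t - dS Y s t * dS (dS X) s t)
        / ((dS X s t) ^ 2 + (dS Y s t) ^ 2) ^ ((3 : ℝ) / 2)) = 0 := by
  obtain ⟨c, hc, hreg⟩ := hS.regular (t + 1) (by linarith)
  have hJ : 0 < dS X s t ^ 2 + dS Y s t ^ 2 := hc.trans_le (hreg s t ⟨ht, by linarith⟩)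
  have hs := trace_dS (s := s) hS hξ hD hφ hT ht
  have hτ := trace_dT (s := s) hS hξ hD hφ hT ht
  have hB := bernoulli_algebra hJ hk hs
  have e : ∀ a b c d : ℝ, a + b + c - d = a + (b + c) - d := fun a b c d => by ring
  rw [e, hB, hτ, curvature]
  constructor <;> intro hh <;> linear_combination hh

theorem eventually_mem_closedRegion (hS : IsSurface h X Y) (hξ : IsC2 ξ) (hD : HasDecay X Y ξ)
    (ht : 0 ≤ t) {p : ℂ} (hp : p ∈ fluidDomain h X Y t) :
    ∀ᶠ q in 𝓝 p, (t, q) ∈ closedRegion h X Y := by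
  obtain ⟨c, C, hcC⟩ := (arcFamily hS hξ hD).exists_arc ht
  filter_upwards [(isOpen_fluidDomain hcC fun s => hS.above s t ht).mem_nhds hp] with q hq
  exact ⟨ht, subset_closure hq⟩

theorem hasFDerivAt_slice (hS : IsSurface h X Y) (hξ : IsC2 ξ) (hD : HasDecay X Y ξ)
    (hφ : DifferentiableOn ℝ φ (closedRegion h X Y)) (ht : 0 ≤ t) {p : ℂ}
    (hp : p ∈ fluidDomain h X Y t) : HasFDerivAt (fun q => φ (t, q))
      ((fderivWithin ℝ φ (closedRegion h X Y) (t, p)).comp (ContinuousLinearMap.inr ℝ ℝ ℂ)) p := by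
  have hev := eventually_mem_closedRegion hS hξ hD ht hp
  have h1 : HasFDerivWithinAt (fun q : ℂ => ((t, q) : ℝ × ℂ)) (ContinuousLinearMap.inr ℝ ℝ ℂ)
      {q | (t, q) ∈ closedRegion h X Y} p := (hasFDerivAt_prodMk_right t p).hasFDerivWithinAt
  have h2 := (hφ (t, p) hev.self_of_nhds).hasFDerivWithinAt.comp p h1 fun q hq => hq
  exact h2.hasFDerivAt hev

/-- The potential being harmonic, the complex velocity is holomorphic. -/
theorem differentiableOn_complexVelocity (hS : IsSurface h X Y) (hξ : IsC2 ξ)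
    (hD : HasDecay X Y ξ) (hφ : DifferentiableOn ℝ φ (closedRegion h X Y)) (ht : 0 ≤ t)
    (hharm : InnerProductSpace.HarmonicOnNhd (fun p : ℂ => φ (t, p)) (fluidDomain h X Y t)) :
    DifferentiableOn ℂ (fun p => complexVelocity h X Y φ (t, p)) (fluidDomain h X Y t) := by
  intro p hp
  obtain ⟨c, C, hcC⟩ := (arcFamily hS hξ hD).exists_arc ht
  refine DifferentiableAt.differentiableWithinAt ?_
  refine (HarmonicAt.differentiableAt_complex_partial (hharm p hp)).congr_of_eventuallyEq ?_
  filter_upwards [(isOpen_fluidDomain hcC fun s => hS.above s t ht).mem_nhds hp] with q hq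
  rw [(hasFDerivAt_slice hS hξ hD hφ ht hq).fderiv]
  rfl

theorem continuousOn_complexVelocity (hS : IsSurface h X Y) (hξ : IsC2 ξ)
    (hD : HasDecay X Y ξ) (hφ : ContDiffOn ℝ 1 φ (closedRegion h X Y)) :
    ContinuousOn (complexVelocity h X Y φ) (closedRegion h X Y) := by
  have h1 := hφ.continuousOn_fderivWithin (uniqueDiffOn_closedRegion hS hξ hD) le_rfl
  exact (Complex.continuous_ofReal.comp_continuousOn (h1.clm_apply continuousOn_const)).sub
    (continuousOn_const.mul
      (Complex.continuous_ofReal.comp_continuousOn (h1.clm_apply continuousOn_const)))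

theorem tendsto_velocity (hS : IsSurface h X Y) (hξ : IsC2 ξ) (hD : HasDecay X Y ξ) (ht : 0 ≤ t) :
    Tendsto (fun s => velocityDensity γ X Y ξ s t * (surfacePoint (dS X) (dS Y) s t)⁻¹)
      (cocompact ℝ) (𝓝 0) := by
  obtain ⟨c, C, hcC⟩ := (arcFamily hS hξ hD).exists_arc ht
  obtain ⟨b, -, hb, A, hA⟩ := exists_velocityDensity_le (γ := γ) hS hξ hD (T := t + 1)
    (by linarith)
  have h1 := hb.mul_const c⁻¹
  rw [zero_mul] at h1
  refine squeeze_zero_norm (fun s => ?_) h1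
  have hbs := (hA s t ⟨ht, by linarith⟩).1.1
  rw [norm_mul, norm_inv]
  exact mul_le_mul hbs (inv_anti₀ hcC.c_pos (hcC.c_le_norm_deriv s)) (by positivity)
    ((norm_nonneg _).trans hbs)

/-- The trace and the kinematic condition determine the velocity on the surface. -/
theorem complexVelocity_surface (hS : IsSurface h X Y) (hξ : IsC2 ξ) (hD : HasDecay X Y ξ)
    (hB : SolvesBVP h γ g σ X Y φ) (hT : IsTrace X Y ξ φ) (ht : 0 ≤ t) (s : ℝ) :
    complexVelocity h X Y φ (t, surfacePoint X Y s t) =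
      velocityDensity γ X Y ξ s t * (surfacePoint (dS X) (dS Y) s t)⁻¹ := by
  obtain ⟨c, C, hcC⟩ := (arcFamily hS hξ hD).exists_arc ht
  rw [eq_mul_inv_iff_mul_eq₀ (hcC.deriv_ne_zero s), surfacePoint_eq (dS X) (dS Y),
    velocityDensity_eq]
  exact velocity_mul_tangent (trace_dS hS hξ hD (hB.smooth.differentiableOn one_ne_zero) hT ht)
    (kinematic_iff.1 (hB.kinematic s t ht))

/-- The velocity of a solution is the Cauchy integral of its boundary values, which vanishes above
the surface. -/
theorem symCauchy_of_solution (hS : IsSurface h X Y) (hξ : IsC2 ξ) (hD : HasDecay X Y ξ)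
    (hB : SolvesBVP h γ g σ X Y φ) (hT : IsTrace X Y ξ φ) (ht : 0 ≤ t) :
    (∀ p ∈ upperSide (fun s => surfacePoint X Y s t) (fun s => surfacePoint (dS X) (dS Y) s t) h,
      symCauchy (fun s => surfacePoint X Y s t) h (fun s => velocityDensity γ X Y ξ s t) p = 0) ∧
    ∀ p ∈ lowerSide (fun s => surfacePoint X Y s t) (fun s => surfacePoint (dS X) (dS Y) s t) h,
      -h ≤ p.im → complexVelocity h X Y φ (t, p) =
        -symCauchy (fun s => surfacePoint X Y s t) h (fun s => velocityDensity γ X Y ξ s t) p := by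
  have ha := arcFamily hS hξ hD
  obtain ⟨c, C, hcC⟩ := ha.exists_arc ht
  have hb : ∀ s, -h < (surfacePoint X Y s t).im := fun s => hS.above s t ht
  have hd := isDensity_velocityDensity (γ := γ) hS hξ hD
  obtain ⟨A, hA⟩ := hd.bound (t + 1) (by linarith)
  have hdiff := hB.smooth.differentiableOn one_ne_zero
  have hmem : ∀ p : ℂ, -h ≤ p.im → p ∉ upperSide (fun s => surfacePoint X Y s t)
      (fun s => surfacePoint (dS X) (dS Y) s t) h → (t, p) ∈ closedRegion h X Y := fun p h1 h2 => by
    rw [closedRegion_eq hS hξ hD]; exact ⟨ht, h1, h2⟩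
  refine ha.symCauchy_of_holomorphic ht hb (hd.mul ha.isDensity_inv_tangent)
    (hd.continuous ht) (hA t ⟨ht, by linarith⟩).1 (integrable_velocityDensity hS hξ hD ht)
    (tendsto_velocity hS hξ hD ht) (w := fun p => complexVelocity h X Y φ (t, p)) ?_ ?_ ?_ ?_ ?_
  · exact (continuousOn_complexVelocity hS hξ hD hB.smooth).comp (by fun_prop)
      fun p hp => hmem p hp.1 hp.2
  · rw [← fluidDomain_eq hcC hb]
    exact differentiableOn_complexVelocity hS hξ hD hdiff ht (hB.harmonic t ht)
  · exact fun s => complexVelocity_surface hS hξ hD hB hT ht s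
  · intro p hp
    have := hB.bed t ht p hp
    simp only [complexVelocity, Complex.sub_im, Complex.mul_im, Complex.ofReal_im, Complex.I_re,
      Complex.I_im, Complex.ofReal_re]
    linarith
  · intro ε hε
    obtain ⟨R, hR⟩ := hB.decay t ht (ε / 2) (half_pos hε)
    refine ⟨R + C + |h|, fun p hp hpu hpR => ?_⟩
    -- the closed fluid lies in a horizontal strip, so that `|x|` is large if `|p|` is
    have hpi : |p.im| ≤ C + |h| := by
      have h1 : p.im ≤ C := by
        by_contra hh
        exact hpu (hcC.mem_upper_of_im_gt hb (not_le.1 hh))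
      rw [abs_le]
      constructor
      · linarith [le_abs_self h, hcC.C_pos]
      · linarith [abs_nonneg h]
    have hpre : R ≤ |p.re| := by
      have := Complex.norm_le_abs_re_add_abs_im p
      linarith
    obtain ⟨h1, h2⟩ := hR p (hmem p hp hpu).2 hpre
    refine (norm_sub_le _ _).trans ?_
    rw [norm_mul, Complex.norm_I, one_mul, Complex.norm_real, Complex.norm_real]
    simp only [Real.norm_eq_abs]
    linarith

/-- The traces of a solution satisfy both surface equations. -/
theorem nonlocal_and_bernoulli (hh : 0 < h) (hS : IsSurface h X Y) (hξ : IsC2 ξ)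
    (hD : HasDecay X Y ξ) (hB : SolvesBVP h γ g σ X Y φ) (hT : IsTrace X Y ξ φ) :
    NonlocalEq h γ X Y ξ ∧ BernoulliEq γ g σ X Y ξ := by
  refine ⟨fun k t ht => ?_, fun s t ht => ?_⟩
  · exact (nonlocal_iff hh hS hξ hD ht).2 (symCauchy_of_solution hS hξ hD hB hT ht).1 k
  · exact (dynamic_iff hS hξ hD (hB.smooth.differentiableOn one_ne_zero) hT ht
      (hB.kinematic s t ht)).1 (hB.dynamic s t ht)

end

/-! ### Uniqueness -/

section

variable {h γ g σ : ℝ} {X Y ξ : ℝ → ℝ → ℝ}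

/-- A solution is determined by its trace: the Cauchy integral determines the velocity, and each
point of the fluid is joined to the surface by a segment in the fluid. -/
theorem eqOn_of_trace_eq (hS : IsSurface h X Y) (hξ : IsC2 ξ) (hD : HasDecay X Y ξ)
    {φ₁ φ₂ : ℝ × ℂ → ℝ} (hB₁ : SolvesBVP h γ g σ X Y φ₁) (hT₁ : IsTrace X Y ξ φ₁)
    (hB₂ : SolvesBVP h γ g σ X Y φ₂) (hT₂ : IsTrace X Y ξ φ₂) :
    EqOn φ₁ φ₂ (closedRegion h X Y) := by
  rintro ⟨t, p⟩ hx
  have hx' := hx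
  rw [closedRegion_eq hS hξ hD] at hx'
  obtain ⟨ht, hp, hpu⟩ := hx'
  simp only at ht hp hpu
  obtain ⟨c, C, hcC⟩ := (arcFamily hS hξ hD).exists_arc ht
  set γt : ℝ → ℂ := fun s => surfacePoint X Y s t with hγt
  have hb : ∀ s, -h < (γt s).im := fun s => hS.above s t ht
  by_cases hps : p ∈ range γt
  · obtain ⟨s, rfl⟩ := hps
    exact (hT₁ s t ht).symm.trans (hT₂ s t ht)
  have hpl := (hcC.mem_or_mem hb hps).resolve_left hpu
  set z := γt (foot γt p) with hz
  set q : ℝ → ℂ := fun u => z + u * (p - z) with hq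
  have hqi : ∀ u : ℝ, (q u).im = (1 - u) * z.im + u * p.im := fun u => by
    simp [hq]; ring
  have hzi : -h < z.im := hb _
  have hqΩ : ∀ u ∈ Ioo (0 : ℝ) 1, q u ∈ fluidDomain h X Y t := by
    intro u hu
    rw [fluidDomain_eq hcC hb]
    refine ⟨?_, hcC.segment_mem_lower hb hpl hu.1 hu.2.le⟩
    show -h < (q u).im
    rw [hqi]
    nlinarith [mul_pos (sub_pos.2 hu.2) (sub_pos.2 hzi),
      mul_nonneg hu.1.le (sub_nonneg.2 hp)]
  have hqD : ∀ u ∈ Icc (0 : ℝ) 1, (t, q u) ∈ closedRegion h X Y := by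
    intro u hu
    rcases eq_or_lt_of_le hu.1 with rfl | h0
    · have : q 0 = z := by simp [hq]
      rw [this]
      exact surfacePoint_mem_closedRegion hS hξ hD _ ht
    · rcases eq_or_lt_of_le hu.2 with rfl | h1
      · have : q 1 = p := by simp [hq]
        rwa [this]
      · exact ⟨ht, subset_closure (hqΩ u ⟨h0, h1⟩)⟩
  have hqc : Continuous q := by fun_prop
  have hcont : ∀ {φ : ℝ × ℂ → ℝ}, SolvesBVP h γ g σ X Y φ →
      ContinuousOn (fun u => φ (t, q u)) (Icc 0 1) := fun hB =>
    hB.smooth.continuousOn.comp (f := fun u => (t, q u)) (by fun_prop) hqD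
  have hder : ∀ {φ : ℝ × ℂ → ℝ}, SolvesBVP h γ g σ X Y φ → IsTrace X Y ξ φ → ∀ u ∈ Ioo (0 : ℝ) 1,
      HasDerivAt (fun u => φ (t, q u)) (-symCauchy γt h
        (fun s => velocityDensity γ X Y ξ s t) (q u) * (p - z)).re u := by
    intro φ hB hT u hu
    have h1 := hasFDerivAt_slice hS hξ hD (hB.smooth.differentiableOn one_ne_zero) ht (hqΩ u hu)
    have h2 : HasDerivAt q (1 * (p - z)) u :=
      (Complex.ofRealCLM.hasDerivAt.mul_const (p - z)).const_add z
    rw [one_mul] at h2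
    refine (h1.comp_hasDerivAt u h2).congr_deriv ?_
    have hΩ := hqΩ u hu
    rw [fluidDomain_eq hcC hb] at hΩ
    have h3 := (symCauchy_of_solution hS hξ hD hB hT ht).2 (q u) hΩ.2 (le_of_lt hΩ.1)
    rw [← h3, ContinuousLinearMap.comp_apply, ContinuousLinearMap.inr_apply, clm_apply_eq]
    simp only [complexVelocity, phiX, phiY]
    simp
    ring
  -- both potentials have the same derivative along the segment and the same value at its end `z`
  obtain ⟨u, hu, hslope⟩ := exists_hasDerivAt_eq_slope (fun u => φ₁ (t, q u) - φ₂ (t, q u))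
    (fun u => (-symCauchy γt h (fun s => velocityDensity γ X Y ξ s t) (q u) * (p - z)).re -
      (-symCauchy γt h (fun s => velocityDensity γ X Y ξ s t) (q u) * (p - z)).re) one_pos
    ((hcont hB₁).sub (hcont hB₂)) fun u hu => (hder hB₁ hT₁ u hu).sub (hder hB₂ hT₂ u hu)
  have e0 : q 0 = z := by simp [hq]
  have e1 : q 1 = p := by simp [hq]
  have hz0 : φ₁ (t, z) = φ₂ (t, z) := (hT₁ _ t ht).symm.trans (hT₂ _ t ht)
  rw [e0, e1, hz0] at hslope
  simp only [sub_self, sub_zero, div_one] at hslope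
  exact sub_eq_zero.1 hslope.symm

end

/-! ### Complex potentials with given boundary values -/

/-- The boundary values `F` of a complex potential on a family of arcs, with `f` the derivative of
`F` along the curve and `Ft` the time derivative at fixed parameter, such that the symmetric Cauchy
integral of `f` vanishes above the curves. -/
structure BoundaryPotential (Z Z' Zt F f Ft : ℝ → ℝ → ℂ) (H : ℝ) : Prop where
  family : ArcFamily Z Z' Zt
  above : ∀ s t, 0 ≤ t → -H < (Z s t).im
  rate : ∃ Zst : ℝ → ℝ → ℂ,
    (∀ s t, 0 ≤ t → HasDerivWithinAt (fun r => Z' s r) (Zst s t) (Ici 0) t) ∧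
    (∀ s t, 0 ≤ t → HasDerivAt (fun r => Zt r t) (Zst s t) s) ∧
    (∀ t, 0 ≤ t → Continuous fun s => Zst s t) ∧
    ∀ T, 0 < T → ∃ A, ∀ t ∈ Icc 0 T, ∀ s, ‖Zst s t‖ ≤ A
  density : IsDensity F
  densityDeriv : IsDensity f
  densityRate : IsDensity Ft
  hasDerivAt : ∀ s t, 0 ≤ t → HasDerivAt (fun r => F r t) (f s t) s
  hasDerivWithinAt : ∀ s t, 0 ≤ t → HasDerivWithinAt (fun r => F s r) (Ft s t) (Ici 0) t
  integrable : ∀ t, 0 ≤ t → Integrable fun s => f s t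
  vanish : ∀ t, 0 ≤ t → ∀ p ∈ upperSide (fun s => Z s t) (fun s => Z' s t) H,
    symCauchy (fun s => Z s t) H (fun s => f s t) p = 0

/-- The real-linear map `(r, z) ↦ r q + w z`. -/
def timeSpaceMap (q w : ℂ) : ℝ × ℂ →L[ℝ] ℂ :=
  (ContinuousLinearMap.fst ℝ ℝ ℂ).smulRight q +
    (ContinuousLinearMap.mul ℝ ℂ w).comp (ContinuousLinearMap.snd ℝ ℝ ℂ)

theorem timeSpaceMap_apply (q w : ℂ) (x : ℝ × ℂ) : timeSpaceMap q w x = x.1 * q + w * x.2 := by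
  simp [timeSpaceMap]

theorem continuous_timeSpaceMap : Continuous fun y : ℂ × ℂ => timeSpaceMap y.1 y.2 := by
  have h1 : Continuous fun q : ℂ => (ContinuousLinearMap.fst ℝ ℝ ℂ).smulRight q :=
    (ContinuousLinearMap.smulRightL ℝ (ℝ × ℂ) ℂ (ContinuousLinearMap.fst ℝ ℝ ℂ)).continuous
  have h2 : Continuous fun w : ℂ =>
      (ContinuousLinearMap.mul ℝ ℂ w).comp (ContinuousLinearMap.snd ℝ ℝ ℂ) :=
    (((ContinuousLinearMap.compL ℝ (ℝ × ℂ) ℂ ℂ).flip (ContinuousLinearMap.snd ℝ ℝ ℂ)).comp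
      (ContinuousLinearMap.mul ℝ ℂ)).continuous
  exact (h1.comp continuous_fst).add (h2.comp continuous_snd)

namespace BoundaryPotential

variable {Z Z' Zt F f Ft : ℝ → ℝ → ℂ} {H t : ℝ} {p : ℂ}

theorem above' (h : BoundaryPotential Z Z' Zt F f Ft H) (ht : 0 ≤ t) (s : ℝ) :
    -H < (Z s t).im := h.above s t ht

theorem isDensity_velocity (h : BoundaryPotential Z Z' Zt F f Ft H) :
    IsDensity fun s t => f s t * (Z' s t)⁻¹ := h.densityDeriv.mul h.family.isDensity_inv_tangent

theorem isDensity_rate (h : BoundaryPotential Z Z' Zt F f Ft H) :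
    IsDensity fun s t => Ft s t - f s t * Zt s t * (Z' s t)⁻¹ :=
  h.densityRate.sub ((h.densityDeriv.mul h.family.velocity).mul h.family.isDensity_inv_tangent)

theorem hasDerivAt_symCauchyDiff (h : BoundaryPotential Z Z' Zt F f Ft H) (ht : 0 ≤ t)
    (hp : p ∉ range fun s => Z s t) (hp' : reflect H p ∉ range fun s => Z s t) :
    HasDerivAt (symCauchyDiff (fun s => Z s t) (fun s => Z' s t) H fun s => F s t)
      (symCauchy (fun s => Z s t) H (fun s => f s t) p) p := by
  obtain ⟨c, C, hcC⟩ := h.family.exists_arc ht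
  obtain ⟨A, hA⟩ := h.density.bound (t + 1) (by linarith)
  exact hcC.hasDerivAt_symCauchyDiff (h.above' ht) (fun s => h.hasDerivAt s t ht)
    (hA t ⟨ht, by linarith⟩).1 (h.integrable t ht) hp hp'

theorem hasDerivWithinAt_symCauchyDiff (h : BoundaryPotential Z Z' Zt F f Ft H) (ht : 0 ≤ t)
    (hp : p ∉ range fun s => Z s t) (hp' : reflect H p ∉ range fun s => Z s t) :
    HasDerivWithinAt (fun r => symCauchyDiff (fun s => Z s r) (fun s => Z' s r) H
        (fun s => F s r) p)
      (symCauchyDiff (fun s => Z s t) (fun s => Z' s t) H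
        (fun s => Ft s t - f s t * Zt s t * (Z' s t)⁻¹) p) (Ici 0) t := by
  obtain ⟨Zst, h1, h2, h3, h4⟩ := h.rate
  have ho : bedPoint H ∉ range fun s => Z s t :=
    Arc.notMem_of_im_le (p := bedPoint H) (h.above' ht) le_rfl
  have k1 := h.family.hasDerivWithinAt_cauchyDiff h1 h2 h3 h4 h.density h.densityDeriv
    h.densityRate h.hasDerivAt h.hasDerivWithinAt ht hp ho
  have k2 := h.family.hasDerivWithinAt_cauchyDiff h1 h2 h3 h4 h.density h.densityDeriv
    h.densityRate h.hasDerivAt h.hasDerivWithinAt ht hp' ho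
  exact k1.add (Complex.conjCLE.toContinuousLinearMap.hasFDerivAt.comp_hasDerivWithinAt t k2)

/-- Above the curve, the normalised Cauchy integral of the boundary potential has derivative zero.
-/
theorem symCauchyDiff_eq (h : BoundaryPotential Z Z' Zt F f Ft H) (ht : 0 ≤ t) {q : ℂ}
    (hp : p ∈ upperSide (fun s => Z s t) (fun s => Z' s t) H)
    (hq : q ∈ upperSide (fun s => Z s t) (fun s => Z' s t) H) :
    symCauchyDiff (fun s => Z s t) (fun s => Z' s t) H (fun s => F s t) p =
      symCauchyDiff (fun s => Z s t) (fun s => Z' s t) H (fun s => F s t) q := by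
  obtain ⟨c, C, hcC⟩ := h.family.exists_arc ht
  have hb := h.above' ht
  have hd : ∀ z ∈ upperSide (fun s => Z s t) (fun s => Z' s t) H, HasDerivAt
      (symCauchyDiff (fun s => Z s t) (fun s => Z' s t) H fun s => F s t) 0 z := fun z hz => by
    rw [← h.vanish t ht z hz]
    exact h.hasDerivAt_symCauchyDiff ht hz.1
      (hcC.reflect_mem_lower hb (hcC.im_gt_of_mem_upper hb hz).le).1
  refine (hcC.isOpen_upper hb).is_const_of_fderiv_eq_zero (𝕜 := ℂ) (hcC.isPreconnected_upper hb)
    (fun z hz => (hd z hz).differentiableAt.differentiableWithinAt) (fun z hz => ?_) hp hq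
  ext
  simp [(hd z hz).hasFDerivAt.fderiv]

theorem upper_nonempty (h : BoundaryPotential Z Z' Zt F f Ft H) (ht : 0 ≤ t) :
    (upperSide (fun s => Z s t) (fun s => Z' s t) H).Nonempty := by
  obtain ⟨c, C, hcC⟩ := h.family.exists_arc ht
  exact ⟨⟨0, C + 1⟩, hcC.mem_upper_of_im_gt (h.above' ht) (by simp)⟩

/-- The constant value of the normalised Cauchy integral of the boundary potential above the
curve. -/
theorem exists_const (h : BoundaryPotential Z Z' Zt F f Ft H) : ∃ k : ℝ → ℂ, ∀ t, 0 ≤ t →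
    ∀ p ∈ upperSide (fun s => Z s t) (fun s => Z' s t) H,
      symCauchyDiff (fun s => Z s t) (fun s => Z' s t) H (fun s => F s t) p = k t := by
  have : ∀ t, ∃ κ : ℂ, 0 ≤ t → ∀ p ∈ upperSide (fun s => Z s t) (fun s => Z' s t) H,
      symCauchyDiff (fun s => Z s t) (fun s => Z' s t) H (fun s => F s t) p = κ := fun t => by
    by_cases ht : 0 ≤ t
    · obtain ⟨q, hq⟩ := h.upper_nonempty ht
      exact ⟨_, fun _ p hp => h.symCauchyDiff_eq ht hp hq⟩
    · exact ⟨0, fun h0 => absurd h0 ht⟩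
  choose k hk using this
  exact ⟨k, hk⟩

theorem symCauchyDiff_velocity (h : BoundaryPotential Z Z' Zt F f Ft H) (ht : 0 ≤ t)
    (hp : p ∈ upperSide (fun s => Z s t) (fun s => Z' s t) H) :
    symCauchyDiff (fun s => Z s t) (fun s => Z' s t) H (fun s => f s t * (Z' s t)⁻¹) p =
      -symCauchy (fun s => Z s t) H (fun s => f s t) (bedPoint H) := by
  obtain ⟨c, C, hcC⟩ := h.family.exists_arc ht
  have hb := h.above' ht
  rw [hcC.symCauchyDiff_div hb (h.integrable t ht) hp.1
    (hcC.reflect_mem_lower hb (hcC.im_gt_of_mem_upper hb hp).le).1, h.vanish t ht p hp, zero_sub]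

/-- The constant above the curve is differentiable in time, since it can be evaluated at a fixed
point. -/
theorem hasDerivWithinAt_const (h : BoundaryPotential Z Z' Zt F f Ft H) {k : ℝ → ℂ}
    (hk : ∀ t, 0 ≤ t → ∀ p ∈ upperSide (fun s => Z s t) (fun s => Z' s t) H,
      symCauchyDiff (fun s => Z s t) (fun s => Z' s t) H (fun s => F s t) p = k t) (ht : 0 ≤ t)
    (hp : p ∈ upperSide (fun s => Z s t) (fun s => Z' s t) H) :
    HasDerivWithinAt k (symCauchyDiff (fun s => Z s t) (fun s => Z' s t) H
      (fun s => Ft s t - f s t * Zt s t * (Z' s t)⁻¹) p) (Ici 0) t := by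
  obtain ⟨c, C, hcC⟩ := h.family.exists_arc ht
  have hb := h.above' ht
  refine (h.hasDerivWithinAt_symCauchyDiff ht hp.1
    (hcC.reflect_mem_lower hb (hcC.im_gt_of_mem_upper hb hp).le).1).congr_of_eventuallyEq ?_
    (hk t ht p hp).symm
  have h1 : Tendsto (fun r : ℝ => (r, p)) (𝓝[≥] t ⊔ 𝓝[Ici 0] t) (𝓝[timeSpace] (t, p)) := by
    refine tendsto_nhdsWithin_iff.2 ⟨?_, ?_⟩
    · exact ((by fun_prop : Continuous fun r : ℝ => (r, p)).tendsto t).mono_left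
        (sup_le nhdsWithin_le_nhds nhdsWithin_le_nhds)
    · refine eventually_sup.2 ⟨?_, ?_⟩
      · filter_upwards [self_mem_nhdsWithin] with r hr using ⟨ht.trans hr, mem_univ _⟩
      · filter_upwards [self_mem_nhdsWithin] with r hr using ⟨hr, mem_univ _⟩
  have h2 := (h1.mono_left le_sup_right).eventually (h.family.eventually_upper h.above ht hp)
  filter_upwards [h2, self_mem_nhdsWithin] with r hr hr0 using (hk r hr0 p hr).symm

/-- The values above the curves of the normalised Cauchy integrals of the boundary potential, of the
boundary velocity and of the time derivative at fixed points of the plane. -/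
structure Consts (h : BoundaryPotential Z Z' Zt F f Ft H) (k κ k' : ℝ → ℂ) : Prop where
  potential : ∀ t, 0 ≤ t → ∀ p ∈ upperSide (fun s => Z s t) (fun s => Z' s t) H,
    symCauchyDiff (fun s => Z s t) (fun s => Z' s t) H (fun s => F s t) p = k t
  velocity : ∀ t, 0 ≤ t → κ t = -symCauchy (fun s => Z s t) H (fun s => f s t) (bedPoint H)
  velocity' : ∀ t, 0 ≤ t → ∀ p ∈ upperSide (fun s => Z s t) (fun s => Z' s t) H,
    symCauchyDiff (fun s => Z s t) (fun s => Z' s t) H (fun s => f s t * (Z' s t)⁻¹) p = κ t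
  rate : ∀ t, 0 ≤ t → ∀ p ∈ upperSide (fun s => Z s t) (fun s => Z' s t) H,
    symCauchyDiff (fun s => Z s t) (fun s => Z' s t) H
      (fun s => Ft s t - f s t * Zt s t * (Z' s t)⁻¹) p = k' t
  hasDerivWithinAt : ∀ t, 0 ≤ t → HasDerivWithinAt k (k' t) (Ici 0) t

theorem exists_consts (h : BoundaryPotential Z Z' Zt F f Ft H) : ∃ k κ k', h.Consts k κ k' := by
  obtain ⟨k, hk⟩ := h.exists_const
  have hk' : ∀ t, 0 ≤ t → ∀ p ∈ upperSide (fun s => Z s t) (fun s => Z' s t) H,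
      symCauchyDiff (fun s => Z s t) (fun s => Z' s t) H
        (fun s => Ft s t - f s t * Zt s t * (Z' s t)⁻¹) p = derivWithin k (Ici 0) t :=
    fun t ht p hp => ((h.hasDerivWithinAt_const hk ht hp).derivWithin
      (uniqueDiffOn_Ici 0 t ht)).symm
  refine ⟨k, fun t => -symCauchy (fun s => Z s t) H (fun s => f s t) (bedPoint H),
    derivWithin k (Ici 0), hk, fun t _ => rfl, fun t ht p hp => h.symCauchyDiff_velocity ht hp,
    hk', fun t ht => ?_⟩
  obtain ⟨q, hq⟩ := h.upper_nonempty ht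
  have := h.hasDerivWithinAt_const hk ht hq
  rwa [hk' t ht q hq] at this

variable {k κ k' : ℝ → ℂ}

/-- Off the curve the velocity is minus the symmetric Cauchy integral. -/
theorem innerExtension_velocity (h : BoundaryPotential Z Z' Zt F f Ft H) (hc : h.Consts k κ k')
    (ht : 0 ≤ t) (hp : p ∉ range fun s => Z s t) (hp' : reflect H p ∉ range fun s => Z s t) :
    innerExtension Z Z' H (fun s t => f s t * (Z' s t)⁻¹) κ (t, p) =
      -symCauchy (fun s => Z s t) H (fun s => f s t) p := by
  obtain ⟨c, C, hcC⟩ := h.family.exists_arc ht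
  rw [ArcFamily.innerExtension_of_notMem _ hp,
    hcC.symCauchyDiff_div (h.above' ht) (h.integrable t ht) hp hp', hc.velocity t ht]
  ring

/-- Off the curve, the potential has the complex derivative that belongs to the velocity. -/
theorem hasDerivAt_potential (h : BoundaryPotential Z Z' Zt F f Ft H) (hc : h.Consts k κ k')
    (ht : 0 ≤ t) (hp : p ∉ range fun s => Z s t) (hp' : reflect H p ∉ range fun s => Z s t) :
    HasDerivAt (fun q => innerExtension Z Z' H F k (t, q))
      (innerExtension Z Z' H (fun s t => f s t * (Z' s t)⁻¹) κ (t, p)) p := by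
  obtain ⟨c, C, hcC⟩ := h.family.exists_arc ht
  rw [h.innerExtension_velocity hc ht hp hp']
  refine ((h.hasDerivAt_symCauchyDiff ht hp hp').const_sub (k t)).congr_of_eventuallyEq ?_
  filter_upwards [hcC.isOpen_compl.mem_nhds hp] with q hq
  exact ArcFamily.innerExtension_of_notMem k hq

theorem hasDerivWithinAt_potential (h : BoundaryPotential Z Z' Zt F f Ft H)
    (hc : h.Consts k κ k') (ht : 0 ≤ t) (hp : p ∉ range fun s => Z s t)
    (hp' : reflect H p ∉ range fun s => Z s t) :
    HasDerivWithinAt (fun r => innerExtension Z Z' H F k (r, p))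
      (innerExtension Z Z' H (fun s t => Ft s t - f s t * Zt s t * (Z' s t)⁻¹) k' (t, p))
      (Ici 0) t := by
  rw [ArcFamily.innerExtension_of_notMem _ hp]
  refine ((hc.hasDerivWithinAt t ht).sub
    (h.hasDerivWithinAt_symCauchyDiff ht hp hp')).congr_of_eventuallyEq ?_
    (ArcFamily.innerExtension_of_notMem k hp)
  have h1 : Tendsto (fun r : ℝ => (r, p)) (𝓝[Ici 0] t) (𝓝[timeSpace] (t, p)) := by
    refine tendsto_nhdsWithin_iff.2 ⟨?_, ?_⟩
    · exact ((by fun_prop : Continuous fun r : ℝ => (r, p)).tendsto t).mono_left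
        nhdsWithin_le_nhds
    · filter_upwards [self_mem_nhdsWithin] with r hr using ⟨hr, mem_univ _⟩
  filter_upwards [h1.eventually (h.family.eventually_notMem ht hp)] with r hr
  exact ArcFamily.innerExtension_of_notMem k hr

end BoundaryPotential

/-! ### Differentiability of the potential up to the curve -/

/-- On `[0, ∞) × E`, a function with a continuous derivative in the second variable and with a time
derivative at the point is differentiable there. -/
theorem hasFDerivWithinAt_of_partial {E : Type*} [NormedAddCommGroup E] [NormedSpace ℝ E]
    {Φ : ℝ × E → ℂ} {W : ℝ × E → E →L[ℝ] ℂ} {t : ℝ} {p : E} {q : ℂ}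
    (hW : ContinuousWithinAt W (Ici 0 ×ˢ univ) (t, p))
    (hd : ∀ᶠ x in 𝓝[Ici 0 ×ˢ univ] (t, p), HasFDerivAt (fun z => Φ (x.1, z)) (W x) x.2)
    (hq : HasDerivWithinAt (fun r => Φ (r, p)) q (Ici 0) t) :
    HasFDerivWithinAt Φ ((ContinuousLinearMap.fst ℝ ℝ E).smulRight q +
      (W (t, p)).comp (ContinuousLinearMap.snd ℝ ℝ E)) (Ici 0 ×ˢ univ) (t, p) := by
  rw [hasFDerivWithinAt_iff_isLittleO]
  have hfst : Tendsto (fun x : ℝ × E => x.1) (𝓝[Ici 0 ×ˢ univ] (t, p)) (𝓝[Ici 0] t) := by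
    refine tendsto_nhdsWithin_iff.2 ⟨(continuous_fst.tendsto (t, p)).mono_left
      nhdsWithin_le_nhds, ?_⟩
    filter_upwards [self_mem_nhdsWithin] with x hx using hx.1
  have h1 : (fun x : ℝ × E => Φ (x.1, p) - Φ (t, p) - (x.1 - t) • q)
      =o[𝓝[Ici 0 ×ˢ univ] (t, p)] fun x => x - (t, p) := by
    have := (hasDerivWithinAt_iff_isLittleO.1 hq).comp_tendsto hfst
    refine this.trans_isBigO (Asymptotics.IsBigO.of_bound 1 (Eventually.of_forall fun x => ?_))
    rw [one_mul]
    exact norm_fst_le (x - (t, p))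
  have h2 : (fun x : ℝ × E => Φ x - Φ (x.1, p) - W (t, p) (x.2 - p))
      =o[𝓝[Ici 0 ×ˢ univ] (t, p)] fun x => x - (t, p) := by
    refine Asymptotics.isLittleO_iff.2 fun ε hε => ?_
    have h3 := hd.and (Metric.tendsto_nhds.1 hW ε hε)
    obtain ⟨δ, hδ, hδ'⟩ := Metric.mem_nhdsWithin_iff.1 h3
    filter_upwards [inter_mem_nhdsWithin _ (Metric.ball_mem_nhds (t, p) hδ)] with x hx
    have hx2 : max (dist x.1 t) (dist x.2 p) < δ := hx.2
    have key : ∀ z ∈ Metric.ball p δ, HasFDerivAt (fun z => Φ (x.1, z)) (W (x.1, z)) z ∧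
        dist (W (x.1, z)) (W (t, p)) < ε := fun z hz => by
      have hz' : (x.1, z) ∈ Metric.ball (t, p) δ := max_lt ((le_max_left _ _).trans_lt hx2) hz
      exact hδ' ⟨hz', hx.1.1, mem_univ _⟩
    have := (convex_ball p δ).norm_image_sub_le_of_norm_hasFDerivWithin_le' (C := ε)
      (φ := W (t, p)) (fun z hz => (key z hz).1.hasFDerivWithinAt)
      (fun z hz => by rw [← dist_eq_norm]; exact (key z hz).2.le) (Metric.mem_ball_self hδ)
      (y := x.2) ((le_max_right _ _).trans_lt hx2)
    refine this.trans ?_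
    gcongr
    exact norm_snd_le (x - (t, p))
  refine (h1.add h2).congr (fun x => ?_) fun _ => rfl
  simp
  ring

namespace BoundaryPotential

variable {Z Z' Zt F f Ft : ℝ → ℝ → ℂ} {H t : ℝ} {p : ℂ} {k κ k' : ℝ → ℂ}

theorem hasFDerivWithinAt_of_notMem (h : BoundaryPotential Z Z' Zt F f Ft H)
    (hc : h.Consts k κ k') (ht : 0 ≤ t) (hp : p ∉ range fun s => Z s t)
    (hp' : reflect H p ∉ range fun s => Z s t) :
    HasFDerivWithinAt (innerExtension Z Z' H F k)
      (timeSpaceMap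
        (innerExtension Z Z' H (fun s t => Ft s t - f s t * Zt s t * (Z' s t)⁻¹) k' (t, p))
        (innerExtension Z Z' H (fun s t => f s t * (Z' s t)⁻¹) κ (t, p))) timeSpace (t, p) := by
  refine hasFDerivWithinAt_of_partial
    (W := fun x => ContinuousLinearMap.mul ℝ ℂ
      (innerExtension Z Z' H (fun s t => f s t * (Z' s t)⁻¹) κ x)) ?_ ?_
    (h.hasDerivWithinAt_potential hc ht hp hp')
  · exact (ContinuousLinearMap.mul ℝ ℂ).continuous.continuousAt.comp_continuousWithinAt
      (h.family.continuousWithinAt_innerExtension_of_notMem h.isDensity_velocity h.above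
        hc.velocity' ht hp hp')
  · have h1 : Tendsto (fun x : ℝ × ℂ => (x.1, reflect H x.2)) (𝓝[timeSpace] (t, p))
        (𝓝[timeSpace] (t, reflect H p)) := by
      refine tendsto_nhdsWithin_iff.2 ⟨?_, ?_⟩
      · have := continuous_reflect H
        exact ((by fun_prop : Continuous fun x : ℝ × ℂ => (x.1, reflect H x.2)).tendsto
          (t, p)).mono_left nhdsWithin_le_nhds
      · filter_upwards [self_mem_nhdsWithin] with x hx using ⟨hx.1, mem_univ _⟩
    filter_upwards [h.family.eventually_notMem ht hp,
      h1.eventually (h.family.eventually_notMem ht hp'), self_mem_nhdsWithin] with x hx hx' hx0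
    have h2 := (h.hasDerivAt_potential hc hx0.1 hx hx').hasFDerivAt.restrictScalars ℝ
    refine h2.congr_fderiv ?_
    ext z
    simp [mul_comm]

/-- Along a segment from a point below the curve to the nearest point of the curve, the potential is
controlled by the velocity. -/
theorem norm_potential_sub_le (h : BoundaryPotential Z Z' Zt F f Ft H) (hc : h.Consts k κ k')
    (ht : 0 ≤ t) (hp : (t, p) ∈ lowerRegion Z Z' H) {w : ℂ} {ε δ : ℝ}
    (hδ : ‖Z (foot (fun s => Z s t) p) t - p‖ ≤ δ)
    (hw : ∀ q, (t, q) ∈ lowerRegion Z Z' H → ‖q - p‖ ≤ δ →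
      ‖innerExtension Z Z' H (fun s t => f s t * (Z' s t)⁻¹) κ (t, q) - w‖ ≤ ε) :
    ‖innerExtension Z Z' H F k (t, p) - F (foot (fun s => Z s t) p) t -
      w * (p - Z (foot (fun s => Z s t) p) t)‖ ≤ ε * ‖p - Z (foot (fun s => Z s t) p) t‖ := by
  obtain ⟨c, C, hcC⟩ := h.family.exists_arc ht
  set z := Z (foot (fun s => Z s t) p) t with hz
  rw [← h.family.innerExtension_surface (g := F) (H := H) k ht (foot (fun s => Z s t) p), ← hz]
  by_cases hpr : p ∈ range fun s => Z s t
  · obtain ⟨s, rfl⟩ := hpr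
    have : z = Z s t := by rw [hz]; simp only [hcC.foot_self s]
    rw [this]
    simp
  have hlow : p ∈ lowerSide (fun s => Z s t) (fun s => Z' s t) H :=
    (hcC.mem_or_mem (h.above' ht) hpr).resolve_left hp.2.2
  -- the path from `p` to the foot point stays in the closed region
  set r : ℝ → ℂ := fun u => p + u * (z - p) with hr
  have hrl : ∀ u ∈ Ico (0 : ℝ) 1, r u ∈ lowerSide (fun s => Z s t) (fun s => Z' s t) H :=
    fun u hu => by
      have := hcC.segment_mem_lower (h.above' ht) hlow (u := 1 - u) (by linarith [hu.2])
        (by linarith [hu.1])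
      convert this using 1
      simp only [hr, hz]
      push_cast
      ring
  have hrim : ∀ u ∈ Icc (0 : ℝ) 1, -H ≤ (r u).im := fun u hu => by
    have h1 : -H < z.im := h.above _ _ ht
    have h2 : -H ≤ p.im := hp.2.1
    simp only [hr, Complex.add_im, Complex.mul_im, Complex.ofReal_re, Complex.ofReal_im,
      Complex.sub_im, zero_mul, add_zero]
    nlinarith [hu.1, hu.2, mul_nonneg hu.1 (sub_nonneg.2 h1.le),
      mul_nonneg (sub_nonneg.2 hu.2) (sub_nonneg.2 h2)]
  have hr1 : r 1 = z := by simp [hr]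
  have hmem : ∀ u ∈ Icc (0 : ℝ) 1, (t, r u) ∈ lowerRegion Z Z' H := fun u hu => by
    refine ⟨ht, hrim u hu, ?_⟩
    rcases hu.2.lt_or_eq with hlt | rfl
    · exact Arc.notMem_upper_of_lower (hrl u ⟨hu.1, hlt⟩)
    · rw [hr1]
      exact fun hm => hm.1 ⟨_, rfl⟩
  have hder : ∀ u ∈ Ico (0 : ℝ) 1, HasDerivWithinAt
      (fun u : ℝ => innerExtension Z Z' H F k (t, r u) - w * r u)
      ((innerExtension Z Z' H (fun s t => f s t * (Z' s t)⁻¹) κ (t, r u) - w) * (z - p))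
      (Ici u) u := fun u hu => by
    have h1 : HasDerivAt r (z - p) u := by
      have := ((hasDerivAt_id u).ofReal_comp.mul_const (z - p)).const_add p
      simpa [hr] using this
    have h2 := h.hasDerivAt_potential hc ht (hrl u hu).1
      (hcC.reflect_mem_lower (h.above' ht) (hrim u ⟨hu.1, hu.2.le⟩)).1
    have h3 := (h2.comp_of_eq u h1 rfl).sub (h1.const_mul w)
    exact (h3.congr_deriv (by ring)).hasDerivWithinAt
  have hcont : ContinuousOn (fun u : ℝ => innerExtension Z Z' H F k (t, r u) - w * r u)
      (Icc 0 1) := by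
    have hrc : Continuous r := by fun_prop
    refine ContinuousOn.sub ?_ (by fun_prop)
    exact (h.family.continuousOn_innerExtension h.density h.above hc.potential).comp
      (f := fun u => (t, r u)) (by fun_prop) hmem
  have hmv := norm_image_sub_le_of_norm_deriv_right_le_segment hcont hder (C := ε * ‖z - p‖)
    (fun u hu => by
      rw [norm_mul]
      gcongr
      refine hw _ (hmem u ⟨hu.1, hu.2.le⟩) ?_
      refine le_trans ?_ hδ
      simp only [hr, add_sub_cancel_left, norm_mul, Complex.norm_real, Real.norm_eq_abs,
        abs_of_nonneg hu.1]
      exact mul_le_of_le_one_left (norm_nonneg _) hu.2.le) 1 (by simp)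
  rw [hr1, sub_zero, mul_one] at hmv
  simp only [hr, Complex.ofReal_zero, zero_mul, add_zero] at hmv
  rw [norm_sub_rev p z, ← norm_neg]
  refine le_of_eq_of_le (congrArg norm ?_) hmv
  ring

end BoundaryPotential

/-- A density with densities as partial derivatives is differentiable in both variables. -/
theorem isLittleO_density {F f Ft : ℝ → ℝ → ℂ} (hf : IsDensity f)
    (hs : ∀ s t, 0 ≤ t → HasDerivAt (fun r => F r t) (f s t) s)
    (hq : ∀ s t, 0 ≤ t → HasDerivWithinAt (fun r => F s r) (Ft s t) (Ici 0) t) {t : ℝ}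
    (ht : 0 ≤ t) (s : ℝ) :
    (fun x : ℝ × ℝ => F x.2 x.1 - F s t - (f s t * ↑(x.2 - s) + Ft s t * ↑(x.1 - t)))
      =o[𝓝[Ici 0 ×ˢ univ] (t, s)] fun x => x - (t, s) := by
  have hc : ContinuousWithinAt (fun x : ℝ × ℝ => f x.2 x.1) (Ici 0 ×ˢ univ) (t, s) := by
    refine ContinuousWithinAt.comp (f := fun x : ℝ × ℝ => (x.2, x.1)) (x := (t, s))
      (hf.cont (s, t) ⟨mem_univ _, ht⟩) ?_ fun x hx => ⟨mem_univ _, hx.1⟩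
    exact (by fun_prop : Continuous fun x : ℝ × ℝ => (x.2, x.1)).continuousWithinAt
  have := hasFDerivWithinAt_of_partial (Φ := fun x : ℝ × ℝ => F x.2 x.1)
    (W := fun x => (ContinuousLinearMap.toSpanSingletonCLE (𝕜 := ℝ) (f x.2 x.1)))
    (p := s) (q := Ft s t)
    ((ContinuousLinearMap.toSpanSingletonCLE (𝕜 := ℝ)
      (E := ℂ)).continuous.continuousAt.comp_continuousWithinAt hc)
    (by
      filter_upwards [self_mem_nhdsWithin] with x hx
      exact (hs x.2 x.1 hx.1).hasFDerivAt) (hq s t ht)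
  refine (hasFDerivWithinAt_iff_isLittleO.1 this).congr (fun x => ?_) fun _ => rfl
  simp
  ring

namespace BoundaryPotential

variable {Z Z' Zt F f Ft : ℝ → ℝ → ℂ} {H t : ℝ} {p : ℂ} {k κ k' : ℝ → ℂ}

/-- The foot point depends on the point of space-time in a Lipschitz way near the curve. -/
theorem isBigO_foot (h : ArcFamily Z Z' Zt) (ht : 0 ≤ t) (s : ℝ) :
    (fun x : ℝ × ℂ => (x.1, foot (fun s => Z s x.1) x.2) - (t, s))
      =O[𝓝[timeSpace] (t, Z s t)] fun x => x - (t, Z s t) := by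
  have hT : 0 < t + 1 := by linarith
  obtain ⟨c, C, hcC⟩ := h.arc (t + 1) hT
  have hc := (hcC 0 ⟨le_rfl, hT.le⟩).c_pos
  obtain ⟨L, hL, hLip⟩ := h.lipschitz_time hT
  refine Asymptotics.IsBigO.of_bound (max 1 (2 / c * (L + 1))) ?_
  filter_upwards [ArcFamily.eventually_time (Z s t)] with x hx
  have h1 : ‖x.1 - t‖ ≤ ‖x - (t, Z s t)‖ := norm_fst_le (x - (t, Z s t))
  have h2 : ‖x.2 - Z s t‖ ≤ ‖x - (t, Z s t)‖ := norm_snd_le (x - (t, Z s t))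
  have h3 := (hcC x.1 hx).foot_lower x.2 s
  have h4 := hLip s x.1 hx t ⟨ht, by linarith⟩
  have h5 : ‖Z s x.1 - x.2‖ ≤ (L + 1) * ‖x - (t, Z s t)‖ := by
    have : Z s x.1 - x.2 = (Z s x.1 - Z s t) - (x.2 - Z s t) := by ring
    rw [this]
    refine (norm_sub_le _ _).trans ?_
    rw [Real.norm_eq_abs] at h1
    nlinarith
  refine max_le (h1.trans (le_mul_of_one_le_left (norm_nonneg _) (le_max_left _ _))) ?_
  refine le_trans ?_ (mul_le_mul_of_nonneg_right (le_max_right _ _) (norm_nonneg _))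
  change ‖foot (fun s => Z s x.1) x.2 - s‖ ≤ _
  rw [Real.norm_eq_abs, abs_sub_comm, mul_assoc, div_mul_eq_mul_div, le_div_iff₀ hc]
  linarith

/-- The potential is differentiable at the points of the curve, with respect to the closed
region. -/
theorem hasFDerivWithinAt_surface (h : BoundaryPotential Z Z' Zt F f Ft H)
    (hc : h.Consts k κ k') (ht : 0 ≤ t) (s : ℝ) :
    HasFDerivWithinAt (innerExtension Z Z' H F k)
      (timeSpaceMap (Ft s t - f s t * Zt s t * (Z' s t)⁻¹) (f s t * (Z' s t)⁻¹))
      (lowerRegion Z Z' H) (t, Z s t) := by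
  obtain ⟨c₀, C₀, hcC₀⟩ := h.family.exists_arc ht
  have hsub : lowerRegion Z Z' H ⊆ timeSpace := fun x hx => ⟨hx.1, mem_univ _⟩
  have hle : 𝓝[lowerRegion Z Z' H] (t, Z s t) ≤ 𝓝[timeSpace] (t, Z s t) :=
    nhdsWithin_mono _ hsub
  have hmem : (t, Z s t) ∈ lowerRegion Z Z' H :=
    ⟨ht, (h.above s t ht).le, fun hm => hm.1 ⟨s, rfl⟩⟩
  set σ : ℝ × ℂ → ℝ := fun x => foot (fun s => Z s x.1) x.2 with hσ
  have hσO : (fun x : ℝ × ℂ => (x.1, σ x) - (t, s)) =O[𝓝[lowerRegion Z Z' H] (t, Z s t)]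
      fun x => x - (t, Z s t) := (isBigO_foot h.family ht s).mono hle
  have hσt : Tendsto (fun x => (x.1, σ x)) (𝓝[lowerRegion Z Z' H] (t, Z s t))
      (𝓝[Ici 0 ×ˢ univ] (t, s)) := by
    refine tendsto_nhdsWithin_iff.2 ⟨?_, ?_⟩
    · exact ((ArcFamily.tendsto_fst (Z s t)).mono_left hle).prodMk_nhds
        ((h.family.tendsto_foot ht s).mono_left hle)
    · filter_upwards [self_mem_nhdsWithin] with x hx using ⟨hx.1, mem_univ _⟩
  -- the increment along the curve
  have hF := ((isLittleO_density h.densityDeriv h.hasDerivAt h.hasDerivWithinAt ht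
    s).comp_tendsto hσt).trans_isBigO hσO
  have hZ := ((isLittleO_density h.family.tangent
    (fun s t ht => (h.family.exists_arc ht).choose_spec.choose_spec.hasDeriv s)
    h.family.hasDeriv ht s).comp_tendsto hσt).trans_isBigO hσO
  have hB := hF.sub (hZ.const_mul_left (f s t * (Z' s t)⁻¹))
  -- the increment between the point and its foot point
  have hA : (fun x : ℝ × ℂ => innerExtension Z Z' H F k x - F (σ x) x.1 -
      f s t * (Z' s t)⁻¹ * (x.2 - Z (σ x) x.1)) =o[𝓝[lowerRegion Z Z' H] (t, Z s t)]
      fun x => x - (t, Z s t) := by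
    have hT : 0 < t + 1 := by linarith
    obtain ⟨c, C, hcC⟩ := h.family.arc (t + 1) hT
    obtain ⟨L, hL, hLip⟩ := h.family.lipschitz_time hT
    refine Asymptotics.isLittleO_iff.2 fun ε hε => ?_
    -- the velocity is continuous up to the curve, hence nearly constant on the segment from the
    -- point to its foot point
    have hW := h.family.continuousOn_innerExtension h.isDensity_velocity h.above hc.velocity'
      (t, Z s t) hmem
    have hW0 := h.family.innerExtension_surface (Z' := Z') (H := H)
      (g := fun s t => f s t * (Z' s t)⁻¹) κ ht s
    rw [ContinuousWithinAt, hW0] at hW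
    obtain ⟨δ, hδ, hδ'⟩ := Metric.mem_nhdsWithin_iff.1
      (Metric.tendsto_nhds.1 hW (ε / (L + 1)) (by positivity))
    have hL2 : 0 < L + 2 := by linarith
    filter_upwards [nhdsWithin_mono _ hsub (ArcFamily.eventually_time (Z s t)),
      inter_mem_nhdsWithin _ (Metric.ball_mem_nhds (t, Z s t) (div_pos hδ hL2))] with x hxt hx
    have hxd : (L + 2) * ‖x - (t, Z s t)‖ < δ := by
      have := hx.2
      rw [Metric.mem_ball, dist_eq_norm, lt_div_iff₀ hL2] at this
      linarith
    have h1 : ‖x.1 - t‖ ≤ ‖x - (t, Z s t)‖ := norm_fst_le (x - (t, Z s t))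
    have h2 : ‖x.2 - Z s t‖ ≤ ‖x - (t, Z s t)‖ := norm_snd_le (x - (t, Z s t))
    have h4 := hLip s x.1 hxt t ⟨ht, by linarith⟩
    have h5 : ‖Z (σ x) x.1 - x.2‖ ≤ (L + 1) * ‖x - (t, Z s t)‖ := by
      refine ((hcC x.1 hxt).foot_le x.2 s).trans ?_
      have : Z s x.1 - x.2 = (Z s x.1 - Z s t) - (x.2 - Z s t) := by ring
      rw [this]
      refine (norm_sub_le _ _).trans ?_
      rw [Real.norm_eq_abs] at h1
      nlinarith
    have h6 := h.norm_potential_sub_le hc hx.1.1 (p := x.2) hx.1 (w := f s t * (Z' s t)⁻¹)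
      (ε := ε / (L + 1)) h5 fun q hq hqx => by
        rw [← dist_eq_norm]
        have h7 : ‖q - Z s t‖ < δ := by
          have : q - Z s t = (q - x.2) + (x.2 - Z s t) := by ring
          rw [this]
          refine (norm_add_le _ _).trans_lt ?_
          linarith
        have h8 : ‖x.1 - t‖ < δ := by
          refine h1.trans_lt (lt_of_le_of_lt ?_ hxd)
          exact le_mul_of_one_le_left (norm_nonneg _) (by linarith)
        rw [← dist_eq_norm] at h7 h8
        have h9 : (x.1, q) ∈ Metric.ball (t, Z s t) δ := max_lt h8 h7
        exact le_of_lt (hδ' ⟨h9, hq⟩)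
    refine h6.trans ?_
    rw [norm_sub_rev]
    calc ε / (L + 1) * ‖Z (σ x) x.1 - x.2‖ ≤ ε / (L + 1) * ((L + 1) * ‖x - (t, Z s t)‖) := by
          gcongr
      _ = ε * ‖x - (t, Z s t)‖ := by field_simp
  rw [hasFDerivWithinAt_iff_isLittleO, h.family.innerExtension_surface k ht]
  refine (hA.add hB).congr (fun x => ?_) fun _ => rfl
  have h0 : Z' s t ≠ 0 := hcC₀.deriv_ne_zero s
  simp only [Function.comp, timeSpaceMap_apply, Prod.fst_sub, Prod.snd_sub]
  field_simp
  ring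

/-- The potential is differentiable on the closed region in space-time. -/
theorem hasFDerivWithinAt (h : BoundaryPotential Z Z' Zt F f Ft H) (hc : h.Consts k κ k')
    {x : ℝ × ℂ} (hx : x ∈ lowerRegion Z Z' H) :
    HasFDerivWithinAt (innerExtension Z Z' H F k)
      (timeSpaceMap
        (innerExtension Z Z' H (fun s t => Ft s t - f s t * Zt s t * (Z' s t)⁻¹) k' x)
        (innerExtension Z Z' H (fun s t => f s t * (Z' s t)⁻¹) κ x)) (lowerRegion Z Z' H) x := by
  obtain ⟨t, p⟩ := x
  have ht : 0 ≤ t := hx.1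
  obtain ⟨c, C, hcC⟩ := h.family.exists_arc ht
  by_cases hp : p ∈ range fun s => Z s t
  · obtain ⟨s, rfl⟩ := hp
    simp only [h.family.innerExtension_surface _ ht]
    exact h.hasFDerivWithinAt_surface hc ht s
  · exact (h.hasFDerivWithinAt_of_notMem hc ht hp
      (hcC.reflect_mem_lower (h.above' ht) hx.2.1).1).mono fun y hy => ⟨hy.1, mem_univ _⟩

/-- The potential has a continuous derivative on the closed region in space-time. -/
theorem contDiffOn (h : BoundaryPotential Z Z' Zt F f Ft H) (hc : h.Consts k κ k') :
    ContDiffOn ℝ 1 (innerExtension Z Z' H F k) (lowerRegion Z Z' H) := by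
  have hu := h.family.uniqueDiffOn_lowerRegion h.above
  have hfd : ∀ x ∈ lowerRegion Z Z' H, fderivWithin ℝ (innerExtension Z Z' H F k)
      (lowerRegion Z Z' H) x = timeSpaceMap
        (innerExtension Z Z' H (fun s t => Ft s t - f s t * Zt s t * (Z' s t)⁻¹) k' x)
        (innerExtension Z Z' H (fun s t => f s t * (Z' s t)⁻¹) κ x) :=
    fun x hx => (h.hasFDerivWithinAt hc hx).fderivWithin (hu x hx)
  have hcont := (continuous_timeSpaceMap.comp_continuousOn
    ((h.family.continuousOn_innerExtension h.isDensity_rate h.above hc.rate).prodMk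
      (h.family.continuousOn_innerExtension h.isDensity_velocity h.above
        hc.velocity'))).congr hfd
  have := contDiffOn_succ_of_fderivWithin (n := 0)
    (fun x hx => (h.hasFDerivWithinAt hc hx).differentiableWithinAt) (by simp)
    (contDiffOn_zero.2 hcont)
  rwa [zero_add] at this

end BoundaryPotential

/-! ### Construction of a solution -/

section

variable {h γ g σ : ℝ} {X Y ξ : ℝ → ℝ → ℝ} {s t : ℝ} {k κ k' : ℝ → ℂ}

/-- The surface variables are the boundary values of a complex potential. -/
abbrev SurfacePotential (h γ : ℝ) (X Y ξ : ℝ → ℝ → ℝ) : Prop :=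
  BoundaryPotential (surfacePoint X Y) (surfacePoint (dS X) (dS Y)) (surfacePoint (dT X) (dT Y))
    (potentialDensity γ X Y ξ) (velocityDensity γ X Y ξ) (potentialRate γ X Y ξ) h

/-- The nonlocal equation says that the surface variables are the boundary values of a complex
potential. -/
theorem surfacePotential_of_nonlocalEq (hh : 0 < h) (hS : IsSurface h X Y) (hξ : IsC2 ξ)
    (hD : HasDecay X Y ξ) (hN : NonlocalEq h γ X Y ξ) :
    SurfacePotential h γ X Y ξ where
  family := arcFamily hS hξ hD
  above := hS.above
  rate := by
    have hX := hS.smoothX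
    have hY := hS.smoothY
    refine ⟨surfacePoint (dT (dS X)) (dT (dS Y)), fun s t ht => ?_, fun s t ht => ?_,
      fun t ht => ?_, fun T hT => ?_⟩
    · exact hasDerivWithinAt_surfacePoint hX.isC1_dS hY.isC1_dS ht
    · refine (hasDerivAt_surfacePoint hX.isC1_dT hY.isC1_dT ht).congr_deriv ?_
      rw [surfacePoint, surfacePoint, hX.dS_dT ht, hY.dS_dT ht]
    · have h1 : ContinuousOn (fun p : ℝ × ℝ => surfacePoint (dT (dS X)) (dT (dS Y)) p.1 p.2)
          paramSpace := by
        simp only [surfacePoint_eq]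
        exact (Complex.continuous_ofReal.comp_continuousOn hX.isC1_dS.continuousOn_dT).add
          (continuousOn_const.mul
            (Complex.continuous_ofReal.comp_continuousOn hY.isC1_dS.continuousOn_dT))
      exact continuous_of_continuousOn h1 ht
    · obtain ⟨C, b, hb⟩ := exists_surfaceBounds hS hξ hD hT
      exact ⟨C + C, fun t ht s => norm_surfacePoint_le (hb.boundX s t ht).2.2.2.1
        (hb.boundY s t ht).2.2.2.1⟩
  density := isDensity_potentialDensity hS hξ hD
  densityDeriv := isDensity_velocityDensity hS hξ hD
  densityRate := isDensity_potentialRate hS hξ hD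
  hasDerivAt := fun s t ht => hasDerivAt_potentialDensity hS hξ ht
  hasDerivWithinAt := fun s t ht => hasDerivWithinAt_potentialDensity hS hξ hD ht
  integrable := fun t ht => integrable_velocityDensity hS hξ hD ht
  vanish := fun t ht => (nonlocal_iff hh hS hξ hD ht).1 fun k => hN k t ht

/-- The pseudo-potential: the real part of the complex potential with given boundary values. -/
def pseudoPotential (h γ : ℝ) (X Y ξ : ℝ → ℝ → ℝ) (k : ℝ → ℂ) (x : ℝ × ℂ) : ℝ :=
  (innerExtension (surfacePoint X Y) (surfacePoint (dS X) (dS Y)) h (potentialDensity γ X Y ξ) k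
    x).re

/-- The complex velocity inside the fluid. -/
def innerVelocity (h γ : ℝ) (X Y ξ : ℝ → ℝ → ℝ) (κ : ℝ → ℂ) : ℝ × ℂ → ℂ :=
  innerExtension (surfacePoint X Y) (surfacePoint (dS X) (dS Y)) h
    (fun s t => velocityDensity γ X Y ξ s t * (surfacePoint (dS X) (dS Y) s t)⁻¹) κ

theorem isTrace_pseudoPotential (hS : IsSurface h X Y) (hξ : IsC2 ξ) (hD : HasDecay X Y ξ)
    (k : ℝ → ℂ) : IsTrace X Y ξ (pseudoPotential h γ X Y ξ k) := fun s t ht => by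
  rw [pseudoPotential, (arcFamily hS hξ hD).innerExtension_surface k ht,
    re_potentialDensity hS hξ ht]

theorem contDiffOn_pseudoPotential (hS : IsSurface h X Y) (hξ : IsC2 ξ) (hD : HasDecay X Y ξ)
    (hP : SurfacePotential h γ X Y ξ) (hc : hP.Consts k κ k') :
    ContDiffOn ℝ 1 (pseudoPotential h γ X Y ξ k) (closedRegion h X Y) := by
  rw [closedRegion_eq hS hξ hD]
  exact Complex.reCLM.contDiff.comp_contDiffOn (hP.contDiffOn hc)

/-- The partial derivatives of the pseudo-potential, up to the boundary, are read off from the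
complex velocity. -/
theorem phi_pseudoPotential (hS : IsSurface h X Y) (hξ : IsC2 ξ) (hD : HasDecay X Y ξ)
    (hP : SurfacePotential h γ X Y ξ) (hc : hP.Consts k κ k') {p : ℂ}
    (hx : (t, p) ∈ closedRegion h X Y) :
    phiX h X Y (pseudoPotential h γ X Y ξ k) t p = (innerVelocity h γ X Y ξ κ (t, p)).re ∧
      phiY h X Y (pseudoPotential h γ X Y ξ k) t p = -(innerVelocity h γ X Y ξ κ (t, p)).im := by
  have hu := uniqueDiffOn_closedRegion hS hξ hD (t, p) hx
  have hx' := hx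
  rw [closedRegion_eq hS hξ hD] at hx'
  have h1 := Complex.reCLM.hasFDerivAt.comp_hasFDerivWithinAt (t, p) (hP.hasFDerivWithinAt hc hx')
  rw [← closedRegion_eq hS hξ hD] at h1
  have h2 : fderivWithin ℝ (pseudoPotential h γ X Y ξ k) (closedRegion h X Y) (t, p) = _ :=
    h1.fderivWithin hu
  rw [phiX, phiY, h2]
  simp [timeSpaceMap_apply, innerVelocity]

/-- The velocity vanishes at infinity, also along the surface. -/
theorem exists_norm_innerVelocity_le (hS : IsSurface h X Y) (hξ : IsC2 ξ) (hD : HasDecay X Y ξ)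
    (hP : SurfacePotential h γ X Y ξ) (hc : hP.Consts k κ k') (ht : 0 ≤ t) {ε : ℝ} (hε : 0 < ε) :
    ∃ R : ℝ, ∀ p ∈ closure (fluidDomain h X Y t), R ≤ |p.re| →
      ‖innerVelocity h γ X Y ξ κ (t, p)‖ ≤ ε := by
  obtain ⟨c, C, hcC⟩ := (arcFamily hS hξ hD).exists_arc ht
  have hb : ∀ s, -h < (surfacePoint X Y s t).im := fun s => hS.above s t ht
  obtain ⟨A, hA⟩ := hP.isDensity_velocity.bound (t + 1) (by linarith)
  have hAt := hA t ⟨ht, by linarith⟩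
  have hlim := tendsto_velocity (γ := γ) hS hξ hD ht
  obtain ⟨R, hR⟩ := hcC.exists_norm_symCauchy_le hb (hP.densityDeriv.continuous ht) hAt.1 hAt.2
    (hP.integrable t ht) hlim hε
  obtain ⟨K, hK, hKε⟩ := mem_cocompact.1 (Metric.tendsto_nhds.1 hlim ε hε)
  obtain ⟨M, hM⟩ := hK.exists_bound_of_continuousOn (f := fun s => X s t)
    ((Complex.continuous_re.comp hcC.continuous).continuousOn)
  refine ⟨max R (M + 1), fun p hp hpR => ?_⟩
  by_cases hps : p ∈ range fun s => surfacePoint X Y s t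
  · obtain ⟨s, rfl⟩ := hps
    rw [innerVelocity, (arcFamily hS hξ hD).innerExtension_surface κ ht]
    have hs : s ∉ K := fun hs => by
      have h1 := hM s hs
      have h2 : M + 1 ≤ |X s t| := (le_max_right _ _).trans hpR
      rw [Real.norm_eq_abs] at h1
      linarith
    have := hKε hs
    simp only [mem_ofPred_eq, dist_zero_right] at this
    exact le_of_lt this
  · rw [closure_fluidDomain hcC hb] at hp
    rw [innerVelocity, hP.innerExtension_velocity hc ht hps (hcC.reflect_mem_lower hb hp.1).1,
      norm_neg]
    exact hR p hps hp.1 (((le_max_left _ _).trans hpR).trans (Complex.abs_re_le_norm p))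

theorem harmonicOnNhd_pseudoPotential (hS : IsSurface h X Y) (hξ : IsC2 ξ) (hD : HasDecay X Y ξ)
    (hP : SurfacePotential h γ X Y ξ) (hc : hP.Consts k κ k') (ht : 0 ≤ t) :
    InnerProductSpace.HarmonicOnNhd (fun p : ℂ => pseudoPotential h γ X Y ξ k (t, p))
      (fluidDomain h X Y t) := fun p hp => by
  obtain ⟨c, C, hcC⟩ := (arcFamily hS hξ hD).exists_arc ht
  have hb : ∀ s, -h < (surfacePoint X Y s t).im := fun s => hS.above s t ht
  have hd : DifferentiableOn ℂ (fun q => innerExtension (surfacePoint X Y)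
      (surfacePoint (dS X) (dS Y)) h (potentialDensity γ X Y ξ) k (t, q))
      (fluidDomain h X Y t) := fun q hq => by
    rw [fluidDomain_eq hcC hb] at hq
    exact (hP.hasDerivAt_potential hc ht hq.2.1
      (hcC.reflect_mem_lower hb (le_of_lt hq.1)).1).differentiableAt.differentiableWithinAt
  exact (hd.analyticAt ((isOpen_fluidDomain hcC hb).mem_nhds hp)).harmonicAt_re

theorem kinematic_pseudoPotential (hS : IsSurface h X Y) (hξ : IsC2 ξ) (hD : HasDecay X Y ξ)
    (hP : SurfacePotential h γ X Y ξ) (hc : hP.Consts k κ k') (ht : 0 ≤ t) (s : ℝ) :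
    (phiX h X Y (pseudoPotential h γ X Y ξ k) t (surfacePoint X Y s t) - γ * Y s t - dT X s t) *
      (-dS Y s t) +
      (phiY h X Y (pseudoPotential h γ X Y ξ k) t (surfacePoint X Y s t) - dT Y s t) * dS X s t
        = 0 := by
  obtain ⟨c, C, hcC⟩ := (arcFamily hS hξ hD).exists_arc ht
  obtain ⟨h1, h2⟩ := phi_pseudoPotential hS hξ hD hP hc
    (surfacePoint_mem_closedRegion hS hξ hD s ht)
  rw [kinematic_iff, h1, h2]
  have h3 : innerVelocity h γ X Y ξ κ (t, surfacePoint X Y s t) * surfacePoint (dS X) (dS Y) s t =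
      velocityDensity γ X Y ξ s t := by
    rw [innerVelocity, (arcFamily hS hξ hD).innerExtension_surface κ ht,
      inv_mul_cancel_right₀ (hcC.deriv_ne_zero s)]
  have h4 := congrArg Complex.im h3
  rw [velocityDensity_eq, Complex.mul_im] at h4
  simp [surfacePoint] at h4 ⊢
  linarith

/-- A solution of the equations for the surface variables comes from a solution of the boundary
value problem. -/
theorem exists_solution (hh : 0 < h) (hS : IsSurface h X Y) (hξ : IsC2 ξ) (hD : HasDecay X Y ξ)
    (hN : NonlocalEq h γ X Y ξ) (hE : BernoulliEq γ g σ X Y ξ) :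
    ∃ φ : ℝ × ℂ → ℝ, SolvesBVP h γ g σ X Y φ ∧ IsTrace X Y ξ φ := by
  have hP := surfacePotential_of_nonlocalEq hh hS hξ hD hN
  obtain ⟨k, κ, k', hc⟩ := hP.exists_consts
  have hT := isTrace_pseudoPotential (γ := γ) hS hξ hD k
  have hsm := contDiffOn_pseudoPotential hS hξ hD hP hc
  have hkin := fun s t (ht : 0 ≤ t) => kinematic_pseudoPotential hS hξ hD hP hc ht s
  refine ⟨pseudoPotential h γ X Y ξ k, ⟨hsm, fun t ht ε hε => ?_,
    fun t ht => harmonicOnNhd_pseudoPotential hS hξ hD hP hc ht, fun t ht p hp => ?_, hkin,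
    fun s t ht => ?_⟩, hT⟩
  · obtain ⟨R, hR⟩ := exists_norm_innerVelocity_le hS hξ hD hP hc ht hε
    refine ⟨R, fun p hp hpR => ?_⟩
    obtain ⟨h1, h2⟩ := phi_pseudoPotential hS hξ hD hP hc (t := t) ⟨ht, hp⟩
    rw [h1, h2, abs_neg]
    exact ⟨(Complex.abs_re_le_norm _).trans (hR p hp hpR),
      (Complex.abs_im_le_norm _).trans (hR p hp hpR)⟩
  · obtain ⟨c, C, hcC⟩ := hP.family.exists_arc ht
    have hb : ∀ s, -h < (surfacePoint X Y s t).im := fun s => hS.above s t ht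
    have hpi : p.im = -h := hp
    have hps := Arc.notMem_of_im_le hb hpi.le
    have hx : (t, p) ∈ closedRegion h X Y := by
      rw [closedRegion_eq hS hξ hD]
      exact ⟨ht, hpi.ge, Arc.notMem_upper_of_lower (hcC.mem_lower_of_im_le hb hpi.le)⟩
    rw [(phi_pseudoPotential hS hξ hD hP hc hx).2, innerVelocity,
      hP.innerExtension_velocity hc ht hps (by rwa [reflect_of_bottom hpi]), Complex.neg_im,
      symCauchy_im_eq_zero hpi]
    simp
  · exact (dynamic_iff hS hξ hD (hsm.differentiableOn one_ne_zero) hT ht (hkin s t ht)).2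
      (hE s t ht)

end

end WaterWave

end

theorem proposition2p3 (h γ g σ : ℝ) (hh : 0 < h) (X Y ξ : ℝ → ℝ → ℝ)
    (hS : WaterWave.IsSurface h X Y) (hξ : WaterWave.IsC2 ξ)
    (hD : WaterWave.HasDecay X Y ξ) :
    ((∃ φ : ℝ × ℂ → ℝ, WaterWave.SolvesBVP h γ g σ X Y φ ∧ WaterWave.IsTrace X Y ξ φ) ↔
      (WaterWave.NonlocalEq h γ X Y ξ ∧ WaterWave.BernoulliEq γ g σ X Y ξ)) ∧
    (∀ φ₁ φ₂ : ℝ × ℂ → ℝ,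
      WaterWave.SolvesBVP h γ g σ X Y φ₁ → WaterWave.IsTrace X Y ξ φ₁ →
      WaterWave.SolvesBVP h γ g σ X Y φ₂ → WaterWave.IsTrace X Y ξ φ₂ →
      Set.EqOn φ₁ φ₂ (WaterWave.closedRegion h X Y)) := by
  exact ⟨⟨fun ⟨_, hB, hT⟩ => WaterWave.nonlocal_and_bernoulli hh hS hξ hD hB hT,
    fun ⟨hN, hE⟩ => WaterWave.exists_solution hh hS hξ hD hN hE⟩,
    fun _ _ hB₁ hT₁ hB₂ hT₂ => WaterWave.eqOn_of_trace_eq hS hξ hD hB₁ hT₁ hB₂ hT₂⟩
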